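/- Let $n\in\mathbb N$, $T>0$, let $f,p:\mathbb R^n\times[0,T]\to\mathbb R$, and consider the system $$\partial_t u+(u\cdot\nabla)u=\Delta u+\nabla(f-p),\qquad u(\cdot,0)=u_0=\nabla\varphi ,\qquad (1)$$ for a vector field $u:\mathbb R^n\times[0,T]\to\mathbb R^n$. Assume that $f-p\in L^\infty(\mathbb R^n\times[0,T])$, that $u_0\in L^\infty(\mathbb R^n;\mathbb R^n)$, and that $\varphi:\mathbb R^n\to\mathbb R$ is a (finite-valued) locally integrable function whose weak gradient is $u_0$. Put $$F=\tfrac12(p-f),\qquad G_0=e^{-\varphi/2},\qquad K(x,t)=\frac1{(4\pi t)^{n/2}}e^{-|x|^2/(4t)},$$ let $*$ be convolution in $x$ (with $K(\cdot,0)*g=g$), and define $$G^{(0)}(\cdot,t)=K(\cdot,t)*G_0,\qquad G^{(k+1)}(\cdot,t)=\int_0^tK(\cdot,t-s)*\big[F(\cdot,s)\,G^{(k)}(\cdot,s)\big]\,ds,\qquad G=\sum_{k\ge0}G^{(k)},\qquad u=-2\,\frac{\nabla G}{G}.$$ 1. On $\mathbb R^n\times[0,T]$ all these integrals and the series converge absolutely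 at every point, and $G>0$; for $0<t\le T$ the function $G(\cdot,t)$ is differentiable; $G$ solves $\partial_tG=\Delta G+FG$, $G(\cdot,0)=G_0$, in the sense of distributions; and $u$ is a solution of (1) in the sense of distributions. The latter means: $u$, its weak spatial derivatives $\partial_ju$ and $(u\cdot\nabla)u=\sum_ju_j\,\partial_ju$ are integrable on compact subsets of $\mathbb R^n\times[0,T]$, and for every $\psi\in C_c^\infty(\mathbb R^n\times[0,T);\mathbb R^n)$ $$\int_0^T\!\!\int_{\mathbb R^n}\Big(-u\cdot\partial_t\psi+\big((u\cdot\nabla)u\big)\cdot\psi-u\cdot\Delta\psi+(f-p)\operatorname{div}\psi\Big)\,dx\,dt=\int_{\mathbb R^n}u_0\cdot\psi(\cdot,0)\,dx ;$$ the equation for $G$ is understood in the analogous way. 2. If moreover $u_0\in C^\infty(\mathbb R^n)$ and $F\in C^\infty(\mathbb R^n\times[0,T])$ (both are bounded by assumption), and $\varphi$ is taken to be the continuous representative, then $u\in C^\infty(\mathbb R^n\times[0,T])\cap L^\infty(\mathbb R^n\times[0,T])$, and $u$ satisfies (1) at every point of $\mathbb R^n\times[0,T]$. -/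

import Mathlib

open MeasureTheory Set
open scoped ContDiff

noncomputable section

namespace ColeHopf

/-- Euclidean space `ℝⁿ`. -/
abbrev Euc (n : ℕ) : Type := EuclideanSpace ℝ (Fin n)

/-- The slab `ℝⁿ × [0, T]`. -/
def slab (n : ℕ) (T : ℝ) : Set (Euc n × ℝ) := univ ×ˢ Icc 0 T

/-- The `j`-th partial derivative of a function on `ℝⁿ`. -/
def partialX {n : ℕ} {W : Type*} [NormedAddCommGroup W] [NormedSpace ℝ W]
    (j : Fin n) (g : Euc n → W) (x : Euc n) : W :=
  fderiv ℝ g x (EuclideanSpace.single j 1)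

/-- The divergence of a vector field on `ℝⁿ`. -/
def divX {n : ℕ} (v : Euc n → Euc n) (x : Euc n) : ℝ :=
  ∑ j, partialX j v x j

/-! ### The convolution series -/

/-- The heat kernel `K(x,t) = (4πt)^{-n/2} exp(-|x|²/(4t))`. -/
def heatKernel {n : ℕ} (x : Euc n) (t : ℝ) : ℝ :=
  1 / (4 * Real.pi * t) ^ ((n : ℝ) / 2) * Real.exp (-(‖x‖ ^ 2) / (4 * t))

/-- The convolution `K(·,t) ∗ g`; at `t = 0` the kernel is the Dirac mass at the origin. -/
def heatConv {n : ℕ} (t : ℝ) (g : Euc n → ℝ) (x : Euc n) : ℝ :=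
  if t = 0 then g x else ∫ y, heatKernel (x - y) t * g y

/-- The terms of the series: `K(·,t) ∗ G₀`, then repeatedly
`V ↦ ∫₀ᵗ K(·,t-s) ∗ [F(·,s) V(·,s)] ds`. -/
def seriesTerm {n : ℕ} (F : Euc n → ℝ → ℝ) (G₀ : Euc n → ℝ) : ℕ → Euc n → ℝ → ℝ
  | 0 => fun x t => heatConv t G₀ x
  | k + 1 => fun x t =>
      ∫ s in (0 : ℝ)..t, heatConv (t - s) (fun y => F y s * seriesTerm F G₀ k y s) x

/-- The sum of the series. -/
def seriesSum {n : ℕ} (F : Euc n → ℝ → ℝ) (G₀ : Euc n → ℝ) (x : Euc n) (t : ℝ) : ℝ :=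
  ∑' k, seriesTerm F G₀ k x t

/-- On `ℝⁿ × [0, T]` all integrals in the terms of the series converge absolutely, and so does
the series itself. -/
structure SeriesConverges {n : ℕ} (T : ℝ) (F : Euc n → ℝ → ℝ) (G₀ : Euc n → ℝ) : Prop where
  integrable_zero : ∀ x : Euc n, ∀ t ∈ Ioc 0 T,
    Integrable (fun y => heatKernel (x - y) t * G₀ y)
  integrable_succ : ∀ k : ℕ, ∀ x : Euc n, ∀ t ∈ Ioc 0 T,
    IntegrableOn
      (fun z : Euc n × ℝ =>
        heatKernel (x - z.1) (t - z.2) * (F z.1 z.2 * seriesTerm F G₀ k z.1 z.2))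
      (univ ×ˢ Ioo 0 t)
  summable : ∀ x : Euc n, ∀ t ∈ Icc 0 T, Summable (fun k => |seriesTerm F G₀ k x t|)

/-- The field `-2 ∇G / G`. -/
def coleHopf {n : ℕ} (G : Euc n → ℝ → ℝ) (x : Euc n) (t : ℝ) : Euc n :=
  (-2 / G x t) • gradient (fun y => G y t) x

/-! ### Weak derivatives and solutions -/

/-- `v` is the weak gradient of `φ` on `ℝⁿ`. -/
structure IsWeakGradient {n : ℕ} (φ : Euc n → ℝ) (v : Euc n → Euc n) : Prop where
  locallyIntegrable : LocallyIntegrable φ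
  locallyIntegrable_grad : LocallyIntegrable v
  integral_eq : ∀ η : Euc n → ℝ, ContDiff ℝ ∞ η → HasCompactSupport η → ∀ j : Fin n,
    ∫ x, φ x * partialX j η x = - ∫ x, v x j * η x

/-- `ψ` is the restriction to `ℝⁿ × [0, T]` of a smooth compactly supported function whose
support lies in `ℝⁿ × (-∞, T)`; it need not vanish at time `0`. -/
structure IsTest {n : ℕ} {W : Type*} [NormedAddCommGroup W] [NormedSpace ℝ W] (T : ℝ)
    (ψ : Euc n → ℝ → W) : Prop where
  smooth : ContDiff ℝ ∞ (Function.uncurry ψ)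
  compact : HasCompactSupport (Function.uncurry ψ)
  support : tsupport (Function.uncurry ψ) ⊆ univ ×ˢ Iio T

/-- `D j` is the weak derivative `∂_j u` on `ℝⁿ × (0, T)`, for each `j`, and it is integrable on
compact subsets of `ℝⁿ × [0, T]`. -/
structure IsWeakSpatialDeriv {n : ℕ} (T : ℝ) (u : Euc n → ℝ → Euc n)
    (D : Fin n → Euc n → ℝ → Euc n) : Prop where
  locallyIntegrableOn : ∀ j, LocallyIntegrableOn (Function.uncurry (D j)) (slab n T)
  integral_eq : ∀ η : Euc n → ℝ → ℝ, ContDiff ℝ ∞ (Function.uncurry η) →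
    HasCompactSupport (Function.uncurry η) →
    tsupport (Function.uncurry η) ⊆ univ ×ˢ Ioo 0 T → ∀ j : Fin n,
    ∫ z in slab n T, partialX j (fun y => η y z.2) z.1 • u z.1 z.2
      = - ∫ z in slab n T, η z.1 z.2 • D j z.1 z.2

/-- `(u·∇)u = ∑ⱼ uⱼ ∂ⱼu`, where `D j` is `∂_j u`. -/
def convection {n : ℕ} (u : Euc n → ℝ → Euc n) (D : Fin n → Euc n → ℝ → Euc n)
    (x : Euc n) (t : ℝ) : Euc n :=
  ∑ j, u x t j • D j x t

/-- `u` solves `∂ₜu + (u·∇)u = Δu + ∇h` on `ℝⁿ × (0, T)`, `u(·,0) = u₀`, in the sense of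
distributions: `u`, its weak spatial derivatives and `(u·∇)u` are locally integrable on
`ℝⁿ × [0, T]`, and the equation tested with any `ψ ∈ C_c^∞(ℝⁿ × [0, T); ℝⁿ)` holds. -/
def IsWeakSolution {n : ℕ} (T : ℝ) (h : Euc n → ℝ → ℝ) (u₀ : Euc n → Euc n)
    (u : Euc n → ℝ → Euc n) : Prop :=
  LocallyIntegrableOn (Function.uncurry u) (slab n T) ∧
  ∃ D : Fin n → Euc n → ℝ → Euc n,
    IsWeakSpatialDeriv T u D ∧
    LocallyIntegrableOn (Function.uncurry (convection u D)) (slab n T) ∧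
    ∀ ψ : Euc n → ℝ → Euc n, IsTest T ψ →
      ∫ z in slab n T,
        (- inner ℝ (u z.1 z.2) (deriv (fun s => ψ z.1 s) z.2)
          + inner ℝ (convection u D z.1 z.2) (ψ z.1 z.2)
          - inner ℝ (u z.1 z.2) (Laplacian.laplacian (fun y => ψ y z.2) z.1)
          + h z.1 z.2 * divX (fun y => ψ y z.2) z.1)
        = ∫ x, inner ℝ (u₀ x) (ψ x 0)

/-- `G` solves `∂ₜG = ΔG + F G` on `ℝⁿ × (0, T)`, `G(·,0) = G₀`, in the sense of
distributions. -/
def IsWeakLinearSolution {n : ℕ} (T : ℝ) (F : Euc n → ℝ → ℝ) (G₀ : Euc n → ℝ)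
    (G : Euc n → ℝ → ℝ) : Prop :=
  LocallyIntegrableOn (Function.uncurry G) (slab n T) ∧
  ∀ η : Euc n → ℝ → ℝ, IsTest T η →
    ∫ z in slab n T,
      (- (G z.1 z.2 * deriv (fun s => η z.1 s) z.2)
        - G z.1 z.2 * Laplacian.laplacian (fun y => η y z.2) z.1
        - F z.1 z.2 * G z.1 z.2 * η z.1 z.2)
      = ∫ x, G₀ x * η x 0

/-- `u` solves `∂ₜu + (u·∇)u = Δu + ∇h`, `u(·,0) = u₀` at every point of `ℝⁿ × [0, T]`
(with one-sided time derivatives at `t = 0` and `t = T`). Meant for `u` and `h` that are smooth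
on `ℝⁿ × [0, T]`. -/
def IsClassicalSolution {n : ℕ} (T : ℝ) (h : Euc n → ℝ → ℝ) (u₀ : Euc n → Euc n)
    (u : Euc n → ℝ → Euc n) : Prop :=
  (∀ x : Euc n, ∀ t ∈ Icc 0 T,
    derivWithin (fun s => u x s) (Icc 0 T) t
        + convection u (fun j y s => partialX j (fun y' => u y' s) y) x t
      = Laplacian.laplacian (fun y => u y t) x + gradient (fun y => h y t) x) ∧
  ∀ x : Euc n, u x 0 = u₀ x

end ColeHopf

end

open ColeHopf

noncomputable section

namespace ColeHopf

open Filter Topology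

variable {n : ℕ}

/-! The substitution `u = -2 ∇ log G` linearizes the quasilinear system: if `∂ₜG = ΔG + F G`, then
`log G` satisfies a viscous Hamilton–Jacobi equation whose gradient is the equation for `u`. The
work is to construct `G`, to bound it from both sides together with its gradient, and to justify the
computation when `F` is only bounded and measurable.

Since `u₀` is bounded, `φ` agrees almost everywhere with a Lipschitz function. Hence `w = exp
(-φ/2)` may grow or decay exponentially, but it changes by at most a factor `exp (a |x - y|)`
between two points (`IsWeight`). Gaussian averages respect such weights, so every bound can be
stated relative to `w`. With `|F| ≤ M` the `k`-th term of the series is at most `A (A M t)^k / k! ·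
w` (`abs_dysonTerm_le`); the sum is a mild solution, and iterating the difference of two mild
solutions gives `IsMild.unique`. For positivity `F` is replaced by `F + M ≥ 0`: the new series has
nonnegative terms and dominates `K(t) ∗ w`, and multiplication by `exp (-M t)` leads back to the
potential `F` (`isMild_exp_mul`), so uniqueness gives `G ≥ c w` (`exists_lower_bound_dyson`). The
gradient of `G` is `O(w)` uniformly down to `t = 0`, because `w` is relatively Lipschitz and the
gradient of the Duhamel term has only an integrable singularity `(t - s)^(-1/2)`. `IsRegularSol`
collects these facts; the rest of the weak theory uses nothing else.

For a regular solution the equation is mollified in space, composed with a function `Φ` and passed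
to the limit (`IsRegularSol.integral_comp_by_parts`). The choice `Φ = id` gives the linear equation,
and `Φ = log`, tested with a derivative of a test function, gives the equation of `u` with its
nonlinearity as the gradient of a square. To rewrite this gradient as `(u·∇)u` one needs weak second
derivatives of `log G`. An energy estimate bounds the Hessians of the mollified solutions locally in
`L²` (`exists_hessian_bound`). The logarithmic Hessians therefore have a weak limit while the
gradients converge strongly, so the chain rule survives the limit (`exists_weak_logHess`).

For smooth data, space regularity is bootstrapped locally (`spaceReg_dyson`). A cutoff splits the
data: the nearby part of the source gains one derivative under the Duhamel integral, and distant
parts act through the heat kernel away from its singularity, which is smooth and decays faster than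
any exponential. Then `G` is a time integral of `ΔG + F G` (`dyson_eq_add_integral`), so space
derivatives can be traded for time derivatives up to the boundary of the slab
(`contDiffOn_of_isTimePrimitive`), and the equation for `u` is the quotient rule
(`logDeriv_equation`).

The data are used through convenient representatives: at positive times the terms of the series
depend only on the almost everywhere classes of `F` and `G₀` (`seriesTerm_eq_dysonTerm`). -/

/-! ### The Gaussian and its exponential moments. -/

/-- The Gaussian `K(·, 1)`. -/
def gauss (z : Euc n) : ℝ := heatKernel z 1

theorem gauss_eq (z : Euc n) :
    gauss z = 1 / (4 * Real.pi) ^ ((n : ℝ) / 2) * Real.exp (-(1 / 4) * ‖z‖ ^ 2) := by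
  simp only [gauss, heatKernel]
  congr 2
  · rw [mul_one]
  · ring

theorem gauss_pos (z : Euc n) : 0 < gauss z := by
  rw [gauss_eq]
  positivity

theorem continuous_gauss : Continuous (gauss (n := n)) := by
  have : gauss (n := n) = fun z => 1 / (4 * Real.pi) ^ ((n : ℝ) / 2) *
      Real.exp (-(1 / 4) * ‖z‖ ^ 2) := funext gauss_eq
  rw [this]
  fun_prop

theorem integrable_exp_neg_mul_sq {b : ℝ} (hb : 0 < b) :
    Integrable (fun z : Euc n => Real.exp (-b * ‖z‖ ^ 2)) := by
  have h := GaussianFourier.integrable_cexp_neg_mul_sq_norm_add (V := Euc n) (b := (b : ℂ))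
    (by simpa using hb) 0 0
  have h2 := h.re
  refine h2.congr (ae_of_all _ fun z => ?_)
  simp only [zero_mul, add_zero, RCLike.re_eq_complex_re]
  have : (-(b : ℂ) * (‖z‖ : ℂ) ^ 2) = ((-b * ‖z‖ ^ 2 : ℝ) : ℂ) := by push_cast; rfl
  rw [this, Complex.exp_ofReal_re]

/-- Half of the Gaussian exponent absorbs the exponential growth: `r²/8 - b r + 2 b² = (r - 4b)²/8`.
-/
theorem exp_mul_exp_neg_sq_le (b r : ℝ) :
    Real.exp (b * r) * Real.exp (-(1 / 4) * r ^ 2)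
      ≤ Real.exp (2 * b ^ 2) * Real.exp (-(1 / 8) * r ^ 2) := by
  rw [← Real.exp_add, ← Real.exp_add]
  apply Real.exp_le_exp.mpr
  nlinarith [sq_nonneg (r - 4 * b)]

/-- The universal dominating function: the data grow at most exponentially, and after rescaling the
heat kernel is always this Gaussian. -/
theorem integrable_exp_mul_gauss (b : ℝ) :
    Integrable (fun z : Euc n => Real.exp (b * ‖z‖) * gauss z) := by
  have h := (integrable_exp_neg_mul_sq (n := n) (b := 1 / 8) (by norm_num)).const_mul
    (1 / (4 * Real.pi) ^ ((n : ℝ) / 2) * Real.exp (2 * b ^ 2))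
  refine h.mono' (Continuous.aestronglyMeasurable ?_) (ae_of_all _ fun z => ?_)
  · exact (by fun_prop : Continuous fun z : Euc n => Real.exp (b * ‖z‖)).mul continuous_gauss
  · rw [Real.norm_of_nonneg (mul_nonneg (Real.exp_pos _).le (gauss_pos z).le), gauss_eq]
    have h1 := exp_mul_exp_neg_sq_le b ‖z‖
    have h2 : 0 ≤ 1 / (4 * Real.pi) ^ ((n : ℝ) / 2) := by positivity
    calc _ = 1 / (4 * Real.pi) ^ ((n : ℝ) / 2) *
        (Real.exp (b * ‖z‖) * Real.exp (-(1 / 4) * ‖z‖ ^ 2)) := by ring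
      _ ≤ _ := by
        rw [mul_assoc]
        exact mul_le_mul_of_nonneg_left h1 h2

theorem integrable_gauss : Integrable (gauss (n := n)) := by
  simpa using integrable_exp_mul_gauss (n := n) 0

theorem integral_gauss : ∫ z : Euc n, gauss z = 1 := by
  simp_rw [gauss_eq, integral_const_mul]
  have h := GaussianFourier.integral_rexp_neg_mul_sq_norm (V := Euc n) (b := 1 / 4) (by norm_num)
  have h2 : ∫ z : Euc n, Real.exp (-(1 / 4) * ‖z‖ ^ 2) = (4 * Real.pi) ^ ((n : ℝ) / 2) := by
    rw [h]
    simp only [finrank_euclideanSpace, Fintype.card_fin]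
    congr 1
    ring
  rw [h2, one_div, inv_mul_cancel₀]
  positivity

/-- The exponential moments of the Gaussian. -/
def expMoment (n : ℕ) (b : ℝ) : ℝ := ∫ z : Euc n, Real.exp (b * ‖z‖) * gauss z

/-- Needed also for negative `b`, where the moment is the constant in the lower bound
`IsWeight.le_heatS`. -/
theorem expMoment_pos (b : ℝ) : 0 < expMoment n b := by
  unfold expMoment
  rw [integral_pos_iff_support_of_nonneg
    (fun z => mul_nonneg (Real.exp_pos _).le (gauss_pos z).le) (integrable_exp_mul_gauss b)]
  have : Function.support (fun z : Euc n => Real.exp (b * ‖z‖) * gauss z) = univ := by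
    ext z
    simp [(gauss_pos z).ne']
  rw [this]
  exact isOpen_univ.measure_pos _ univ_nonempty

theorem heatKernel_smul {t : ℝ} (ht : 0 < t) (z : Euc n) :
    heatKernel (√t • z) t = (√t ^ n)⁻¹ * gauss z := by
  rw [gauss_eq, heatKernel, norm_smul, mul_pow, Real.norm_of_nonneg (Real.sqrt_nonneg t),
    Real.sq_sqrt ht.le, Real.mul_rpow (by positivity) ht.le]
  have h1 : -(t * ‖z‖ ^ 2) / (4 * t) = -(1 / 4) * ‖z‖ ^ 2 := by
    field_simp
  have h2 : t ^ ((n : ℝ) / 2) = √t ^ n := by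
    rw [Real.sqrt_eq_rpow, ← Real.rpow_natCast, ← Real.rpow_mul ht.le]
    congr 1
    ring
  rw [h1, h2]
  field_simp

/-! ### The heat semigroup in parabolic variables. -/

/-- The heat semigroup in rescaled form. -/
def heatS (t : ℝ) (q : Euc n → ℝ) (x : Euc n) : ℝ := ∫ z, gauss z * q (x - √t • z)

theorem heatS_zero (q : Euc n → ℝ) (x : Euc n) : heatS 0 q x = q x := by
  simp [heatS, integral_mul_const, integral_gauss]

/-- Change of variables `y = x - √t z`. -/
theorem integral_rescale {W : Type*} [NormedAddCommGroup W] [NormedSpace ℝ W]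
    {t : ℝ} (ht : 0 < t) (x : Euc n) (f : Euc n → W) :
    ∫ y, f y = √t ^ n • ∫ z, f (x - √t • z) := by
  have hs : 0 < √t := Real.sqrt_pos.mpr ht
  have h1 : ∫ y, f y = ∫ y, f (x - y) := (integral_sub_left_eq_self f volume x).symm
  have h2 := Measure.integral_comp_smul (volume : Measure (Euc n)) (fun y => f (x - y)) (√t)
  simp only [finrank_euclideanSpace, Fintype.card_fin] at h2
  rw [h2, h1, smul_smul, abs_of_nonneg (by positivity), mul_inv_cancel₀ (by positivity), one_smul]

theorem integrable_rescale_iff {W : Type*} [NormedAddCommGroup W] [NormedSpace ℝ W]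
    {t : ℝ} (ht : 0 < t) (x : Euc n) (f : Euc n → W) :
    Integrable (fun z => f (x - √t • z)) ↔ Integrable f := by
  have hs : 0 < √t := Real.sqrt_pos.mpr ht
  rw [integrable_comp_smul_iff volume (fun y => f (x - y)) hs.ne', integrable_comp_sub_left]

theorem heatKernel_rescale {t : ℝ} (ht : 0 < t) (x z : Euc n) :
    heatKernel (x - (x - √t • z)) t = (√t ^ n)⁻¹ * gauss z := by
  rw [sub_sub_cancel, heatKernel_smul ht]

theorem heatConv_eq_heatS {t : ℝ} (ht : 0 ≤ t) (q : Euc n → ℝ) (x : Euc n) :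
    heatConv t q x = heatS t q x := by
  rcases ht.eq_or_lt with rfl | ht
  · simp [heatConv, heatS_zero]
  · rw [heatConv, if_neg ht.ne', integral_rescale ht x, heatS, smul_eq_mul, ← integral_const_mul]
    refine integral_congr_ae (ae_of_all _ fun z => ?_)
    have : 0 < √t := Real.sqrt_pos.mpr ht
    simp only [heatKernel_rescale ht]
    field_simp

/-! ### Weights, and the heat flow of functions dominated by them. -/

/-- A positive continuous function on `ℝⁿ` which changes at most by the factor `exp (a |x - y|)`
from `x` to `y`. -/
structure IsWeight (a : ℝ) (w : Euc n → ℝ) : Prop where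
  rate_nonneg : 0 ≤ a
  pos : ∀ x, 0 < w x
  continuous : Continuous w
  le_mul_exp : ∀ x y, w y ≤ w x * Real.exp (a * ‖x - y‖)

/-- Through this weight the weighted estimates apply to bounded functions, in particular to sources
with compact support. -/
theorem isWeight_one : IsWeight 0 (fun _ : Euc n => (1 : ℝ)) :=
  ⟨le_rfl, fun _ => one_pos, continuous_const, fun _ _ => by simp⟩

section Weighted

variable {a : ℝ} {w : Euc n → ℝ} {T t B : ℝ} {q : Euc n → ℝ}

theorem IsWeight.shift_le (hw : IsWeight a w) (ht : t ≤ T) (x z : Euc n) :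
    w (x - √t • z) ≤ w x * Real.exp (a * √T * ‖z‖) := by
  refine (hw.le_mul_exp x _).trans (mul_le_mul_of_nonneg_left ?_ (hw.pos x).le)
  rw [sub_sub_cancel, norm_smul, Real.norm_of_nonneg (Real.sqrt_nonneg t), ← mul_assoc]
  have := Real.sqrt_le_sqrt ht
  have := hw.rate_nonneg
  gcongr

theorem IsWeight.le_shift (hw : IsWeight a w) (ht : t ≤ T) (x z : Euc n) :
    w x * Real.exp (-(a * √T) * ‖z‖) ≤ w (x - √t • z) := by
  have h := hw.le_mul_exp (x - √t • z) x
  have h2 : a * ‖x - √t • z - x‖ ≤ a * √T * ‖z‖ := by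
    rw [sub_sub_cancel_left, norm_neg, norm_smul, Real.norm_of_nonneg (Real.sqrt_nonneg t),
      ← mul_assoc]
    have := Real.sqrt_le_sqrt ht
    have := hw.rate_nonneg
    gcongr
  have h3 : w x ≤ w (x - √t • z) * Real.exp (a * √T * ‖z‖) :=
    h.trans (mul_le_mul_of_nonneg_left (Real.exp_le_exp.mpr h2) (hw.pos _).le)
  calc w x * Real.exp (-(a * √T) * ‖z‖)
      ≤ w (x - √t • z) * Real.exp (a * √T * ‖z‖) * Real.exp (-(a * √T) * ‖z‖) :=
        mul_le_mul_of_nonneg_right h3 (Real.exp_pos _).le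
    _ = w (x - √t • z) := by
        rw [mul_assoc, ← Real.exp_add]
        simp

theorem IsWeight.gauss_mul_le (hw : IsWeight a w) (hq : ∀ y, |q y| ≤ B * w y) (ht : t ≤ T)
    (x z : Euc n) :
    |gauss z * q (x - √t • z)| ≤ B * w x * (Real.exp (a * √T * ‖z‖) * gauss z) := by
  have hB : 0 ≤ B := nonneg_of_mul_nonneg_left ((abs_nonneg _).trans (hq x)) (hw.pos x)
  rw [abs_mul, abs_of_pos (gauss_pos z)]
  calc gauss z * |q (x - √t • z)| ≤ gauss z * (B * (w x * Real.exp (a * √T * ‖z‖))) := by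
        refine mul_le_mul_of_nonneg_left ((hq _).trans ?_) (gauss_pos z).le
        exact mul_le_mul_of_nonneg_left (hw.shift_le ht x z) hB
    _ = _ := by ring

theorem IsWeight.integrable_gauss_mul (hw : IsWeight a w) (hqm : Measurable q)
    (hq : ∀ y, |q y| ≤ B * w y) (t : ℝ) (x : Euc n) :
    Integrable (fun z => gauss z * q (x - √t • z)) := by
  refine ((integrable_exp_mul_gauss (n := n) (a * √t)).const_mul (B * w x)).mono' ?_
    (ae_of_all _ fun z => hw.gauss_mul_le hq le_rfl x z)
  exact (continuous_gauss.measurable.mul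
    (hqm.comp (by fun_prop))).aestronglyMeasurable

/-- The shift `√t z` costs at most `exp (a √T |z|)`, which the Gaussian integrates. The constant
depends on `T` and not on `t`, so it can be iterated along the series. -/
theorem IsWeight.abs_heatS_le (hw : IsWeight a w)
    (hq : ∀ y, |q y| ≤ B * w y) (ht : t ≤ T) (x : Euc n) :
    |heatS t q x| ≤ expMoment n (a * √T) * B * w x := by
  have h := norm_integral_le_of_norm_le (f := fun z => gauss z * q (x - √t • z))
    ((integrable_exp_mul_gauss (n := n) (a * √T)).const_mul (B * w x))
    (ae_of_all _ fun z => hw.gauss_mul_le hq ht x z)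
  rw [integral_const_mul] at h
  calc |heatS t q x| ≤ _ := h
    _ = _ := by rw [expMoment]; ring

/-- The weight inequality is symmetric in its two points, so it also bounds the average from below.
This is the source of the strict positivity of the series. -/
theorem IsWeight.le_heatS (hw : IsWeight a w) (ht : t ≤ T) (x : Euc n) :
    expMoment n (-(a * √T)) * w x ≤ heatS t w x := by
  rw [expMoment, ← integral_mul_const, heatS]
  refine integral_mono ((integrable_exp_mul_gauss _).mul_const _)
    (hw.integrable_gauss_mul (B := 1) hw.continuous.measurable
      (fun y => by rw [one_mul, abs_of_pos (hw.pos y)]) t x) fun z => ?_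
  calc _ = gauss z * (w x * Real.exp (-(a * √T) * ‖z‖)) := by ring
    _ ≤ _ := mul_le_mul_of_nonneg_left (hw.le_shift ht x z) (gauss_pos z).le

theorem IsWeight.integrable_heatKernel_mul (hw : IsWeight a w) (hqm : Measurable q)
    (hq : ∀ y, |q y| ≤ B * w y) (ht : 0 < t) (x : Euc n) :
    Integrable (fun y => heatKernel (x - y) t * q y) := by
  rw [← integrable_rescale_iff ht x]
  simp only [heatKernel_rescale ht, mul_assoc]
  exact (hw.integrable_gauss_mul hqm hq t x).const_mul _

end Weighted

/-- Time, point and function may all depend on the parameter; every joint measurability needed for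
Fubini is an instance. -/
theorem measurable_heatS {α : Type*} [MeasurableSpace α] {τ : α → ℝ} {X : α → Euc n}
    {q : α → Euc n → ℝ} (hτ : Measurable τ) (hX : Measurable X)
    (hq : Measurable (Function.uncurry q)) :
    Measurable (fun b => heatS (τ b) (q b) (X b)) := by
  have h : Measurable (fun p : α × Euc n => gauss p.2 * q p.1 (X p.1 - √(τ p.1) • p.2)) := by
    refine (continuous_gauss.measurable.comp measurable_snd).mul ?_
    have h2 : Measurable (fun p : α × Euc n => X p.1 - √(τ p.1) • p.2) :=
      (hX.comp measurable_fst).sub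
        (((Real.continuous_sqrt.measurable).comp (hτ.comp measurable_fst)).smul measurable_snd)
    exact hq.comp (measurable_fst.prodMk h2)
  exact (h.stronglyMeasurable.integral_prod_right (ν := volume)).measurable

theorem heatS_add (q r : Euc n → ℝ) (t : ℝ) (x : Euc n)
    (hq : Integrable (fun z => gauss z * q (x - √t • z)))
    (hr : Integrable (fun z => gauss z * r (x - √t • z))) :
    heatS t (fun y => q y + r y) x = heatS t q x + heatS t r x := by
  simp only [heatS, mul_add]
  exact integral_add hq hr

theorem heatS_sub (q r : Euc n → ℝ) (t : ℝ) (x : Euc n)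
    (hq : Integrable (fun z => gauss z * q (x - √t • z)))
    (hr : Integrable (fun z => gauss z * r (x - √t • z))) :
    heatS t (fun y => q y - r y) x = heatS t q x - heatS t r x := by
  simp only [heatS, mul_sub]
  exact integral_sub hq hr

theorem heatS_const_mul (c : ℝ) (q : Euc n → ℝ) (t : ℝ) (x : Euc n) :
    heatS t (fun y => c * q y) x = c * heatS t q x := by
  simp only [heatS, ← integral_const_mul]
  refine integral_congr_ae (ae_of_all _ fun z => ?_)
  ring

/-- The Chapman–Kolmogorov identity. Completing the square in `z` about `(√s / (s + t)) v` leaves a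
Gaussian integral times the kernel at time `s + t`. -/
theorem integral_gauss_mul_heatKernel {s t : ℝ} (hs : 0 < s) (ht : 0 < t) (v : Euc n) :
    ∫ z, gauss z * heatKernel (v - √s • z) t = heatKernel v (s + t) := by
  have hst : 0 < s + t := add_pos hs ht
  have hsq : √s ^ 2 = s := Real.sq_sqrt hs.le
  have key : ∀ z : Euc n, gauss z * heatKernel (v - √s • z) t =
      (1 / (4 * Real.pi) ^ ((n : ℝ) / 2) * (1 / (4 * Real.pi * t) ^ ((n : ℝ) / 2)) *
        Real.exp (-(‖v‖ ^ 2) / (4 * (s + t)))) *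
      Real.exp (-((s + t) / (4 * t)) * ‖z - (√s / (s + t)) • v‖ ^ 2) := by
    intro z
    rw [gauss_eq, heatKernel]
    have : Real.exp (-(1 / 4) * ‖z‖ ^ 2) * Real.exp (-(‖v - √s • z‖ ^ 2) / (4 * t)) =
        Real.exp (-(‖v‖ ^ 2) / (4 * (s + t))) *
          Real.exp (-((s + t) / (4 * t)) * ‖z - (√s / (s + t)) • v‖ ^ 2) := by
      rw [← Real.exp_add, ← Real.exp_add]
      congr 1
      rw [norm_sub_sq_real, norm_sub_sq_real, norm_smul, norm_smul, inner_smul_right,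
        inner_smul_right, real_inner_comm v z, mul_pow, mul_pow, Real.norm_eq_abs,
        Real.norm_eq_abs, sq_abs, sq_abs, div_pow, hsq]
      field_simp
      ring
    linear_combination (1 / (4 * Real.pi) ^ ((n : ℝ) / 2) *
      (1 / (4 * Real.pi * t) ^ ((n : ℝ) / 2))) * this
  simp_rw [key]
  rw [integral_const_mul, integral_sub_right_eq_self
    (fun z : Euc n => Real.exp (-((s + t) / (4 * t)) * ‖z‖ ^ 2)),
    GaussianFourier.integral_rexp_neg_mul_sq_norm (by positivity), heatKernel]
  simp only [finrank_euclideanSpace, Fintype.card_fin]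
  have h1 : Real.pi / ((s + t) / (4 * t)) = (4 * Real.pi * t) / (s + t) := by field_simp
  rw [h1, Real.div_rpow (by positivity) hst.le, Real.mul_rpow (by positivity) hst.le]
  have h2 : 0 < (4 * Real.pi * t) ^ ((n : ℝ) / 2) := by positivity
  field_simp

/-- The semigroup property. -/
theorem IsWeight.heatS_heatS {a : ℝ} {w : Euc n → ℝ} {B : ℝ} {q : Euc n → ℝ}
    (hw : IsWeight a w) (hqm : Measurable q) (hq : ∀ y, |q y| ≤ B * w y) {s t : ℝ}
    (hs : 0 ≤ s) (ht : 0 ≤ t) (x : Euc n) :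
    heatS s (heatS t q) x = heatS (s + t) q x := by
  rcases ht.eq_or_lt with rfl | ht
  · have : heatS (n := n) 0 q = q := funext (heatS_zero q)
    rw [this, add_zero]
  rcases hs.eq_or_lt with rfl | hs
  · rw [heatS_zero, zero_add]
  have hK : Measurable (fun p : Euc n => heatKernel p t) := by
    unfold heatKernel
    fun_prop
  have h1 : heatS s (heatS t q) x
      = ∫ z, ∫ y, gauss z * (heatKernel (x - √s • z - y) t * q y) := by
    rw [heatS]
    refine integral_congr_ae (ae_of_all _ fun z => ?_)
    simp only
    rw [← heatConv_eq_heatS ht.le, heatConv, if_neg ht.ne', integral_const_mul]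
  have hInt : Integrable (Function.uncurry fun z y : Euc n =>
      gauss z * (heatKernel (x - √s • z - y) t * q y)) (volume.prod volume) := by
    have hmeas : Measurable (Function.uncurry fun z y : Euc n =>
        gauss z * (heatKernel (x - √s • z - y) t * q y)) := by
      refine (continuous_gauss.measurable.comp measurable_fst).mul
        ((hK.comp ?_).mul (hqm.comp measurable_snd))
      fun_prop
    rw [integrable_prod_iff hmeas.aestronglyMeasurable]
    refine ⟨ae_of_all _ fun z =>
      (hw.integrable_heatKernel_mul hqm hq ht (x - √s • z)).const_mul (gauss z), ?_⟩
    have h2 : ∀ z : Euc n,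
        ∫ y, ‖Function.uncurry (fun z y : Euc n =>
          gauss z * (heatKernel (x - √s • z - y) t * q y)) (z, y)‖
        = gauss z * heatS t (fun y => |q y|) (x - √s • z) := by
      intro z
      rw [← heatConv_eq_heatS ht.le, heatConv, if_neg ht.ne', ← integral_const_mul]
      refine integral_congr_ae (ae_of_all _ fun y => ?_)
      simp only [Function.uncurry, norm_mul, Real.norm_eq_abs, abs_of_pos (gauss_pos z)]
      rw [abs_of_nonneg (by unfold heatKernel; positivity : 0 ≤ heatKernel (x - √s • z - y) t)]
    simp_rw [h2]
    exact hw.integrable_gauss_mul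
      (q := heatS t (fun y => |q y|))
      (measurable_heatS (α := Euc n) measurable_const measurable_id
        ((hqm.comp measurable_snd).abs))
      (fun y => hw.abs_heatS_le (q := fun y => |q y|) (by simpa using hq) le_rfl y) s x
  rw [h1, integral_integral_swap hInt, ← heatConv_eq_heatS (add_pos hs ht).le, heatConv,
    if_neg (add_pos hs ht).ne']
  refine integral_congr_ae (ae_of_all _ fun y => ?_)
  simp only
  rw [← integral_gauss_mul_heatKernel hs ht, ← integral_mul_const]
  refine integral_congr_ae (ae_of_all _ fun z => ?_)
  simp only
  rw [sub_right_comm]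
  ring

/-! ### The chain rule along primitives of bounded functions. -/

theorem lipschitzOnWith_of_hasDerivAt_continuousOn {Φ Φ' : ℝ → ℝ} {c d : ℝ}
    (hΦ : ∀ r ∈ Icc c d, HasDerivAt Φ (Φ' r) r) (hΦ' : ContinuousOn Φ' (Icc c d)) :
    ∃ K, LipschitzOnWith K Φ (Icc c d) := by
  obtain ⟨L, hL⟩ := isCompact_Icc.exists_bound_of_continuousOn hΦ'
  refine ⟨L.toNNReal, (convex_Icc c d).lipschitzOnWith_of_nnnorm_hasDerivWithin_le
    (fun r hr => (hΦ r hr).hasDerivWithinAt) fun r hr => ?_⟩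
  rw [← NNReal.coe_le_coe, coe_nnnorm]
  exact (hL r hr).trans (Real.le_coe_toNNReal L)

/-- The fundamental theorem of calculus for `Φ(y) ξ`, where `y` is the primitive of a bounded
function. -/
theorem integral_comp_primitive {y b Φ Φ' ξ ξ' : ℝ → ℝ} {T C c d : ℝ} (hT : 0 ≤ T)
    (hb : IntervalIntegrable b volume 0 T) (hbC : ∀ s ∈ Icc 0 T, |b s| ≤ C)
    (hy : ∀ t ∈ Icc 0 T, y t = y 0 + ∫ s in (0 : ℝ)..t, b s)
    (hyr : ∀ t ∈ Icc 0 T, y t ∈ Icc c d)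
    (hΦ : ∀ r ∈ Icc c d, HasDerivAt Φ (Φ' r) r) (hΦ' : ContinuousOn Φ' (Icc c d))
    (hξ : ∀ t, HasDerivAt ξ (ξ' t) t) (hξ' : Continuous ξ') :
    ∫ t in (0 : ℝ)..T, (Φ' (y t) * b t * ξ t + Φ (y t) * ξ' t)
      = Φ (y T) * ξ T - Φ (y 0) * ξ 0 := by
  have hsub : ∀ {s t : ℝ}, s ∈ Icc 0 T → t ∈ Icc 0 T → IntervalIntegrable b volume s t := by
    intro s t hs ht
    refine hb.mono_set ?_
    rw [uIcc_of_le hT]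
    exact uIcc_subset_Icc hs ht
  have yLip : LipschitzOnWith C.toNNReal y (Icc 0 T) := by
    refine LipschitzOnWith.of_dist_le_mul fun t ht s hs => ?_
    have h0 : (0 : ℝ) ∈ Icc 0 T := ⟨le_rfl, hT⟩
    rw [dist_eq_norm, hy t ht, hy s hs, add_sub_add_left_eq_sub,
      intervalIntegral.integral_interval_sub_left (hsub h0 ht) (hsub h0 hs), Real.dist_eq]
    refine (intervalIntegral.norm_integral_le_of_norm_le_const (C := C) fun r hr => ?_).trans ?_
    · exact hbC r (uIcc_subset_Icc hs ht (uIoc_subset_uIcc hr))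
    · exact mul_le_mul_of_nonneg_right (Real.le_coe_toNNReal C) (abs_nonneg _)
  obtain ⟨K, hK⟩ := lipschitzOnWith_of_hasDerivAt_continuousOn hΦ hΦ'
  obtain ⟨K', hK'⟩ := lipschitzOnWith_of_hasDerivAt_continuousOn (c := 0) (d := T)
    (fun r _ => hξ r) hξ'.continuousOn
  have h1 : AbsolutelyContinuousOnInterval (fun t => Φ (y t)) 0 T := by
    refine LipschitzOnWith.absolutelyContinuousOnInterval (K := K * C.toNNReal) ?_
    rw [uIcc_of_le hT]
    exact hK.comp yLip hyr
  have h2 : AbsolutelyContinuousOnInterval ξ 0 T := by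
    refine LipschitzOnWith.absolutelyContinuousOnInterval (K := K') ?_
    rwa [uIcc_of_le hT]
  rw [← h1.integral_deriv_mul_eq_sub h2]
  refine intervalIntegral.integral_congr_ae ?_
  have hne : ∀ᵐ x : ℝ, x ≠ T := by simp [ae_iff, measure_singleton]
  -- Lebesgue differentiation gives `y' = b` almost everywhere. The endpoint `T` is discarded
  -- because `hy` describes `y` only inside `[0, T]`, and a two-sided derivative needs a
  -- neighbourhood.
  filter_upwards [hb.ae_hasDerivAt_integral, hne] with t ht htT ht'
  rw [uIoc_of_le hT] at ht'
  have htI : t ∈ Ioo 0 T := ⟨ht'.1, lt_of_le_of_ne ht'.2 htT⟩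
  have hd := ht (by rw [uIcc_of_le hT]; exact Ioo_subset_Icc_self htI) 0 left_mem_uIcc
  have hyd : HasDerivAt y (b t) t := by
    refine (hd.const_add (y 0)).congr_of_eventuallyEq ?_
    filter_upwards [Ioo_mem_nhds htI.1 htI.2] with s hs
    exact hy s (Ioo_subset_Icc_self hs)
  have hc : HasDerivAt (fun t => Φ (y t)) (Φ' (y t) * b t) t :=
    (hΦ _ (hyr t (Ioo_subset_Icc_self htI))).comp t hyd
  rw [hc.deriv, (hξ t).deriv]

/-! ### The Duhamel integral. -/

/-- The Duhamel integral `∫₀ᵗ K(·, t - s) ∗ q(·, s) ds`. -/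
def duh (q : Euc n → ℝ → ℝ) (x : Euc n) (t : ℝ) : ℝ :=
  ∫ s in Ioo 0 t, heatS (t - s) (fun y => q y s) x

theorem duh_of_nonpos (q : Euc n → ℝ → ℝ) (x : Euc n) {t : ℝ} (ht : t ≤ 0) : duh q x t = 0 := by
  simp [duh, Ioo_eq_empty (not_lt.mpr ht)]

theorem measurable_duh {q : Euc n → ℝ → ℝ} (hq : Measurable (Function.uncurry q)) :
    Measurable (Function.uncurry (duh q)) := by
  have h1 : Measurable (fun p : (Euc n × ℝ) × ℝ =>
      heatS (p.1.2 - p.2) (fun y => q y p.2) p.1.1) := by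
    refine measurable_heatS (q := fun (p : (Euc n × ℝ) × ℝ) y => q y p.2)
      (by fun_prop) (by fun_prop) ?_
    exact hq.comp (measurable_snd.prodMk (measurable_snd.comp measurable_fst))
  have hS : MeasurableSet {p : (Euc n × ℝ) × ℝ | p.2 ∈ Ioo 0 p.1.2} :=
    (measurableSet_lt measurable_const measurable_snd).inter
      (measurableSet_lt measurable_snd (measurable_snd.comp measurable_fst))
  have h2 := ((h1.indicator hS).stronglyMeasurable.integral_prod_right' (ν := volume)).measurable
  convert h2 using 1
  ext ⟨x, t⟩
  rw [Function.uncurry_apply_pair, duh, ← integral_indicator measurableSet_Ioo]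
  rfl

section Weighted

variable {a : ℝ} {w : Euc n → ℝ} {T B : ℝ} {q : Euc n → ℝ → ℝ}

theorem IsWeight.integrableOn_duh (hw : IsWeight a w) (hqm : Measurable (Function.uncurry q))
    (hq : ∀ y, ∀ s ∈ Ioo 0 T, |q y s| ≤ B * w y) (hτ : ℝ) (x : Euc n) :
    IntegrableOn (fun s => heatS (hτ - s) (fun y => q y s) x) (Ioo 0 T) := by
  have hm : Measurable (fun s => heatS (hτ - s) (fun y => q y s) x) :=
    measurable_heatS (q := fun s y => q y s) (by fun_prop) measurable_const
      (hqm.comp measurable_swap)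
  refine IntegrableOn.of_bound (by simp) hm.aestronglyMeasurable
    (expMoment n (a * √hτ) * B * w x) ?_
  rw [ae_restrict_iff' measurableSet_Ioo]
  exact ae_of_all _ fun s hs => hw.abs_heatS_le (fun y => hq y s hs) (by linarith [hs.1]) x

/-- Tracking the power of time is what produces the factorials: each Duhamel integration turns `s ^
k` into `t ^ (k + 1) / (k + 1)`. -/
theorem IsWeight.abs_duh_le (hw : IsWeight a w) (k : ℕ)
    (hq : ∀ y, ∀ s ∈ Ioo 0 T, |q y s| ≤ B * s ^ k * w y) {t : ℝ} (ht : t ∈ Icc 0 T) (x : Euc n) :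
    |duh q x t| ≤ expMoment n (a * √T) * B * (t ^ (k + 1) / (k + 1)) * w x := by
  have h : ∀ s ∈ Ioo 0 t, ‖heatS (t - s) (fun y => q y s) x‖
      ≤ expMoment n (a * √T) * B * w x * s ^ k := by
    intro s hs
    have := hw.abs_heatS_le (T := T) (fun y => hq y s ⟨hs.1, hs.2.trans_le ht.2⟩)
      (show t - s ≤ T by linarith [hs.1, ht.2]) x
    rw [Real.norm_eq_abs]
    linarith
  have hInt : IntegrableOn (fun s => expMoment n (a * √T) * B * w x * s ^ k) (Ioo 0 t) :=
    (Continuous.integrableOn_Icc (by fun_prop)).mono_set Ioo_subset_Icc_self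
  have h2 := norm_integral_le_of_norm_le hInt
    ((ae_restrict_iff' measurableSet_Ioo).mpr (ae_of_all _ h))
  have h3 : ∫ s in Ioo 0 t, expMoment n (a * √T) * B * w x * s ^ k
      = expMoment n (a * √T) * B * (t ^ (k + 1) / (k + 1)) * w x := by
    rw [← integral_Ioc_eq_integral_Ioo, ← intervalIntegral.integral_of_le ht.1,
      intervalIntegral.integral_const_mul, integral_pow]
    simp
    ring
  rw [← h3]
  exact h2

end Weighted

/-! ### The Dyson series and mild solutions. -/

/-- The terms of the Dyson series with potential `F` and initial value `w`, in rescaled form. -/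
def dysonTerm (F : Euc n → ℝ → ℝ) (w : Euc n → ℝ) : ℕ → Euc n → ℝ → ℝ
  | 0 => fun x t => heatS t w x
  | k + 1 => duh (fun y s => F y s * dysonTerm F w k y s)

/-- The sum of the Dyson series. -/
def dyson (F : Euc n → ℝ → ℝ) (w : Euc n → ℝ) (x : Euc n) (t : ℝ) : ℝ :=
  ∑' k, dysonTerm F w k x t

/-- A measurable potential bounded by `M`. -/
structure IsPotential (M : ℝ) (F : Euc n → ℝ → ℝ) : Prop where
  measurable : Measurable (Function.uncurry F)
  bound : ∀ x t, |F x t| ≤ M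

/-- `V` solves `V(t) = K(t) ∗ w + ∫₀ᵗ K(t-s) ∗ [F(s) V(s)] ds` on `[0, T]`, and is bounded by a
multiple of `w`. -/
structure IsMild (T : ℝ) (F : Euc n → ℝ → ℝ) (w : Euc n → ℝ) (V : Euc n → ℝ → ℝ) : Prop where
  measurable : Measurable (Function.uncurry V)
  bound : ∃ C, ∀ x, ∀ t ∈ Icc 0 T, |V x t| ≤ C * w x
  eq : ∀ x, ∀ t ∈ Icc 0 T, V x t = heatS t w x + duh (fun y s => F y s * V y s) x t

section

variable {a M T : ℝ} {w : Euc n → ℝ} {F : Euc n → ℝ → ℝ}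

theorem IsPotential.nonneg (hF : IsPotential M F) : 0 ≤ M := (abs_nonneg _).trans (hF.bound 0 0)

theorem IsPotential.abs_mul_le (hF : IsPotential M F) {V : Euc n → ℝ → ℝ} {C : ℝ} {x : Euc n}
    {t : ℝ} (h : |V x t| ≤ C) : |F x t * V x t| ≤ M * C := by
  rw [abs_mul]
  exact mul_le_mul (hF.bound x t) h (abs_nonneg _) hF.nonneg

theorem IsPotential.measurable_mul (hF : IsPotential M F) {V : Euc n → ℝ → ℝ}
    (hV : Measurable (Function.uncurry V)) :
    Measurable (Function.uncurry fun y s => F y s * V y s) :=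
  hF.measurable.mul hV

theorem measurable_dysonTerm (hw : IsWeight a w) (hF : IsPotential M F) (k : ℕ) :
    Measurable (Function.uncurry (dysonTerm F w k)) := by
  induction k with
  | zero =>
    exact measurable_heatS (α := Euc n × ℝ) (q := fun _ y => w y) measurable_snd measurable_fst
      (hw.continuous.measurable.comp measurable_snd)
  | succ k ih => exact measurable_duh (hF.measurable.mul ih)

theorem abs_dysonTerm_le (hw : IsWeight a w) (hF : IsPotential M F) (k : ℕ) :
    ∀ x, ∀ t ∈ Icc 0 T, |dysonTerm F w k x t|
      ≤ expMoment n (a * √T) * ((expMoment n (a * √T) * M) ^ k / k.factorial) * t ^ k * w x := by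
  induction k with
  | zero =>
    intro x t ht
    have := hw.abs_heatS_le (q := w) (B := 1) (fun y => by rw [one_mul, abs_of_pos (hw.pos y)])
      ht.2 x
    simpa [dysonTerm] using this
  | succ k ih =>
    intro x t ht
    set A := expMoment n (a * √T)
    have h := hw.abs_duh_le (T := T) (B := M * (A * ((A * M) ^ k / k.factorial))) k
      (q := fun y s => F y s * dysonTerm F w k y s)
      (fun y s hs => by
        have := hF.abs_mul_le (ih y s (Ioo_subset_Icc_self hs))
        linarith) ht x
    refine h.trans (le_of_eq ?_)
    rw [Nat.factorial_succ, pow_succ (A * M), show expMoment n (a * √T) = A from rfl]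
    push_cast
    have := Nat.factorial_pos k
    field_simp

theorem summable_exp_bound (A B t c : ℝ) :
    Summable (fun k : ℕ => A * (B ^ k / k.factorial) * t ^ k * c) := by
  have h := (Real.summable_pow_div_factorial (B * t)).mul_left (A * c)
  refine h.congr fun k => ?_
  rw [mul_pow]
  ring

/-- No restriction on `t` is needed: for negative `t` the Duhamel integrals are over empty
intervals, and only the term of index `0` remains. -/
theorem summable_abs_dysonTerm (hw : IsWeight a w) (hF : IsPotential M F) (x : Euc n) (t : ℝ) :
    Summable (fun k => |dysonTerm F w k x t|) := by
  rcases le_or_gt 0 t with ht | ht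
  · exact Summable.of_nonneg_of_le (fun _ => abs_nonneg _)
      (fun k => abs_dysonTerm_le (T := t) hw hF k x t ⟨ht, le_rfl⟩)
      (summable_exp_bound _ _ _ _)
  · refine summable_of_ne_finset_zero (s := {0}) fun k hk => ?_
    obtain ⟨k, rfl⟩ := Nat.exists_eq_succ_of_ne_zero (by simpa using hk)
    simp [dysonTerm, duh_of_nonpos _ x ht.le]

theorem dyson_zero (w : Euc n → ℝ) (F : Euc n → ℝ → ℝ) (x : Euc n) : dyson F w x 0 = w x := by
  rw [dyson, tsum_eq_single 0]
  · exact heatS_zero w x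
  intro k hk
  obtain ⟨k, rfl⟩ := Nat.exists_eq_succ_of_ne_zero hk
  simp [dysonTerm, duh_of_nonpos _ x le_rfl]

theorem measurable_dyson (hw : IsWeight a w) (hF : IsPotential M F) :
    Measurable (Function.uncurry (dyson F w)) := by
  refine measurable_of_tendsto_metrizable (f := fun N (p : Euc n × ℝ) =>
    ∑ k ∈ Finset.range N, dysonTerm F w k p.1 p.2) (fun N => ?_) ?_
  · exact Finset.measurable_sum _ fun k _ => measurable_dysonTerm hw hF k
  · rw [tendsto_pi_nhds]
    intro p
    exact (summable_abs_dysonTerm hw hF p.1 p.2).of_abs.hasSum.tendsto_sum_nat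

theorem duh_sub (hw : IsWeight a w) {q r : Euc n → ℝ → ℝ} {B B' : ℝ}
    (hqm : Measurable (Function.uncurry q)) (hrm : Measurable (Function.uncurry r))
    {t : ℝ} (hq : ∀ y, ∀ s ∈ Ioo 0 t, |q y s| ≤ B * w y)
    (hr : ∀ y, ∀ s ∈ Ioo 0 t, |r y s| ≤ B' * w y) (x : Euc n) :
    duh (fun y s => q y s - r y s) x t = duh q x t - duh r x t := by
  rw [duh, duh, duh, ← integral_sub (hw.integrableOn_duh hqm hq t x)
    (hw.integrableOn_duh hrm hr t x)]
  refine setIntegral_congr_fun measurableSet_Ioo fun s hs => ?_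
  exact heatS_sub _ _ _ _
    (hw.integrable_gauss_mul (hqm.comp (measurable_id.prodMk measurable_const))
      (fun y => hq y s hs) _ _)
    (hw.integrable_gauss_mul (hrm.comp (measurable_id.prodMk measurable_const))
      (fun y => hr y s hs) _ _)

theorem duh_add (hw : IsWeight a w) {q r : Euc n → ℝ → ℝ} {B B' : ℝ}
    (hqm : Measurable (Function.uncurry q)) (hrm : Measurable (Function.uncurry r))
    {t : ℝ} (hq : ∀ y, ∀ s ∈ Ioo 0 t, |q y s| ≤ B * w y)
    (hr : ∀ y, ∀ s ∈ Ioo 0 t, |r y s| ≤ B' * w y) (x : Euc n) :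
    duh (fun y s => q y s + r y s) x t = duh q x t + duh r x t := by
  rw [duh, duh, duh, ← integral_add (hw.integrableOn_duh hqm hq t x)
    (hw.integrableOn_duh hrm hr t x)]
  refine setIntegral_congr_fun measurableSet_Ioo fun s hs => ?_
  exact heatS_add _ _ _ _
    (hw.integrable_gauss_mul (hqm.comp (measurable_id.prodMk measurable_const))
      (fun y => hq y s hs) _ _)
    (hw.integrable_gauss_mul (hrm.comp (measurable_id.prodMk measurable_const))
      (fun y => hr y s hs) _ _)

theorem exp_bound_mono {A B t T c : ℝ} (hA : 0 ≤ A) (hB : 0 ≤ B) (ht : t ∈ Icc 0 T) (hc : 0 ≤ c)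
    (k : ℕ) : A * (B ^ k / k.factorial) * t ^ k * c ≤ A * (B ^ k / k.factorial) * T ^ k * c := by
  have := ht.1
  have := ht.2
  gcongr

/-- Up to `T` the tail of the series is uniformly small relative to `w`. -/
theorem exists_tail_bound (hw : IsWeight a w) (hF : IsPotential M F) (T : ℝ) :
    ∃ ε : ℕ → ℝ, Tendsto ε atTop (𝓝 0) ∧ ∀ N x, ∀ t ∈ Icc 0 T,
      |dyson F w x t - ∑ k ∈ Finset.range N, dysonTerm F w k x t| ≤ ε N * w x := by
  set A := expMoment n (a * √T)
  have hA : 0 ≤ A := (expMoment_pos _).le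
  set g : ℕ → ℝ := fun k => A * ((A * M) ^ k / k.factorial) * T ^ k * 1 with hg
  have hgs : Summable g := summable_exp_bound _ _ _ _
  refine ⟨fun N => ∑' k, g (k + N), tendsto_sum_nat_add g, fun N x t ht => ?_⟩
  have hs := (summable_abs_dysonTerm hw hF x t)
  have h1 : dyson F w x t - ∑ k ∈ Finset.range N, dysonTerm F w k x t
      = ∑' k, dysonTerm F w (k + N) x t := by
    rw [dyson, ← hs.of_abs.sum_add_tsum_nat_add N]
    ring
  rw [h1, ← tsum_mul_right, ← Real.norm_eq_abs]
  refine tsum_of_norm_bounded (((summable_nat_add_iff N).mpr hgs).mul_right _).hasSum fun k => ?_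
  refine (abs_dysonTerm_le hw hF (k + N) x t ht).trans ?_
  refine (exp_bound_mono hA (mul_nonneg hA hF.nonneg) ht (hw.pos x).le _).trans (le_of_eq ?_)
  simp [hg]

theorem exists_bound_dyson (hw : IsWeight a w) (hF : IsPotential M F) (T : ℝ) :
    ∃ C, ∀ x, ∀ t ∈ Icc 0 T, |dyson F w x t| ≤ C * w x := by
  obtain ⟨ε, -, h⟩ := exists_tail_bound hw hF T
  exact ⟨ε 0, fun x t ht => by simpa using h 0 x t ht⟩

/-- The partial sums are the Picard iterates of the mild equation, by linearity of the Duhamel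
integral. -/
theorem sum_dysonTerm_succ (hw : IsWeight a w) (hF : IsPotential M F) (N : ℕ) (x : Euc n)
    (t : ℝ) :
    ∑ k ∈ Finset.range (N + 1), dysonTerm F w k x t
      = heatS t w x + duh (fun y s => F y s * ∑ k ∈ Finset.range N, dysonTerm F w k y s) x t := by
  induction N with
  | zero =>
    simp [dysonTerm, duh, heatS]
  | succ N ih =>
    rw [Finset.sum_range_succ, ih, add_assoc]
    congr 1
    -- A partial sum is the full sum minus a tail, and both are bounded by multiples of `w`.
    have hb : ∀ N, ∃ B, ∀ y, ∀ s ∈ Ioo 0 t,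
        |F y s * ∑ k ∈ Finset.range N, dysonTerm F w k y s| ≤ B * w y := by
      intro N
      obtain ⟨C, hC⟩ := exists_bound_dyson hw hF t
      obtain ⟨ε, -, h⟩ := exists_tail_bound hw hF t
      refine ⟨M * (C + ε N), fun y s hs => ?_⟩
      rw [mul_assoc, add_mul]
      refine hF.abs_mul_le (V := fun y s => ∑ k ∈ Finset.range N, dysonTerm F w k y s) ?_
      have h1 := hC y s (Ioo_subset_Icc_self hs)
      have h2 := h N y s (Ioo_subset_Icc_self hs)
      rw [abs_le] at *
      constructor <;> linarith
    obtain ⟨B, hB⟩ := hb N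
    have hB' : ∀ y, ∀ s ∈ Ioo 0 t, |F y s * dysonTerm F w N y s|
        ≤ M * (expMoment n (a * √t) * ((expMoment n (a * √t) * M) ^ N / N.factorial) * t ^ N)
          * w y := by
      intro y s hs
      rw [mul_assoc]
      refine hF.abs_mul_le ((abs_dysonTerm_le hw hF N y s (Ioo_subset_Icc_self hs)).trans ?_)
      exact exp_bound_mono (expMoment_pos _).le (mul_nonneg (expMoment_pos _).le hF.nonneg)
        (Ioo_subset_Icc_self hs) (hw.pos y).le _
    have hm : Measurable (Function.uncurry
        fun y s => F y s * ∑ k ∈ Finset.range N, dysonTerm F w k y s) :=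
      hF.measurable.mul (Finset.measurable_sum _ fun k _ => measurable_dysonTerm hw hF k)
    have h := duh_add hw hm (hF.measurable_mul (measurable_dysonTerm hw hF N)) hB hB' x
    rw [dysonTerm]
    refine h.symm.trans ?_
    simp only [Finset.sum_range_succ, mul_add]

/-- The Picard recursion passes to the limit because the tail is small relative to `w` uniformly on
`[0, T]`, and the Duhamel integral is bounded on functions dominated by `w`. -/
theorem isMild_dyson (hw : IsWeight a w) (hF : IsPotential M F) (T : ℝ) :
    IsMild T F w (dyson F w) := by
  refine ⟨measurable_dyson hw hF, exists_bound_dyson hw hF T, fun x t ht => ?_⟩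
  obtain ⟨C, hC⟩ := exists_bound_dyson hw hF T
  obtain ⟨ε, hε, hb⟩ := exists_tail_bound hw hF T
  have hlim1 : Tendsto (fun N => ∑ k ∈ Finset.range (N + 1), dysonTerm F w k x t) atTop
      (𝓝 (dyson F w x t)) :=
    (tendsto_add_atTop_iff_nat 1).mpr
      (summable_abs_dysonTerm hw hF x t).of_abs.hasSum.tendsto_sum_nat
  refine tendsto_nhds_unique hlim1 ?_
  simp_rw [sum_dysonTerm_succ hw hF _ x t]
  refine Tendsto.const_add _ ?_
  have hmN : ∀ N, Measurable (Function.uncurry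
      fun y s => F y s * ∑ k ∈ Finset.range N, dysonTerm F w k y s) := fun N =>
    hF.measurable.mul (Finset.measurable_sum _ fun k _ => measurable_dysonTerm hw hF k)
  have hm : Measurable (Function.uncurry fun y s => F y s * dyson F w y s) :=
    hF.measurable.mul (measurable_dyson hw hF)
  have hT : 0 ≤ T := ht.1.trans ht.2
  rw [tendsto_iff_norm_sub_tendsto_zero]
  refine squeeze_zero (fun _ => norm_nonneg _)
    (g := fun N => expMoment n (a * √T) * (M * ε N) * (t ^ (0 + 1) / ((0 : ℕ) + 1)) * w x)
    (fun N => ?_) ?_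
  · have h1 : ∀ y, ∀ s ∈ Ioo 0 T, |F y s * dyson F w y s| ≤ (M * C) * w y := fun y s hs => by
      rw [mul_assoc]
      exact hF.abs_mul_le (hC y s (Ioo_subset_Icc_self hs))
    have h3 : ∀ y, ∀ s ∈ Ioo 0 T,
        |F y s * (dyson F w y s - ∑ k ∈ Finset.range N, dysonTerm F w k y s)|
        ≤ (M * ε N) * w y := fun y s hs => by
      rw [mul_assoc]
      exact hF.abs_mul_le (V := fun y s => dyson F w y s
        - ∑ k ∈ Finset.range N, dysonTerm F w k y s) (hb N y s (Ioo_subset_Icc_self hs))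
    have h2 : ∀ y, ∀ s ∈ Ioo 0 T, |F y s * ∑ k ∈ Finset.range N, dysonTerm F w k y s|
        ≤ (M * C + M * ε N) * w y := fun y s hs => by
      have e1 := h1 y s hs
      have e3 := h3 y s hs
      rw [mul_sub] at e3
      rw [abs_le] at *
      constructor <;> linarith
    rw [norm_sub_rev, ← duh_sub hw hm (hmN N) (fun y s hs => h1 y s ⟨hs.1, hs.2.trans_le ht.2⟩)
      (fun y s hs => h2 y s ⟨hs.1, hs.2.trans_le ht.2⟩) x]
    simp_rw [← mul_sub]
    exact hw.abs_duh_le 0 (fun y s hs => by simpa using h3 y s hs) ht x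
  · have := ((hε.const_mul M).const_mul (expMoment n (a * √T))).mul_const
      (t ^ (0 + 1) / ((0 : ℕ) + 1)) |>.mul_const (w x)
    simpa using this

/-- The difference of two solutions is a fixed point of the homogeneous Duhamel operator, whose
iterates are bounded by `(A M t)^k / k!`. -/
theorem IsMild.unique (hw : IsWeight a w) (hF : IsPotential M F) {V W : Euc n → ℝ → ℝ}
    (hV : IsMild T F w V) (hW : IsMild T F w W) (x : Euc n) {t : ℝ} (ht : t ∈ Icc 0 T) :
    V x t = W x t := by
  obtain ⟨C, hC⟩ := hV.bound
  obtain ⟨C', hC'⟩ := hW.bound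
  set A := expMoment n (a * √T)
  have key : ∀ k : ℕ, ∀ y, ∀ s ∈ Icc 0 T,
      |V y s - W y s| ≤ (C + C') * ((A * M) ^ k / k.factorial) * s ^ k * w y := by
    intro k
    induction k with
    | zero =>
      intro y s hs
      have h1 := hC y s hs
      have h2 := hC' y s hs
      have h3 : |V y s - W y s| ≤ (C + C') * w y := by
        rw [abs_le] at *
        constructor <;> linarith
      simpa using h3
    | succ k ih =>
      intro y s hs
      have h1 : V y s - W y s = duh (fun y s => F y s * (V y s - W y s)) y s := by
        rw [hV.eq y s hs, hW.eq y s hs, add_sub_add_left_eq_sub]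
        simp_rw [mul_sub]
        rw [duh_sub hw (hF.measurable_mul hV.measurable) (hF.measurable_mul hW.measurable)
          (B := M * C) (B' := M * C')]
        · intro z r hr
          rw [mul_assoc]
          exact hF.abs_mul_le (hC z r ⟨hr.1.le, hr.2.le.trans hs.2⟩)
        · intro z r hr
          rw [mul_assoc]
          exact hF.abs_mul_le (hC' z r ⟨hr.1.le, hr.2.le.trans hs.2⟩)
      rw [h1]
      refine (hw.abs_duh_le (T := T) (B := M * ((C + C') * ((A * M) ^ k / k.factorial))) k
        (fun z r hr => ?_) hs y).trans (le_of_eq ?_)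
      · have := hF.abs_mul_le (V := fun y s => V y s - W y s) (ih z r (Ioo_subset_Icc_self hr))
        linarith
      · rw [Nat.factorial_succ, pow_succ (A * M), show expMoment n (a * √T) = A from rfl]
        push_cast
        have := Nat.factorial_pos k
        field_simp
  have hlim := (summable_exp_bound (C + C') (A * M) t (w x)).tendsto_atTop_zero
  have : |V x t - W x t| ≤ 0 :=
    ge_of_tendsto hlim (Eventually.of_forall fun k => key k x t ht)
  exact sub_eq_zero.mp (abs_eq_zero.mp (le_antisymm this (abs_nonneg _)))

end

/-! ### Positivity: shifting the potential by a constant. -/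

section

variable {a M T : ℝ} {w : Euc n → ℝ} {F : Euc n → ℝ → ℝ}

/-- Fubini and the semigroup law: running the flow further only lengthens the time lag in the
Duhamel integral. -/
theorem heatS_duh (hw : IsWeight a w) {Q : Euc n → ℝ → ℝ} {B : ℝ}
    (hQm : Measurable (Function.uncurry Q)) {s : ℝ} (hQ : ∀ y, ∀ r ∈ Ioo 0 s, |Q y r| ≤ B * w y)
    {τ : ℝ} (hτ : 0 ≤ τ) (x : Euc n) :
    heatS τ (fun y => duh Q y s) x = ∫ r in Ioo 0 s, heatS (τ + (s - r)) (fun y => Q y r) x := by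
  have hm : Measurable (fun p : Euc n × ℝ =>
      gauss p.1 * heatS (s - p.2) (fun y => Q y p.2) (x - √τ • p.1)) := by
    refine (continuous_gauss.measurable.comp measurable_fst).mul ?_
    refine measurable_heatS (q := fun (p : Euc n × ℝ) y => Q y p.2) (by fun_prop) (by fun_prop) ?_
    exact hQm.comp (measurable_snd.prodMk (measurable_snd.comp measurable_fst))
  have hInt : Integrable (Function.uncurry fun (z : Euc n) (r : ℝ) =>
      gauss z * heatS (s - r) (fun y => Q y r) (x - √τ • z))
      (volume.prod (volume.restrict (Ioo 0 s))) := by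
    have h1 := (((integrable_exp_mul_gauss (n := n) (a * √τ)).const_mul
      (expMoment n (a * √s) * B * w x))).mul_prod
      (integrable_const (1 : ℝ) (μ := volume.restrict (Ioo 0 s)))
    refine h1.mono' hm.aestronglyMeasurable ?_
    have : ∀ᵐ r ∂(volume.restrict (Ioo 0 s)), r ∈ Ioo 0 s :=
      ae_restrict_mem measurableSet_Ioo
    have h2 : ∀ᵐ p ∂((volume : Measure (Euc n)).prod (volume.restrict (Ioo 0 s))),
        p.2 ∈ Ioo 0 s := Measure.quasiMeasurePreserving_snd.ae this
    filter_upwards [h2] with p hp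
    rw [mul_one]
    exact hw.gauss_mul_le (q := heatS (s - p.2) (fun y => Q y p.2))
      (fun y => hw.abs_heatS_le (fun y => hQ y p.2 hp) (by linarith [hp.1]) y) le_rfl x p.1
  have h3 : heatS τ (fun y => duh Q y s) x = ∫ z, ∫ r in Ioo 0 s,
      gauss z * heatS (s - r) (fun y => Q y r) (x - √τ • z) := by
    simp only [heatS, duh, ← integral_const_mul]
  rw [h3, integral_integral_swap hInt]
  refine setIntegral_congr_fun measurableSet_Ioo fun r hr => ?_
  exact hw.heatS_heatS (hQm.comp (measurable_id.prodMk measurable_const))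
    (fun y => hQ y r hr) hτ (by linarith [hr.2]) x

theorem IsWeight.heatS_nonneg {q : Euc n → ℝ} (hq : ∀ y, 0 ≤ q y) (t : ℝ) (x : Euc n) :
    0 ≤ heatS t q x :=
  integral_nonneg fun z => mul_nonneg (gauss_pos z).le (hq _)

theorem dysonTerm_nonneg (hw : IsWeight a w) (hF : ∀ x t, 0 ≤ F x t) (k : ℕ) (x : Euc n) (t : ℝ) :
    0 ≤ dysonTerm F w k x t := by
  induction k generalizing x t with
  | zero => exact IsWeight.heatS_nonneg (fun y => (hw.pos y).le) t x
  | succ k ih =>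
    exact integral_nonneg fun s => IsWeight.heatS_nonneg (fun y => mul_nonneg (hF y s) (ih y s)) _ _

/-- For differentiable solutions this is the product rule for `exp (-M t) H`. At the mild level the
product rule is applied, at a fixed point `(x, t)`, to `exp (-M s)` times `s ↦ K(t - s) ∗ H(s)`,
which is Lipschitz in `s`. -/
theorem isMild_exp_mul (hw : IsWeight a w) (hF : IsPotential M F) {H : Euc n → ℝ → ℝ}
    (hH : IsMild T (fun x t => F x t + M) w H) :
    IsMild T F w (fun x t => Real.exp (-M * t) * H x t) := by
  obtain ⟨C, hC⟩ := hH.bound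
  have hM := hF.nonneg
  refine ⟨?_, ⟨C, fun x t ht => ?_⟩, fun x t ht => ?_⟩
  · exact (by fun_prop : Measurable fun p : Euc n × ℝ => Real.exp (-M * p.2)).mul hH.measurable
  · rw [abs_mul, abs_of_pos (Real.exp_pos _)]
    refine (mul_le_of_le_one_left (abs_nonneg _) ?_).trans (hC x t ht)
    rw [Real.exp_le_one_iff]
    nlinarith [ht.1]
  set Q : Euc n → ℝ → ℝ := fun y s => (F y s + M) * H y s with hQ
  have hFM : IsPotential (M + M) (fun x t => F x t + M) :=
    ⟨hF.measurable.add_const M, fun x t => by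
      have := hF.bound x t
      rw [abs_le] at *
      constructor <;> linarith⟩
  have hQm : Measurable (Function.uncurry Q) := hFM.measurable_mul hH.measurable
  have hQb : ∀ y, ∀ r ∈ Ioo 0 T, |Q y r| ≤ (M + M) * C * w y := fun y r hr => by
    rw [mul_assoc]
    exact hFM.abs_mul_le (hC y r (Ioo_subset_Icc_self hr))
  set q : ℝ → ℝ := fun s => if s ∈ Ioo 0 t then heatS (t - s) (fun y => Q y s) x else 0 with hq
  set Cq := expMoment n (a * √T) * ((M + M) * C) * w x with hCq
  have hC0 : 0 ≤ C := nonneg_of_mul_nonneg_left ((abs_nonneg _).trans (hC x t ht)) (hw.pos x)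
  have hCq0 : 0 ≤ Cq := by
    have := expMoment_pos (n := n) (a * √T)
    have := hw.pos x
    positivity
  have hqb : ∀ s, |q s| ≤ Cq := by
    intro s
    simp only [hq]
    split_ifs with h
    · exact hw.abs_heatS_le (fun y => hQb y s ⟨h.1, h.2.trans_le ht.2⟩)
        (by linarith [h.1, ht.2]) x
    · simpa using hCq0
  have hqm : Measurable q := by
    refine Measurable.ite measurableSet_Ioo ?_ measurable_const
    exact measurable_heatS (q := fun s y => Q y s) (by fun_prop) measurable_const
      (hQm.comp measurable_swap)
  have hqi : IntervalIntegrable q volume 0 t := by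
    rw [intervalIntegrable_iff]
    exact IntegrableOn.of_bound (by simp) hqm.aestronglyMeasurable Cq (ae_of_all _ hqb)
  set Y : ℝ → ℝ := fun s => heatS t w x + ∫ r in (0 : ℝ)..s, q r with hY
  have hY0 : Y 0 = heatS t w x := by simp [hY]
  -- Applying `K(t - s)` to the mild equation at time `s` and using the semigroup law gives an
  -- integral whose integrand `q` does not depend on `s`; so the left-hand side is a primitive of
  -- `q`.
  have hYs : ∀ s ∈ Ioo 0 t, heatS (t - s) (fun y => H y s) x = Y s := by
    intro s hs
    have hsT : s ∈ Icc 0 T := ⟨hs.1.le, hs.2.le.trans ht.2⟩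
    have hw1 : ∀ y, |w y| ≤ 1 * w y := fun y => by rw [one_mul, abs_of_pos (hw.pos y)]
    have hQs : ∀ y, ∀ r ∈ Ioo 0 s, |Q y r| ≤ (M + M) * C * w y := fun y r hr =>
      hQb y r ⟨hr.1, hr.2.trans_le hsT.2⟩
    have e1 : (fun y => H y s) = fun y => heatS s w y + duh Q y s :=
      funext fun y => hH.eq y s hsT
    have hdb : ∀ y, |duh Q y s| ≤ expMoment n (a * √s) * ((M + M) * C) * s * w y := fun y => by
      have := hw.abs_duh_le (T := s) (B := (M + M) * C) 0 (q := Q)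
        (fun y r hr => by simpa using hQs y r hr) ⟨hs.1.le, le_rfl⟩ y
      simpa using this
    rw [e1, heatS_add]
    · rw [hw.heatS_heatS hw.continuous.measurable hw1 (by linarith [hs.2]) hs.1.le,
        heatS_duh hw hQm hQs (by linarith [hs.2]), sub_add_cancel, hY]
      simp only
      rw [intervalIntegral.integral_of_le hs.1.le, integral_Ioc_eq_integral_Ioo]
      congr 1
      refine setIntegral_congr_fun measurableSet_Ioo fun r hr => ?_
      simp only [hq]
      rw [if_pos ⟨hr.1, hr.2.trans hs.2⟩]
      congr 1
      ring
    · exact hw.integrable_gauss_mul (measurable_heatS (α := Euc n) (q := fun _ y => w y)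
        measurable_const measurable_id (hw.continuous.measurable.comp measurable_snd))
        (fun y => hw.abs_heatS_le hw1 le_rfl y) _ _
    · exact hw.integrable_gauss_mul ((measurable_duh hQm).comp
        (measurable_id.prodMk measurable_const)) hdb _ _
  have hYt : Y t = H x t := by
    rw [hH.eq x t ht, hY]
    simp only
    rw [intervalIntegral.integral_of_le ht.1, integral_Ioc_eq_integral_Ioo, duh]
    congr 1
    refine setIntegral_congr_fun measurableSet_Ioo fun r hr => ?_
    simp only [hq]
    rw [if_pos hr]
  have hYr : ∀ s ∈ Icc 0 t, Y s ∈ Icc (-(|heatS t w x| + Cq * t)) (|heatS t w x| + Cq * t) := by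
    intro s hs
    rw [mem_Icc, ← abs_le, hY]
    refine (abs_add_le _ _).trans (add_le_add le_rfl ?_)
    refine (intervalIntegral.norm_integral_le_of_norm_le_const (C := Cq) (f := q)
      fun r _ => hqb r).trans ?_
    rw [sub_zero, abs_of_nonneg hs.1]
    exact mul_le_mul_of_nonneg_left hs.2 hCq0
  have key := integral_comp_primitive (y := Y) (b := q) (Φ := id) (Φ' := fun _ => 1)
    (ξ := fun s => Real.exp (-M * s)) (ξ' := fun s => Real.exp (-M * s) * (-M)) ht.1 hqi
    (fun s _ => hqb s) (fun s _ => by rw [hY0]) hYr (fun r _ => hasDerivAt_id r)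
    continuousOn_const (fun s => by
      have := ((hasDerivAt_id s).const_mul (-M)).exp
      simpa using this) (by fun_prop)
  simp only [id, hYt, hY0, one_mul, mul_zero, Real.exp_zero, mul_one] at key
  -- Writing `F = (F + M) - M` splits the integrand into exactly the two terms of the product rule
  -- in `key`.
  have e2 : duh (fun y s => F y s * (Real.exp (-M * s) * H y s)) x t
      = ∫ s in (0 : ℝ)..t, (q s * Real.exp (-M * s) + Y s * (Real.exp (-M * s) * (-M))) := by
    rw [duh, intervalIntegral.integral_of_le ht.1, integral_Ioc_eq_integral_Ioo]
    refine setIntegral_congr_fun measurableSet_Ioo fun s hs => ?_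
    have hsT : s ∈ Ioo 0 T := ⟨hs.1, hs.2.trans_le ht.2⟩
    have e3 : (fun y => F y s * (Real.exp (-M * s) * H y s))
        = fun y => Real.exp (-M * s) * (Q y s - M * H y s) := by
      funext y
      simp only [hQ]
      ring
    rw [e3, heatS_const_mul, heatS_sub, heatS_const_mul, hYs s hs]
    · simp only [hq]
      rw [if_pos hs]
      ring
    · exact hw.integrable_gauss_mul (hQm.comp (measurable_id.prodMk measurable_const))
        (fun y => hQb y s hsT) _ _
    · refine hw.integrable_gauss_mul (B := M * C) ((hH.measurable.comp
        (measurable_id.prodMk measurable_const)).const_mul M) (fun y => ?_) _ _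
      rw [abs_mul, abs_of_nonneg hM, mul_assoc]
      exact mul_le_mul_of_nonneg_left (hC y s (Ioo_subset_Icc_self hsT)) hM
  rw [e2, key]
  ring

/-- With the potential `F + M ≥ 0` all terms are nonnegative, so the sum is at least its first term
`K(t) ∗ w`. Uniqueness identifies the series for `F` with `exp (-M t)` times this sum. -/
theorem exists_lower_bound_dyson (hw : IsWeight a w) (hF : IsPotential M F) (T : ℝ) :
    ∃ c, 0 < c ∧ ∀ x, ∀ t ∈ Icc 0 T, c * w x ≤ dyson F w x t := by
  have hFM : IsPotential (M + M) (fun x t => F x t + M) :=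
    ⟨hF.measurable.add_const M, fun x t => by
      have := hF.bound x t
      rw [abs_le] at *
      constructor <;> linarith⟩
  refine ⟨Real.exp (-M * T) * expMoment n (-(a * √T)),
    mul_pos (Real.exp_pos _) (expMoment_pos _), fun x t ht => ?_⟩
  rw [(isMild_dyson hw hF T).unique hw hF (isMild_exp_mul hw hF (isMild_dyson hw hFM T)) x ht,
    mul_assoc]
  have h0 : ∀ k, 0 ≤ dysonTerm (fun x t => F x t + M) w k x t := fun k =>
    dysonTerm_nonneg hw (fun x t => by linarith [(abs_le.mp (hF.bound x t)).1]) k x t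
  have h1 : heatS t w x ≤ dyson (fun x t => F x t + M) w x t :=
    (summable_abs_dysonTerm hw hFM x t).of_abs.le_tsum 0 fun k _ => h0 k
  have h2 := hw.le_heatS ht.2 x
  have h3 : 0 ≤ expMoment n (-(a * √T)) * w x := mul_nonneg (expMoment_pos _).le (hw.pos x).le
  refine mul_le_mul (Real.exp_le_exp.mpr ?_) (h2.trans h1) h3 (Real.exp_pos _).le
  nlinarith [ht.2, hF.nonneg]

end

/-! ### Gradients of the heat flow and of the Duhamel integral. -/

theorem integrable_exp_mul_exp_neg_sq {b : ℝ} (hb : 0 < b) (c : ℝ) (x : Euc n) :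
    Integrable (fun y : Euc n => Real.exp (c * ‖x - y‖) * Real.exp (-b * ‖x - y‖ ^ 2)) := by
  have h := ((integrable_exp_neg_mul_sq (n := n) (half_pos hb)).comp_sub_left x).const_mul
    (Real.exp (c ^ 2 / (2 * b)))
  refine h.mono' (Continuous.aestronglyMeasurable (by fun_prop)) (ae_of_all _ fun y => ?_)
  rw [Real.norm_of_nonneg (by positivity), ← Real.exp_add, ← Real.exp_add]
  apply Real.exp_le_exp.mpr
  have : 0 ≤ b / 2 * (‖x - y‖ - c / b) ^ 2 := by positivity
  have h2 : b / 2 * (‖x - y‖ - c / b) ^ 2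
      = b / 2 * ‖x - y‖ ^ 2 - c * ‖x - y‖ + c ^ 2 / (2 * b) := by
    field_simp
    ring
  linarith

/-- The gradient of `heatS τ q`. -/
def gradS (τ : ℝ) (q : Euc n → ℝ) (x : Euc n) : Euc n :=
  (-(1 / (2 * √τ))) • ∫ z, (gauss z * q (x - √τ • z)) • z

theorem measurable_gradS {α : Type*} [MeasurableSpace α] {τ : α → ℝ} {X : α → Euc n}
    {q : α → Euc n → ℝ} (hτ : Measurable τ) (hX : Measurable X)
    (hq : Measurable (Function.uncurry q)) :
    Measurable (fun b => gradS (τ b) (q b) (X b)) := by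
  have hs : Measurable (fun b => √(τ b)) := Real.continuous_sqrt.measurable.comp hτ
  have h : Measurable (fun p : α × Euc n =>
      (gauss p.2 * q p.1 (X p.1 - √(τ p.1) • p.2)) • p.2) := by
    have h2 : Measurable (fun p : α × Euc n => X p.1 - √(τ p.1) • p.2) :=
      (hX.comp measurable_fst).sub ((hs.comp measurable_fst).smul measurable_snd)
    exact ((continuous_gauss.measurable.comp measurable_snd).mul
      (hq.comp (measurable_fst.prodMk h2))).smul measurable_snd
  have h3 := (h.stronglyMeasurable.integral_prod_right' (ν := volume)).measurable
  exact (measurable_const.div (measurable_const.mul hs)).neg.smul h3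

theorem norm_le_exp_norm (z : Euc n) : ‖z‖ ≤ Real.exp ‖z‖ := by
  linarith [Real.add_one_le_exp ‖z‖]

section

variable {a T B t : ℝ} {w : Euc n → ℝ} {q : Euc n → ℝ}

theorem IsWeight.norm_gauss_smul_le (hw : IsWeight a w) (hq : ∀ y, |q y| ≤ B * w y) (ht : t ≤ T)
    (x z : Euc n) : ‖(gauss z * q (x - √t • z)) • z‖
      ≤ B * w x * (Real.exp ((a * √T + 1) * ‖z‖) * gauss z) := by
  rw [norm_smul, Real.norm_eq_abs]
  refine (mul_le_mul (hw.gauss_mul_le hq ht x z) (norm_le_exp_norm z) (norm_nonneg _)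
    ((abs_nonneg _).trans (hw.gauss_mul_le hq ht x z))).trans (le_of_eq ?_)
  rw [add_mul, Real.exp_add, one_mul]
  ring

theorem IsWeight.integrable_gauss_smul (hw : IsWeight a w) (hqm : Measurable q)
    (hq : ∀ y, |q y| ≤ B * w y) (t : ℝ) (x : Euc n) :
    Integrable (fun z => (gauss z * q (x - √t • z)) • z) := by
  refine ((integrable_exp_mul_gauss (n := n) (a * √t + 1)).const_mul (B * w x)).mono' ?_
    (ae_of_all _ fun z => hw.norm_gauss_smul_le hq le_rfl x z)
  exact ((continuous_gauss.measurable.mul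
    (hqm.comp (by fun_prop))).smul measurable_id).aestronglyMeasurable

/-- Without regularity of `q` the gradient blows up like `t^(-1/2)`. This is integrable in time,
hence good enough for the Duhamel term, but not for the initial value, for which
`IsWeight.norm_gradS_self_le` is used. -/
theorem IsWeight.norm_gradS_le (hw : IsWeight a w)
    (hq : ∀ y, |q y| ≤ B * w y) (ht : t ≤ T) (x : Euc n) :
    ‖gradS t q x‖ ≤ 1 / (2 * √t) * (expMoment n (a * √T + 1) * B * w x) := by
  have h := norm_integral_le_of_norm_le (f := fun z => (gauss z * q (x - √t • z)) • z)
    ((integrable_exp_mul_gauss (n := n) (a * √T + 1)).const_mul (B * w x))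
    (ae_of_all _ fun z => hw.norm_gauss_smul_le hq ht x z)
  rw [integral_const_mul] at h
  rw [gradS, norm_smul, norm_neg, Real.norm_of_nonneg (by positivity)]
  refine mul_le_mul_of_nonneg_left (h.trans (le_of_eq ?_)) (by positivity)
  rw [expMoment]
  ring

theorem hasFDerivAt_heatKernel (ht : 0 < t) (v : Euc n) :
    HasFDerivAt (fun v : Euc n => heatKernel v t)
      ((-(1 / (2 * t)) * heatKernel v t) • innerSL ℝ v) v := by
  have h1 := (HasStrictFDerivAt.hasFDerivAt (hasStrictFDerivAt_norm_sq v))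
  have h2 := ((h1.neg.mul_const (1 / (4 * t))).exp.const_mul
    (1 / (4 * Real.pi * t) ^ ((n : ℝ) / 2)))
  have e : (fun v : Euc n => heatKernel v t) = fun v => 1 / (4 * Real.pi * t) ^ ((n : ℝ) / 2) *
      Real.exp (-‖v‖ ^ 2 * (1 / (4 * t))) := by
    funext v
    rw [heatKernel]
    congr 2
    ring
  rw [e]
  refine h2.congr_fderiv ?_
  ext u
  simp [heatKernel]
  field_simp
  ring

/-- Since `q` is only measurable, the derivative must fall on the kernel: one differentiates the
unscaled integral in `x` under the integral sign and rescales the result. -/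
theorem IsWeight.hasFDerivAt_heatS (hw : IsWeight a w) (hqm : Measurable q)
    (hq : ∀ y, |q y| ≤ B * w y) (ht : 0 < t) (x : Euc n) :
    HasFDerivAt (heatS t q) (innerSL ℝ (gradS t q x)) x := by
  have hs : 0 < √t := Real.sqrt_pos.mpr ht
  have hB : 0 ≤ B := nonneg_of_mul_nonneg_left ((abs_nonneg _).trans (hq x)) (hw.pos x)
  have hK : Measurable (fun p : Euc n => heatKernel p t) := by
    unfold heatKernel
    fun_prop
  have e1 : heatS t q = fun x => ∫ y, heatKernel (x - y) t * q y := by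
    funext x
    rw [← heatConv_eq_heatS ht.le, heatConv, if_neg ht.ne']
  set F' : Euc n → Euc n → (Euc n →L[ℝ] ℝ) := fun x y =>
    (q y * (-(1 / (2 * t)) * heatKernel (x - y) t)) • innerSL ℝ (x - y) with hF'
  have hmeas : ∀ x, AEStronglyMeasurable (F' x) := by
    intro x
    have h1 : Measurable (fun y => q y * (-(1 / (2 * t)) * heatKernel (x - y) t)) :=
      hqm.mul ((hK.comp (by fun_prop)).const_mul _)
    exact h1.aestronglyMeasurable.smul
      (Continuous.aestronglyMeasurable (by fun_prop))
  set D := 1 / (4 * Real.pi * t) ^ ((n : ℝ) / 2) with hD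
  have hD0 : 0 ≤ D := by positivity
  have key : HasFDerivAt (fun x => ∫ y, heatKernel (x - y) t * q y) (∫ y, F' x y) x := by
    refine hasFDerivAt_integral_of_dominated_of_fderiv_le (Metric.ball_mem_nhds x one_pos)
      (bound := fun y => (B * w x * (1 / (2 * t)) * (D * Real.exp (1 / (4 * t))) * Real.exp 0) *
        (Real.exp ((a + 1) * ‖x - y‖) * Real.exp (-(1 / (8 * t)) * ‖x - y‖ ^ 2)))
      (Eventually.of_forall fun x => ((hK.comp (by fun_prop)).mul hqm).aestronglyMeasurable)
      (hw.integrable_heatKernel_mul hqm hq ht x) (hmeas x) ?_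
      ((integrable_exp_mul_exp_neg_sq (by positivity) _ x).const_mul _) ?_
    · refine ae_of_all _ fun y x' hx' => ?_
      have hd : ‖x' - x‖ < 1 := by rwa [mem_ball_iff_norm] at hx'
      have h1 : ‖x' - y‖ ≤ 1 + ‖x - y‖ := by
        have := norm_add_le (x' - x) (x - y)
        rw [sub_add_sub_cancel] at this
        linarith
      have h2 : ‖x - y‖ ≤ 1 + ‖x' - y‖ := by
        have := norm_add_le (x - x') (x' - y)
        rw [sub_add_sub_cancel, norm_sub_rev x x'] at this
        linarith
      -- This gives a Gaussian bound centred at `x` valid for all `x'` in the unit ball about `x`,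
      -- at the price of replacing `1 / (4t)` by `1 / (8t)` in the exponent.
      have h3 : ‖x - y‖ ^ 2 ≤ 2 * ‖x' - y‖ ^ 2 + 2 := by
        nlinarith [norm_nonneg (x - y), norm_nonneg (x' - y), sq_nonneg (‖x' - y‖ - 1)]
      have h4 : heatKernel (x' - y) t
          ≤ D * Real.exp (1 / (4 * t)) * Real.exp (-(1 / (8 * t)) * ‖x - y‖ ^ 2) := by
        rw [heatKernel, mul_assoc D, ← Real.exp_add]
        refine mul_le_mul_of_nonneg_left (Real.exp_le_exp.mpr ?_) hD0
        have : 1 / (4 * t) + -(1 / (8 * t)) * ‖x - y‖ ^ 2 - -‖x' - y‖ ^ 2 / (4 * t)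
            = (1 / (8 * t)) * (2 * ‖x' - y‖ ^ 2 + 2 - ‖x - y‖ ^ 2) := by
          field_simp
          ring
        have h5 : 0 ≤ (1 / (8 * t)) * (2 * ‖x' - y‖ ^ 2 + 2 - ‖x - y‖ ^ 2) :=
          mul_nonneg (by positivity) (by linarith)
        linarith
      have h5 : |q y| ≤ B * w x * Real.exp (a * ‖x - y‖) := by
        refine (hq y).trans ?_
        rw [mul_assoc]
        exact mul_le_mul_of_nonneg_left (hw.le_mul_exp x y) hB
      have h6 : ‖x' - y‖ ≤ Real.exp ‖x - y‖ := by linarith [Real.add_one_le_exp ‖x - y‖]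
      have hK0 : 0 ≤ heatKernel (x' - y) t := by unfold heatKernel; positivity
      have hwx := hw.pos x
      simp only [hF']
      rw [norm_smul, innerSL_apply_norm, norm_mul, Real.norm_eq_abs, norm_mul, norm_neg,
        Real.norm_of_nonneg hK0, Real.norm_of_nonneg (by positivity : 0 ≤ 1 / (2 * t))]
      calc |q y| * (1 / (2 * t) * heatKernel (x' - y) t) * ‖x' - y‖
          ≤ (B * w x * Real.exp (a * ‖x - y‖)) * (1 / (2 * t) *
            (D * Real.exp (1 / (4 * t)) * Real.exp (-(1 / (8 * t)) * ‖x - y‖ ^ 2)))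
            * Real.exp ‖x - y‖ := by gcongr
        _ = _ := by
          rw [add_mul, Real.exp_add, one_mul, Real.exp_zero]
          ring
    · refine ae_of_all _ fun y x' _ => ?_
      have h := ((hasFDerivAt_heatKernel ht (x' - y)).comp x'
        ((hasFDerivAt_id x').sub_const y)).mul_const (q y)
      refine h.congr_fderiv ?_
      ext u
      simp [hF']
      ring
  rw [e1]
  refine key.congr_fderiv ?_
  rw [integral_rescale ht x, gradS]
  have h7 : ∀ z, F' x (x - √t • z)
      = ((√t ^ n)⁻¹ * (-(1 / (2 * √t)))) • innerSL ℝ ((gauss z * q (x - √t • z)) • z) := by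
    intro z
    simp only [hF', sub_sub_cancel, heatKernel_smul ht, map_smul, smul_smul]
    congr 1
    have : t = √t * √t := (Real.mul_self_sqrt ht.le).symm
    rw [show 1 / (2 * t) = 1 / (2 * (√t * √t)) by rw [← this]]
    field_simp
  simp_rw [h7]
  rw [integral_smul, ContinuousLinearMap.integral_comp_comm _
    (hw.integrable_gauss_smul hqm hq t x), smul_smul, ← mul_assoc,
    mul_inv_cancel₀ (by positivity), one_mul, map_smul]

/-- Relative Lipschitz bound for the gradient of the heat flow of the weight. -/
theorem IsWeight.norm_gradS_self_le (hw : IsWeight a w) (ht : 0 < t) (htT : t ≤ T) (x : Euc n) :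
    ‖gradS t w x‖ ≤ 2 * a * expMoment n (a * √T) * w x := by
  have hw1 : ∀ y, |w y| ≤ 1 * w y := fun y => by rw [one_mul, abs_of_pos (hw.pos y)]
  have hd := hw.hasFDerivAt_heatS hw.continuous.measurable hw1 ht x
  have hA := expMoment_pos (n := n) (a * √T)
  have ha := hw.rate_nonneg
  have hwx := hw.pos x
  rw [← innerSL_apply_norm (𝕜 := ℝ)]
  refine hd.le_of_lip' (by positivity) ?_
  have hev : ∀ᶠ y in 𝓝 x, a * ‖y - x‖ < 1 := by
    have : Tendsto (fun y => a * ‖y - x‖) (𝓝 x) (𝓝 (a * ‖x - x‖)) := by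
      apply Continuous.tendsto
      fun_prop
    simp only [sub_self, norm_zero, mul_zero] at this
    exact this.eventually (gt_mem_nhds one_pos)
  filter_upwards [hev] with y hy
  have hdiff : ∀ u v : Euc n, v - u = y - x → |w v - w u| ≤ 2 * a * ‖y - x‖ * w u := by
    intro u v huv
    have h1 := hw.le_mul_exp u v
    have h2 := hw.le_mul_exp v u
    rw [norm_sub_rev, huv] at h1
    rw [huv] at h2
    have h3 : |Real.exp (a * ‖y - x‖) - 1| ≤ 2 * |a * ‖y - x‖| :=
      Real.abs_exp_sub_one_le (by rw [abs_of_nonneg (by positivity)]; exact hy.le)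
    rw [abs_of_nonneg (by positivity : 0 ≤ a * ‖y - x‖)] at h3
    have h4 := (abs_le.mp h3).2
    have hu := hw.pos u
    have hv := hw.pos v
    set e := Real.exp (a * ‖y - x‖)
    rw [abs_le]
    constructor
    -- If `w v ≤ w u`, then `w u - w v ≤ (e - 1) w v ≤ (e - 1) w u`; otherwise the lower bound is
    -- trivial.
    · by_cases hc : w v ≤ w u
      · nlinarith [mul_le_mul_of_nonneg_right hc (by
          have : 1 ≤ e := Real.one_le_exp (by positivity)
          linarith : 0 ≤ e - 1)]
      · nlinarith [mul_nonneg (mul_nonneg ha (norm_nonneg (y - x))) hu.le]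
    · nlinarith
  have e1 : heatS t w y - heatS t w x
      = ∫ z, gauss z * (w (y - √t • z) - w (x - √t • z)) := by
    simp only [mul_sub]
    rw [integral_sub (hw.integrable_gauss_mul hw.continuous.measurable hw1 t y)
      (hw.integrable_gauss_mul hw.continuous.measurable hw1 t x)]
    rfl
  rw [e1]
  have h := norm_integral_le_of_norm_le (f := fun z => gauss z * (w (y - √t • z) - w (x - √t • z)))
    ((integrable_exp_mul_gauss (n := n) (a * √T)).const_mul (2 * a * ‖y - x‖ * w x))
    (ae_of_all _ fun z => by
      have h1 := hdiff (x - √t • z) (y - √t • z) (by abel)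
      have h2 := hw.shift_le htT x z
      rw [norm_mul, Real.norm_eq_abs, Real.norm_eq_abs, abs_of_pos (gauss_pos z)]
      calc _ ≤ gauss z * (2 * a * ‖y - x‖ * (w x * Real.exp (a * √T * ‖z‖))) := by
            refine mul_le_mul_of_nonneg_left (h1.trans ?_) (gauss_pos z).le
            exact mul_le_mul_of_nonneg_left h2 (by positivity)
        _ = _ := by ring)
  refine h.trans (le_of_eq ?_)
  rw [integral_const_mul, expMoment]
  ring

end

/-- The gradient of the Duhamel integral. -/
def gradDuh (q : Euc n → ℝ → ℝ) (x : Euc n) (t : ℝ) : Euc n :=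
  ∫ s in Ioo 0 t, gradS (t - s) (fun y => q y s) x

theorem integrableOn_inv_sqrt_sub (t : ℝ) :
    IntegrableOn (fun s => 1 / (2 * √(t - s))) (Ioo 0 t) := by
  rcases le_or_gt t 0 with ht | ht
  · simp [Ioo_eq_empty (not_lt.mpr ht)]
  have h1 : IntervalIntegrable (fun r : ℝ => r ^ (-(1 / 2) : ℝ)) volume 0 t :=
    intervalIntegral.intervalIntegrable_rpow' (by norm_num)
  have h2 := (h1.comp_sub_left t).symm
  simp only [sub_zero, sub_self] at h2
  have h3 := ((intervalIntegrable_iff_integrableOn_Ioo_of_le ht.le).mp h2).const_mul (1 / 2)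
  refine (IntegrableOn.congr_fun h3 (fun s hs => ?_) measurableSet_Ioo)
  rw [Real.rpow_neg (by linarith [hs.2]), ← Real.sqrt_eq_rpow]
  field_simp

theorem integral_inv_sqrt_sub {t : ℝ} (ht : 0 ≤ t) :
    ∫ s in Ioo 0 t, 1 / (2 * √(t - s)) = √t := by
  rw [← integral_Ioc_eq_integral_Ioo, ← intervalIntegral.integral_of_le ht,
    intervalIntegral.integral_comp_sub_left (fun r => 1 / (2 * √r)) t]
  simp only [sub_self, sub_zero]
  have : ∀ r : ℝ, 1 / (2 * √r) = 1 / 2 * (√r)⁻¹ := fun r => by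
    rw [one_div, mul_inv, one_div]
  have h2 : ∫ r in (0 : ℝ)..t, 1 / (2 * √r) = ∫ r in (0 : ℝ)..t, 1 / 2 * r ^ (-(1 / 2) : ℝ) := by
    refine intervalIntegral.integral_congr fun r hr => ?_
    rw [uIcc_of_le ht] at hr
    rw [this, Real.rpow_neg hr.1, ← Real.sqrt_eq_rpow]
  rw [h2, intervalIntegral.integral_const_mul, integral_rpow (Or.inl (by norm_num))]
  rw [Real.sqrt_eq_rpow, Real.zero_rpow (by norm_num)]
  norm_num
  ring

section

variable {a T B : ℝ} {w : Euc n → ℝ} {q : Euc n → ℝ → ℝ}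

/-- Differentiation under the time integral, dominated on a unit ball by the integrable singularity
`1 / (2√(t - s))`. -/
theorem IsWeight.hasFDerivAt_duh (hw : IsWeight a w) (hqm : Measurable (Function.uncurry q))
    {t : ℝ} (hq : ∀ y, ∀ s ∈ Ioo 0 t, |q y s| ≤ B * w y) (x : Euc n) :
    HasFDerivAt (fun y => duh q y t) (innerSL ℝ (gradDuh q x t)) x := by
  have hqs : ∀ s, Measurable (fun y => q y s) := fun s =>
    hqm.comp (measurable_id.prodMk measurable_const)
  have hgm : ∀ x : Euc n, Measurable (fun s => gradS (t - s) (fun y => q y s) x) := fun x =>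
    measurable_gradS (q := fun s y => q y s) (by fun_prop) measurable_const
      (hqm.comp measurable_swap)
  have hbd : ∀ s ∈ Ioo 0 t, ∀ x' ∈ Metric.ball x 1, ‖gradS (t - s) (fun y => q y s) x'‖
      ≤ 1 / (2 * √(t - s)) * (expMoment n (a * √t + 1) * B * (w x * Real.exp a)) := by
    intro s hs x' hx'
    have hB : 0 ≤ B := nonneg_of_mul_nonneg_left ((abs_nonneg _).trans (hq x s hs)) (hw.pos x)
    refine (hw.norm_gradS_le (T := t) (fun y => hq y s hs) (by linarith [hs.1]) x').trans ?_
    have h1 : w x' ≤ w x * Real.exp a := by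
      refine (hw.le_mul_exp x x').trans (mul_le_mul_of_nonneg_left ?_ (hw.pos x).le)
      rw [Real.exp_le_exp]
      rw [mem_ball_iff_norm, norm_sub_rev] at hx'
      exact mul_le_of_le_one_right hw.rate_nonneg hx'.le
    have := expMoment_pos (n := n) (a * √t + 1)
    gcongr
  have hInt : IntegrableOn (fun s => gradS (t - s) (fun y => q y s) x) (Ioo 0 t) := by
    refine Integrable.mono' ((integrableOn_inv_sqrt_sub t).mul_const
      (expMoment n (a * √t + 1) * B * (w x * Real.exp a))) (hgm x).aestronglyMeasurable ?_
    rw [ae_restrict_iff' measurableSet_Ioo]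
    exact ae_of_all _ fun s hs => hbd s hs x (Metric.mem_ball_self one_pos)
  have key := hasFDerivAt_integral_of_dominated_of_fderiv_le
    (μ := volume.restrict (Ioo 0 t)) (F := fun x s => heatS (t - s) (fun y => q y s) x)
    (F' := fun x s => innerSL ℝ (gradS (t - s) (fun y => q y s) x)) (x₀ := x)
    (bound := fun s => 1 / (2 * √(t - s)) * (expMoment n (a * √t + 1) * B * (w x * Real.exp a)))
    (Metric.ball_mem_nhds x one_pos) ?_ (hw.integrableOn_duh hqm hq t x) ?_ ?_
    ((integrableOn_inv_sqrt_sub t).mul_const _) ?_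
  · refine key.congr_fderiv ?_
    exact ContinuousLinearMap.integral_comp_comm (innerSL ℝ : Euc n →L[ℝ] (Euc n →L[ℝ] ℝ)) hInt
  · refine Eventually.of_forall fun x' => ?_
    exact (measurable_heatS (q := fun s y => q y s) (by fun_prop) measurable_const
      (hqm.comp measurable_swap)).aestronglyMeasurable
  · exact ((innerSL ℝ : Euc n →L[ℝ] (Euc n →L[ℝ] ℝ)).continuous.measurable.comp
      (hgm x)).aestronglyMeasurable
  · rw [ae_restrict_iff' measurableSet_Ioo]
    refine ae_of_all _ fun s hs x' hx' => ?_
    rw [innerSL_apply_norm]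
    exact hbd s hs x' hx'
  · rw [ae_restrict_iff' measurableSet_Ioo]
    exact ae_of_all _ fun s hs x' _ =>
      hw.hasFDerivAt_heatS (hqs s) (fun y => hq y s hs) (by linarith [hs.2]) x'

theorem IsWeight.norm_gradDuh_le (hw : IsWeight a w)
    {t : ℝ} (ht : 0 ≤ t) (hq : ∀ y, ∀ s ∈ Ioo 0 t, |q y s| ≤ B * w y) (x : Euc n) :
    ‖gradDuh q x t‖ ≤ √t * (expMoment n (a * √t + 1) * B * w x) := by
  have h := norm_integral_le_of_norm_le (f := fun s => gradS (t - s) (fun y => q y s) x)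
    ((integrableOn_inv_sqrt_sub t).mul_const (expMoment n (a * √t + 1) * B * w x))
    ((ae_restrict_iff' measurableSet_Ioo).mpr (ae_of_all _ fun s hs =>
      hw.norm_gradS_le (T := t) (fun y => hq y s hs) (by linarith [hs.1]) x))
  rwa [integral_mul_const, integral_inv_sqrt_sub ht] at h

end

theorem measurable_gradDuh {q : Euc n → ℝ → ℝ} (hq : Measurable (Function.uncurry q)) :
    Measurable (Function.uncurry (gradDuh q)) := by
  have h1 : Measurable (fun p : (Euc n × ℝ) × ℝ =>
      gradS (p.1.2 - p.2) (fun y => q y p.2) p.1.1) := by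
    refine measurable_gradS (q := fun (p : (Euc n × ℝ) × ℝ) y => q y p.2)
      (by fun_prop) (by fun_prop) ?_
    exact hq.comp (measurable_snd.prodMk (measurable_snd.comp measurable_fst))
  have hS : MeasurableSet {p : (Euc n × ℝ) × ℝ | p.2 ∈ Ioo 0 p.1.2} :=
    (measurableSet_lt measurable_const measurable_snd).inter
      (measurableSet_lt measurable_snd (measurable_snd.comp measurable_fst))
  have h2 := ((h1.indicator hS).stronglyMeasurable.integral_prod_right' (ν := volume)).measurable
  convert h2 using 1
  ext ⟨x, t⟩ : 1
  rw [Function.uncurry_apply_pair, gradDuh, ← integral_indicator measurableSet_Ioo]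
  rfl

/-! ### Partial derivatives -/

theorem contDiff_partialX {W : Type*} [NormedAddCommGroup W] [NormedSpace ℝ W]
    {η : Euc n → W} (h : ContDiff ℝ ∞ η) (j : Fin n) : ContDiff ℝ ∞ (partialX j η) :=
  (h.fderiv_right (m := ∞) (by simp)).clm_apply contDiff_const

theorem hasCompactSupport_partialX {W : Type*} [NormedAddCommGroup W] [NormedSpace ℝ W]
    {η : Euc n → W} (h : HasCompactSupport η) (j : Fin n) :
    HasCompactSupport (partialX j η) :=
  h.fderiv_apply ℝ _

/-- The Laplacian as the sum of the pure second partial derivatives. -/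
def lap (η : Euc n → ℝ) (x : Euc n) : ℝ := ∑ j, partialX j (partialX j η) x

theorem contDiff_lap {η : Euc n → ℝ} (h : ContDiff ℝ ∞ η) : ContDiff ℝ ∞ (lap η) :=
  ContDiff.sum fun j _ => contDiff_partialX (contDiff_partialX h j) j

theorem hasCompactSupport_lap {η : Euc n → ℝ} (h : HasCompactSupport η) :
    HasCompactSupport (lap η) := by
  have : ∀ s : Finset (Fin n),
      HasCompactSupport (fun x => ∑ j ∈ s, partialX j (partialX j η) x) := by
    intro s
    induction s using Finset.induction_on with
    | empty =>
      simp only [Finset.sum_empty]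
      exact HasCompactSupport.zero
    | insert j s hj ih =>
      simp only [Finset.sum_insert hj]
      exact (hasCompactSupport_partialX (hasCompactSupport_partialX h j) j).add ih
  exact this _

theorem fderiv_apply_eq_sum {W : Type*} [NormedAddCommGroup W] [NormedSpace ℝ W]
    (L : Euc n →L[ℝ] W) (z : Euc n) :
    L z = ∑ j, z j • L (EuclideanSpace.single j 1) := by
  conv_lhs => rw [← (EuclideanSpace.basisFun (Fin n) ℝ).sum_repr z]
  simp [map_sum]

theorem HasCompactSupport.exists_norm_le {W : Type*} [NormedAddCommGroup W] {η : Euc n → W}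
    (hc : HasCompactSupport η) (h : Continuous η) : ∃ C, ∀ x, ‖η x‖ ≤ C :=
  h.bounded_above_of_compact_support hc

/-! ### The heat flow of test functions -/

theorem continuous_heatS_time {q : Euc n → ℝ} (hq : Continuous q) {C : ℝ} (hC : ∀ x, |q x| ≤ C)
    (x : Euc n) : Continuous (fun t => heatS t q x) := by
  refine continuous_of_dominated (bound := fun z => C * gauss z) (fun t => ?_) (fun t => ?_)
    (integrable_gauss.const_mul C) (ae_of_all _ fun z => ?_)
  · exact (continuous_gauss.mul (hq.comp (by fun_prop))).aestronglyMeasurable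
  · refine ae_of_all _ fun z => ?_
    rw [norm_mul, Real.norm_of_nonneg (gauss_pos z).le, mul_comm]
    exact mul_le_mul_of_nonneg_right (hC _) (gauss_pos z).le
  · exact continuous_const.mul (hq.comp (by fun_prop))

theorem partialX_gauss (j : Fin n) (z : Euc n) :
    partialX j gauss z = -(1 / 2) * (gauss z * z j) := by
  have h := hasFDerivAt_heatKernel (n := n) one_pos z
  have : partialX j gauss z = _ := congrArg (fun L => L (EuclideanSpace.single j 1)) h.fderiv
  have h2 : inner ℝ z (EuclideanSpace.single j (1 : ℝ)) = z j := by
    rw [EuclideanSpace.inner_single_right]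
    simp
  rw [this]
  simp only [gauss, smul_apply, innerSL_apply_apply, smul_eq_mul, h2]
  ring

theorem differentiable_gauss : Differentiable ℝ (gauss (n := n)) :=
  fun z => (hasFDerivAt_heatKernel (n := n) one_pos z).differentiableAt

theorem abs_coord_le (z : Euc n) (j : Fin n) : |z j| ≤ ‖z‖ := by
  simpa using PiLp.norm_apply_le z j

theorem integrable_gauss_mul_coord (j : Fin n) : Integrable (fun z : Euc n => gauss z * z j) := by
  refine (integrable_exp_mul_gauss (n := n) 1).mono'
    (continuous_gauss.mul (by fun_prop)).aestronglyMeasurable (ae_of_all _ fun z => ?_)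
  rw [norm_mul, Real.norm_of_nonneg (gauss_pos z).le, mul_comm, one_mul]
  exact mul_le_mul_of_nonneg_right ((abs_coord_le z j).trans (norm_le_exp_norm z)) (gauss_pos z).le

/-- Integration by parts with `∂ⱼ gauss = -(1/2) zⱼ gauss`; the factor `√t` is the inner derivative
of `x - √t z`. -/
theorem integral_gauss_coord_mul_partialX {ζ : Euc n → ℝ} (h : ContDiff ℝ 1 ζ)
    {C C' : ℝ} (hC : ∀ x, |ζ x| ≤ C) (j : Fin n) (hC' : ∀ x, |partialX j ζ x| ≤ C')
    (t : ℝ) (x : Euc n) :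
    ∫ z, gauss z * z j * ζ (x - √t • z)
      = -(2 * √t) * ∫ z, gauss z * partialX j ζ (x - √t • z) := by
  set g : Euc n → ℝ := fun z => ζ (x - √t • z) with hg
  have hgd : ∀ z, HasFDerivAt g (-(√t) • fderiv ℝ ζ (x - √t • z)) z := by
    intro z
    have h1 : HasFDerivAt (fun z : Euc n => x - √t • z)
        (-(√t • ContinuousLinearMap.id ℝ (Euc n))) z :=
      ((hasFDerivAt_id z).const_smul √t).const_sub x
    have h2 := ((h.differentiable one_ne_zero) (x - √t • z)).hasFDerivAt.comp z h1
    refine h2.congr_fderiv ?_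
    ext u
    simp
  have hgp : ∀ z, fderiv ℝ g z (EuclideanSpace.single j 1)
      = -(√t) * partialX j ζ (x - √t • z) := by
    intro z
    rw [(hgd z).fderiv]
    simp [partialX]
  have hgc : Continuous g := h.continuous.comp (by fun_prop)
  have hpc : Continuous (fun z => partialX j ζ (x - √t • z)) := by
    have : Continuous (partialX j ζ) :=
      (h.continuous_fderiv one_ne_zero).clm_apply continuous_const
    exact this.comp (by fun_prop)
  have i1 : Integrable (fun z => gauss z * z j * g z) := by
    refine (integrable_gauss_mul_coord j).mul_bdd hgc.aestronglyMeasurable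
      (ae_of_all _ fun z => hC _)
  have i2 : Integrable (fun z => gauss z * partialX j ζ (x - √t • z)) :=
    integrable_gauss.mul_bdd hpc.aestronglyMeasurable (ae_of_all _ fun z => hC' _)
  have i3 : Integrable (fun z => gauss z * g z) :=
    integrable_gauss.mul_bdd hgc.aestronglyMeasurable (ae_of_all _ fun z => hC _)
  have hp : ∀ z : Euc n, fderiv ℝ gauss z (EuclideanSpace.single j 1)
      = -(1 / 2) * (gauss z * z j) := partialX_gauss j
  have key := integral_mul_fderiv_eq_neg_fderiv_mul_of_integrable (μ := volume)
    (f := gauss) (g := g) (v := EuclideanSpace.single j 1)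
    (by
      simp_rw [hp]
      refine (i1.const_mul (-(1 / 2))).congr (ae_of_all _ fun z => ?_)
      ring)
    (by
      simp_rw [hgp]
      refine (i2.const_mul (-√t)).congr (ae_of_all _ fun z => ?_)
      ring) i3
    (fun z _ => differentiable_gauss z) (fun z _ => (hgd z).differentiableAt)
  simp_rw [hp, hgp] at key
  have e1 : ∫ z, gauss z * (-√t * partialX j ζ (x - √t • z))
      = -√t * ∫ z, gauss z * partialX j ζ (x - √t • z) := by
    rw [← integral_const_mul]
    congr 1
    ext z
    ring
  have e2 : ∫ z, -(1 / 2) * (gauss z * z j) * g z = -(1 / 2) * ∫ z, gauss z * z j * g z := by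
    rw [← integral_const_mul]
    congr 1
    ext z
    ring
  rw [e1, e2] at key
  linarith

/-- The time derivative of `η (x - √t z)` is `-(1 / (2√t)) z · ∇η`. Integrating `gauss z · zⱼ` by
parts yields the compensating factor `-2√t` and a second derivative, so the Laplacian appears
without singular factor. -/
theorem hasDerivAt_heatS_time {η : Euc n → ℝ} (h : ContDiff ℝ ∞ η) (hc : HasCompactSupport η)
    {t : ℝ} (ht : 0 < t) (x : Euc n) :
    HasDerivAt (fun t => heatS t η x) (heatS t (lap η) x) t := by
  have h1 : ContDiff ℝ 1 η := h.of_le (by simp)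
  obtain ⟨C0, hC0⟩ := HasCompactSupport.exists_norm_le hc h.continuous
  obtain ⟨C1, hC1⟩ := HasCompactSupport.exists_norm_le (hc.fderiv ℝ)
    (h1.continuous_fderiv one_ne_zero)
  have hpart : ∀ j, ∃ C, ∀ x, |partialX j η x| ≤ C := fun j =>
    HasCompactSupport.exists_norm_le (hasCompactSupport_partialX hc j)
      (contDiff_partialX h j).continuous
  have hpart2 : ∀ j, ∃ C, ∀ x, |partialX j (partialX j η) x| ≤ C := fun j =>
    HasCompactSupport.exists_norm_le (hasCompactSupport_partialX (hasCompactSupport_partialX hc j) j)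
      (contDiff_partialX (contDiff_partialX h j) j).continuous
  set F' : ℝ → Euc n → ℝ := fun t z =>
    gauss z * fderiv ℝ η (x - √t • z) (-((1 / (2 * √t)) • z)) with hF'
  have hdiff : ∀ z, ∀ s : ℝ, 0 < s → HasDerivAt (fun t => gauss z * η (x - √t • z)) (F' s z) s := by
    intro z s hs
    have e1 : HasDerivAt (fun t => x - √t • z) (-((1 / (2 * √s)) • z)) s :=
      ((Real.hasDerivAt_sqrt hs.ne').smul_const z).const_sub x
    have e2 := ((h1.differentiable one_ne_zero) (x - √s • z)).hasFDerivAt.comp_hasDerivAt s e1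
    exact e2.const_mul (gauss z)
  -- On this neighbourhood `1 / (2√s) ≤ 1 / √t`, which makes the dominating function independent of
  -- `s`.
  have hnh : Ioi (t / 4) ∈ 𝓝 t := Ioi_mem_nhds (by linarith)
  have hC1' : 0 ≤ C1 := (norm_nonneg _).trans (hC1 0)
  have key := hasDerivAt_integral_of_dominated_loc_of_deriv_le (μ := volume) (F' := F')
    (F := fun t z => gauss z * η (x - √t • z)) (x₀ := t)
    (bound := fun z => C1 * (1 / √t) * (Real.exp (1 * ‖z‖) * gauss z)) hnh
    (Eventually.of_forall fun s =>
      (continuous_gauss.mul (h.continuous.comp (by fun_prop))).aestronglyMeasurable)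
    (integrable_gauss.mul_bdd (h.continuous.comp (by fun_prop)).aestronglyMeasurable
      (ae_of_all _ fun z => hC0 _)) ?_ ?_ ((integrable_exp_mul_gauss 1).const_mul _) ?_
  · refine key.2.congr_deriv ?_
    have e3 : ∀ z, F' t z = ∑ j, -(1 / (2 * √t)) * (gauss z * z j * partialX j η (x - √t • z)) := by
      intro z
      simp only [hF']
      rw [map_neg, map_smul, fderiv_apply_eq_sum (fderiv ℝ η (x - √t • z)) z, Finset.smul_sum,
        ← Finset.sum_neg_distrib, Finset.mul_sum]
      refine Finset.sum_congr rfl fun j _ => ?_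
      simp only [partialX, smul_eq_mul]
      ring
    simp_rw [e3]
    have hi : ∀ j, Integrable fun z => gauss z * z j * partialX j η (x - √t • z) := by
      intro j
      obtain ⟨C, hC⟩ := hpart j
      exact (integrable_gauss_mul_coord j).mul_bdd
        ((contDiff_partialX h j).continuous.comp (by fun_prop)).aestronglyMeasurable
        (ae_of_all _ fun z => hC _)
    rw [integral_finsetSum _ fun j _ => (hi j).const_mul _]
    simp only [heatS, lap, Finset.mul_sum]
    rw [integral_finsetSum]
    · refine Finset.sum_congr rfl fun j _ => ?_
      obtain ⟨C, hC⟩ := hpart j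
      obtain ⟨C', hC'⟩ := hpart2 j
      rw [integral_const_mul, integral_gauss_coord_mul_partialX
        ((contDiff_partialX h j).of_le (by simp)) hC j hC' t x]
      have : 0 < √t := Real.sqrt_pos.mpr ht
      field_simp
    · intro j _
      obtain ⟨C', hC'⟩ := hpart2 j
      exact integrable_gauss.mul_bdd
        ((contDiff_partialX (contDiff_partialX h j) j).continuous.comp
          (by fun_prop)).aestronglyMeasurable (ae_of_all _ fun z => hC' _)
  · refine Continuous.aestronglyMeasurable ?_
    refine continuous_gauss.mul (((h1.continuous_fderiv one_ne_zero).comp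
      (by fun_prop : Continuous fun z : Euc n => x - √t • z)).clm_apply (by fun_prop))
  · refine ae_of_all _ fun z s hs => ?_
    have hs0 : 0 < s := lt_trans (by positivity) hs
    have hss : √t / 2 ≤ √s := by
      rw [show √t / 2 = √(t / 4) by
        rw [show t / 4 = t / 2 ^ 2 by ring, Real.sqrt_div' _ (by positivity),
          Real.sqrt_sq (by norm_num)]]
      exact Real.sqrt_le_sqrt (le_of_lt hs)
    have htp : 0 < √t := Real.sqrt_pos.mpr ht
    simp only [hF']
    rw [norm_mul, Real.norm_of_nonneg (gauss_pos z).le]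
    have e4 : ‖fderiv ℝ η (x - √s • z) (-((1 / (2 * √s)) • z))‖ ≤ C1 * (1 / √t * ‖z‖) := by
      refine (ContinuousLinearMap.le_opNorm _ _).trans ?_
      refine mul_le_mul (hC1 _) ?_ (norm_nonneg _) hC1'
      rw [norm_neg, norm_smul, Real.norm_of_nonneg (by positivity)]
      refine mul_le_mul_of_nonneg_right ?_ (norm_nonneg z)
      exact one_div_le_one_div_of_le htp (by linarith)
    calc _ ≤ gauss z * (C1 * (1 / √t * ‖z‖)) :=
          mul_le_mul_of_nonneg_left e4 (gauss_pos z).le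
      _ ≤ gauss z * (C1 * (1 / √t * Real.exp (1 * ‖z‖))) := by
          have := norm_le_exp_norm z
          have := (gauss_pos z).le
          rw [one_mul]
          gcongr
      _ = _ := by ring
  · exact ae_of_all _ fun z s hs => hdiff z s (lt_trans (by positivity) hs)

theorem heatS_eq_add_integral {η : Euc n → ℝ} (h : ContDiff ℝ ∞ η) (hc : HasCompactSupport η)
    {t : ℝ} (ht : 0 ≤ t) (x : Euc n) :
    heatS t η x = η x + ∫ s in (0 : ℝ)..t, heatS s (lap η) x := by
  obtain ⟨C0, hC0⟩ := HasCompactSupport.exists_norm_le hc h.continuous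
  obtain ⟨C1, hC1⟩ := HasCompactSupport.exists_norm_le (hasCompactSupport_lap hc)
    (contDiff_lap h).continuous
  rw [intervalIntegral.integral_eq_sub_of_hasDerivAt_of_le ht
    (continuous_heatS_time h.continuous hC0 x).continuousOn
    (fun s hs => hasDerivAt_heatS_time h hc hs.1 x)
    ((continuous_heatS_time (contDiff_lap h).continuous hC1 x).intervalIntegrable _ _), heatS_zero]
  ring

/-! ### The heat equation tested in space. -/

/-- Decaying exponentials are weights too. Hence the heat flow of a function with compact support
keeps any prescribed exponential decay and can be integrated against growing data. -/
theorem isWeight_exp_neg {b : ℝ} (hb : 0 ≤ b) : IsWeight b (fun y : Euc n => Real.exp (-b * ‖y‖)) := by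
  refine ⟨hb, fun _ => Real.exp_pos _, by fun_prop, fun x y => ?_⟩
  rw [← Real.exp_add, Real.exp_le_exp]
  have := norm_sub_norm_le x y
  nlinarith

theorem integrable_exp_neg_norm : Integrable (fun y : Euc n => Real.exp (-‖y‖)) := by
  -- Comparison with `(1 + ‖y‖) ^ (-(n + 1))`: the exponential series gives `(1 + ‖y‖) ^ (n + 1) ≤
  -- (n + 1)! exp (1 + ‖y‖)`.
  have h := (integrable_one_add_norm (E := Euc n) (μ := volume) (r := (n : ℝ) + 1)
    (by simp)).const_mul ((n + 1).factorial * Real.exp 1)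
  refine h.mono' (Continuous.aestronglyMeasurable (by fun_prop)) (ae_of_all _ fun y => ?_)
  have h1 := Real.pow_div_factorial_le_exp (1 + ‖y‖) (by positivity) (n + 1)
  rw [Real.norm_of_nonneg (Real.exp_pos _).le, Real.rpow_neg (by positivity)]
  have h2 : (1 + ‖y‖) ^ ((n : ℝ) + 1) = (1 + ‖y‖) ^ (n + 1) := by
    rw [← Real.rpow_natCast]
    push_cast
    rfl
  rw [h2]
  have h3 : 0 < (1 + ‖y‖) ^ (n + 1) := by positivity
  have h4 : (0 : ℝ) < (n + 1).factorial := by positivity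
  rw [Real.exp_add, div_le_iff₀ h4] at h1
  rw [Real.exp_neg, ← div_eq_mul_inv, inv_eq_one_div, div_le_div_iff₀ (Real.exp_pos _) h3]
  linarith

section

variable {a B T : ℝ} {w : Euc n → ℝ} {q : Euc n → ℝ}

theorem IsWeight.le_zero_mul_exp (hw : IsWeight a w) (y : Euc n) :
    w y ≤ w 0 * Real.exp (a * ‖y‖) := by
  simpa using hw.le_mul_exp 0 y

theorem IsWeight.integrable_mul_of_compact (hw : IsWeight a w) {η : Euc n → ℝ}
    (hη : Continuous η) (hc : HasCompactSupport η) (hqm : Measurable q)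
    (hq : ∀ y, |q y| ≤ B * w y) : Integrable (fun y => η y * q y) := by
  have h : Integrable (fun y => ‖η y‖ * (B * w y)) := by
    refine Continuous.integrable_of_hasCompactSupport
      (hη.norm.mul (continuous_const.mul hw.continuous)) ?_
    exact hc.norm.mul_right
  refine h.mono' (hη.measurable.mul hqm).aestronglyMeasurable (ae_of_all _ fun y => ?_)
  rw [norm_mul]
  exact mul_le_mul_of_nonneg_left (hq y) (norm_nonneg _)

theorem measurable_heatS_space (t : ℝ) (hq : Measurable q) : Measurable (heatS t q) :=
  measurable_heatS (α := Euc n) (q := fun _ => q) measurable_const measurable_id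
    (hq.comp measurable_snd)

/-- The heat flow is symmetric. -/
theorem IsWeight.integral_mul_heatS (hw : IsWeight a w) {η : Euc n → ℝ}
    (hη : Continuous η) (hc : HasCompactSupport η) (hqm : Measurable q)
    (hq : ∀ y, |q y| ≤ B * w y) {t : ℝ} (ht : 0 ≤ t) :
    ∫ x, η x * heatS t q x = ∫ y, heatS t η y * q y := by
  rcases ht.eq_or_lt with rfl | ht
  · simp only [heatS_zero]
  have hK : Measurable (fun p : Euc n => heatKernel p t) := by
    unfold heatKernel
    fun_prop
  have e : ∀ (r : Euc n → ℝ) x, heatS t r x = ∫ y, heatKernel (x - y) t * r y := by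
    intro r x
    rw [← heatConv_eq_heatS ht.le, heatConv, if_neg ht.ne']
  have hInt : Integrable (Function.uncurry fun x y : Euc n =>
      η x * (heatKernel (x - y) t * q y)) (volume.prod volume) := by
    have hmeas : Measurable (Function.uncurry fun x y : Euc n =>
        η x * (heatKernel (x - y) t * q y)) := by
      refine (hη.measurable.comp measurable_fst).mul
        ((hK.comp ?_).mul (hqm.comp measurable_snd))
      fun_prop
    rw [integrable_prod_iff hmeas.aestronglyMeasurable]
    refine ⟨ae_of_all _ fun x =>
      (hw.integrable_heatKernel_mul hqm hq ht x).const_mul (η x), ?_⟩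
    have h2 : ∀ x : Euc n,
        ∫ y, ‖Function.uncurry (fun x y : Euc n => η x * (heatKernel (x - y) t * q y)) (x, y)‖
        = ‖η x‖ * heatS t (fun y => |q y|) x := by
      intro x
      rw [e, ← integral_const_mul]
      refine integral_congr_ae (ae_of_all _ fun y => ?_)
      simp only [Function.uncurry, norm_mul, Real.norm_eq_abs]
      rw [abs_of_nonneg (by unfold heatKernel; positivity : 0 ≤ heatKernel (x - y) t)]
    simp_rw [h2]
    exact hw.integrable_mul_of_compact hη.norm hc.norm (measurable_heatS_space t hqm.abs)
      (fun y => hw.abs_heatS_le (q := fun y => |q y|) (by simpa using hq) le_rfl y)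
  simp_rw [e, ← integral_const_mul, ← integral_mul_const]
  rw [integral_integral_swap hInt]
  refine integral_congr_ae (ae_of_all _ fun y => integral_congr_ae (ae_of_all _ fun x => ?_))
  have : heatKernel (y - x) t = heatKernel (x - y) t := by
    simp only [heatKernel, norm_sub_rev]
  simp only [this]
  ring

theorem exists_exp_decay {η : Euc n → ℝ} (hη : Continuous η) (hc : HasCompactSupport η) (b : ℝ) :
    ∃ C, ∀ y, |η y| ≤ C * Real.exp (-b * ‖y‖) := by
  obtain ⟨C, hC⟩ := HasCompactSupport.exists_norm_le (η := fun y => η y * Real.exp (b * ‖y‖))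
    hc.mul_right (hη.mul (by fun_prop))
  refine ⟨C, fun y => ?_⟩
  have h1 := hC y
  rw [norm_mul, Real.norm_eq_abs, Real.norm_of_nonneg (Real.exp_pos _).le] at h1
  rw [neg_mul, Real.exp_neg, ← div_eq_mul_inv, le_div_iff₀ (Real.exp_pos _)]
  exact h1

/-- By symmetry the flow is moved onto the smooth function `η`, where it can be differentiated in
time, and then back; no regularity of `q` is used. -/
theorem IsWeight.integral_mul_heatS_eq (hw : IsWeight a w) {η : Euc n → ℝ}
    (h : ContDiff ℝ ∞ η) (hc : HasCompactSupport η) (hqm : Measurable q)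
    (hq : ∀ y, |q y| ≤ B * w y) {t : ℝ} (ht : 0 ≤ t) :
    ∫ x, η x * heatS t q x
      = (∫ x, η x * q x) + ∫ s in Ioo 0 t, ∫ x, lap η x * heatS s q x := by
  have hl := contDiff_lap h
  have hlc := hasCompactSupport_lap hc
  have hB : 0 ≤ B := nonneg_of_mul_nonneg_left ((abs_nonneg _).trans (hq 0)) (hw.pos 0)
  have ha := hw.rate_nonneg
  -- Decay at rate `a + 1` beats the growth `exp (a ‖y‖)` of the data and leaves the integrable
  -- factor `exp (-‖y‖)`.
  obtain ⟨C, hC⟩ := exists_exp_decay hl.continuous hlc (a + 1)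
  have hwe := isWeight_exp_neg (n := n) (b := a + 1) (by linarith)
  have hInt : Integrable (Function.uncurry fun (y : Euc n) (s : ℝ) => heatS s (lap η) y * q y)
      (volume.prod (volume.restrict (Ioo 0 t))) := by
    have hm : Measurable (Function.uncurry fun (y : Euc n) (s : ℝ) => heatS s (lap η) y * q y) :=
      (measurable_heatS (α := Euc n × ℝ) (q := fun _ => lap η) measurable_snd measurable_fst
        (hl.continuous.measurable.comp measurable_snd)).mul (hqm.comp measurable_fst)
    have h1 := (integrable_exp_neg_norm (n := n)).const_mul
      (expMoment n ((a + 1) * √t) * C * (B * w 0)) |>.mul_prod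
      (integrable_const (1 : ℝ) (μ := volume.restrict (Ioo 0 t)))
    refine h1.mono' hm.aestronglyMeasurable ?_
    have : ∀ᵐ r ∂(volume.restrict (Ioo 0 t)), r ∈ Ioo 0 t := ae_restrict_mem measurableSet_Ioo
    have h2 : ∀ᵐ p ∂((volume : Measure (Euc n)).prod (volume.restrict (Ioo 0 t))),
        p.2 ∈ Ioo 0 t := Measure.quasiMeasurePreserving_snd.ae this
    filter_upwards [h2] with p hp
    have e1 := hwe.abs_heatS_le (T := t) hC hp.2.le p.1
    have e2 : |q p.1| ≤ B * (w 0 * Real.exp (a * ‖p.1‖)) :=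
      (hq p.1).trans (mul_le_mul_of_nonneg_left (hw.le_zero_mul_exp p.1) hB)
    simp only [Function.uncurry_def]
    rw [norm_mul, mul_one, Real.norm_eq_abs, Real.norm_eq_abs]
    refine (mul_le_mul e1 e2 (abs_nonneg _) ((abs_nonneg _).trans e1)).trans (le_of_eq ?_)
    rw [show Real.exp (-‖p.1‖) = Real.exp (-(a + 1) * ‖p.1‖) * Real.exp (a * ‖p.1‖) by
      rw [← Real.exp_add]; congr 1; ring]
    ring
  rw [hw.integral_mul_heatS h.continuous hc hqm hq ht]
  have e3 : ∀ y, heatS t η y * q y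
      = η y * q y + ∫ s in Ioo 0 t, heatS s (lap η) y * q y := by
    intro y
    rw [heatS_eq_add_integral h hc ht, intervalIntegral.integral_of_le ht,
      integral_Ioc_eq_integral_Ioo, add_mul, integral_mul_const]
  simp_rw [e3]
  have hi : Integrable (fun y => ∫ s in Ioo 0 t, heatS s (lap η) y * q y) :=
    hInt.integral_prod_left
  rw [integral_add (hw.integrable_mul_of_compact h.continuous hc hqm hq) hi,
    integral_integral_swap hInt]
  congr 1
  refine setIntegral_congr_fun measurableSet_Ioo fun s hs => ?_
  exact (hw.integral_mul_heatS hl.continuous hlc hqm hq hs.1.le).symm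

end

theorem integral_triangle_swap {f : ℝ → ℝ → ℝ} (hf : Measurable (Function.uncurry f)) {t C : ℝ}
    (hC : ∀ s r, 0 < s → s < r → r < t → |f s r| ≤ C) :
    ∫ s in Ioo 0 t, ∫ r in Ioo s t, f s r = ∫ r in Ioo 0 t, ∫ s in Ioo 0 r, f s r := by
  set g : ℝ → ℝ → ℝ := fun s r => if s < r then f s r else 0 with hg
  have hgm : Measurable (Function.uncurry g) :=
    Measurable.ite (measurableSet_lt measurable_fst measurable_snd) hf measurable_const
  have hInt : Integrable (Function.uncurry g)
      ((volume.restrict (Ioo 0 t)).prod (volume.restrict (Ioo 0 t))) := by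
    refine Integrable.of_bound hgm.aestronglyMeasurable (max C 0) ?_
    rw [Measure.prod_restrict, ae_restrict_iff' (measurableSet_Ioo.prod measurableSet_Ioo)]
    refine ae_of_all _ fun p hp => ?_
    simp only [Function.uncurry_def, hg]
    split_ifs with hlt
    · exact (hC _ _ hp.1.1 hlt hp.2.2).trans (le_max_left _ _)
    · simp
  have e1 : ∀ s ∈ Ioo 0 t, ∫ r in Ioo s t, f s r = ∫ r in Ioo 0 t, g s r := by
    intro s hs
    rw [← integral_indicator measurableSet_Ioo, ← integral_indicator measurableSet_Ioo]
    congr 1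
    ext r
    simp only [indicator, mem_Ioo, hg]
    split_ifs <;> first | rfl | (exfalso; simp_all; try linarith [hs.1])
  have e2 : ∀ r ∈ Ioo 0 t, ∫ s in Ioo 0 r, f s r = ∫ s in Ioo 0 t, g s r := by
    intro r hr
    rw [← integral_indicator measurableSet_Ioo, ← integral_indicator measurableSet_Ioo]
    congr 1
    ext s
    simp only [indicator, mem_Ioo, hg]
    split_ifs <;> first | rfl | (exfalso; simp_all; try linarith [hr.2])
  rw [setIntegral_congr_fun measurableSet_Ioo e1, setIntegral_congr_fun measurableSet_Ioo e2]
  exact integral_integral_swap hInt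

section

variable {a B T : ℝ} {w : Euc n → ℝ} {Q : Euc n → ℝ → ℝ}

theorem IsWeight.integral_mul_duh (hw : IsWeight a w) {η : Euc n → ℝ}
    (h : Continuous η) (hc : HasCompactSupport η) (hQm : Measurable (Function.uncurry Q))
    {t : ℝ} (hQ : ∀ y, ∀ s ∈ Ioo 0 t, |Q y s| ≤ B * w y) :
    ∫ x, η x * duh Q x t = ∫ s in Ioo 0 t, ∫ x, η x * heatS (t - s) (fun y => Q y s) x := by
  have hm : Measurable (Function.uncurry fun (x : Euc n) (s : ℝ) =>
      η x * heatS (t - s) (fun y => Q y s) x) :=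
    (h.measurable.comp measurable_fst).mul
      (measurable_heatS (q := fun (p : Euc n × ℝ) y => Q y p.2) (by fun_prop) measurable_fst
        (hQm.comp (measurable_snd.prodMk (measurable_snd.comp measurable_fst))))
  have hInt : Integrable (Function.uncurry fun (x : Euc n) (s : ℝ) =>
      η x * heatS (t - s) (fun y => Q y s) x) (volume.prod (volume.restrict (Ioo 0 t))) := by
    have h0 : Integrable (fun y => ‖η y‖ * (expMoment n (a * √t) * B * w y)) := by
      refine Continuous.integrable_of_hasCompactSupport
        (h.norm.mul (continuous_const.mul hw.continuous)) ?_
      exact hc.norm.mul_right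
    have h1 := h0.mul_prod (integrable_const (1 : ℝ) (μ := volume.restrict (Ioo 0 t)))
    refine h1.mono' hm.aestronglyMeasurable ?_
    have : ∀ᵐ r ∂(volume.restrict (Ioo 0 t)), r ∈ Ioo 0 t := ae_restrict_mem measurableSet_Ioo
    have h2 : ∀ᵐ p ∂((volume : Measure (Euc n)).prod (volume.restrict (Ioo 0 t))),
        p.2 ∈ Ioo 0 t := Measure.quasiMeasurePreserving_snd.ae this
    filter_upwards [h2] with p hp
    simp only [Function.uncurry_def]
    rw [norm_mul, mul_one]
    exact mul_le_mul_of_nonneg_left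
      (hw.abs_heatS_le (fun y => hQ y p.2 hp) (by linarith [hp.1]) p.1) (norm_nonneg _)
  rw [← integral_integral_swap hInt]
  simp only [duh, integral_const_mul]

/-- The source at time `s` evolves freely from `s` to `t`, so `IsWeight.integral_mul_heatS_eq`
applies to each `s`. Exchanging the order of integration over the triangle `s < r < t` reassembles
the Duhamel integral at time `r`. -/
theorem IsWeight.integral_mul_duh_eq (hw : IsWeight a w) {η : Euc n → ℝ}
    (h : ContDiff ℝ ∞ η) (hc : HasCompactSupport η) (hQm : Measurable (Function.uncurry Q))
    {t : ℝ} (hQ : ∀ y, ∀ s ∈ Ioo 0 t, |Q y s| ≤ B * w y) :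
    ∫ x, η x * duh Q x t
      = ∫ s in Ioo 0 t, ((∫ x, η x * Q x s) + ∫ x, lap η x * duh Q x s) := by
  have hl := contDiff_lap h
  have hlc := hasCompactSupport_lap hc
  have hQs : ∀ s, Measurable (fun y => Q y s) := fun s =>
    hQm.comp (measurable_id.prodMk measurable_const)
  set L : ℝ → ℝ → ℝ := fun s r => ∫ x, lap η x * heatS (r - s) (fun y => Q y s) x with hL
  have hLm : Measurable (Function.uncurry L) := by
    have : Measurable (fun p : (ℝ × ℝ) × Euc n =>
        lap η p.2 * heatS (p.1.2 - p.1.1) (fun y => Q y p.1.1) p.2) := by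
      refine (hl.continuous.measurable.comp measurable_snd).mul ?_
      refine measurable_heatS (q := fun (p : (ℝ × ℝ) × Euc n) y => Q y p.1.1) (by fun_prop)
        measurable_snd ?_
      exact hQm.comp (measurable_snd.prodMk
        (measurable_fst.comp (measurable_fst.comp measurable_fst)))
    exact (this.stronglyMeasurable.integral_prod_right' (ν := volume)).measurable
  have hηm : Measurable (fun s => ∫ x, η x * Q x s) := by
    have : Measurable (fun p : ℝ × Euc n => η p.2 * Q p.2 p.1) :=
      (h.continuous.measurable.comp measurable_snd).mul (hQm.comp measurable_swap)
    exact (this.stronglyMeasurable.integral_prod_right' (ν := volume)).measurable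
  have hbint : ∀ ζ : Euc n → ℝ, Continuous ζ → HasCompactSupport ζ → ∀ D : ℝ,
      Integrable (fun y => ‖ζ y‖ * (D * w y)) := fun ζ hζ hζc D =>
    Continuous.integrable_of_hasCompactSupport (hζ.norm.mul (continuous_const.mul hw.continuous))
      hζc.norm.mul_right
  have hbd : ∀ ζ : Euc n → ℝ, Continuous ζ → HasCompactSupport ζ → ∀ D : ℝ, ∀ r : Euc n → ℝ,
      (∀ y, |r y| ≤ D * w y) → |∫ x, ζ x * r x| ≤ ∫ y, ‖ζ y‖ * (D * w y) := by
    intro ζ hζ hζc D r hr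
    refine norm_integral_le_of_norm_le (f := fun x => ζ x * r x) (hbint ζ hζ hζc D)
      (ae_of_all _ fun y => ?_)
    rw [norm_mul]
    exact mul_le_mul_of_nonneg_left (hr y) (norm_nonneg _)
  have hLb : ∀ s r, 0 < s → s < r → r < t →
      |L s r| ≤ ∫ y, ‖lap η y‖ * (expMoment n (a * √t) * B * w y) := by
    intro s r hs hsr hrt
    exact hbd _ hl.continuous hlc _ _ fun y =>
      hw.abs_heatS_le (fun y => hQ y s ⟨hs, hsr.trans hrt⟩) (by linarith) y
  rw [hw.integral_mul_duh h.continuous hc hQm hQ]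
  have e1 : ∀ s ∈ Ioo 0 t, ∫ x, η x * heatS (t - s) (fun y => Q y s) x
      = (∫ x, η x * Q x s) + ∫ r in Ioo s t, L s r := by
    intro s hs
    rw [hw.integral_mul_heatS_eq h hc (hQs s) (fun y => hQ y s hs) (by linarith [hs.2])]
    congr 1
    rw [← integral_Ioc_eq_integral_Ioo, ← integral_Ioc_eq_integral_Ioo,
      ← intervalIntegral.integral_of_le (by linarith [hs.2]),
      ← intervalIntegral.integral_of_le hs.2.le]
    have := intervalIntegral.integral_comp_sub_right (a := s) (b := t)
      (fun r => ∫ x, lap η x * heatS r (fun y => Q y s) x) s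
    rw [sub_self] at this
    exact this.symm
  rw [setIntegral_congr_fun measurableSet_Ioo e1]
  have i1 : IntegrableOn (fun s => ∫ x, η x * Q x s) (Ioo 0 t) := by
    refine IntegrableOn.of_bound (by simp) hηm.aestronglyMeasurable
      (∫ y, ‖η y‖ * (B * w y)) ?_
    rw [ae_restrict_iff' measurableSet_Ioo]
    exact ae_of_all _ fun s hs => hbd _ h.continuous hc _ _ fun y => hQ y s hs
  have e2 : ∀ r ∈ Ioo 0 t, ∫ x, lap η x * duh Q x r = ∫ s in Ioo 0 r, L s r := by
    intro r hr
    exact hw.integral_mul_duh hl.continuous hlc hQm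
      (fun y s hs => hQ y s ⟨hs.1, hs.2.trans hr.2⟩)
  have hLtm : Measurable (fun s => ∫ r in Ioo s t, L s r) := by
    have : Measurable (fun p : ℝ × ℝ => if p.1 < p.2 ∧ p.2 < t then L p.1 p.2 else 0) :=
      Measurable.ite ((measurableSet_lt measurable_fst measurable_snd).inter
        (measurableSet_lt measurable_snd measurable_const)) hLm measurable_const
    have h2 := (this.stronglyMeasurable.integral_prod_right' (ν := volume)).measurable
    convert h2 using 1
    ext s
    rw [← integral_indicator measurableSet_Ioo]
    refine integral_congr_ae (ae_of_all _ fun r => ?_)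
    simp only [indicator, mem_Ioo]
  have hduhm : Measurable (fun s => ∫ x, lap η x * duh Q x s) := by
    have : Measurable (fun p : ℝ × Euc n => lap η p.2 * duh Q p.2 p.1) :=
      (hl.continuous.measurable.comp measurable_snd).mul
        ((measurable_duh hQm).comp measurable_swap)
    exact (this.stronglyMeasurable.integral_prod_right' (ν := volume)).measurable
  set CL := ∫ y, ‖lap η y‖ * (expMoment n (a * √t) * B * w y)
  have i2 : IntegrableOn (fun s => ∫ r in Ioo s t, L s r) (Ioo 0 t) := by
    refine IntegrableOn.of_bound (by simp) hLtm.aestronglyMeasurable (CL * t) ?_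
    rw [ae_restrict_iff' measurableSet_Ioo]
    refine ae_of_all _ fun s hs => ?_
    have := norm_setIntegral_le_of_norm_le_const (μ := volume) (s := Ioo s t) (f := L s) (C := CL)
      (by simp) (fun r hr => hLb s r hs.1 hr.1 hr.2)
    have hCL : 0 ≤ CL := (abs_nonneg _).trans
      (hLb s ((s + t) / 2) hs.1 (by linarith [hs.2]) (by linarith [hs.2]))
    refine this.trans (mul_le_mul_of_nonneg_left ?_ hCL)
    simp only [Measure.real, Real.volume_Ioo]
    rw [ENNReal.toReal_ofReal (by linarith [hs.2])]
    linarith [hs.1]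
  have i3 : IntegrableOn (fun s => ∫ x, lap η x * duh Q x s) (Ioo 0 t) := by
    refine IntegrableOn.of_bound (by simp) hduhm.aestronglyMeasurable (CL * t) ?_
    rw [ae_restrict_iff' measurableSet_Ioo]
    refine ae_of_all _ fun r hr => ?_
    have hCL : 0 ≤ CL := (abs_nonneg _).trans
      (hLb (r / 2) r (by linarith [hr.1]) (by linarith [hr.1]) hr.2)
    rw [e2 r hr]
    have := norm_setIntegral_le_of_norm_le_const (μ := volume) (s := Ioo 0 r)
      (f := fun s => L s r) (C := CL)
      (by simp) (fun s hs => hLb s r hs.1 hs.2 hr.2)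
    refine this.trans (mul_le_mul_of_nonneg_left ?_ hCL)
    simp only [Measure.real, Real.volume_Ioo]
    rw [ENNReal.toReal_ofReal (by linarith [hr.1])]
    linarith [hr.2]
  rw [integral_add i1 i2, integral_add i1 i3, integral_triangle_swap hLm hLb,
    setIntegral_congr_fun measurableSet_Ioo e2]

end

/-- A mild solution, tested with a test function in space. -/
theorem IsMild.integral_mul_eq {a M T : ℝ} {w : Euc n → ℝ} {F V : Euc n → ℝ → ℝ}
    (hw : IsWeight a w) (hF : IsPotential M F) (hV : IsMild T F w V) {η : Euc n → ℝ}
    (h : ContDiff ℝ ∞ η) (hc : HasCompactSupport η) {t : ℝ} (ht : t ∈ Icc 0 T) :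
    ∫ x, η x * V x t = (∫ x, η x * w x)
      + ∫ s in (0 : ℝ)..t, ((∫ x, lap η x * V x s) + ∫ x, η x * (F x s * V x s)) := by
  obtain ⟨C, hC⟩ := hV.bound
  have hl := contDiff_lap h
  have hlc := hasCompactSupport_lap hc
  have hw1 : ∀ y, |w y| ≤ 1 * w y := fun y => by rw [one_mul, abs_of_pos (hw.pos y)]
  have hwm := hw.continuous.measurable
  have hQm := hF.measurable_mul hV.measurable
  have hQ : ∀ y, ∀ s ∈ Icc 0 T, |F y s * V y s| ≤ M * C * w y := fun y s hs => by
    rw [mul_assoc]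
    exact hF.abs_mul_le (hC y s hs)
  have hQ' : ∀ s ∈ Icc 0 T, ∀ y, ∀ r ∈ Ioo 0 s, |F y r * V y r| ≤ M * C * w y :=
    fun s hs y r hr => hQ y r ⟨hr.1.le, hr.2.le.trans hs.2⟩
  -- The Duhamel part is `V` minus the free evolution of `w`, and both are already bounded.
  have hduhb : ∀ s ∈ Icc 0 T, ∀ y, |duh (fun y s => F y s * V y s) y s|
      ≤ (C + expMoment n (a * √T)) * w y := by
    intro s hs y
    have e := hV.eq y s hs
    have h1 := hC y s hs
    have h2 := hw.abs_heatS_le hw1 hs.2 y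
    rw [e] at h1
    rw [abs_le] at *
    constructor <;> linarith
  have hduhm : ∀ s, Measurable (fun y => duh (fun y s => F y s * V y s) y s) := fun s =>
    (measurable_duh hQm).comp (measurable_id.prodMk measurable_const)
  have split : ∀ ζ : Euc n → ℝ, Continuous ζ → HasCompactSupport ζ → ∀ s ∈ Icc 0 T,
      ∫ x, ζ x * V x s = (∫ x, ζ x * heatS s w x)
        + ∫ x, ζ x * duh (fun y s => F y s * V y s) x s := by
    intro ζ hζ hζc s hs
    rw [← integral_add
      (hw.integrable_mul_of_compact hζ hζc (measurable_heatS_space s hwm)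
        (fun y => hw.abs_heatS_le hw1 le_rfl y))
      (hw.integrable_mul_of_compact hζ hζc (hduhm s) (hduhb s hs))]
    refine integral_congr_ae (ae_of_all _ fun x => ?_)
    simp only
    rw [hV.eq x s hs]
    ring
  rw [split η h.continuous hc t ht, hw.integral_mul_heatS_eq h hc hwm hw1 ht.1,
    hw.integral_mul_duh_eq h hc hQm (hQ' t ht), add_assoc, intervalIntegral.integral_of_le ht.1,
    integral_Ioc_eq_integral_Ioo]
  congr 1
  have hbint : ∀ D : ℝ, ∀ ζ : Euc n → ℝ, Continuous ζ → HasCompactSupport ζ →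
      Integrable (fun y => ‖ζ y‖ * (D * w y)) := fun D ζ hζ hζc =>
    Continuous.integrable_of_hasCompactSupport (hζ.norm.mul (continuous_const.mul hw.continuous))
      hζc.norm.mul_right
  have hgen : ∀ D : ℝ, ∀ ζ : Euc n → ℝ, Continuous ζ → HasCompactSupport ζ →
      ∀ r : Euc n → ℝ → ℝ, Measurable (Function.uncurry r) →
      (∀ y, ∀ s ∈ Icc 0 T, |r y s| ≤ D * w y) →
      IntegrableOn (fun s => ∫ x, ζ x * r x s) (Ioo 0 t) := by
    intro D ζ hζ hζc r hr hrb
    have hm : Measurable (fun p : ℝ × Euc n => ζ p.2 * r p.2 p.1) :=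
      (hζ.measurable.comp measurable_snd).mul (hr.comp measurable_swap)
    refine IntegrableOn.of_bound (by simp)
      ((hm.stronglyMeasurable.integral_prod_right' (ν := volume)).aestronglyMeasurable)
      (∫ y, ‖ζ y‖ * (D * w y)) ?_
    rw [ae_restrict_iff' measurableSet_Ioo]
    refine ae_of_all _ fun s hs => ?_
    refine norm_integral_le_of_norm_le (hbint D ζ hζ hζc) (ae_of_all _ fun y => ?_)
    rw [norm_mul]
    exact mul_le_mul_of_nonneg_left (hrb y s ⟨hs.1.le, hs.2.le.trans ht.2⟩) (norm_nonneg _)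
  have j1 := hgen (expMoment n (a * √T) * 1) (lap η) hl.continuous hlc (fun x s => heatS s w x)
    (measurable_heatS (α := Euc n × ℝ) (q := fun _ => w) measurable_snd measurable_fst
      (hwm.comp measurable_snd)) (fun y s hs => hw.abs_heatS_le hw1 hs.2 y)
  have j2 := hgen _ η h.continuous hc _ hQm hQ
  have j3 := hgen _ (lap η) hl.continuous hlc _ (measurable_duh hQm)
    (fun y s hs => hduhb s hs y)
  have j4 : IntegrableOn (fun s => (∫ x, η x * (F x s * V x s))
      + ∫ x, lap η x * duh (fun y s => F y s * V y s) x s) (Ioo 0 t) := j2.add j3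
  rw [← integral_add j1 j4]
  refine setIntegral_congr_fun measurableSet_Ioo fun s hs => ?_
  have hsT : s ∈ Icc 0 T := ⟨hs.1.le, hs.2.le.trans ht.2⟩
  rw [split (lap η) hl.continuous hlc s hsT]
  ring

/-! ### Test functions on the slab -/

/-- The spatial partial derivative of a function of space and time. -/
def dX {W : Type*} [NormedAddCommGroup W] [NormedSpace ℝ W] (j : Fin n) (ξ : Euc n → ℝ → W)
    (x : Euc n) (t : ℝ) : W := partialX j (fun y => ξ y t) x

/-- The time derivative of a function of space and time. -/
def dT {W : Type*} [NormedAddCommGroup W] [NormedSpace ℝ W] (ξ : Euc n → ℝ → W)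
    (x : Euc n) (t : ℝ) : W := deriv (fun s => ξ x s) t

/-- The projection of the support of a test function to space. -/
def spaceSupport {W : Type*} [NormedAddCommGroup W] (ξ : Euc n → ℝ → W) : Set (Euc n) :=
  Prod.fst '' tsupport (Function.uncurry ξ)

theorem eq_zero_of_notMem_spaceSupport {W : Type*} [NormedAddCommGroup W] {ξ : Euc n → ℝ → W}
    {x : Euc n} (hx : x ∉ spaceSupport ξ) (t : ℝ) : ξ x t = 0 := by
  by_contra hne
  exact hx ⟨(x, t), subset_tsupport _ hne, rfl⟩

section

variable {W : Type*} [NormedAddCommGroup W] [NormedSpace ℝ W] {ξ : Euc n → ℝ → W}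

theorem hasFDerivAt_slice_space (h : ContDiff ℝ ∞ (Function.uncurry ξ)) (x : Euc n) (t : ℝ) :
    HasFDerivAt (fun y => ξ y t)
      ((fderiv ℝ (Function.uncurry ξ) (x, t)).comp (ContinuousLinearMap.inl ℝ (Euc n) ℝ)) x := by
  have h1 := ((h.differentiable (by simp)) (x, t)).hasFDerivAt
  have h2 : HasFDerivAt (fun y : Euc n => (y, t)) (ContinuousLinearMap.inl ℝ (Euc n) ℝ) x :=
    hasFDerivAt_prodMk_left x t
  exact h1.comp x h2

theorem hasDerivAt_slice_time (h : ContDiff ℝ ∞ (Function.uncurry ξ)) (x : Euc n) (t : ℝ) :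
    HasDerivAt (fun s => ξ x s) (fderiv ℝ (Function.uncurry ξ) (x, t) (0, 1)) t := by
  have h1 := ((h.differentiable (by simp)) (x, t)).hasFDerivAt
  have h2 : HasDerivAt (fun s : ℝ => (x, s)) ((0 : Euc n), (1 : ℝ)) t :=
    (hasDerivAt_const t x).prodMk (hasDerivAt_id t)
  exact h1.comp_hasDerivAt t h2

theorem uncurry_dX (h : ContDiff ℝ ∞ (Function.uncurry ξ)) (j : Fin n) :
    Function.uncurry (dX j ξ)
      = fun z => fderiv ℝ (Function.uncurry ξ) z (EuclideanSpace.single j 1, 0) := by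
  ext ⟨x, t⟩
  simp only [Function.uncurry_apply_pair, dX, partialX]
  rw [(hasFDerivAt_slice_space h x t).fderiv]
  simp

theorem uncurry_dT (h : ContDiff ℝ ∞ (Function.uncurry ξ)) :
    Function.uncurry (dT ξ) = fun z => fderiv ℝ (Function.uncurry ξ) z (0, 1) := by
  ext ⟨x, t⟩
  exact (hasDerivAt_slice_time h x t).deriv

/-- A derivative in a fixed space-time direction does not enlarge the support; this covers space and
time derivatives at once. -/
theorem IsTest.fderiv_apply {T : ℝ} (h : IsTest T ξ) {ζ : Euc n → ℝ → W} (v : Euc n × ℝ)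
    (hζ : Function.uncurry ζ = fun z => fderiv ℝ (Function.uncurry ξ) z v) : IsTest T ζ := by
  refine ⟨?_, ?_, ?_⟩
  · rw [hζ]
    exact (h.smooth.fderiv_right (m := ∞) (by simp)).clm_apply contDiff_const
  · rw [hζ]
    exact h.compact.fderiv_apply ℝ v
  · rw [hζ]
    refine Subset.trans ?_ h.support
    refine closure_minimal (fun z hz => ?_) (isClosed_tsupport _)
    apply support_fderiv_subset ℝ
    rw [Function.mem_support] at hz ⊢
    intro h0
    exact hz (by rw [h0]; simp)

theorem IsTest.dX {T : ℝ} (h : IsTest T ξ) (j : Fin n) : IsTest T (dX j ξ) :=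
  h.fderiv_apply _ (uncurry_dX h.smooth j)

theorem IsTest.dT {T : ℝ} (h : IsTest T ξ) : IsTest T (dT ξ) :=
  h.fderiv_apply _ (uncurry_dT h.smooth)

theorem IsTest.apply_T {T : ℝ} (h : IsTest T ξ) (x : Euc n) : ξ x T = 0 := by
  by_contra hne
  have : (x, T) ∈ tsupport (Function.uncurry ξ) := subset_tsupport _ hne
  exact lt_irrefl T (mem_Iio.mp (h.support this).2)

theorem IsTest.smooth_space {T : ℝ} (h : IsTest T ξ) (t : ℝ) : ContDiff ℝ ∞ (fun y => ξ y t) :=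
  h.smooth.comp (contDiff_id.prodMk contDiff_const)

theorem IsTest.isCompact_spaceSupport {T : ℝ} (h : IsTest T ξ) : IsCompact (spaceSupport ξ) :=
  h.compact.isCompact.image continuous_fst

theorem IsTest.compact_space {T : ℝ} (h : IsTest T ξ) (t : ℝ) :
    HasCompactSupport (fun y => ξ y t) :=
  HasCompactSupport.intro h.isCompact_spaceSupport fun _ hx =>
    eq_zero_of_notMem_spaceSupport hx t

theorem IsTest.exists_bound {T : ℝ} (h : IsTest T ξ) : ∃ C, ∀ x t, ‖ξ x t‖ ≤ C := by
  obtain ⟨C, hC⟩ := h.smooth.continuous.bounded_above_of_compact_support h.compact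
  exact ⟨C, fun x t => hC (x, t)⟩

theorem IsTest.continuous {T : ℝ} (h : IsTest T ξ) : Continuous (Function.uncurry ξ) :=
  h.smooth.continuous

end

/-! ### Integrals over the slab -/

theorem restrict_slab (T : ℝ) : (volume : Measure (Euc n × ℝ)).restrict (slab n T)
    = (volume : Measure (Euc n)).prod ((volume : Measure ℝ).restrict (Icc 0 T)) := by
  rw [slab, Measure.volume_eq_prod, ← Measure.prod_restrict, Measure.restrict_univ]

theorem measurableSet_slab (T : ℝ) : MeasurableSet (slab n T) :=
  MeasurableSet.univ.prod measurableSet_Icc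

section

variable {W : Type*} [NormedAddCommGroup W] {T : ℝ}

theorem integrableOn_slab_bound {K : Set (Euc n)} (hK : IsCompact K) (C : ℝ) :
    Integrable (indicator (K ×ˢ univ) fun _ : Euc n × ℝ => C) (volume.restrict (slab n T)) := by
  have hm : MeasurableSet (K ×ˢ (univ : Set ℝ)) := hK.measurableSet.prod MeasurableSet.univ
  rw [integrable_indicator_iff hm]
  refine integrableOn_const ?_
  rw [Measure.restrict_apply hm, slab, prod_inter_prod, univ_inter, inter_univ,
    Measure.volume_eq_prod, Measure.prod_prod]
  exact ENNReal.mul_ne_top hK.measure_lt_top.ne (by simp)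

theorem ae_slab_of_forall {p : Euc n × ℝ → Prop} (h : ∀ x, ∀ t ∈ Icc 0 T, p (x, t)) :
    ∀ᵐ z ∂(volume : Measure (Euc n × ℝ)).restrict (slab n T), p z := by
  rw [ae_restrict_iff' (measurableSet_slab T)]
  exact ae_of_all _ fun z hz => h z.1 z.2 hz.2

/-- The slice `t = 0` is null. It has to be avoided because differentiability and gradient bounds
are available only for positive times. -/
theorem ae_slab_of_forall_Ioc {p : Euc n × ℝ → Prop} (h : ∀ x, ∀ t ∈ Ioc 0 T, p (x, t)) :
    ∀ᵐ z ∂(volume : Measure (Euc n × ℝ)).restrict (slab n T), p z := by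
  rw [restrict_slab, Measure.restrict_congr_set (Ioc_ae_eq_Icc (μ := (volume : Measure ℝ))).symm]
  have : ∀ᵐ r ∂((volume : Measure ℝ).restrict (Ioc 0 T)), r ∈ Ioc 0 T :=
    ae_restrict_mem measurableSet_Ioc
  have h2 : ∀ᵐ z ∂((volume : Measure (Euc n)).prod (volume.restrict (Ioc 0 T))),
      z.2 ∈ Ioc 0 T := Measure.quasiMeasurePreserving_snd.ae this
  filter_upwards [h2] with z hz
  exact h z.1 z.2 hz

/-- Bounded functions supported over a compact set are integrable on the slab. -/
theorem integrable_slab {f : Euc n × ℝ → W} {K : Set (Euc n)} (hK : IsCompact K) {C : ℝ}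
    (hf : AEStronglyMeasurable f (volume.restrict (slab n T)))
    (h0 : ∀ x ∉ K, ∀ t, f (x, t) = 0) (hC : ∀ x ∈ K, ∀ t ∈ Ioc 0 T, ‖f (x, t)‖ ≤ C) :
    Integrable f (volume.restrict (slab n T)) := by
  refine (integrableOn_slab_bound hK C).mono' hf (ae_slab_of_forall_Ioc fun x t ht => ?_)
  by_cases hx : x ∈ K
  · rw [indicator_of_mem (by exact ⟨hx, mem_univ _⟩)]
    exact hC x hx t ht
  · rw [indicator_of_notMem (fun h => hx h.1), h0 x hx, norm_zero]

theorem tendsto_integral_slab [NormedSpace ℝ W] {ι : Type*} {l : Filter ι}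
    [l.IsCountablyGenerated] {f : ι → Euc n × ℝ → W}
    {g : Euc n × ℝ → W} {K : Set (Euc n)} (hK : IsCompact K) {C : ℝ}
    (hf : ∀ i, AEStronglyMeasurable (f i) (volume.restrict (slab n T)))
    (h0 : ∀ i, ∀ x ∉ K, ∀ t, f i (x, t) = 0)
    (hC : ∀ i, ∀ x ∈ K, ∀ t ∈ Ioc 0 T, ‖f i (x, t)‖ ≤ C)
    (hlim : ∀ᵐ z ∂(volume : Measure (Euc n × ℝ)).restrict (slab n T),
      Tendsto (fun i => f i z) l (𝓝 (g z))) :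
    Tendsto (fun i => ∫ z in slab n T, f i z) l (𝓝 (∫ z in slab n T, g z)) := by
  refine tendsto_integral_filter_of_dominated_convergence _ (Eventually.of_forall hf)
    (Eventually.of_forall fun i => ?_) (integrableOn_slab_bound hK C) hlim
  refine ae_slab_of_forall_Ioc fun x t ht => ?_
  by_cases hx : x ∈ K
  · rw [indicator_of_mem (by exact ⟨hx, mem_univ _⟩)]
    exact hC i x hx t ht
  · rw [indicator_of_notMem (fun h => hx h.1), h0 i x hx, norm_zero]

theorem integral_slab_time_first [NormedSpace ℝ W] {f : Euc n × ℝ → W} (hT : 0 ≤ T)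
    (hf : Integrable f (volume.restrict (slab n T))) :
    ∫ z in slab n T, f z = ∫ x, ∫ t in (0 : ℝ)..T, f (x, t) := by
  rw [restrict_slab] at hf ⊢
  rw [integral_prod _ hf]
  simp only [intervalIntegral.integral_of_le hT, integral_Icc_eq_integral_Ioc]

theorem integral_slab_space_first [NormedSpace ℝ W] {f : Euc n × ℝ → W} (hT : 0 ≤ T)
    (hf : Integrable f (volume.restrict (slab n T))) :
    ∫ z in slab n T, f z = ∫ t in (0 : ℝ)..T, ∫ x, f (x, t) := by
  rw [restrict_slab] at hf ⊢
  rw [integral_prod_symm _ hf]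
  simp only [intervalIntegral.integral_of_le hT, integral_Icc_eq_integral_Ioc]

end

/-! ### Integration by parts in space -/

theorem integral_mul_partialX {f g : Euc n → ℝ} (hf : Differentiable ℝ f) (hg : ContDiff ℝ 1 g)
    (hc : HasCompactSupport g) (j : Fin n) (hi : Integrable (fun x => partialX j f x * g x)) :
    ∫ x, f x * partialX j g x = - ∫ x, partialX j f x * g x := by
  refine integral_mul_fderiv_eq_neg_fderiv_mul_of_integrable hi ?_ ?_
    (fun x _ => hf x) (fun x _ => (hg.differentiable one_ne_zero) x)
  · refine Continuous.integrable_of_hasCompactSupport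
      (hf.continuous.mul ((hg.continuous_fderiv one_ne_zero).clm_apply continuous_const)) ?_
    exact (hc.fderiv_apply ℝ _).mul_left
  · exact Continuous.integrable_of_hasCompactSupport (hf.continuous.mul hg.continuous)
      hc.mul_left

theorem continuous_partialX {f : Euc n → ℝ} (hf : ContDiff ℝ 1 f) (j : Fin n) :
    Continuous (partialX j f) :=
  (hf.continuous_fderiv one_ne_zero).clm_apply continuous_const

theorem integral_mul_partialX_of_contDiff {f g : Euc n → ℝ} (hf : ContDiff ℝ 1 f)
    (hg : ContDiff ℝ 1 g) (hc : HasCompactSupport g) (j : Fin n) :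
    ∫ x, f x * partialX j g x = - ∫ x, partialX j f x * g x :=
  integral_mul_partialX (hf.differentiable one_ne_zero) hg hc j
    (Continuous.integrable_of_hasCompactSupport ((continuous_partialX hf j).mul hg.continuous)
      hc.mul_left)

theorem partialX_mul {f g : Euc n → ℝ} {x : Euc n} (hf : DifferentiableAt ℝ f x)
    (hg : DifferentiableAt ℝ g x) (j : Fin n) :
    partialX j (fun y => f y * g y) x = partialX j f x * g x + f x * partialX j g x := by
  rw [partialX, fderiv_fun_mul hf hg]
  simp [partialX]
  ring

/-! ### Mollification in space -/

/-- Convolution in space with `ζ`. -/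
def moll (ζ : Euc n → ℝ) (f : Euc n → ℝ → ℝ) (x : Euc n) (t : ℝ) : ℝ := ∫ y, ζ y * f (x - y) t

theorem moll_eq_convolution (ζ : Euc n → ℝ) (f : Euc n → ℝ → ℝ) (t : ℝ) :
    (fun x => moll ζ f x t)
      = MeasureTheory.convolution ζ (fun y => f y t) (ContinuousLinearMap.lsmul ℝ ℝ) volume := rfl

theorem moll_swap (ζ : Euc n → ℝ) (f : Euc n → ℝ → ℝ) (x : Euc n) (t : ℝ) :
    moll ζ f x t = ∫ y, ζ (x - y) * f y t := by
  rw [moll, ← integral_sub_left_eq_self _ volume x]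
  simp

theorem measurable_moll {ζ : Euc n → ℝ} {f : Euc n → ℝ → ℝ} (hζ : Measurable ζ)
    (hf : Measurable (Function.uncurry f)) : Measurable (Function.uncurry (moll ζ f)) := by
  have : Measurable (fun p : (Euc n × ℝ) × Euc n => ζ p.2 * f (p.1.1 - p.2) p.1.2) := by
    refine (hζ.comp measurable_snd).mul ?_
    exact hf.comp (((measurable_fst.comp measurable_fst).sub measurable_snd).prodMk
      (measurable_snd.comp measurable_fst))
  exact (this.stronglyMeasurable.integral_prod_right' (ν := volume)).measurable

theorem contDiff_moll {ζ : Euc n → ℝ} {f : Euc n → ℝ → ℝ} (hζ : ContDiff ℝ ∞ ζ)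
    (hc : HasCompactSupport ζ) {t : ℝ} (hf : LocallyIntegrable (fun y => f y t)) :
    ContDiff ℝ ∞ (fun x => moll ζ f x t) := by
  rw [moll_eq_convolution]
  exact hc.contDiff_convolution_left _ hζ hf

theorem partialX_moll {ζ : Euc n → ℝ} {f : Euc n → ℝ → ℝ} (hζ : ContDiff ℝ ∞ ζ)
    (hc : HasCompactSupport ζ) {t : ℝ} (hf : LocallyIntegrable (fun y => f y t)) (j : Fin n)
    (x : Euc n) :
    partialX j (fun x => moll ζ f x t) x = moll (partialX j ζ) f x t := by
  have h := hc.hasFDerivAt_convolution_left (L := ContinuousLinearMap.lsmul ℝ ℝ) (μ := volume)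
    (hζ.of_le (by simp) : ContDiff ℝ 1 ζ) hf x
  rw [moll_eq_convolution, partialX, h.fderiv, moll, MeasureTheory.convolution]
  rw [ContinuousLinearMap.integral_apply]
  · refine integral_congr_ae (ae_of_all _ fun y => ?_)
    simp [ContinuousLinearMap.precompL_apply, partialX]
  · exact (hc.fderiv ℝ).convolutionExists_left _
      ((hζ.of_le (by simp) : ContDiff ℝ 1 ζ).continuous_fderiv one_ne_zero) hf x

/-- The mollified equation naturally carries the Laplacian on the mollifier; this transfers it to
the mollified function, where Green's formula applies. -/
theorem moll_lap {ζ : Euc n → ℝ} {f : Euc n → ℝ → ℝ} (hζ : ContDiff ℝ ∞ ζ)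
    (hc : HasCompactSupport ζ) {t : ℝ} (hf : LocallyIntegrable (fun y => f y t)) (x : Euc n) :
    moll (lap ζ) f x t = lap (fun x => moll ζ f x t) x := by
  have e : ∀ j, partialX j (partialX j fun x => moll ζ f x t) x
      = moll (partialX j (partialX j ζ)) f x t := by
    intro j
    have e1 : partialX j (fun x => moll ζ f x t) = fun x => moll (partialX j ζ) f x t :=
      funext fun x => partialX_moll hζ hc hf j x
    rw [e1, partialX_moll (contDiff_partialX hζ j) (hasCompactSupport_partialX hc j) hf]
  simp only [lap, e]
  simp only [moll]
  rw [← integral_finsetSum]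
  · simp only [lap, Finset.sum_mul]
  · intro j _
    exact (hasCompactSupport_partialX (hasCompactSupport_partialX hc j) j).convolutionExists_left
      (ContinuousLinearMap.lsmul ℝ ℝ) (contDiff_partialX (contDiff_partialX hζ j) j).continuous hf x

/-! ### Regular solutions. -/

/-- What the mild solution `V` of `∂ₜV = ΔV + g`, `V(·,0) = w`, with gradient `P`, satisfies on
`ℝⁿ × [0, T]`: `V` is comparable to `w`, `P` and `g` are bounded by multiples of `w`, and the
equation holds when tested in space. -/
structure IsRegularSol (T a C : ℝ) (w : Euc n → ℝ) (g V : Euc n → ℝ → ℝ)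
    (P : Euc n → ℝ → Euc n) : Prop where
  T_pos : 0 < T
  weight : IsWeight a w
  measurable_sol : Measurable (Function.uncurry V)
  measurable_source : Measurable (Function.uncurry g)
  measurable_grad : Measurable (Function.uncurry P)
  le_sol : ∀ x, ∀ t ∈ Icc 0 T, w x ≤ C * V x t
  sol_le : ∀ x, ∀ t ∈ Icc 0 T, |V x t| ≤ C * w x
  source_le : ∀ x, ∀ t ∈ Icc 0 T, |g x t| ≤ C * w x
  grad_le : ∀ x, ∀ t ∈ Ioc 0 T, ‖P x t‖ ≤ C * w x
  hasFDerivAt : ∀ x, ∀ t ∈ Ioc 0 T, HasFDerivAt (fun y => V y t) (innerSL ℝ (P x t)) x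
  init : ∀ x, V x 0 = w x
  weak : ∀ η : Euc n → ℝ, ContDiff ℝ ∞ η → HasCompactSupport η → ∀ t ∈ Icc 0 T,
    ∫ x, η x * V x t = (∫ x, η x * w x)
      + ∫ s in (0 : ℝ)..t, ((∫ x, lap η x * V x s) + ∫ x, η x * g x s)

/-- Mildly solving the heat equation with a bounded potential gives a regular solution. -/
theorem IsMild.exists_isRegularSol {a M T : ℝ} {w : Euc n → ℝ} {F : Euc n → ℝ → ℝ} (hT : 0 < T)
    (hw : IsWeight a w) (hF : IsPotential M F) :
    ∃ C P, IsRegularSol T a C w (fun x t => F x t * dyson F w x t) (dyson F w) P := by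
  have hV := isMild_dyson hw hF T
  obtain ⟨C, hC⟩ := hV.bound
  obtain ⟨c, hc, hcV⟩ := exists_lower_bound_dyson hw hF T
  have hQm := hF.measurable_mul hV.measurable
  have hw1 : ∀ y, |w y| ≤ 1 * w y := fun y => by rw [one_mul, abs_of_pos (hw.pos y)]
  have hQ : ∀ y, ∀ s ∈ Icc 0 T, |F y s * dyson F w y s| ≤ M * C * w y := fun y s hs => by
    rw [mul_assoc]
    exact hF.abs_mul_le (hC y s hs)
  have hQ' : ∀ t ∈ Ioc 0 T, ∀ y, ∀ s ∈ Ioo 0 t, |F y s * dyson F w y s| ≤ M * C * w y :=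
    fun t ht y s hs => hQ y s ⟨hs.1.le, hs.2.le.trans ht.2⟩
  have hC0 : 0 ≤ C := nonneg_of_mul_nonneg_left
    ((abs_nonneg _).trans (hC 0 0 ⟨le_rfl, hT.le⟩)) (hw.pos 0)
  have hM := hF.nonneg
  set P : Euc n → ℝ → Euc n := fun x t =>
    gradS t w x + gradDuh (fun y s => F y s * dyson F w y s) x t with hP
  set C1 := 2 * a * expMoment n (a * √T) + √T * (expMoment n (a * √T + 1) * (M * C)) with hC1
  have hgrad : ∀ x, ∀ t ∈ Ioc 0 T, ‖P x t‖ ≤ C1 * w x := by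
    intro x t ht
    refine (norm_add_le _ _).trans ?_
    rw [hC1, add_mul]
    refine add_le_add (hw.norm_gradS_self_le ht.1 ht.2 x) ?_
    refine (hw.norm_gradDuh_le ht.1.le (hQ' t ht) x).trans ?_
    have h1 : expMoment n (a * √t + 1) ≤ expMoment n (a * √T + 1) := by
      refine integral_mono (integrable_exp_mul_gauss _) (integrable_exp_mul_gauss _) fun z => ?_
      have := Real.sqrt_le_sqrt ht.2
      have := hw.rate_nonneg
      have := (gauss_pos z).le
      simp only
      gcongr
    have h2 := Real.sqrt_le_sqrt ht.2
    have h3 := hw.pos x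
    have h4 := expMoment_pos (n := n) (a * √t + 1)
    calc _ ≤ √T * (expMoment n (a * √T + 1) * (M * C) * w x) := by gcongr
      _ = _ := by ring
  -- One constant serves for the lower bound (`1 / c`), the upper bound (`C`), the source (`M C`)
  -- and the gradient (`C1`).
  refine ⟨max (max (1 / c) C) (max (M * C) C1), P, hT, hw, hV.measurable, hQm, ?_, ?_, ?_, ?_, ?_,
    ?_, ?_, ?_⟩
  · exact (measurable_gradS (α := Euc n × ℝ) (q := fun _ => w) measurable_snd measurable_fst
      (hw.continuous.measurable.comp measurable_snd)).add (measurable_gradDuh hQm)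
  · intro x t ht
    have h1 := hcV x t ht
    have hpos : 0 < dyson F w x t := lt_of_lt_of_le (mul_pos hc (hw.pos x)) h1
    calc w x ≤ 1 / c * dyson F w x t := by
          rw [div_mul_eq_mul_div, one_mul, le_div_iff₀ hc]
          linarith
      _ ≤ _ := mul_le_mul_of_nonneg_right
          ((le_max_left _ _).trans (le_max_left _ _)) hpos.le
  · intro x t ht
    exact (hC x t ht).trans (mul_le_mul_of_nonneg_right
      ((le_max_right _ _).trans (le_max_left _ _)) (hw.pos x).le)
  · intro x t ht
    exact (hQ x t ht).trans (mul_le_mul_of_nonneg_right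
      ((le_max_left _ _).trans (le_max_right _ _)) (hw.pos x).le)
  · intro x t ht
    exact (hgrad x t ht).trans (mul_le_mul_of_nonneg_right
      ((le_max_right _ _).trans (le_max_right _ _)) (hw.pos x).le)
  · intro x t ht
    have h1 := (hw.hasFDerivAt_heatS hw.continuous.measurable hw1 ht.1 x).add
      (hw.hasFDerivAt_duh hQm (hQ' t ht) x)
    rw [← map_add] at h1
    refine h1.congr_of_eventuallyEq (Eventually.of_forall fun y => ?_)
    exact hV.eq y t ⟨ht.1.le, ht.2⟩
  · exact dyson_zero w F
  · intro η h hc t ht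
    exact hV.integral_mul_eq hw hF h hc ht

/-! ### Mollifiers and weights. -/

/-- A sequence of bump functions shrinking to the origin. -/
def bump (n k : ℕ) : ContDiffBump (0 : Euc n) where
  rIn := 1 / (2 * (k + 1))
  rOut := 1 / (k + 1)
  rIn_pos := by positivity
  rIn_lt_rOut := by
    apply one_div_lt_one_div_of_lt (by positivity)
    have : (0 : ℝ) < k + 1 := by positivity
    linarith

/-- The corresponding mollifiers. -/
def mol (n k : ℕ) : Euc n → ℝ := (bump n k).normed volume

theorem contDiff_mol (k : ℕ) : ContDiff ℝ ∞ (mol n k) := (bump n k).contDiff_normed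
theorem hasCompactSupport_mol (k : ℕ) : HasCompactSupport (mol n k) :=
  (bump n k).hasCompactSupport_normed
theorem mol_nonneg (k : ℕ) (x : Euc n) : 0 ≤ mol n k x := (bump n k).nonneg_normed x
theorem integral_mol (k : ℕ) : ∫ x, mol n k x = 1 := (bump n k).integral_normed
theorem integrable_mol (k : ℕ) : Integrable (mol n k) := (bump n k).integrable_normed

theorem norm_le_one_of_mol_ne_zero {k : ℕ} {y : Euc n} (h : mol n k y ≠ 0) : ‖y‖ ≤ 1 := by
  have h1 : y ∈ Function.support ((bump n k).normed volume) := h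
  rw [(bump n k).support_normed_eq, mem_ball_zero_iff] at h1
  refine h1.le.trans ?_
  change 1 / ((k : ℝ) + 1) ≤ 1
  rw [div_le_one (by positivity)]
  linarith [(Nat.cast_nonneg k : (0 : ℝ) ≤ k)]

theorem ae_tendsto_mol {W : Type*} [NormedAddCommGroup W] [NormedSpace ℝ W] [CompleteSpace W]
    {f : Euc n → W} (hf : LocallyIntegrable f) :
    ∀ᵐ x, Tendsto (fun k => ∫ y, mol n k y • f (x - y)) atTop (𝓝 (f x)) := by
  refine ContDiffBump.ae_convolution_tendsto_right_of_locallyIntegrable (φ := bump n) (K := 2)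
    ?_ ?_ hf
  · exact tendsto_one_div_add_atTop_nhds_zero_nat
  · refine Eventually.of_forall fun k => le_of_eq ?_
    change 1 / ((k : ℝ) + 1) = 2 * (1 / (2 * (k + 1)))
    field_simp

theorem tendsto_mol_of_continuous {W : Type*} [NormedAddCommGroup W] [NormedSpace ℝ W]
    [CompleteSpace W] {f : Euc n → W} (hf : Continuous f) (x : Euc n) :
    Tendsto (fun k => ∫ y, mol n k y • f (x - y)) atTop (𝓝 (f x)) :=
  ContDiffBump.convolution_tendsto_right_of_continuous (φ := bump n)
    tendsto_one_div_add_atTop_nhds_zero_nat hf x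

section

variable {a B C T t : ℝ} {w : Euc n → ℝ} {f : Euc n → ℝ → ℝ}

theorem IsWeight.locallyIntegrable (hw : IsWeight a w) {W : Type*} [NormedAddCommGroup W]
    {q : Euc n → W} (hqm : AEStronglyMeasurable q)
    (hq : ∀ y, ‖q y‖ ≤ B * w y) : LocallyIntegrable q :=
  (hw.continuous.locallyIntegrable.smul B).mono hqm (ae_of_all _ fun y =>
    (hq y).trans (le_abs_self _))

theorem IsWeight.shift_le_of_norm_le_one (hw : IsWeight a w) (x : Euc n) {y : Euc n}
    (hy : ‖y‖ ≤ 1) : w (x - y) ≤ Real.exp a * w x := by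
  refine (hw.le_mul_exp x (x - y)).trans ?_
  rw [sub_sub_cancel, mul_comm]
  refine mul_le_mul_of_nonneg_right (Real.exp_le_exp.mpr ?_) (hw.pos x).le
  exact mul_le_of_le_one_right hw.rate_nonneg hy

theorem IsWeight.le_shift_of_norm_le_one (hw : IsWeight a w) (x : Euc n) {y : Euc n}
    (hy : ‖y‖ ≤ 1) : w x ≤ Real.exp a * w (x - y) := by
  have := hw.shift_le_of_norm_le_one (x - y) (y := -y) (by rwa [norm_neg])
  simpa using this

/-- All mollifiers live in the unit ball, where a weight changes by at most `exp a`. So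
mollification keeps weighted bounds uniformly in `k`. -/
theorem IsWeight.norm_integral_mol_le (hw : IsWeight a w) {W : Type*} [NormedAddCommGroup W]
    [NormedSpace ℝ W] {q : Euc n → W} (hB : 0 ≤ B)
    (hq : ∀ y, ‖q y‖ ≤ B * w y) (k : ℕ) (x : Euc n) :
    ‖∫ y, mol n k y • q (x - y)‖ ≤ Real.exp a * B * w x := by
  have h := norm_integral_le_of_norm_le (f := fun y => mol n k y • q (x - y))
    ((integrable_mol k).mul_const (Real.exp a * B * w x)) (ae_of_all _ fun y => by
      rw [norm_smul, Real.norm_of_nonneg (mol_nonneg k y)]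
      by_cases hy : mol n k y = 0
      · simp [hy]
      refine mul_le_mul_of_nonneg_left ((hq _).trans ?_) (mol_nonneg k y)
      have := mul_le_mul_of_nonneg_left
        (hw.shift_le_of_norm_le_one x (norm_le_one_of_mol_ne_zero hy)) hB
      linarith)
  rwa [integral_mul_const, integral_mol, one_mul] at h

theorem IsWeight.le_moll_mol (hw : IsWeight a w) (hfm : Measurable (fun y => f y t))
    (hfB : ∀ y, |f y t| ≤ B * w y)
    (hf : ∀ y, w y ≤ C * f y t) (k : ℕ) (x : Euc n) :
    w x ≤ Real.exp a * C * moll (mol n k) f x t := by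
  have hi : Integrable (fun y => mol n k y * f (x - y) t) :=
    (hasCompactSupport_mol k).convolutionExists_left (ContinuousLinearMap.lsmul ℝ ℝ)
      (contDiff_mol k).continuous (hw.locallyIntegrable hfm.aestronglyMeasurable hfB) x
  rw [moll, ← integral_const_mul]
  have h1 : w x = ∫ y, mol n k y * w x := by rw [integral_mul_const, integral_mol, one_mul]
  rw [h1]
  refine integral_mono ((integrable_mol k).mul_const _) (hi.const_mul _) fun y => ?_
  by_cases hy : mol n k y = 0
  · simp [hy]
  have h2 := hw.le_shift_of_norm_le_one x (norm_le_one_of_mol_ne_zero hy)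
  have h3 := mul_le_mul_of_nonneg_left (hf (x - y)) (Real.exp_pos a).le
  have h4 := mul_le_mul_of_nonneg_left (h2.trans h3) (mol_nonneg k y)
  simp only
  linarith

/-- For a general kernel the constant depends on `ζ`. It is used for derivatives of mollifiers at
fixed `k`, where only finiteness matters. -/
theorem IsWeight.abs_moll_le (hw : IsWeight a w) {ζ : Euc n → ℝ} (hζ : Continuous ζ)
    (hc : HasCompactSupport ζ) (hB : 0 ≤ B) (hf : ∀ y, |f y t| ≤ B * w y) (x : Euc n) :
    |moll ζ f x t| ≤ (∫ y, |ζ y| * Real.exp (a * ‖y‖)) * B * w x := by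
  have hi : Integrable (fun y => |ζ y| * Real.exp (a * ‖y‖)) :=
    Continuous.integrable_of_hasCompactSupport (hζ.abs.mul (by fun_prop)) hc.norm.mul_right
  have h := norm_integral_le_of_norm_le (f := fun y => ζ y * f (x - y) t)
    (hi.mul_const (B * w x)) (ae_of_all _ fun y => by
      rw [norm_mul, Real.norm_eq_abs, Real.norm_eq_abs, mul_assoc]
      refine mul_le_mul_of_nonneg_left ((hf _).trans ?_) (abs_nonneg _)
      have h1 := hw.le_mul_exp x (x - y)
      rw [sub_sub_cancel] at h1
      have := mul_le_mul_of_nonneg_left h1 hB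
      linarith)
  rw [integral_mul_const] at h
  calc |moll ζ f x t| ≤ _ := h
    _ = _ := by ring

end

/-- Almost everywhere convergence of the mollifications on the slab. -/
theorem ae_slab_tendsto_moll {T B a : ℝ} {w : Euc n → ℝ} (hw : IsWeight a w)
    {f : Euc n → ℝ → ℝ} (hf : Measurable (Function.uncurry f))
    (hB : ∀ x, ∀ t ∈ Ioc 0 T, |f x t| ≤ B * w x) :
    ∀ᵐ z ∂(volume : Measure (Euc n × ℝ)).restrict (slab n T),
      Tendsto (fun k => moll (mol n k) f z.1 z.2) atTop (𝓝 (f z.1 z.2)) := by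
  have hm : ∀ k, Measurable (fun z : Euc n × ℝ => moll (mol n k) f z.1 z.2) := fun k =>
    measurable_moll (contDiff_mol k).continuous.measurable hf
  have hset : MeasurableSet {z : Euc n × ℝ |
      Tendsto (fun k => moll (mol n k) f z.1 z.2) atTop (𝓝 (f z.1 z.2))} :=
    measurableSet_tendsto_fun hm hf
  rw [restrict_slab, Measure.restrict_congr_set (Ioc_ae_eq_Icc (μ := (volume : Measure ℝ))).symm]
  rw [← Measure.prod_swap, ae_map_iff measurable_swap.aemeasurable hset]
  refine (Measure.ae_prod_iff_ae_ae (p := fun x : ℝ × Euc n => Tendsto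
    (fun k => moll (mol n k) f x.swap.1 x.swap.2) atTop (𝓝 (f x.swap.1 x.swap.2)))
    (measurable_swap hset)).mpr ?_
  rw [ae_restrict_iff' measurableSet_Ioc]
  refine ae_of_all _ fun t ht => ?_
  have hloc : LocallyIntegrable (fun y => f y t) :=
    hw.locallyIntegrable (hf.comp (measurable_id.prodMk measurable_const)).aestronglyMeasurable
      (fun y => hB y t ht)
  exact ae_tendsto_mol hloc

/-! ### Locally bounded families -/

/-- A family of measurable functions of space and time which, over compact sets in space and for
`0 < t ≤ T`, is bounded uniformly in the index. -/
structure LocBdd {ι : Type*} (T : ℝ) (f : ι → Euc n → ℝ → ℝ) : Prop where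
  measurable : ∀ i, Measurable (Function.uncurry (f i))
  bdd : ∀ K : Set (Euc n), IsCompact K → ∃ C, ∀ i, ∀ x ∈ K, ∀ t ∈ Ioc 0 T, |f i x t| ≤ C

section

variable {ι : Type*} {T : ℝ} {f g : ι → Euc n → ℝ → ℝ}

theorem LocBdd.add (hf : LocBdd T f) (hg : LocBdd T g) :
    LocBdd T (fun i x t => f i x t + g i x t) := by
  refine ⟨fun i => (hf.measurable i).add (hg.measurable i), fun K hK => ?_⟩
  obtain ⟨C, hC⟩ := hf.bdd K hK
  obtain ⟨D, hD⟩ := hg.bdd K hK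
  exact ⟨C + D, fun i x hx t ht => (abs_add_le _ _).trans
    (add_le_add (hC i x hx t ht) (hD i x hx t ht))⟩

theorem LocBdd.mul (hf : LocBdd T f) (hg : LocBdd T g) :
    LocBdd T (fun i x t => f i x t * g i x t) := by
  refine ⟨fun i => (hf.measurable i).mul (hg.measurable i), fun K hK => ?_⟩
  obtain ⟨C, hC⟩ := hf.bdd K hK
  obtain ⟨D, hD⟩ := hg.bdd K hK
  refine ⟨C * D, fun i x hx t ht => ?_⟩
  rw [abs_mul]
  exact mul_le_mul (hC i x hx t ht) (hD i x hx t ht) (abs_nonneg _)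
    ((abs_nonneg _).trans (hC i x hx t ht))

theorem LocBdd.const (c : ℝ) : LocBdd T (fun (_ : ι) (_ : Euc n) (_ : ℝ) => c) :=
  ⟨fun _ => measurable_const, fun _ _ => ⟨|c|, fun _ _ _ _ _ => le_rfl⟩⟩

theorem LocBdd.const_mul (hf : LocBdd T f) (c : ℝ) : LocBdd T (fun i x t => c * f i x t) :=
  (LocBdd.const c).mul hf

theorem LocBdd.sub (hf : LocBdd T f) (hg : LocBdd T g) :
    LocBdd T (fun i x t => f i x t - g i x t) := by
  have := hf.add (hg.const_mul (-1))
  convert this using 4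
  ring

theorem LocBdd.sum {κ : Type*} {s : Finset κ} {F : κ → ι → Euc n → ℝ → ℝ}
    (h : ∀ j ∈ s, LocBdd T (F j)) : LocBdd T (fun i x t => ∑ j ∈ s, F j i x t) := by
  classical
  induction s using Finset.induction_on with
  | empty => simpa using LocBdd.const (T := T) (ι := ι) (n := n) 0
  | insert j s hj ih =>
    simp only [Finset.sum_insert hj]
    exact (h j (Finset.mem_insert_self _ _)).add
      (ih fun i hi => h i (Finset.mem_insert_of_mem hi))

theorem LocBdd.reindex {κ : Type*} (hf : LocBdd T f) (σ : κ → ι) :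
    LocBdd T (fun k => f (σ k)) :=
  ⟨fun k => hf.measurable (σ k), fun K hK => (hf.bdd K hK).imp fun _ h k => h (σ k)⟩

theorem LocBdd.of_weight {a B : ℝ} {w : Euc n → ℝ} (hw : IsWeight a w)
    (hm : ∀ i, Measurable (Function.uncurry (f i)))
    (hB : ∀ i x, ∀ t ∈ Ioc 0 T, |f i x t| ≤ B * w x) : LocBdd T f := by
  refine ⟨hm, fun K hK => ?_⟩
  obtain ⟨C, hC⟩ := hK.exists_bound_of_continuousOn (hw.continuous.const_smul B).continuousOn
  exact ⟨C, fun i x hx t ht => (hB i x t ht).trans ((le_abs_self _).trans (hC x hx))⟩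

/-- Allows `Φ` to be singular at `0`, such as `log` and the inverse: `f / w` lies in the compact
interval `[A⁻¹, B]` of positive numbers, and `(r, x) ↦ Φ (r w(x))` is continuous on its product with
`K`. -/
theorem LocBdd.comp_pos {a A B : ℝ} {w : Euc n → ℝ} (hw : IsWeight a w) {Φ : ℝ → ℝ}
    (hΦm : Measurable Φ) (hΦ : ContinuousOn Φ (Ioi 0))
    (hm : ∀ i, Measurable (Function.uncurry (f i))) (hA : 0 < A)
    (hlo : ∀ i x, ∀ t ∈ Ioc 0 T, w x ≤ A * f i x t)
    (hup : ∀ i x, ∀ t ∈ Ioc 0 T, f i x t ≤ B * w x) :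
    LocBdd T (fun i x t => Φ (f i x t)) := by
  refine ⟨fun i => hΦm.comp (hm i), fun K hK => ?_⟩
  obtain ⟨C, hC⟩ := (isCompact_Icc (a := A⁻¹) (b := B)).prod hK
    |>.exists_bound_of_continuousOn (f := fun p : ℝ × Euc n => Φ (p.1 * w p.2))
    (hΦ.comp (by have := hw.continuous; fun_prop)
      fun p hp => mul_pos ((inv_pos.mpr hA).trans_le hp.1.1) (hw.pos p.2))
  refine ⟨C, fun i x hx t ht => ?_⟩
  have h0 := hw.pos x
  have h1 := hC (f i x t / w x, x) ⟨⟨?_, ?_⟩, hx⟩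
  · simpa [div_mul_cancel₀ _ h0.ne'] using h1
  · rw [le_div_iff₀ h0, inv_mul_le_iff₀ hA]
    exact hlo i x t ht
  · rw [div_le_iff₀ h0]
    exact hup i x t ht

theorem LocBdd.of_continuous {ξ : Euc n → ℝ → ℝ} (hξ : Continuous (Function.uncurry ξ)) :
    LocBdd T (fun (_ : ι) => ξ) := by
  refine ⟨fun _ => hξ.measurable, fun K hK => ?_⟩
  obtain ⟨C, hC⟩ := (hK.prod (isCompact_Icc (a := 0) (b := T))).exists_bound_of_continuousOn
    hξ.continuousOn
  exact ⟨C, fun _ x hx t ht => hC (x, t) ⟨hx, Ioc_subset_Icc_self ht⟩⟩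

theorem LocBdd.of_test {ξ : Euc n → ℝ → ℝ} (hξ : IsTest T ξ) : LocBdd T (fun (_ : ι) => ξ) := by
  obtain ⟨C, hC⟩ := hξ.exists_bound
  exact ⟨fun _ => hξ.continuous.measurable, fun _ _ => ⟨C, fun _ x _ t _ => hC x t⟩⟩

theorem LocBdd.integrable {K : Set (Euc n)} (hf : LocBdd T f) (hK : IsCompact K)
    (h0 : ∀ i, ∀ x ∉ K, ∀ t, f i x t = 0) (i : ι) :
    Integrable (fun z : Euc n × ℝ => f i z.1 z.2) (volume.restrict (slab n T)) := by
  obtain ⟨C, hC⟩ := hf.bdd K hK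
  exact integrable_slab hK (hf.measurable i).aestronglyMeasurable (h0 i) (hC i)

theorem LocBdd.integrable_mul_test (hf : LocBdd T f) {ξ : Euc n → ℝ → ℝ} (hξ : IsTest T ξ)
    (i : ι) : Integrable (fun z : Euc n × ℝ => f i z.1 z.2 * ξ z.1 z.2)
      (volume.restrict (slab n T)) :=
  (hf.mul (LocBdd.of_test hξ)).integrable hξ.isCompact_spaceSupport
    (fun i x hx t => by rw [eq_zero_of_notMem_spaceSupport hx, mul_zero]) i

theorem LocBdd.tendsto_integral_mul_test (hf : LocBdd T f) {ξ : Euc n → ℝ → ℝ} (hξ : IsTest T ξ)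
    {l : Filter ι} [l.IsCountablyGenerated] {F : Euc n → ℝ → ℝ}
    (hlim : ∀ᵐ z ∂(volume : Measure (Euc n × ℝ)).restrict (slab n T),
      Tendsto (fun i => f i z.1 z.2) l (𝓝 (F z.1 z.2))) :
    Tendsto (fun i => ∫ z in slab n T, f i z.1 z.2 * ξ z.1 z.2) l
      (𝓝 (∫ z in slab n T, F z.1 z.2 * ξ z.1 z.2)) := by
  obtain ⟨C, hC⟩ := (hf.mul (LocBdd.of_test hξ)).bdd _ hξ.isCompact_spaceSupport
  refine tendsto_integral_slab hξ.isCompact_spaceSupport (C := C)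
    (fun i => ((hf.mul (LocBdd.of_test hξ)).measurable i).aestronglyMeasurable)
    (fun i x hx t => by rw [eq_zero_of_notMem_spaceSupport hx, mul_zero])
    (fun i x hx t ht => hC i x hx t ht) ?_
  filter_upwards [hlim] with z hz
  exact hz.mul_const _

end

/-! ### Mollified regular solutions -/

theorem partialX_reflect {θ : Euc n → ℝ} (hθ : Differentiable ℝ θ) (x : Euc n) (j : Fin n)
    (y : Euc n) : partialX j (fun y => θ (x - y)) y = -partialX j θ (x - y) := by
  have h1 : HasFDerivAt (fun y : Euc n => x - y) (-(ContinuousLinearMap.id ℝ (Euc n))) y :=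
    (hasFDerivAt_id y).const_sub x
  have h2 := (hθ (x - y)).hasFDerivAt.comp y h1
  have h3 : partialX j (fun y => θ (x - y)) y
      = _ := congrArg (fun L => L (EuclideanSpace.single j 1)) h2.fderiv
  rw [h3]
  simp [partialX]

namespace IsRegularSol

variable {T a C : ℝ} {w : Euc n → ℝ} {g V : Euc n → ℝ → ℝ} {P : Euc n → ℝ → Euc n}

theorem const_nonneg (h : IsRegularSol T a C w g V P) : 0 ≤ C :=
  nonneg_of_mul_nonneg_left
    ((abs_nonneg _).trans (h.sol_le 0 0 ⟨le_rfl, h.T_pos.le⟩)) (h.weight.pos 0)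

theorem sol_pos (h : IsRegularSol T a C w g V P) {x : Euc n} {t : ℝ} (ht : t ∈ Icc 0 T) :
    0 < V x t := by
  have h1 := h.weight.pos x
  exact pos_of_mul_pos_right (h1.trans_le (h.le_sol x t ht)) h.const_nonneg

theorem measurable_sol_slice (h : IsRegularSol T a C w g V P) (t : ℝ) :
    Measurable (fun y => V y t) := h.measurable_sol.comp (measurable_id.prodMk measurable_const)

theorem measurable_source_slice (h : IsRegularSol T a C w g V P) (t : ℝ) :
    Measurable (fun y => g y t) := h.measurable_source.comp (measurable_id.prodMk measurable_const)

theorem locallyIntegrable_sol (h : IsRegularSol T a C w g V P) {t : ℝ} (ht : t ∈ Icc 0 T) :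
    LocallyIntegrable (fun y => V y t) :=
  h.weight.locallyIntegrable (h.measurable_sol_slice t).aestronglyMeasurable
    (fun y => h.sol_le y t ht)

theorem locallyIntegrable_source (h : IsRegularSol T a C w g V P) {t : ℝ} (ht : t ∈ Icc 0 T) :
    LocallyIntegrable (fun y => g y t) :=
  h.weight.locallyIntegrable (h.measurable_source_slice t).aestronglyMeasurable
    (fun y => h.source_le y t ht)

/-- The weak equation tested with `y ↦ ζ (x - y)`. For fixed `x` the mollified solution is thus a
primitive in time of a bounded function, as the chain rule `integral_comp_primitive` requires. -/
theorem moll_time (h : IsRegularSol T a C w g V P) {ζ : Euc n → ℝ} (hζ : ContDiff ℝ ∞ ζ)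
    (hc : HasCompactSupport ζ) (x : Euc n) {t : ℝ} (ht : t ∈ Icc 0 T) :
    moll ζ V x t = moll ζ V x 0
      + ∫ s in (0 : ℝ)..t, (moll (lap ζ) V x s + moll ζ g x s) := by
  set η : Euc n → ℝ := fun y => ζ (x - y) with hη
  have hηs : ContDiff ℝ ∞ η := hζ.comp (contDiff_const.sub contDiff_id)
  have hηc : HasCompactSupport η :=
    hc.comp_homeomorph (Homeomorph.subLeft x)
  have hlap : ∀ y, lap η y = lap ζ (x - y) := by
    intro y
    refine Finset.sum_congr rfl fun j _ => ?_
    have e1 : partialX j η = fun y => -partialX j ζ (x - y) :=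
      funext fun y => partialX_reflect (hζ.differentiable (by simp)) x j y
    have e2 : partialX j (fun y => -partialX j ζ (x - y)) y
        = -partialX j (fun y => partialX j ζ (x - y)) y := by
      simp only [partialX]
      rw [fderiv_fun_neg]
      simp
    rw [e1, e2, partialX_reflect ((contDiff_partialX hζ j).differentiable (by simp)) x j y, neg_neg]
  have h1 := h.weak η hηs hηc t ht
  simp only [hlap] at h1
  rw [moll_swap, moll_swap, h1]
  simp only [h.init, moll_swap]
  rfl

theorem exists_moll_bound (h : IsRegularSol T a C w g V P) {ζ : Euc n → ℝ} (hζ : Continuous ζ)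
    (hc : HasCompactSupport ζ) : ∃ D, ∀ x, ∀ t ∈ Icc 0 T,
      |moll ζ V x t| ≤ D * w x ∧ |moll ζ g x t| ≤ D * w x :=
  ⟨(∫ y, |ζ y| * Real.exp (a * ‖y‖)) * C, fun x t ht =>
    ⟨h.weight.abs_moll_le hζ hc h.const_nonneg (fun y => h.sol_le y t ht) x,
      h.weight.abs_moll_le hζ hc h.const_nonneg (fun y => h.source_le y t ht) x⟩⟩

theorem intervalIntegrable_moll (h : IsRegularSol T a C w g V P) {ζ : Euc n → ℝ}
    (hζ : ContDiff ℝ ∞ ζ) (hc : HasCompactSupport ζ) (x : Euc n) :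
    IntervalIntegrable (fun s => moll (lap ζ) V x s + moll ζ g x s) volume 0 T := by
  obtain ⟨D, hD⟩ := h.exists_moll_bound hζ.continuous hc
  obtain ⟨D', hD'⟩ := h.exists_moll_bound (contDiff_lap hζ).continuous (hasCompactSupport_lap hc)
  have hm : Measurable (fun s => moll (lap ζ) V x s + moll ζ g x s) :=
    ((measurable_moll (contDiff_lap hζ).continuous.measurable h.measurable_sol).comp
      (measurable_const.prodMk measurable_id)).add
    ((measurable_moll hζ.continuous.measurable h.measurable_source).comp
      (measurable_const.prodMk measurable_id))
  rw [intervalIntegrable_iff, uIoc_of_le h.T_pos.le]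
  refine IntegrableOn.of_bound (by simp) hm.aestronglyMeasurable (D' * w x + D * w x) ?_
  rw [ae_restrict_iff' measurableSet_Ioc]
  refine ae_of_all _ fun s hs => (norm_add_le _ _).trans (add_le_add ?_ ?_)
  · exact (hD' x s (Ioc_subset_Icc_self hs)).1
  · exact (hD x s (Ioc_subset_Icc_self hs)).2

theorem continuousOn_moll_time (h : IsRegularSol T a C w g V P) {ζ : Euc n → ℝ}
    (hζ : ContDiff ℝ ∞ ζ) (hc : HasCompactSupport ζ) (x : Euc n) :
    ContinuousOn (fun t => moll ζ V x t) (Icc 0 T) := by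
  have h1 := intervalIntegral.continuousOn_primitive_interval'
    (h.intervalIntegrable_moll hζ hc x) left_mem_uIcc
  rw [uIcc_of_le h.T_pos.le] at h1
  exact (h1.const_add (moll ζ V x 0)).congr fun t ht => h.moll_time hζ hc x ht

theorem measurable_grad_coord (h : IsRegularSol T a C w g V P) (j : Fin n) :
    Measurable (Function.uncurry fun x t => P x t j) :=
  (EuclideanSpace.proj j : Euc n →L[ℝ] ℝ).continuous.measurable.comp
    h.measurable_grad

theorem abs_grad_coord_le (h : IsRegularSol T a C w g V P) (j : Fin n) (x : Euc n) {t : ℝ}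
    (ht : t ∈ Ioc 0 T) : |P x t j| ≤ C * w x :=
  (abs_coord_le _ _).trans (h.grad_le x t ht)

/-- The gradient of the mollified solution is the mollified gradient, which yields bounds uniform in
`k` and almost everywhere convergence for first derivatives. -/
theorem moll_partialX (h : IsRegularSol T a C w g V P) {ζ : Euc n → ℝ} (hζ : ContDiff ℝ ∞ ζ)
    (hc : HasCompactSupport ζ) (j : Fin n) (x : Euc n) {t : ℝ} (ht : t ∈ Ioc 0 T) :
    moll (partialX j ζ) V x t = moll ζ (fun y s => P y s j) x t := by
  have ht' := Ioc_subset_Icc_self ht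
  set η : Euc n → ℝ := fun y => ζ (x - y) with hη
  have hηs : ContDiff ℝ ∞ η := hζ.comp (contDiff_const.sub contDiff_id)
  have hηc : HasCompactSupport η := hc.comp_homeomorph (Homeomorph.subLeft x)
  have hpart : ∀ y, partialX j η y = -partialX j ζ (x - y) :=
    partialX_reflect (hζ.differentiable (by simp)) x j
  have hV : ∀ y, partialX j (fun y => V y t) y = P y t j := by
    intro y
    rw [partialX, (h.hasFDerivAt y t ht).fderiv]
    simp [EuclideanSpace.inner_single_right]
  have hP : LocallyIntegrable (fun y => P y t j) :=
    h.weight.locallyIntegrable ((h.measurable_grad_coord j).comp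
      (measurable_id.prodMk measurable_const)).aestronglyMeasurable
      (fun y => h.abs_grad_coord_le j y ht)
  have hkey := integral_mul_partialX (f := fun y => V y t) (g := η)
    (fun y => (h.hasFDerivAt y t ht).differentiableAt) (hηs.of_le (by simp)) hηc j (by
      simp only [hV]
      refine (hP.integrable_smul_left_of_hasCompactSupport hηs.continuous hηc).congr
        (ae_of_all _ fun y => ?_)
      simp only [smul_eq_mul, mul_comm])
  simp only [hV, hpart, mul_neg, integral_neg, neg_inj] at hkey
  rw [moll_swap, moll_swap]
  simp only [mul_comm _ (V _ _), hkey, hη, mul_comm]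

end IsRegularSol

/-- Green's formula against a compactly supported function. -/
theorem integral_lap_mul {f q : Euc n → ℝ} (hf : ContDiff ℝ ∞ f) (hq : ContDiff ℝ 1 q)
    (hc : HasCompactSupport q) :
    ∫ x, lap f x * q x = -∑ j, ∫ x, partialX j f x * partialX j q x := by
  have h1 : ∀ j, ∫ x, partialX j f x * partialX j q x
      = -∫ x, partialX j (partialX j f) x * q x := fun j =>
    integral_mul_partialX_of_contDiff ((contDiff_partialX hf j).of_le (by simp)) hq hc j
  simp only [h1, Finset.sum_neg_distrib, neg_neg, lap, Finset.sum_mul]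
  refine integral_finsetSum _ fun j _ => Continuous.integrable_of_hasCompactSupport
    ((contDiff_partialX (contDiff_partialX hf j) j).continuous.mul hq.continuous) hc.mul_left

namespace IsRegularSol

variable {T a C : ℝ} {w : Euc n → ℝ} {g V : Euc n → ℝ → ℝ} {P : Euc n → ℝ → Euc n}

theorem locBdd_moll_sol {ι : Type*} (h : IsRegularSol T a C w g V P) {ζ : Euc n → ℝ}
    (hζ : Continuous ζ) (hc : HasCompactSupport ζ) : LocBdd T (fun _ : ι => moll ζ V) := by
  obtain ⟨D, hD⟩ := h.exists_moll_bound hζ hc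
  exact LocBdd.of_weight h.weight (fun _ => measurable_moll hζ.measurable h.measurable_sol)
    fun _ x t ht => (hD x t (Ioc_subset_Icc_self ht)).1

theorem locBdd_moll_source {ι : Type*} (h : IsRegularSol T a C w g V P) {ζ : Euc n → ℝ}
    (hζ : Continuous ζ) (hc : HasCompactSupport ζ) : LocBdd T (fun _ : ι => moll ζ g) := by
  obtain ⟨D, hD⟩ := h.exists_moll_bound hζ hc
  exact LocBdd.of_weight h.weight (fun _ => measurable_moll hζ.measurable h.measurable_source)
    fun _ x t ht => (hD x t (Ioc_subset_Icc_self ht)).2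

/-- The equation satisfied by a function of a mollified solution, integrated against a function
with compact support in space. -/
theorem integral_comp_moll (h : IsRegularSol T a C w g V P) {ζ : Euc n → ℝ} (hζ : ContDiff ℝ ∞ ζ)
    (hc : HasCompactSupport ζ) {I : Set ℝ} {Φ Φ' : ℝ → ℝ}
    (hI : ∀ x, ∀ t ∈ Icc 0 T, moll ζ V x t ∈ I) (hΦ : ∀ r ∈ I, HasDerivAt Φ (Φ' r) r)
    (hΦ' : ContinuousOn Φ' I)
    (hb : LocBdd T (fun (_ : Unit) x t => Φ (moll ζ V x t)))
    (hb' : LocBdd T (fun (_ : Unit) x t => Φ' (moll ζ V x t)))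
    {ξ : Euc n → ℝ → ℝ} (hξ : ContDiff ℝ ∞ (Function.uncurry ξ)) {K : Set (Euc n)}
    (hK : IsCompact K) (h0 : ∀ x ∉ K, ∀ t, ξ x t = 0) :
    ∫ z in slab n T, (Φ' (moll ζ V z.1 z.2) * (moll (lap ζ) V z.1 z.2 + moll ζ g z.1 z.2)
        * ξ z.1 z.2 + Φ (moll ζ V z.1 z.2) * dT ξ z.1 z.2)
      = ∫ x, (Φ (moll ζ V x T) * ξ x T - Φ (moll ζ V x 0) * ξ x 0) := by
  have hζl := (contDiff_lap hζ).continuous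
  have hcl := hasCompactSupport_lap hc
  have hdT : Continuous (Function.uncurry (dT ξ)) := by
    rw [uncurry_dT hξ]
    exact (hξ.continuous_fderiv (by simp)).clm_apply continuous_const
  have h0' : ∀ x ∉ K, ∀ t, dT ξ x t = 0 := fun x hx t => by
    simp [dT, h0 x hx]
  have hInt := (((hb'.mul ((h.locBdd_moll_sol hζl hcl).add
    (h.locBdd_moll_source hζ.continuous hc))).mul (LocBdd.of_continuous hξ.continuous)).add
    (hb.mul (LocBdd.of_continuous hdT))).integrable hK (fun _ x hx t => by
      rw [h0 x hx, h0' x hx]; simp) ()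
  rw [integral_slab_time_first h.T_pos.le hInt]
  refine integral_congr_ae (ae_of_all _ fun x => ?_)
  have hcont := h.continuousOn_moll_time hζ hc x
  have himg := hcont.image_Icc h.T_pos.le
  obtain ⟨D, hD⟩ := h.exists_moll_bound hζ.continuous hc
  obtain ⟨D', hD'⟩ := h.exists_moll_bound hζl hcl
  -- At fixed `x` the continuous path `t ↦ moll ζ V x t` has a compact interval as its image; this
  -- interval lies in `I`, so `Φ` needs to be regular only on `I`.
  have hsub : ∀ r ∈ Icc (sInf ((fun t => moll ζ V x t) '' Icc 0 T))
      (sSup ((fun t => moll ζ V x t) '' Icc 0 T)), r ∈ I := by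
    rw [← himg]
    rintro _ ⟨t, ht, rfl⟩
    exact hI x t ht
  refine integral_comp_primitive (C := D' * w x + D * w x) h.T_pos.le
    (h.intervalIntegrable_moll hζ hc x)
    (fun s hs => (abs_add_le _ _).trans (add_le_add (hD' x s hs).1 (hD x s hs).2))
    (fun t ht => h.moll_time hζ hc x ht)
    (fun t ht => by rw [← himg]; exact ⟨t, ht, rfl⟩)
    (fun r hr => hΦ r (hsub r hr)) (hΦ'.mono hsub) (fun t => ?_) ?_
  · exact (hasDerivAt_slice_time hξ x t).differentiableAt.hasDerivAt
  · exact hdT.comp (by fun_prop : Continuous fun s : ℝ => (x, s))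

end IsRegularSol

theorem dX_eq_zero_of_isTest {T : ℝ} {ξ : Euc n → ℝ → ℝ} (hξ : IsTest T ξ) (j : Fin n) (x : Euc n)
    (hx : x ∉ spaceSupport ξ) (t : ℝ) : dX j ξ x t = 0 := by
  have h1 : (fun y => ξ y t) =ᶠ[𝓝 x] fun _ => 0 := by
    filter_upwards [hξ.isCompact_spaceSupport.isClosed.isOpen_compl.mem_nhds hx] with y hy
      using eq_zero_of_notMem_spaceSupport hy t
  simp only [dX, partialX]
  rw [h1.fderiv_eq]
  simp

theorem dT_eq_zero_of_isTest {T : ℝ} {ξ : Euc n → ℝ → ℝ} (_ : IsTest T ξ) (x : Euc n)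
    (hx : x ∉ spaceSupport ξ) (t : ℝ) : dT ξ x t = 0 := by
  simp [dT, eq_zero_of_notMem_spaceSupport hx]

theorem partialX_comp_real {f : Euc n → ℝ} {Φ Φ' : ℝ → ℝ} {x : Euc n}
    (hf : DifferentiableAt ℝ f x) (hΦ : HasDerivAt Φ (Φ' (f x)) (f x)) (j : Fin n) :
    partialX j (fun y => Φ (f y)) x = Φ' (f x) * partialX j f x := by
  have h : HasFDerivAt (fun y => Φ (f y)) (Φ' (f x) • fderiv ℝ f x) x :=
    hΦ.comp_hasFDerivAt x hf.hasFDerivAt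
  rw [partialX, h.fderiv]
  simp [partialX]

namespace IsRegularSol

variable {T a C : ℝ} {w : Euc n → ℝ} {g V : Euc n → ℝ → ℝ} {P : Euc n → ℝ → Euc n}

theorem const_pos (h : IsRegularSol T a C w g V P) : 0 < C := by
  refine h.const_nonneg.lt_of_ne fun h0 => ?_
  have h1 := h.le_sol 0 0 ⟨le_rfl, h.T_pos.le⟩
  rw [← h0, zero_mul] at h1
  exact (h.weight.pos 0).not_ge h1

theorem le_mol_sol (h : IsRegularSol T a C w g V P) (k : ℕ) (x : Euc n) {t : ℝ}
    (ht : t ∈ Icc 0 T) : w x ≤ Real.exp a * C * moll (mol n k) V x t :=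
  h.weight.le_moll_mol (h.measurable_sol_slice t) (fun y => h.sol_le y t ht)
    (fun y => h.le_sol y t ht) k x

theorem mol_sol_pos (h : IsRegularSol T a C w g V P) (k : ℕ) (x : Euc n) {t : ℝ}
    (ht : t ∈ Icc 0 T) : 0 < moll (mol n k) V x t := by
  refine pos_of_mul_pos_right ((h.weight.pos x).trans_le (h.le_mol_sol k x ht)) ?_
  have := h.const_pos
  positivity

theorem abs_mol_sol_le (h : IsRegularSol T a C w g V P) (k : ℕ) (x : Euc n) {t : ℝ}
    (ht : t ∈ Icc 0 T) : |moll (mol n k) V x t| ≤ Real.exp a * C * w x :=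
  h.weight.norm_integral_mol_le (q := fun y => V y t) h.const_nonneg
    (fun y => h.sol_le y t ht) k x

theorem abs_mol_source_le (h : IsRegularSol T a C w g V P) (k : ℕ) (x : Euc n) {t : ℝ}
    (ht : t ∈ Icc 0 T) : |moll (mol n k) g x t| ≤ Real.exp a * C * w x :=
  h.weight.norm_integral_mol_le (q := fun y => g y t) h.const_nonneg
    (fun y => h.source_le y t ht) k x

/-- For `t > 0` this is the bound on `P`, mollified. At `t = 0`, where `P` is not controlled, it
follows by continuity in time of the mollified function; the energy estimate needs it there. -/
theorem abs_mol_grad_le (h : IsRegularSol T a C w g V P) (k : ℕ) (j : Fin n) (x : Euc n) {t : ℝ}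
    (ht : t ∈ Icc 0 T) : |moll (partialX j (mol n k)) V x t| ≤ Real.exp a * C * w x := by
  have hIoc : ∀ s ∈ Ioc 0 T, |moll (partialX j (mol n k)) V x s| ≤ Real.exp a * C * w x := by
    intro s hs
    rw [h.moll_partialX (contDiff_mol k) (hasCompactSupport_mol k) j x hs]
    exact h.weight.norm_integral_mol_le (q := fun y => P y s j) h.const_nonneg
      (fun y => h.abs_grad_coord_le j y hs) k x
  have hcont := (h.continuousOn_moll_time (contDiff_partialX (contDiff_mol k) j)
    (hasCompactSupport_partialX (hasCompactSupport_mol k) j) x).abs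
  rcases ht.1.eq_or_lt with h0 | h0
  · rw [← h0]
    have h1 : Tendsto (fun s => |moll (partialX j (mol n k)) V x s|) (𝓝[Ioc 0 T] 0)
        (𝓝 |moll (partialX j (mol n k)) V x 0|) :=
      (hcont 0 ⟨le_rfl, h.T_pos.le⟩).mono_left (nhdsWithin_mono _ Ioc_subset_Icc_self)
    have : (𝓝[Ioc 0 T] (0 : ℝ)).NeBot := by
      rw [nhdsWithin_Ioc_eq_nhdsGT h.T_pos]
      infer_instance
    exact le_of_tendsto h1 (eventually_mem_nhdsWithin.mono hIoc)
  · exact hIoc t ⟨h0, ht.2⟩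

theorem locBdd_mol_sol (h : IsRegularSol T a C w g V P) :
    LocBdd T (fun k => moll (mol n k) V) :=
  LocBdd.of_weight h.weight (fun k =>
    measurable_moll (contDiff_mol k).continuous.measurable h.measurable_sol)
    fun k x _ ht => h.abs_mol_sol_le k x (Ioc_subset_Icc_self ht)

theorem locBdd_mol_source (h : IsRegularSol T a C w g V P) :
    LocBdd T (fun k => moll (mol n k) g) :=
  LocBdd.of_weight h.weight (fun k =>
    measurable_moll (contDiff_mol k).continuous.measurable h.measurable_source)
    fun k x _ ht => h.abs_mol_source_le k x (Ioc_subset_Icc_self ht)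

theorem locBdd_mol_grad (h : IsRegularSol T a C w g V P) (j : Fin n) :
    LocBdd T (fun k => moll (partialX j (mol n k)) V) :=
  LocBdd.of_weight h.weight (fun k =>
    measurable_moll (contDiff_partialX (contDiff_mol k) j).continuous.measurable
      h.measurable_sol)
    fun k x _ ht => h.abs_mol_grad_le k j x (Ioc_subset_Icc_self ht)

theorem locBdd_comp_mol_sol (h : IsRegularSol T a C w g V P) {Φ : ℝ → ℝ} (hΦm : Measurable Φ)
    (hΦ : ContinuousOn Φ (Ioi 0)) : LocBdd T (fun k x t => Φ (moll (mol n k) V x t)) := by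
  have := h.const_pos
  exact LocBdd.comp_pos h.weight hΦm hΦ h.locBdd_mol_sol.measurable
    (A := Real.exp a * C) (B := Real.exp a * C) (by positivity)
    (fun k x t ht => h.le_mol_sol k x (Ioc_subset_Icc_self ht))
    (fun k x t ht => (le_abs_self _).trans (h.abs_mol_sol_le k x (Ioc_subset_Icc_self ht)))

theorem ae_tendsto_mol_sol (h : IsRegularSol T a C w g V P) :
    ∀ᵐ z ∂(volume : Measure (Euc n × ℝ)).restrict (slab n T),
      Tendsto (fun k => moll (mol n k) V z.1 z.2) atTop (𝓝 (V z.1 z.2)) :=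
  ae_slab_tendsto_moll h.weight h.measurable_sol
    fun x t ht => h.sol_le x t (Ioc_subset_Icc_self ht)

theorem ae_tendsto_mol_source (h : IsRegularSol T a C w g V P) :
    ∀ᵐ z ∂(volume : Measure (Euc n × ℝ)).restrict (slab n T),
      Tendsto (fun k => moll (mol n k) g z.1 z.2) atTop (𝓝 (g z.1 z.2)) :=
  ae_slab_tendsto_moll h.weight h.measurable_source
    fun x t ht => h.source_le x t (Ioc_subset_Icc_self ht)

theorem ae_tendsto_mol_grad (h : IsRegularSol T a C w g V P) (j : Fin n) :
    ∀ᵐ z ∂(volume : Measure (Euc n × ℝ)).restrict (slab n T),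
      Tendsto (fun k => moll (partialX j (mol n k)) V z.1 z.2) atTop (𝓝 (P z.1 z.2 j)) := by
  have h1 := ae_slab_tendsto_moll h.weight (h.measurable_grad_coord j)
    fun x t ht => h.abs_grad_coord_le j x ht
  have h2 : ∀ᵐ z ∂(volume : Measure (Euc n × ℝ)).restrict (slab n T), ∀ k,
      moll (partialX j (mol n k)) V z.1 z.2 = moll (mol n k) (fun y s => P y s j) z.1 z.2 :=
    ae_slab_of_forall_Ioc fun x t ht k =>
      h.moll_partialX (contDiff_mol k) (hasCompactSupport_mol k) j x ht
  filter_upwards [h1, h2] with z hz hz'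
  simpa only [hz'] using hz

theorem partialX_mol_sol (h : IsRegularSol T a C w g V P) {ζ : Euc n → ℝ} (hζ : ContDiff ℝ ∞ ζ)
    (hc : HasCompactSupport ζ) (j : Fin n) {t : ℝ} (ht : t ∈ Icc 0 T) :
    partialX j (fun x => moll ζ V x t) = fun x => moll (partialX j ζ) V x t :=
  funext fun x => partialX_moll hζ hc (h.locallyIntegrable_sol ht) j x

/-- The equation satisfied by `Φ` of a mollified solution, integrated by parts in space. -/
theorem integral_comp_mol_by_parts (h : IsRegularSol T a C w g V P) {Φ Φ' Φ'' : ℝ → ℝ}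
    (hΦm : Measurable Φ) (hΦm' : Measurable Φ') (hΦm'' : Measurable Φ'')
    (hΦ : ∀ r, 0 < r → HasDerivAt Φ (Φ' r) r) (hΦ' : ContDiffOn ℝ 1 Φ' (Ioi 0))
    (hΦ'' : ∀ r, 0 < r → HasDerivAt Φ' (Φ'' r) r)
    {ξ : Euc n → ℝ → ℝ} (hξ : IsTest T ξ) (k : ℕ) :
    ∫ z in slab n T, (Φ (moll (mol n k) V z.1 z.2) * dT ξ z.1 z.2
        - ∑ j, (Φ'' (moll (mol n k) V z.1 z.2) * moll (partialX j (mol n k)) V z.1 z.2 ^ 2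
            * ξ z.1 z.2 + Φ' (moll (mol n k) V z.1 z.2) * moll (partialX j (mol n k)) V z.1 z.2
            * dX j ξ z.1 z.2)
        + Φ' (moll (mol n k) V z.1 z.2) * moll (mol n k) g z.1 z.2 * ξ z.1 z.2)
      = -∫ x, Φ (moll (mol n k) V x 0) * ξ x 0 := by
  set ρ := mol n k with hρ
  have hρs : ContDiff ℝ ∞ ρ := contDiff_mol k
  have hρc : HasCompactSupport ρ := hasCompactSupport_mol k
  have hcont : ContinuousOn Φ (Ioi 0) := fun r hr => (hΦ r hr).continuousAt.continuousWithinAt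
  have hcont'' : ContinuousOn Φ'' (Ioi 0) :=
    (hΦ'.continuousOn_deriv_of_isOpen isOpen_Ioi le_rfl).congr
      fun r hr => (hΦ'' r hr).deriv.symm
  have hK := hξ.isCompact_spaceSupport
  have h0 : ∀ x ∉ spaceSupport ξ, ∀ t, ξ x t = 0 := fun x hx t =>
    eq_zero_of_notMem_spaceSupport hx t
  have hX0 := dX_eq_zero_of_isTest hξ
  have B0 := (h.locBdd_comp_mol_sol hΦm hcont).reindex (fun _ : Unit => k)
  have B1 := (h.locBdd_comp_mol_sol hΦm' hΦ'.continuousOn).reindex (fun _ : Unit => k)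
  have B2 := (h.locBdd_comp_mol_sol hΦm'' hcont'').reindex (fun _ : Unit => k)
  have hmain := h.integral_comp_moll hρs hρc (I := Ioi 0) (Φ := Φ) (Φ' := Φ')
    (fun x t ht => h.mol_sol_pos k x ht) hΦ hΦ'.continuousOn B0 B1 hξ.smooth hK h0
  have Bξ := LocBdd.of_continuous (T := T) (ι := Unit) hξ.continuous
  have BL := h.locBdd_moll_sol (ι := Unit) (contDiff_lap hρs).continuous (hasCompactSupport_lap hρc)
  have BN := h.locBdd_moll_source (ι := Unit) hρs.continuous hρc
  have BT := LocBdd.of_continuous (T := T) (ι := Unit) hξ.dT.continuous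
  have hT0 := dT_eq_zero_of_isTest hξ
  have I1 := (((B1.mul (BL.add BN)).mul Bξ).add (B0.mul BT)).integrable hK (fun _ x hx t => by
    rw [h0 x hx, hT0 x hx]; simp) ()
  have I2 := ((B1.mul BL).mul Bξ).integrable hK (fun _ x hx t => by
    rw [h0 x hx]; simp) ()
  have BX : ∀ j, LocBdd T (fun (_ : Unit) => dX j ξ) := fun j =>
    LocBdd.of_continuous (hξ.dX j).continuous
  have BP : ∀ j, LocBdd T (fun (_ : Unit) => moll (partialX j ρ) V) := fun j =>
    (h.locBdd_mol_grad j).reindex (fun _ : Unit => k)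
  have I3 := (LocBdd.sum (s := Finset.univ) fun j _ => ((B2.mul ((BP j).mul (BP j))).mul Bξ).add
    ((B1.mul (BP j)).mul (BX j))).integrable hK (fun _ x hx t => by
    simp [h0 x hx, hX0 _ x hx]) ()
  -- Green's formula on each time slice against `Φ'(V_k) ξ`. It removes the second derivatives of
  -- `V_k`, which have no pointwise bound uniform in `k`.
  have hslice : ∫ z in slab n T, Φ' (moll ρ V z.1 z.2) * moll (lap ρ) V z.1 z.2 * ξ z.1 z.2
      = -∫ z in slab n T, ∑ j, (Φ'' (moll ρ V z.1 z.2) * (moll (partialX j ρ) V z.1 z.2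
          * moll (partialX j ρ) V z.1 z.2) * ξ z.1 z.2
          + Φ' (moll ρ V z.1 z.2) * moll (partialX j ρ) V z.1 z.2 * dX j ξ z.1 z.2) := by
    rw [integral_slab_space_first h.T_pos.le I2, integral_slab_space_first h.T_pos.le I3,
      ← intervalIntegral.integral_neg]
    refine intervalIntegral.integral_congr fun t ht => ?_
    rw [uIcc_of_le h.T_pos.le] at ht
    have hW := contDiff_moll hρs hρc (h.locallyIntegrable_sol ht)
    have hpos : ∀ x, moll ρ V x t ∈ Ioi 0 := fun x => h.mol_sol_pos k x ht
    have hq : ContDiff ℝ 1 (fun x => Φ' (moll ρ V x t) * ξ x t) :=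
      (hΦ'.comp_contDiff (hW.of_le (by simp)) hpos).mul ((hξ.smooth_space t).of_le (by simp))
    have hgreen := integral_lap_mul hW hq (hξ.compact_space t).mul_left
    have e1 : ∀ j x, partialX j (fun x => Φ' (moll ρ V x t) * ξ x t) x
        = Φ'' (moll ρ V x t) * moll (partialX j ρ) V x t * ξ x t
          + Φ' (moll ρ V x t) * dX j ξ x t := by
      intro j x
      rw [partialX_mul (f := fun x => Φ' (moll ρ V x t)) (g := fun x => ξ x t)
        ((hΦ'' _ (hpos x)).differentiableAt.comp x ((hW.differentiable (by simp)) x))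
        (((hξ.smooth_space t).differentiable (by simp)) x),
        partialX_comp_real ((hW.differentiable (by simp)) x) (hΦ'' _ (hpos x)),
        partialX_moll hρs hρc (h.locallyIntegrable_sol ht)]
      rfl
    simp only [← moll_lap hρs hρc (h.locallyIntegrable_sol ht), e1,
      h.partialX_mol_sol hρs hρc _ ht] at hgreen
    have hc1 : ∀ j, Continuous (fun x => moll (partialX j ρ) V x t) := fun j =>
      (contDiff_moll (contDiff_partialX hρs j) (hasCompactSupport_partialX hρc j)
        (h.locallyIntegrable_sol ht)).continuous
    simp only
    calc _ = ∫ x, moll (lap ρ) V x t * (Φ' (moll ρ V x t) * ξ x t) :=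
          integral_congr_ae (ae_of_all _ fun x => by ring)
      _ = _ := hgreen
      _ = _ := by
        rw [← integral_finsetSum]
        · congr 1
          refine integral_congr_ae (ae_of_all _ fun x => Finset.sum_congr rfl fun j _ => ?_)
          ring
        · intro j _
          refine Continuous.integrable_of_hasCompactSupport ((hc1 j).mul ?_) ?_
          · simp only [← e1 j]
            exact continuous_partialX hq j
          · simp only [← e1 j]
            exact (hasCompactSupport_partialX ((hξ.compact_space t).mul_left) j).mul_left
  calc _ = ∫ z in slab n T, ((Φ' (moll ρ V z.1 z.2) * (moll (lap ρ) V z.1 z.2 + moll ρ g z.1 z.2)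
            * ξ z.1 z.2 + Φ (moll ρ V z.1 z.2) * dT ξ z.1 z.2)
          - Φ' (moll ρ V z.1 z.2) * moll (lap ρ) V z.1 z.2 * ξ z.1 z.2
          - ∑ j, (Φ'' (moll ρ V z.1 z.2) * (moll (partialX j ρ) V z.1 z.2
          * moll (partialX j ρ) V z.1 z.2) * ξ z.1 z.2
          + Φ' (moll ρ V z.1 z.2) * moll (partialX j ρ) V z.1 z.2 * dX j ξ z.1 z.2)) := by
        refine integral_congr_ae (ae_of_all _ fun z => ?_)
        simp only [sq]
        ring
    _ = _ := by
        refine (integral_sub (I1.sub I2) I3).trans ?_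
        refine (congrArg (· - _) (integral_sub I1 I2)).trans ?_
        refine (congrArg₂ (fun p q => p - q - _) hmain hslice).trans ?_
        simp only [hξ.apply_T, mul_zero, zero_sub, integral_neg]
        ring

/-- The equation satisfied by `Φ` of a regular solution, in weak form. -/
theorem integral_comp_by_parts (h : IsRegularSol T a C w g V P) {Φ Φ' Φ'' : ℝ → ℝ}
    (hΦm : Measurable Φ) (hΦm' : Measurable Φ') (hΦm'' : Measurable Φ'')
    (hΦ : ∀ r, 0 < r → HasDerivAt Φ (Φ' r) r) (hΦ' : ContDiffOn ℝ 1 Φ' (Ioi 0))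
    (hΦ'' : ∀ r, 0 < r → HasDerivAt Φ' (Φ'' r) r)
    {ξ : Euc n → ℝ → ℝ} (hξ : IsTest T ξ) :
    ∫ z in slab n T, (Φ (V z.1 z.2) * dT ξ z.1 z.2
        - ∑ j, (Φ'' (V z.1 z.2) * P z.1 z.2 j ^ 2 * ξ z.1 z.2
          + Φ' (V z.1 z.2) * P z.1 z.2 j * dX j ξ z.1 z.2)
        + Φ' (V z.1 z.2) * g z.1 z.2 * ξ z.1 z.2)
      = -∫ x, Φ (w x) * ξ x 0 := by
  have hcont : ContinuousOn Φ (Ioi 0) := fun r hr => (hΦ r hr).continuousAt.continuousWithinAt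
  have hcont'' : ContinuousOn Φ'' (Ioi 0) :=
    (hΦ'.continuousOn_deriv_of_isOpen isOpen_Ioi le_rfl).congr
      fun r hr => (hΦ'' r hr).deriv.symm
  have hK := hξ.isCompact_spaceSupport
  have h0 : ∀ x ∉ spaceSupport ξ, ∀ t, ξ x t = 0 := fun x hx t =>
    eq_zero_of_notMem_spaceSupport hx t
  have hX0 := dX_eq_zero_of_isTest hξ
  have hT0 := dT_eq_zero_of_isTest hξ
  have B := (((h.locBdd_comp_mol_sol hΦm hcont).mul
      (LocBdd.of_continuous (T := T) (ι := ℕ) hξ.dT.continuous)).sub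
    (LocBdd.sum (s := Finset.univ) fun j _ =>
      (((h.locBdd_comp_mol_sol hΦm'' hcont'').mul
        ((h.locBdd_mol_grad j).mul (h.locBdd_mol_grad j))).mul
        (LocBdd.of_continuous (T := T) (ι := ℕ) hξ.continuous)).add
      (((h.locBdd_comp_mol_sol hΦm' hΦ'.continuousOn).mul (h.locBdd_mol_grad j)).mul
        (LocBdd.of_continuous (T := T) (ι := ℕ) (hξ.dX j).continuous)))).add
    (((h.locBdd_comp_mol_sol hΦm' hΦ'.continuousOn).mul h.locBdd_mol_source).mul
      (LocBdd.of_continuous (T := T) (ι := ℕ) hξ.continuous))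
  obtain ⟨D, hD⟩ := B.bdd _ hK
  have hlim := tendsto_integral_slab (l := atTop) (g := fun z => Φ (V z.1 z.2) * dT ξ z.1 z.2
        - ∑ j, (Φ'' (V z.1 z.2) * (P z.1 z.2 j * P z.1 z.2 j) * ξ z.1 z.2
          + Φ' (V z.1 z.2) * P z.1 z.2 j * dX j ξ z.1 z.2)
        + Φ' (V z.1 z.2) * g z.1 z.2 * ξ z.1 z.2) hK (T := T)
    (fun k => (B.measurable k).aestronglyMeasurable) (fun k x hx t => by
      simp [h0 x hx, hX0 _ x hx, hT0 x hx]) hD (by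
      have hP : ∀ᵐ z ∂(volume : Measure (Euc n × ℝ)).restrict (slab n T), ∀ j,
        Tendsto (fun k => moll (partialX j (mol n k)) V z.1 z.2) atTop (𝓝 (P z.1 z.2 j)) :=
        ae_all_iff.mpr h.ae_tendsto_mol_grad
      filter_upwards [h.ae_tendsto_mol_sol, h.ae_tendsto_mol_source, hP,
        ae_slab_of_forall (p := fun z => 0 < V z.1 z.2) fun x t ht => h.sol_pos ht]
        with z hz hz2 hz3 hpos
      have hc := (hcont.continuousAt (Ioi_mem_nhds hpos)).tendsto.comp hz
      have hc' := (hΦ'.continuousOn.continuousAt (Ioi_mem_nhds hpos)).tendsto.comp hz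
      have hc'' := (hcont''.continuousAt (Ioi_mem_nhds hpos)).tendsto.comp hz
      refine ((hc.mul_const _).sub (tendsto_finsetSum _ fun j _ => ?_)).add
        ((hc'.mul hz2).mul_const _)
      exact ((hc''.mul ((hz3 j).mul (hz3 j))).mul_const _).add ((hc'.mul (hz3 j)).mul_const _))
  have hlim0 : Tendsto (fun k => -∫ x, Φ (moll (mol n k) V x 0) * ξ x 0) atTop
      (𝓝 (-∫ x, Φ (w x) * ξ x 0)) := by
    have hwc : ∀ k, Continuous fun x => moll (mol n k) V x 0 := fun k =>
      (contDiff_moll (contDiff_mol k) (hasCompactSupport_mol k)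
        (h.locallyIntegrable_sol ⟨le_rfl, h.T_pos.le⟩)).continuous
    have hC := h.const_pos
    -- The initial values are regarded as a family constant in time, so that `LocBdd.comp_pos`
    -- covers them; the resulting bound is then read off at the time `T`.
    have B0 : LocBdd T (fun k x (_ : ℝ) => Φ (moll (mol n k) V x 0)) :=
      LocBdd.comp_pos h.weight hΦm hcont (f := fun k x _ => moll (mol n k) V x 0)
        (fun k => (hwc k).measurable.comp measurable_fst)
        (A := Real.exp a * C) (B := Real.exp a * C) (by positivity)
        (fun k x t _ => h.le_mol_sol k x ⟨le_rfl, h.T_pos.le⟩)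
        (fun k x t _ => (le_abs_self _).trans (h.abs_mol_sol_le k x ⟨le_rfl, h.T_pos.le⟩))
    obtain ⟨D, hD⟩ := B0.bdd _ hK
    have hInt : Integrable (fun x => D * |ξ x 0|) :=
      ((Continuous.integrable_of_hasCompactSupport (hξ.smooth_space 0).continuous
        (hξ.compact_space 0)).abs).const_mul D
    refine (tendsto_integral_of_dominated_convergence (fun x => D * |ξ x 0|) (fun k => ?_) hInt
      (fun k => ae_of_all _ fun x => ?_) (ae_of_all _ fun x => ?_)).neg
    · exact ((hΦm.comp (hwc k).measurable).mul
        (hξ.smooth_space 0).continuous.measurable).aestronglyMeasurable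
    · rw [norm_mul]
      by_cases hx : x ∈ spaceSupport ξ
      · exact mul_le_mul_of_nonneg_right (hD k x hx T ⟨h.T_pos, le_rfl⟩) (abs_nonneg _)
      · simp [h0 x hx]
    · have h1 := tendsto_mol_of_continuous h.weight.continuous x
      have h2 : (fun k => moll (mol n k) V x 0) = fun k => ∫ y, mol n k y • w (x - y) := by
        ext k
        simp [moll, h.init]
      rw [← h2] at h1
      exact ((hcont.continuousAt (Ioi_mem_nhds (h.weight.pos x))).tendsto.comp h1).mul_const _
  refine (tendsto_nhds_unique ?_ hlim0)
  simp only [← sq] at hlim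
  simp only [← h.integral_comp_mol_by_parts hΦm hΦm' hΦm'' hΦ hΦ' hΦ'' hξ]
  exact hlim

end IsRegularSol

/-! ### The weak equations for the solution and for its logarithm. -/

theorem laplacian_eq_sum_partialX {W : Type*} [NormedAddCommGroup W] [NormedSpace ℝ W]
    {f : Euc n → W} (hf : ContDiff ℝ ∞ f) (x : Euc n) :
    Laplacian.laplacian f x = ∑ j, partialX j (partialX j f) x := by
  rw [InnerProductSpace.laplacian_eq_iteratedFDeriv_orthonormalBasis f
    (EuclideanSpace.basisFun (Fin n) ℝ)]
  refine Finset.sum_congr rfl fun j _ => ?_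
  rw [iteratedFDeriv_two_apply]
  have h1 : DifferentiableAt ℝ (fderiv ℝ f) x :=
    (hf.fderiv_right (m := ∞) (by simp)).differentiable (by simp) x
  have h2 : partialX j f = fun y => fderiv ℝ f y (EuclideanSpace.single j 1) := rfl
  rw [h2, partialX, fderiv_clm_apply h1 (differentiableAt_const _)]
  simp

theorem partialX_coord {f : Euc n → Euc n} {x : Euc n} (hf : DifferentiableAt ℝ f x)
    (j i : Fin n) : partialX j f x i = partialX j (fun y => f y i) x := by
  have h1 : HasFDerivAt (fun y => f y i)
      ((EuclideanSpace.proj i : Euc n →L[ℝ] ℝ).comp (fderiv ℝ f x)) x :=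
    (EuclideanSpace.proj i : Euc n →L[ℝ] ℝ).hasFDerivAt.comp x hf.hasFDerivAt
  rw [partialX, partialX, h1.fderiv]
  rfl

namespace IsRegularSol

variable {T a C : ℝ} {w : Euc n → ℝ} {g V : Euc n → ℝ → ℝ} {P : Euc n → ℝ → Euc n}

theorem locBdd_sol {ι : Type*} (h : IsRegularSol T a C w g V P) : LocBdd T (fun _ : ι => V) :=
  LocBdd.of_weight h.weight (fun _ => h.measurable_sol)
    fun _ x t ht => h.sol_le x t (Ioc_subset_Icc_self ht)

theorem locBdd_source {ι : Type*} (h : IsRegularSol T a C w g V P) : LocBdd T (fun _ : ι => g) :=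
  LocBdd.of_weight h.weight (fun _ => h.measurable_source)
    fun _ x t ht => h.source_le x t (Ioc_subset_Icc_self ht)

theorem locBdd_grad {ι : Type*} (h : IsRegularSol T a C w g V P) (j : Fin n) :
    LocBdd T (fun (_ : ι) x t => P x t j) :=
  LocBdd.of_weight h.weight (fun _ => h.measurable_grad_coord j)
    fun _ x _ ht => h.abs_grad_coord_le j x ht

theorem locBdd_comp_sol {ι : Type*} (h : IsRegularSol T a C w g V P) {Φ : ℝ → ℝ}
    (hΦm : Measurable Φ) (hΦ : ContinuousOn Φ (Ioi 0)) :
    LocBdd T (fun (_ : ι) x t => Φ (V x t)) :=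
  LocBdd.comp_pos h.weight hΦm hΦ (fun _ => h.measurable_sol) (A := C) (B := C) h.const_pos
    (fun _ x t ht => h.le_sol x t (Ioc_subset_Icc_self ht))
    (fun _ x t ht => (le_abs_self _).trans (h.sol_le x t (Ioc_subset_Icc_self ht)))

theorem partialX_sol (h : IsRegularSol T a C w g V P) (j : Fin n) (x : Euc n) {t : ℝ}
    (ht : t ∈ Ioc 0 T) : partialX j (fun y => V y t) x = P x t j := by
  rw [partialX, (h.hasFDerivAt x t ht).fderiv]
  simp [EuclideanSpace.inner_single_right]

/-- Integration by parts in space for `Φ` of a regular solution. -/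
theorem integral_comp_mul_dX (h : IsRegularSol T a C w g V P) {Φ Φ' : ℝ → ℝ}
    (hΦm : Measurable Φ) (hΦm' : Measurable Φ') (hΦ : ∀ r, 0 < r → HasDerivAt Φ (Φ' r) r)
    (hΦ' : ContinuousOn Φ' (Ioi 0)) {ξ : Euc n → ℝ → ℝ} (hξ : IsTest T ξ) (j : Fin n) :
    ∫ z in slab n T, Φ (V z.1 z.2) * dX j ξ z.1 z.2
      = -∫ z in slab n T, Φ' (V z.1 z.2) * P z.1 z.2 j * ξ z.1 z.2 := by
  have hcont : ContinuousOn Φ (Ioi 0) := fun r hr => (hΦ r hr).continuousAt.continuousWithinAt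
  have I1 := (h.locBdd_comp_sol (ι := Unit) hΦm hcont).integrable_mul_test (hξ.dX j) ()
  have B2 := (h.locBdd_comp_sol (ι := Unit) hΦm' hΦ').mul (h.locBdd_grad j)
  have I2 := B2.integrable_mul_test hξ ()
  obtain ⟨D, hD⟩ := B2.bdd _ hξ.isCompact_spaceSupport
  rw [integral_slab_space_first h.T_pos.le I1, integral_slab_space_first h.T_pos.le I2,
    ← intervalIntegral.integral_neg, intervalIntegral.integral_of_le h.T_pos.le,
    intervalIntegral.integral_of_le h.T_pos.le]
  refine setIntegral_congr_fun measurableSet_Ioc fun t ht => ?_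
  have hd : ∀ x, DifferentiableAt ℝ (fun y => V y t) x := fun x =>
    (h.hasFDerivAt x t ht).differentiableAt
  have hpos : ∀ x, 0 < V x t := fun x => h.sol_pos (Ioc_subset_Icc_self ht)
  have e : ∀ x, partialX j (fun y => Φ (V y t)) x = Φ' (V x t) * P x t j := fun x => by
    rw [partialX_comp_real (hd x) (hΦ _ (hpos x)), h.partialX_sol j x ht]
  have := integral_mul_partialX (f := fun y => Φ (V y t)) (g := fun y => ξ y t)
    (fun x => (hΦ _ (hpos x)).differentiableAt.comp x (hd x))
    ((hξ.smooth_space t).of_le (by simp)) (hξ.compact_space t) j (by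
      simp only [e]
      refine Integrable.mono' (g := fun x => D * |ξ x t|)
        ((Continuous.integrable_of_hasCompactSupport (hξ.smooth_space t).continuous
          (hξ.compact_space t)).abs.const_mul D) ?_ (ae_of_all _ fun x => ?_)
      · exact (((B2.measurable ()).comp (measurable_id.prodMk measurable_const)).mul
          (hξ.smooth_space t).continuous.measurable).aestronglyMeasurable
      · rw [norm_mul]
        by_cases hx : x ∈ spaceSupport ξ
        · exact mul_le_mul_of_nonneg_right (hD () x hx t ht) (abs_nonneg _)
        · simp [eq_zero_of_notMem_spaceSupport hx])
  simp only [e] at this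
  exact this

/-- The weak form of the linear equation. -/
theorem integral_weak_linear (h : IsRegularSol T a C w g V P) {ξ : Euc n → ℝ → ℝ}
    (hξ : IsTest T ξ) :
    ∫ z in slab n T, (-(V z.1 z.2 * deriv (fun s => ξ z.1 s) z.2)
        - V z.1 z.2 * Laplacian.laplacian (fun y => ξ y z.2) z.1 - g z.1 z.2 * ξ z.1 z.2)
      = ∫ x, w x * ξ x 0 := by
  have h1 := h.integral_comp_by_parts (Φ := fun r => r) (Φ' := fun _ => 1) (Φ'' := fun _ => 0)
    measurable_id measurable_const measurable_const (fun r _ => hasDerivAt_id r) contDiffOn_const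
    (fun r _ => hasDerivAt_const r _) hξ
  have h2 : ∀ j, ∫ z in slab n T, V z.1 z.2 * dX j (dX j ξ) z.1 z.2
      = -∫ z in slab n T, 1 * P z.1 z.2 j * dX j ξ z.1 z.2 := fun j =>
    h.integral_comp_mul_dX (Φ := fun r => r) (Φ' := fun _ => 1) measurable_id measurable_const
      (fun r _ => hasDerivAt_id r) continuousOn_const (hξ.dX j) j
  have IT := (h.locBdd_sol (ι := Unit)).integrable_mul_test hξ.dT ()
  have IG := (h.locBdd_source (ι := Unit)).integrable_mul_test hξ ()
  have IP : ∀ j, Integrable (fun z : Euc n × ℝ => 1 * P z.1 z.2 j * dX j ξ z.1 z.2)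
      (volume.restrict (slab n T)) := fun j =>
    ((h.locBdd_grad (ι := Unit) j).const_mul 1).integrable_mul_test (hξ.dX j) ()
  have IL : ∀ j, Integrable (fun z : Euc n × ℝ => V z.1 z.2 * dX j (dX j ξ) z.1 z.2)
      (volume.restrict (slab n T)) := fun j =>
    (h.locBdd_sol (ι := Unit)).integrable_mul_test ((hξ.dX j).dX j) ()
  have e1 : ∫ z in slab n T, (V z.1 z.2 * dT ξ z.1 z.2
        - ∑ j, 1 * P z.1 z.2 j * dX j ξ z.1 z.2 + g z.1 z.2 * ξ z.1 z.2)
      = -∫ x, w x * ξ x 0 := by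
    rw [← h1]
    refine integral_congr_ae (ae_of_all _ fun z => ?_)
    simp
  have e2 : ∀ z : Euc n × ℝ, -(V z.1 z.2 * deriv (fun s => ξ z.1 s) z.2)
        - V z.1 z.2 * Laplacian.laplacian (fun y => ξ y z.2) z.1 - g z.1 z.2 * ξ z.1 z.2
      = -(V z.1 z.2 * dT ξ z.1 z.2 + ∑ j, V z.1 z.2 * dX j (dX j ξ) z.1 z.2
        + g z.1 z.2 * ξ z.1 z.2) := by
    intro z
    rw [laplacian_eq_sum_partialX (hξ.smooth_space z.2), ← Finset.mul_sum]
    simp only [dX, dT]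
    ring
  simp only [e2]
  have SL := integrable_finsetSum Finset.univ fun j _ => IL j
  have SP := integrable_finsetSum Finset.univ fun j _ => IP j
  rw [integral_neg, neg_eq_iff_eq_neg, ← e1]
  refine ((integral_add (IT.add SL) IG).trans ?_).trans (integral_add (IT.sub SP) IG).symm
  congr 1
  refine ((integral_add IT SL).trans ?_).trans (integral_sub IT SP).symm
  rw [integral_finsetSum _ fun j _ => IL j, integral_finsetSum _ fun j _ => IP j]
  simp only [h2, Finset.sum_neg_distrib, sub_eq_add_neg]

end IsRegularSol

section

variable {W : Type*} [NormedAddCommGroup W] [NormedSpace ℝ W]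

theorem fderiv_fderiv_apply_comm {E : Type*} [NormedAddCommGroup E] [NormedSpace ℝ E] {f : E → W}
    (hf : ContDiff ℝ ∞ f) (z v v' : E) :
    fderiv ℝ (fun y => fderiv ℝ f y v) z v' = fderiv ℝ (fun y => fderiv ℝ f y v') z v := by
  have h1 : DifferentiableAt ℝ (fderiv ℝ f) z :=
    (hf.fderiv_right (m := ∞) (by simp)).differentiable (by simp) z
  have h2 : IsSymmSndFDerivAt ℝ f z := by
    refine hf.contDiffAt.isSymmSndFDerivAt ?_
    simpa using (WithTop.coe_le_coe.mpr le_top : ((2 : ℕ∞) : WithTop ℕ∞) ≤ ((⊤ : ℕ∞) : WithTop ℕ∞))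
  rw [fderiv_clm_apply h1 (differentiableAt_const _), fderiv_clm_apply h1 (differentiableAt_const _)]
  simpa using h2 v' v

theorem partialX_comm {f : Euc n → W} (hf : ContDiff ℝ ∞ f) (i j : Fin n) (x : Euc n) :
    partialX i (partialX j f) x = partialX j (partialX i f) x :=
  fderiv_fderiv_apply_comm hf x _ _

theorem dX_comm {ξ : Euc n → ℝ → W} {T : ℝ} (hξ : IsTest T ξ) (i j : Fin n) :
    dX i (dX j ξ) = dX j (dX i ξ) := by
  ext x t
  exact partialX_comm (hξ.smooth_space t) i j x

theorem dT_dX_comm {ξ : Euc n → ℝ → W} {T : ℝ} (hξ : IsTest T ξ) (j : Fin n) :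
    dT (dX j ξ) = dX j (dT ξ) := by
  have : Function.uncurry (dT (dX j ξ)) = Function.uncurry (dX j (dT ξ)) := by
    rw [uncurry_dT (hξ.dX j).smooth, uncurry_dX hξ.dT.smooth, uncurry_dX hξ.smooth,
      uncurry_dT hξ.smooth]
    ext z
    exact fderiv_fderiv_apply_comm hξ.smooth z _ _
  ext x t
  exact congrFun this (x, t)

end

namespace IsRegularSol

variable {T a C : ℝ} {w : Euc n → ℝ} {g V : Euc n → ℝ → ℝ} {P : Euc n → ℝ → Euc n}

/-- Lets every linear term be rewritten with `log V`, so that derivatives of the test function can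
be permuted. -/
theorem integral_log_mul_dX (h : IsRegularSol T a C w g V P) {ξ : Euc n → ℝ → ℝ}
    (hξ : IsTest T ξ) (j : Fin n) :
    ∫ z in slab n T, Real.log (V z.1 z.2) * dX j ξ z.1 z.2
      = -∫ z in slab n T, (V z.1 z.2)⁻¹ * P z.1 z.2 j * ξ z.1 z.2 :=
  h.integral_comp_mul_dX Real.measurable_log measurable_inv
    (fun _ hr => Real.hasDerivAt_log hr.ne')
    (continuousOn_inv₀.mono fun _ hr => ne_of_gt hr) hξ j

theorem locBdd_inv_sol {ι : Type*} (h : IsRegularSol T a C w g V P) :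
    LocBdd T (fun (_ : ι) x t => (V x t)⁻¹) :=
  h.locBdd_comp_sol measurable_inv (continuousOn_inv₀.mono fun _ hr => ne_of_gt hr)

theorem locBdd_log_sol {ι : Type*} (h : IsRegularSol T a C w g V P) :
    LocBdd T (fun (_ : ι) x t => Real.log (V x t)) :=
  h.locBdd_comp_sol Real.measurable_log
    (Real.continuousOn_log.mono fun _ hr => ne_of_gt hr)

/-- The weak form of the equation for the `j`-th component of `∇ log V`, before the nonlinear
term is put into nondivergence form. -/
theorem integral_weak_log (h : IsRegularSol T a C w g V P) {θ : Euc n → ℝ → ℝ}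
    (hθ : IsTest T θ) (j : Fin n) :
    ∫ z in slab n T, (-((V z.1 z.2)⁻¹ * P z.1 z.2 j * dT θ z.1 z.2)
        + (∑ i, ((V z.1 z.2)⁻¹ * P z.1 z.2 i) ^ 2 * dX j θ z.1 z.2)
        - (∑ i, (V z.1 z.2)⁻¹ * P z.1 z.2 j * dX i (dX i θ) z.1 z.2)
        + (V z.1 z.2)⁻¹ * g z.1 z.2 * dX j θ z.1 z.2)
      = -∫ x, Real.log (w x) * dX j θ x 0 := by
  have hsub : ∀ r ∈ Ioi (0 : ℝ), r ≠ 0 := fun _ hr => ne_of_gt hr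
  have h1 := h.integral_comp_by_parts (Φ := Real.log) (Φ' := fun r => r⁻¹)
    (Φ'' := fun r => -(r ^ 2)⁻¹) Real.measurable_log measurable_inv (by fun_prop)
    (fun _ hr => Real.hasDerivAt_log hr.ne') (contDiffOn_inv ℝ |>.mono hsub)
    (fun r hr => hasDerivAt_inv hr.ne') (hθ.dX j)
  rw [← h1]
  have BV := h.locBdd_inv_sol (ι := Unit)
  have BL := h.locBdd_log_sol (ι := Unit)
  have A1 := (BV.mul (h.locBdd_grad j)).integrable_mul_test hθ.dT ()
  have A1' := BL.integrable_mul_test (hθ.dX j).dT ()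
  have A2 : ∀ i, Integrable _ _ := fun i =>
    ((BV.mul (h.locBdd_grad i)).mul (BV.mul (h.locBdd_grad i))).integrable_mul_test (hθ.dX j) ()
  have A3 : ∀ i, Integrable _ _ := fun i =>
    (BV.mul (h.locBdd_grad j)).integrable_mul_test ((hθ.dX i).dX i) ()
  have A3' : ∀ i, Integrable _ _ := fun i =>
    (BV.mul (h.locBdd_grad i)).integrable_mul_test ((hθ.dX j).dX i) ()
  have A4 := (BV.mul h.locBdd_source).integrable_mul_test (hθ.dX j) ()
  have e1 : ∫ z in slab n T, Real.log (V z.1 z.2) * dT (dX j θ) z.1 z.2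
      = -∫ z in slab n T, (V z.1 z.2)⁻¹ * P z.1 z.2 j * dT θ z.1 z.2 := by
    rw [dT_dX_comm hθ]
    exact h.integral_log_mul_dX hθ.dT j
  -- `∇ log V` is curl-free: both sides are minus the integral of `log V` against the same third
  -- derivative of `θ`, so the indices `i` and `j` may be exchanged.
  have e3 : ∀ i, ∫ z in slab n T, (V z.1 z.2)⁻¹ * P z.1 z.2 j * dX i (dX i θ) z.1 z.2
      = ∫ z in slab n T, (V z.1 z.2)⁻¹ * P z.1 z.2 i * dX i (dX j θ) z.1 z.2 := by
    intro i
    have h2 := h.integral_log_mul_dX ((hθ.dX i).dX i) j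
    have h3 := h.integral_log_mul_dX ((hθ.dX j).dX i) i
    rw [dX_comm hθ i j, dX_comm (hθ.dX i) i j, h2, neg_inj] at h3
    rw [h3, dX_comm hθ i j]
  have S2 := integrable_finsetSum Finset.univ fun i _ => A2 i
  have S3 := integrable_finsetSum Finset.univ fun i _ => A3 i
  have S3' := integrable_finsetSum Finset.univ fun i _ => A3' i
  have L : ∫ z in slab n T, (-((V z.1 z.2)⁻¹ * P z.1 z.2 j * dT θ z.1 z.2)
        + (∑ i, ((V z.1 z.2)⁻¹ * P z.1 z.2 i) * ((V z.1 z.2)⁻¹ * P z.1 z.2 i) * dX j θ z.1 z.2)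
        - (∑ i, (V z.1 z.2)⁻¹ * P z.1 z.2 j * dX i (dX i θ) z.1 z.2)
        + (V z.1 z.2)⁻¹ * g z.1 z.2 * dX j θ z.1 z.2) = _ :=
    ((integral_add ((A1.neg.add S2).sub S3) A4).trans (congrArg (· + _)
      ((integral_sub (A1.neg.add S2) S3).trans
        (congrArg₂ (fun p q => p - q) ((integral_add A1.neg S2).trans (congrArg (· + _)
          (integral_neg _))) (integral_finsetSum _ fun i _ => A3 i)))))
  have R : ∫ z in slab n T, (Real.log (V z.1 z.2) * dT (dX j θ) z.1 z.2
        + (∑ i, ((V z.1 z.2)⁻¹ * P z.1 z.2 i) * ((V z.1 z.2)⁻¹ * P z.1 z.2 i) * dX j θ z.1 z.2)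
        - (∑ i, (V z.1 z.2)⁻¹ * P z.1 z.2 i * dX i (dX j θ) z.1 z.2)
        + (V z.1 z.2)⁻¹ * g z.1 z.2 * dX j θ z.1 z.2) = _ :=
    ((integral_add ((A1'.add S2).sub S3') A4).trans (congrArg (· + _)
      ((integral_sub (A1'.add S2) S3').trans
        (congrArg₂ (fun p q => p - q) (integral_add A1' S2)
          (integral_finsetSum _ fun i _ => A3' i)))))
  calc _ = _ := by simp only [sq]
    _ = _ := L
    _ = _ := by
      rw [← e1]
      simp only [e3]
    _ = _ := R.symm
    _ = _ := by
      refine integral_congr_ae (ae_of_all _ fun z => ?_)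
      simp only [Finset.sum_add_distrib]
      have : ∀ i, -(V z.1 z.2 ^ 2)⁻¹ * P z.1 z.2 i ^ 2 * dX j θ z.1 z.2
        = -((V z.1 z.2)⁻¹ * P z.1 z.2 i * ((V z.1 z.2)⁻¹ * P z.1 z.2 i) * dX j θ z.1 z.2) := by
        intro i
        rw [← inv_pow]
        ring
      simp only [this, Finset.sum_neg_distrib]
      ring

end IsRegularSol

/-! ### The local energy estimate for second derivatives. -/

theorem partialX_eq_zero_of_notMem_tsupport {χ : Euc n → ℝ} {x : Euc n} (hx : x ∉ tsupport χ)
    (j : Fin n) : partialX j χ x = 0 := by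
  have : fderiv ℝ χ x = 0 := by
    by_contra hne
    exact hx (support_fderiv_subset ℝ hne)
  rw [partialX, this]
  rfl

namespace IsRegularSol

variable {T a C : ℝ} {w : Euc n → ℝ} {g V : Euc n → ℝ → ℝ} {P : Euc n → ℝ → Euc n}

/-- The energy identity for a partial derivative of a mollified solution. -/
theorem energy_identity (h : IsRegularSol T a C w g V P) {ρ χ : Euc n → ℝ}
    (hρs : ContDiff ℝ ∞ ρ) (hρc : HasCompactSupport ρ) (hχ : ContDiff ℝ ∞ χ)
    (hχc : HasCompactSupport χ) (i : Fin n) :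
    ∫ z in slab n T, ((∑ j, moll (partialX j (partialX i ρ)) V z.1 z.2
        * (moll (partialX j (partialX i ρ)) V z.1 z.2 * χ z.1 ^ 2
          + 2 * (moll (partialX i ρ) V z.1 z.2 * χ z.1 * partialX j χ z.1)))
        + moll ρ g z.1 z.2 * (moll (partialX i (partialX i ρ)) V z.1 z.2 * χ z.1 ^ 2
          + 2 * (moll (partialX i ρ) V z.1 z.2 * χ z.1 * partialX i χ z.1)))
      = ∫ x, (moll (partialX i ρ) V x 0 ^ 2 / 2 * χ x ^ 2
          - moll (partialX i ρ) V x T ^ 2 / 2 * χ x ^ 2) := by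
  have hs := contDiff_partialX hρs i
  have hc := hasCompactSupport_partialX hρc i
  have hK : IsCompact (tsupport χ) := hχc
  have h0 : ∀ x ∉ tsupport χ, χ x = 0 := fun x hx => image_eq_zero_of_notMem_tsupport hx
  have hX0 : ∀ x ∉ tsupport χ, ∀ j, partialX j χ x = 0 := fun x hx j =>
    partialX_eq_zero_of_notMem_tsupport hx j
  have hξs : ContDiff ℝ ∞ (Function.uncurry fun x (_ : ℝ) => χ x ^ 2) :=
    (hχ.comp contDiff_fst).pow 2
  have BW := h.locBdd_moll_sol (ι := Unit) hs.continuous hc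
  -- The mollifier is `∂ᵢρ`, so that the function being squared is the derivative `∂ᵢ` of the
  -- mollified solution; the cutoff `χ²` is constant in time.
  have hmain := h.integral_comp_moll hs hc (I := univ) (Φ := fun r => r ^ 2 / 2)
    (Φ' := fun r => r) (fun _ _ _ => mem_univ _)
    (fun r _ => by simpa using ((hasDerivAt_id r).pow 2).div_const 2) continuousOn_id
    (by simpa only [sq, div_eq_inv_mul] using (BW.mul BW).const_mul 2⁻¹) BW hξs hK
    (fun x hx _ => by simp [h0 x hx])
  have hdT : ∀ x t, dT (fun x (_ : ℝ) => χ x ^ 2) x t = 0 := fun x t => by simp [dT]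
  simp only [hdT, mul_zero, add_zero] at hmain
  have Bχ : LocBdd T (fun (_ : Unit) x (_ : ℝ) => χ x ^ 2) := LocBdd.of_continuous hξs.continuous
  have Bχ1 : LocBdd T (fun (_ : Unit) x (_ : ℝ) => χ x) :=
    LocBdd.of_continuous (hχ.continuous.comp continuous_fst)
  have BX : ∀ j, LocBdd T (fun (_ : Unit) x (_ : ℝ) => partialX j χ x) := fun j =>
    LocBdd.of_continuous ((contDiff_partialX hχ j).continuous.comp continuous_fst)
  have BWj : ∀ j, LocBdd T (fun _ : Unit => moll (partialX j (partialX i ρ)) V) := fun j =>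
    h.locBdd_moll_sol (contDiff_partialX hs j).continuous (hasCompactSupport_partialX hc j)
  have BL := h.locBdd_moll_sol (ι := Unit) (contDiff_lap hs).continuous (hasCompactSupport_lap hc)
  have BN := h.locBdd_moll_source (ι := Unit) hρs.continuous hρc
  have BNi := h.locBdd_moll_source (ι := Unit) hs.continuous hc
  have Bq : ∀ j, LocBdd T (fun (_ : Unit) x t => moll (partialX j (partialX i ρ)) V x t * χ x ^ 2
          + 2 * (moll (partialX i ρ) V x t * χ x * partialX j χ x)) := fun j =>
    ((BWj j).mul Bχ).add (((BW.mul Bχ1).mul (BX j)).const_mul 2)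
  have I1 := ((BW.mul (BL.add BNi)).mul Bχ).integrable hK (fun _ x hx t => by simp [h0 x hx]) ()
  have I2 := ((LocBdd.sum (s := Finset.univ) fun j _ => (BWj j).mul (Bq j)).add
    (BN.mul (Bq i))).integrable hK (fun _ x hx t => by simp [h0 x hx]) ()
  -- Besides Green's formula, the derivative on the source is integrated by parts, so that only `g`
  -- itself enters; `∂ᵢg` would not be bounded uniformly in `k`.
  have hneg : ∫ z in slab n T, (moll (partialX i ρ) V z.1 z.2
      * (moll (lap (partialX i ρ)) V z.1 z.2 + moll (partialX i ρ) g z.1 z.2) * χ z.1 ^ 2)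
      = -∫ z in slab n T, ((∑ j, moll (partialX j (partialX i ρ)) V z.1 z.2
        * (moll (partialX j (partialX i ρ)) V z.1 z.2 * χ z.1 ^ 2
          + 2 * (moll (partialX i ρ) V z.1 z.2 * χ z.1 * partialX j χ z.1)))
        + moll ρ g z.1 z.2 * (moll (partialX i (partialX i ρ)) V z.1 z.2 * χ z.1 ^ 2
          + 2 * (moll (partialX i ρ) V z.1 z.2 * χ z.1 * partialX i χ z.1))) := by
    rw [integral_slab_space_first h.T_pos.le I1, integral_slab_space_first h.T_pos.le I2,
      ← intervalIntegral.integral_neg]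
    refine intervalIntegral.integral_congr fun t ht => ?_
    rw [uIcc_of_le h.T_pos.le] at ht
    have hV := h.locallyIntegrable_sol ht
    have hW := contDiff_moll hs hc hV
    have hχ2 : ContDiff ℝ ∞ (fun x => χ x ^ 2) := hχ.pow 2
    have hχ2c : HasCompactSupport (fun x => χ x ^ 2) := by
      simp only [sq]
      exact hχc.mul_left
    have hq : ContDiff ℝ ∞ (fun x => moll (partialX i ρ) V x t * χ x ^ 2) := hW.mul hχ2
    have hqc : HasCompactSupport (fun x => moll (partialX i ρ) V x t * χ x ^ 2) :=
      hχ2c.mul_left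
    have e : ∀ j x, partialX j (fun x => moll (partialX i ρ) V x t * χ x ^ 2) x
        = moll (partialX j (partialX i ρ)) V x t * χ x ^ 2
          + 2 * (moll (partialX i ρ) V x t * χ x * partialX j χ x) := by
      intro j x
      rw [partialX_mul ((hW.differentiable (by simp)) x) ((hχ2.differentiable (by simp)) x),
        partialX_moll hs hc hV, partialX_comp_real (Φ := fun r => r ^ 2) (Φ' := fun r => 2 * r)
          ((hχ.differentiable (by simp)) x) (by simpa using hasDerivAt_pow 2 (χ x))]
      ring
    have hgreen := integral_lap_mul hW (hq.of_le (by simp)) hqc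
    have hNs := contDiff_moll (f := g) hρs hρc (h.locallyIntegrable_source ht)
    have hibp := integral_mul_partialX_of_contDiff (hNs.of_le (by simp))
      (hq.of_le (by simp)) hqc i
    simp only [← moll_lap hs hc hV, e, h.partialX_mol_sol hs hc _ ht] at hgreen
    simp only [partialX_moll hρs hρc (h.locallyIntegrable_source ht), e] at hibp
    have c1 : ∀ j, Continuous (fun x => moll (partialX j (partialX i ρ)) V x t) := fun j =>
      (contDiff_moll (contDiff_partialX hs j) (hasCompactSupport_partialX hc j) hV).continuous
    have cq : ∀ j, Continuous (fun x => moll (partialX j (partialX i ρ)) V x t * χ x ^ 2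
          + 2 * (moll (partialX i ρ) V x t * χ x * partialX j χ x)) := fun j => by
      simp only [← e]
      exact (contDiff_partialX hq j).continuous
    have sq' : ∀ j, HasCompactSupport (fun x => moll (partialX j (partialX i ρ)) V x t * χ x ^ 2
          + 2 * (moll (partialX i ρ) V x t * χ x * partialX j χ x)) := fun j => by
      simp only [← e]
      exact hasCompactSupport_partialX hqc j
    have J1 : Integrable (fun x => moll (lap (partialX i ρ)) V x t
        * (moll (partialX i ρ) V x t * χ x ^ 2)) :=
      Continuous.integrable_of_hasCompactSupport ((contDiff_moll (contDiff_lap hs)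
        (hasCompactSupport_lap hc) hV).continuous.mul hq.continuous) hqc.mul_left
    have J2 : Integrable (fun x => moll (partialX i ρ) g x t
        * (moll (partialX i ρ) V x t * χ x ^ 2)) :=
      Continuous.integrable_of_hasCompactSupport ((contDiff_moll hs hc
        (h.locallyIntegrable_source ht)).continuous.mul hq.continuous) hqc.mul_left
    have J3 : ∀ j, Integrable (fun x => moll (partialX j (partialX i ρ)) V x t
        * (moll (partialX j (partialX i ρ)) V x t * χ x ^ 2
          + 2 * (moll (partialX i ρ) V x t * χ x * partialX j χ x))) := fun j =>
      Continuous.integrable_of_hasCompactSupport ((c1 j).mul (cq j)) (sq' j).mul_left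
    have J4 : Integrable (fun x => moll ρ g x t
        * (moll (partialX i (partialX i ρ)) V x t * χ x ^ 2
          + 2 * (moll (partialX i ρ) V x t * χ x * partialX i χ x))) :=
      Continuous.integrable_of_hasCompactSupport (hNs.continuous.mul (cq i)) (sq' i).mul_left
    simp only
    rw [integral_add (integrable_finsetSum _ fun j _ => J3 j) J4,
      integral_finsetSum _ fun j _ => J3 j, hibp, neg_add, neg_neg, ← hgreen,
      ← integral_add J1 J2]
    refine integral_congr_ae (ae_of_all _ fun x => ?_)
    simp only
    ring
  rw [hneg, neg_eq_iff_eq_neg] at hmain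
  rw [hmain, ← integral_neg]
  refine integral_congr_ae (ae_of_all _ fun x => ?_)
  simp only
  ring

/-- Local bounds in `L²` for the second derivatives of the mollified solutions. -/
theorem exists_hessian_bound (h : IsRegularSol T a C w g V P) {χ : Euc n → ℝ}
    (hχ : ContDiff ℝ ∞ χ) (hχc : HasCompactSupport χ) (i : Fin n) :
    ∃ B, ∀ k j, ∫ z in slab n T,
      (moll (partialX j (partialX i (mol n k))) V z.1 z.2 * χ z.1) ^ 2 ≤ B := by
  have hK : IsCompact (tsupport χ) := hχc
  have h0 : ∀ x ∉ tsupport χ, χ x = 0 := fun x hx => image_eq_zero_of_notMem_tsupport hx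
  have hX0 : ∀ x ∉ tsupport χ, ∀ j, partialX j χ x = 0 := fun x hx j =>
    partialX_eq_zero_of_notMem_tsupport hx j
  have Bχ1 : LocBdd T (fun (_ : ℕ) x (_ : ℝ) => χ x) :=
    LocBdd.of_continuous (hχ.continuous.comp continuous_fst)
  have BX : ∀ j, LocBdd T (fun (_ : ℕ) x (_ : ℝ) => partialX j χ x) := fun j =>
    LocBdd.of_continuous ((contDiff_partialX hχ j).continuous.comp continuous_fst)
  have Ba : ∀ j, LocBdd T (fun k x t => moll (partialX i (mol n k)) V x t * partialX j χ x) :=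
    fun j => (h.locBdd_mol_grad i).mul (BX j)
  have Bb : LocBdd T (fun k x t => moll (mol n k) g x t * χ x) := h.locBdd_mol_source.mul Bχ1
  have BQ := (((LocBdd.sum (s := Finset.univ) fun j _ => (Ba j).mul (Ba j)).const_mul 4).add
    ((Bb.mul Bb).const_mul 2)).add ((Ba i).mul (Ba i))
  obtain ⟨D, hD⟩ := BQ.bdd _ hK
  have IQ := BQ.integrable hK (fun _ x hx t => by simp [h0 x hx, hX0 x hx])
  obtain ⟨M, hM⟩ := hK.exists_bound_of_continuousOn
    (h.weight.continuous.const_smul (Real.exp a * C)).continuousOn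
  -- `M` controls the gradient at time `0` on the support of `χ`, and `D` the products of gradients,
  -- source and cutoff; both are uniform in `k`.
  refine ⟨2 * ((∫ x, M ^ 2 / 2 * χ x ^ 2)
    + ∫ z in slab n T, indicator (tsupport χ ×ˢ univ) (fun _ => D) z), fun k j => ?_⟩
  set ρ := mol n k with hρ
  have hρs : ContDiff ℝ ∞ ρ := contDiff_mol k
  have hρc : HasCompactSupport ρ := hasCompactSupport_mol k
  have hs := contDiff_partialX hρs i
  have hc := hasCompactSupport_partialX hρc i
  have hen := h.energy_identity hρs hρc hχ hχc i
  have Bχ' : LocBdd T (fun (_ : Unit) x (_ : ℝ) => χ x) := Bχ1.reindex fun _ => k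
  have BW := h.locBdd_moll_sol (ι := Unit) hs.continuous hc
  have BWj : ∀ j, LocBdd T (fun _ : Unit => moll (partialX j (partialX i ρ)) V) := fun j =>
    h.locBdd_moll_sol (contDiff_partialX hs j).continuous (hasCompactSupport_partialX hc j)
  have BN := h.locBdd_moll_source (ι := Unit) hρs.continuous hρc
  have Bq : ∀ j, LocBdd T (fun (_ : Unit) x t => moll (partialX j (partialX i ρ)) V x t * χ x ^ 2
          + 2 * (moll (partialX i ρ) V x t * χ x * partialX j χ x)) := fun j => by
    have := ((BWj j).mul (Bχ'.mul Bχ')).add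
      (((BW.mul Bχ').mul ((BX j).reindex fun _ : Unit => k)).const_mul 2)
    simpa only [← sq] using this
  have I2 := ((LocBdd.sum (s := Finset.univ) fun j _ => (BWj j).mul (Bq j)).add
    (BN.mul (Bq i))).integrable hK (fun _ x hx t => by simp [h0 x hx]) ()
  have I3 : Integrable (fun z : Euc n × ℝ =>
      (moll (partialX j (partialX i ρ)) V z.1 z.2 * χ z.1) ^ 2) (volume.restrict (slab n T)) := by
    have := (((BWj j).mul Bχ').mul ((BWj j).mul Bχ')).integrable hK
      (fun _ x hx t => by simp [h0 x hx]) ()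
    simpa only [← sq] using this
  have hinit : ∫ x, (moll (partialX i ρ) V x 0 ^ 2 / 2 * χ x ^ 2
          - moll (partialX i ρ) V x T ^ 2 / 2 * χ x ^ 2) ≤ ∫ x, M ^ 2 / 2 * χ x ^ 2 := by
    have hχ2c : HasCompactSupport (fun x => χ x ^ 2) := by
      simp only [sq]
      exact hχc.mul_left
    have hcw : ∀ s ∈ Icc 0 T, Continuous (fun x => moll (partialX i ρ) V x s ^ 2 / 2) :=
      fun s hs' => ((contDiff_moll hs hc (h.locallyIntegrable_sol hs')).continuous.pow 2).div_const 2
    have J : ∀ s ∈ Icc 0 T, Integrable fun x => moll (partialX i ρ) V x s ^ 2 / 2 * χ x ^ 2 :=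
      fun s hs' => Continuous.integrable_of_hasCompactSupport
        ((hcw s hs').mul (hχ.continuous.pow 2)) hχ2c.mul_left
    refine integral_mono ((J 0 ⟨le_rfl, h.T_pos.le⟩).sub (J T ⟨h.T_pos.le, le_rfl⟩))
      (Continuous.integrable_of_hasCompactSupport (continuous_const.mul (hχ.continuous.pow 2))
        hχ2c.mul_left) fun x => ?_
    by_cases hx : x ∈ tsupport χ
    · have h1 : |moll (partialX i ρ) V x 0| ≤ M :=
        (h.abs_mol_grad_le k i x ⟨le_rfl, h.T_pos.le⟩).trans ((le_abs_self _).trans (hM x hx))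
      have h2 : moll (partialX i ρ) V x 0 ^ 2 ≤ M ^ 2 := sq_le_sq' (abs_le.mp h1).1 (abs_le.mp h1).2
      have h3 := mul_le_mul_of_nonneg_right h2 (sq_nonneg (χ x))
      have h4 : 0 ≤ moll (partialX i ρ) V x T ^ 2 / 2 * χ x ^ 2 := by positivity
      simp only
      linarith
    · simp [h0 x hx]
  have hQ : ∫ z in slab n T, (4 * ∑ j, moll (partialX i ρ) V z.1 z.2 * partialX j χ z.1
        * (moll (partialX i ρ) V z.1 z.2 * partialX j χ z.1)
        + 2 * (moll ρ g z.1 z.2 * χ z.1 * (moll ρ g z.1 z.2 * χ z.1))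
        + moll (partialX i ρ) V z.1 z.2 * partialX i χ z.1
          * (moll (partialX i ρ) V z.1 z.2 * partialX i χ z.1))
      ≤ ∫ z in slab n T, indicator (tsupport χ ×ˢ univ) (fun _ => D) z := by
    refine integral_mono_ae (IQ k) (integrableOn_slab_bound hK D) ?_
    refine ae_slab_of_forall_Ioc fun x t ht => ?_
    by_cases hx : x ∈ tsupport χ
    · rw [indicator_of_mem (show (x, t) ∈ tsupport χ ×ˢ univ from ⟨hx, mem_univ _⟩)]
      exact (le_abs_self _).trans (hD k x hx t ht)
    · rw [indicator_of_notMem (fun hh => hx hh.1)]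
      simp [h0 x hx, hX0 x hx]
  have hpt : ∫ z in slab n T, (moll (partialX j (partialX i ρ)) V z.1 z.2 * χ z.1) ^ 2
      ≤ ∫ z in slab n T, 2 * (((∑ j, moll (partialX j (partialX i ρ)) V z.1 z.2
        * (moll (partialX j (partialX i ρ)) V z.1 z.2 * χ z.1 ^ 2
          + 2 * (moll (partialX i ρ) V z.1 z.2 * χ z.1 * partialX j χ z.1)))
        + moll ρ g z.1 z.2 * (moll (partialX i (partialX i ρ)) V z.1 z.2 * χ z.1 ^ 2
          + 2 * (moll (partialX i ρ) V z.1 z.2 * χ z.1 * partialX i χ z.1)))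
        + (4 * ∑ j, moll (partialX i ρ) V z.1 z.2 * partialX j χ z.1
        * (moll (partialX i ρ) V z.1 z.2 * partialX j χ z.1)
        + 2 * (moll ρ g z.1 z.2 * χ z.1 * (moll ρ g z.1 z.2 * χ z.1))
        + moll (partialX i ρ) V z.1 z.2 * partialX i χ z.1
          * (moll (partialX i ρ) V z.1 z.2 * partialX i χ z.1))) := by
    refine integral_mono I3 ((I2.add (IQ k)).const_mul 2) fun z => ?_
    -- Young's inequality pointwise: the mixed terms of the energy density are absorbed by a part of
    -- `∑ (pⱼ c)²`, at the price of the lower order terms in the last bracket.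
    have key : ∀ (q A c : ℝ) (p b : Fin n → ℝ),
        (p j * c) ^ 2 ≤ 2 * (((∑ j, p j * (p j * c ^ 2 + 2 * (q * c * b j)))
          + A * (p i * c ^ 2 + 2 * (q * c * b i)))
          + (4 * ∑ j, q * b j * (q * b j) + 2 * (A * c * (A * c)) + q * b i * (q * b i))) := by
      intro q A c p b
      have s1 : ∑ j, (3 / 4 * (p j * c) ^ 2) ≤ ∑ j, (p j * (p j * c ^ 2 + 2 * (q * c * b j))
          + 4 * (q * b j * (q * b j))) := by
        refine Finset.sum_le_sum fun j _ => ?_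
        nlinarith [sq_nonneg (p j * c / 2 + 2 * (q * b j))]
      rw [Finset.sum_add_distrib, ← Finset.mul_sum, ← Finset.mul_sum] at s1
      have s2 : ∀ l, (p l * c) ^ 2 ≤ ∑ j, (p j * c) ^ 2 := fun l =>
        Finset.single_le_sum (f := fun j => (p j * c) ^ 2) (fun j _ => sq_nonneg _)
          (Finset.mem_univ l)
      have s3 := s2 i
      have s4 := s2 j
      nlinarith [sq_nonneg (p i * c / 2 + A * c), sq_nonneg (A * c + q * b i)]
    exact key _ _ _ (fun j => moll (partialX j (partialX i ρ)) V z.1 z.2) (fun j => partialX j χ z.1)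
  refine hpt.trans ?_
  rw [integral_const_mul]
  refine mul_le_mul_of_nonneg_left ?_ zero_le_two
  refine (integral_add I2 (IQ k)).trans_le (add_le_add ?_ hQ)
  rw [hen]
  exact hinit

end IsRegularSol

/-! ### Weak compactness. -/

/-- A bounded sequence in a Hilbert space has a weak limit along an ultrafilter, and the pairing
with a strongly convergent sequence converges. -/
theorem exists_weak_limit_hilbert {H : Type*} [NormedAddCommGroup H] [InnerProductSpace ℝ H]
    [CompleteSpace H] {v : ℕ → H} {B : ℝ} (hv : ∀ k, ‖v k‖ ≤ B) :
    ∃ d : H, ∀ (q : ℕ → H) (q' : H), Tendsto q atTop (𝓝 q') →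
      Tendsto (fun k => inner ℝ (v k) (q k)) (hyperfilter ℕ : Filter ℕ) (𝓝 (inner ℝ d q')) := by
  -- Banach–Alaoglu. A limit along one fixed ultrafilter replaces the extraction of subsequences: no
  -- separability is needed, and all components converge along the same filter.
  have hc := WeakDual.isCompact_closedBall (𝕜 := ℝ) (E := H) 0 B
  set Λ : ℕ → WeakDual ℝ H := fun k => StrongDual.toWeakDual (InnerProductSpace.toDual ℝ H (v k))
    with hΛ
  have hmem : ∀ k, Λ k ∈ WeakDual.toStrongDual ⁻¹' Metric.closedBall (0 : StrongDual ℝ H) B := by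
    intro k
    rw [mem_preimage, mem_closedBall_zero_iff]
    exact ((InnerProductSpace.toDual ℝ H).norm_map (v k)).le.trans (hv k)
  obtain ⟨L, -, hL⟩ := hc.ultrafilter_le_nhds' ((hyperfilter ℕ).map Λ)
    (Ultrafilter.mem_map.mpr (Filter.mem_of_superset Filter.univ_mem fun k _ => hmem k))
  refine ⟨(InnerProductSpace.toDual ℝ H).symm (WeakDual.toStrongDual L), fun q q' hq => ?_⟩
  have h1 : Tendsto (fun k => inner ℝ (v k) q') (hyperfilter ℕ : Filter ℕ)
      (𝓝 (inner ℝ ((InnerProductSpace.toDual ℝ H).symm (WeakDual.toStrongDual L)) q')) := by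
    rw [InnerProductSpace.toDual_symm_apply]
    have : Tendsto Λ (hyperfilter ℕ : Filter ℕ) (𝓝 L) := hL
    exact ((WeakDual.eval_continuous q').tendsto L).comp this
  have h2 : Tendsto (fun k => inner ℝ (v k) (q k - q')) (hyperfilter ℕ : Filter ℕ) (𝓝 0) := by
    have h3 : Tendsto (fun k => B * ‖q k - q'‖) atTop (𝓝 0) := by
      simpa using (tendsto_iff_norm_sub_tendsto_zero.mp hq).const_mul B
    refine squeeze_zero_norm (fun k => ?_) (h3.mono_left ?_)
    · exact (norm_inner_le_norm _ _).trans (mul_le_mul_of_nonneg_right (hv k) (norm_nonneg _))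
    · exact Nat.cofinite_eq_atTop ▸ hyperfilter_le_cofinite
  have h4 := h1.add h2
  rw [add_zero] at h4
  refine h4.congr fun k => ?_
  rw [inner_sub_right]
  ring

theorem inner_toLp_eq_integral {α : Type*} [MeasurableSpace α] {μ : Measure α} {f g : α → ℝ}
    (hf : MemLp f 2 μ) (hg : MemLp g 2 μ) :
    inner ℝ (hf.toLp f) (hg.toLp g) = ∫ x, f x * g x ∂μ := by
  rw [L2.inner_def]
  refine integral_congr_ae ?_
  filter_upwards [hf.coeFn_toLp, hg.coeFn_toLp] with x h1 h2
  rw [h1, h2]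
  simp [mul_comm]

/-- Dominated convergence; it supplies the strongly convergent factor in the pairing with a weakly
convergent one. -/
theorem tendsto_toLp_of_ae {α : Type*} [MeasurableSpace α] {μ : Measure α} [IsFiniteMeasure μ]
    {q : ℕ → α → ℝ} {q' : α → ℝ} {B : ℝ} (hq : ∀ k, MemLp (q k) 2 μ) (hq' : MemLp q' 2 μ)
    (hB : ∀ k, ∀ᵐ x ∂μ, |q k x| ≤ B) (hlim : ∀ᵐ x ∂μ, Tendsto (fun k => q k x) atTop (𝓝 (q' x))) :
    Tendsto (fun k => (hq k).toLp (q k)) atTop (𝓝 (hq'.toLp q')) := by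
  rw [tendsto_iff_norm_sub_tendsto_zero]
  have e : ∀ k, ‖(hq k).toLp (q k) - hq'.toLp q'‖ = √(∫ x, (q k x - q' x) ^ 2 ∂μ) := by
    intro k
    rw [← MemLp.toLp_sub, norm_eq_sqrt_real_inner, inner_toLp_eq_integral]
    simp [sq]
  simp only [e]
  have hB' : ∀ᵐ x ∂μ, |q' x| ≤ B := by
    filter_upwards [ae_all_iff.mpr hB, hlim] with x h1 h2
    exact le_of_tendsto h2.abs (Eventually.of_forall h1)
  have h1 : Tendsto (fun k => ∫ x, (q k x - q' x) ^ 2 ∂μ) atTop (𝓝 (∫ _, 0 ∂μ)) := by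
    refine tendsto_integral_of_dominated_convergence (fun _ => (B + B) ^ 2)
      (fun k => ((hq k).1.sub hq'.1).pow 2) (integrable_const _) (fun k => ?_) ?_
    · filter_upwards [hB k, hB'] with x h1 h2
      rw [Real.norm_eq_abs, abs_pow]
      exact pow_le_pow_left₀ (abs_nonneg _) ((abs_sub _ _).trans (add_le_add h1 h2)) 2
    · filter_upwards [hlim] with x hx
      simpa using (hx.sub_const (q' x)).pow 2
  have h2 := (Real.continuous_sqrt.tendsto _).comp h1
  rw [integral_zero, Real.sqrt_zero] at h2
  exact h2

/-- The part of the slab over the annulus `m ≤ |x| < m + 1`. -/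
def annulus (n : ℕ) (T : ℝ) (m : ℕ) : Set (Euc n × ℝ) := {x | ⌊‖x‖⌋₊ = m} ×ˢ Icc 0 T

theorem measurableSet_annulus (T : ℝ) (m : ℕ) : MeasurableSet (annulus n T m) :=
  ((Nat.measurable_floor.comp measurable_norm) (measurableSet_singleton m)).prod measurableSet_Icc

theorem annulus_subset (T : ℝ) (m : ℕ) :
    annulus n T m ⊆ Metric.closedBall 0 (m + 1) ×ˢ Icc 0 T := by
  rintro ⟨x, t⟩ ⟨hx, ht⟩
  refine ⟨?_, ht⟩
  rw [mem_closedBall_zero_iff]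
  have h1 := Nat.lt_floor_add_one ‖x‖
  rw [show ⌊‖x‖⌋₊ = m from hx] at h1
  exact h1.le

theorem volume_cylinder_lt_top (T R : ℝ) :
    volume (Metric.closedBall (0 : Euc n) R ×ˢ Icc 0 T) < ⊤ :=
  ((isCompact_closedBall _ _).prod isCompact_Icc).measure_lt_top

theorem iUnion_annulus (T : ℝ) (M : ℕ) :
    ⋃ m ∈ Finset.range M, annulus n T m = {x | ‖x‖ < M} ×ˢ Icc 0 T := by
  ext ⟨x, t⟩
  simp only [annulus, Finset.mem_range, mem_iUnion, mem_prod, mem_ofPred_eq, exists_prop]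
  constructor
  · rintro ⟨m, hm, hx, ht⟩
    exact ⟨(Nat.floor_lt (norm_nonneg _)).mp (hx ▸ hm), ht⟩
  · rintro ⟨hx, ht⟩
    exact ⟨_, (Nat.floor_lt (norm_nonneg _)).mpr hx, rfl, ht⟩

/-- Weak compactness of a sequence which is bounded in `L²` over bounded parts of the slab. -/
theorem exists_weak_limit {T : ℝ} {f : ℕ → Euc n → ℝ → ℝ}
    (hb : ∀ m : ℕ, ∃ B, ∀ k, MemLp (Function.uncurry (f k)) 2 (volume.restrict (annulus n T m)) ∧
      ∫ z in annulus n T m, f k z.1 z.2 ^ 2 ≤ B) :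
    ∃ D : Euc n → ℝ → ℝ,
      (∀ M : ℕ, IntegrableOn (Function.uncurry D) ({x | ‖x‖ < M} ×ˢ Icc 0 T)) ∧
      ∀ (q : ℕ → Euc n → ℝ → ℝ) (q' : Euc n → ℝ → ℝ) (K : Set (Euc n)), LocBdd T q →
        IsCompact K → (∀ k, ∀ x ∉ K, ∀ t, q k x t = 0) → (∀ x ∉ K, ∀ t, q' x t = 0) →
        (∀ᵐ z ∂(volume : Measure (Euc n × ℝ)).restrict (slab n T),
          Tendsto (fun k => q k z.1 z.2) atTop (𝓝 (q' z.1 z.2))) →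
        Tendsto (fun k => ∫ z in slab n T, f k z.1 z.2 * q k z.1 z.2)
          (hyperfilter ℕ : Filter ℕ) (𝓝 (∫ z in slab n T, D z.1 z.2 * q' z.1 z.2)) := by
  have hfin : ∀ m, IsFiniteMeasure ((volume : Measure (Euc n × ℝ)).restrict (annulus n T m)) :=
    fun m => ⟨by
      rw [Measure.restrict_apply_univ]
      exact (measure_mono (annulus_subset T m)).trans_lt (volume_cylinder_lt_top T _)⟩
  have hsub : ∀ m, annulus n T m ⊆ slab n T := fun m => prod_mono (subset_univ _) le_rfl
  have hex : ∀ m, ∃ d : Lp ℝ 2 ((volume : Measure (Euc n × ℝ)).restrict (annulus n T m)),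
      ∀ (q : ℕ → Lp ℝ 2 ((volume : Measure (Euc n × ℝ)).restrict (annulus n T m))) q',
        Tendsto q atTop (𝓝 q') →
        Tendsto (fun k => inner ℝ (((hb m).choose_spec k).1.toLp _) (q k))
          (hyperfilter ℕ : Filter ℕ) (𝓝 (inner ℝ d q')) := by
    intro m
    refine exists_weak_limit_hilbert (B := √(hb m).choose) fun k => ?_
    rw [norm_eq_sqrt_real_inner, inner_toLp_eq_integral]
    refine Real.sqrt_le_sqrt ?_
    exact (integral_congr_ae (ae_of_all _ fun z => (sq _).symm)).trans_le ((hb m).choose_spec k).2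
  choose d hd using hex
  -- The annuli are disjoint, so the local weak limits are glued without any compatibility
  -- condition.
  set D : Euc n → ℝ → ℝ := fun x t => d ⌊‖x‖⌋₊ (x, t) with hD
  have hDm : ∀ m, ∀ z ∈ annulus n T m, D z.1 z.2 = d m z := by
    rintro m ⟨x, t⟩ ⟨hx, -⟩
    simp only [hD]
    rw [show ⌊‖x‖⌋₊ = m from hx]
  have hDmem : ∀ m, MemLp (Function.uncurry D) 2 (volume.restrict (annulus n T m)) := by
    intro m
    refine (Lp.memLp (d m)).ae_eq ?_
    filter_upwards [ae_restrict_mem (measurableSet_annulus T m)] with z hz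
    exact (hDm m z hz).symm
  refine ⟨D, fun M => ?_, fun q q' K hq hK h0 h0' hlim => ?_⟩
  · rw [← iUnion_annulus, integrableOn_finset_iUnion]
    exact fun m _ => (hDmem m).integrable one_le_two
  obtain ⟨R, hR⟩ := hK.isBounded.subset_ball 0
  obtain ⟨M, hM⟩ := exists_nat_ge R
  have hKM : ∀ x ∈ K, ‖x‖ < M := fun x hx =>
    (mem_ball_zero_iff.mp (hR hx)).trans_le hM
  have hrest : ∀ F : Euc n × ℝ → ℝ, (∀ x ∉ K, ∀ t, F (x, t) = 0) →
      (∀ m, IntegrableOn F (annulus n T m)) →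
      ∫ z in slab n T, F z = ∑ m ∈ Finset.range M, ∫ z in annulus n T m, F z := by
    intro F hF hI
    rw [← integral_biUnion_finset _ (fun m _ => measurableSet_annulus T m) ?_ fun m _ => hI m]
    · rw [iUnion_annulus]
      refine (setIntegral_eq_of_subset_of_forall_sdiff_eq_zero (measurableSet_slab T)
        (prod_mono (subset_univ _) le_rfl) ?_)
      rintro ⟨x, t⟩ ⟨hx, hx'⟩
      exact hF x (fun hxK => hx' ⟨hKM x hxK, hx.2⟩) t
    · intro m _ m' _ hne
      refine Set.disjoint_left.mpr ?_
      rintro ⟨x, t⟩ ⟨hx, -⟩ ⟨hx', -⟩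
      exact hne (hx.symm.trans hx')
  have hqB : ∀ m, ∃ B, ∀ k, ∀ᵐ z ∂(volume : Measure (Euc n × ℝ)).restrict (annulus n T m),
      |q k z.1 z.2| ≤ B := by
    intro m
    obtain ⟨B, hB⟩ := hq.bdd _ (isCompact_closedBall (0 : Euc n) (m + 1))
    refine ⟨B, fun k => ?_⟩
    have h1 : ∀ᵐ z ∂(volume : Measure (Euc n × ℝ)).restrict (slab n T),
        z.1 ∈ Metric.closedBall (0 : Euc n) (m + 1) → |q k z.1 z.2| ≤ B :=
      ae_slab_of_forall_Ioc fun x t ht hx => hB k x hx t ht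
    filter_upwards [ae_restrict_of_ae_restrict_of_subset (hsub m) h1,
      ae_restrict_mem (measurableSet_annulus T m)] with z hz hz'
    exact hz (annulus_subset T m hz').1
  choose B hB using hqB
  have hqmem : ∀ m k, MemLp (Function.uncurry (q k)) 2 (volume.restrict (annulus n T m)) :=
    fun m k => MemLp.of_bound (hq.measurable k).aestronglyMeasurable (B m) (hB m k)
  have hlim' : ∀ m, ∀ᵐ z ∂(volume : Measure (Euc n × ℝ)).restrict (annulus n T m),
      Tendsto (fun k => q k z.1 z.2) atTop (𝓝 (q' z.1 z.2)) := fun m =>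
    ae_restrict_of_ae_restrict_of_subset (hsub m) hlim
  have hqmem' : ∀ m, MemLp (Function.uncurry q') 2 (volume.restrict (annulus n T m)) := by
    intro m
    refine MemLp.of_bound (aestronglyMeasurable_of_tendsto_ae atTop
      (fun k => (hq.measurable k).aestronglyMeasurable) (hlim' m)) (B m) ?_
    filter_upwards [ae_all_iff.mpr (hB m), hlim' m] with x h1 h2
    exact le_of_tendsto h2.abs (Eventually.of_forall h1)
  have hL : ∀ k, ∫ z in slab n T, f k z.1 z.2 * q k z.1 z.2
      = ∑ m ∈ Finset.range M, ∫ z in annulus n T m, f k z.1 z.2 * q k z.1 z.2 := fun k =>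
    hrest _ (fun x hx t => by simp [h0 k x hx])
      fun m => (((hb m).choose_spec k).1).integrable_mul (hqmem m k)
  have hL' : ∫ z in slab n T, D z.1 z.2 * q' z.1 z.2
      = ∑ m ∈ Finset.range M, ∫ z in annulus n T m, D z.1 z.2 * q' z.1 z.2 :=
    hrest _ (fun x hx t => by simp [h0' x hx]) fun m => (hDmem m).integrable_mul (hqmem' m)
  simp only [hL, hL']
  refine tendsto_finsetSum _ fun m _ => ?_
  have h1 := hd m _ _ (tendsto_toLp_of_ae (hqmem m) (hqmem' m) (hB m) (hlim' m))
  simp only [inner_toLp_eq_integral] at h1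
  have h2 : inner ℝ (d m) ((hqmem' m).toLp _) = ∫ z in annulus n T m, D z.1 z.2 * q' z.1 z.2 := by
    refine Eq.trans ?_ (inner_toLp_eq_integral (hDmem m) (hqmem' m))
    congr 1
    refine Lp.ext ?_
    filter_upwards [(hDmem m).coeFn_toLp, ae_restrict_mem (measurableSet_annulus T m)] with z h3 h4
    rw [h3]
    exact (hDm m z h4).symm
  rw [h2] at h1
  exact h1

/-! ### Second logarithmic derivatives. -/

/-- Integration by parts in space over the slab. -/
theorem integral_slab_mul_dX {T : ℝ} (hT : 0 < T) {F f : Euc n → ℝ → ℝ} {ξ : Euc n → ℝ → ℝ}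
    (hξ : IsTest T ξ) (j : Fin n) (hF : LocBdd T fun _ : Unit => F)
    (hf : LocBdd T fun _ : Unit => f) (hFs : ∀ t ∈ Icc 0 T, ContDiff ℝ 1 fun x => F x t)
    (hFf : ∀ t ∈ Icc 0 T, ∀ x, partialX j (fun x => F x t) x = f x t) :
    ∫ z in slab n T, F z.1 z.2 * dX j ξ z.1 z.2 = -∫ z in slab n T, f z.1 z.2 * ξ z.1 z.2 := by
  rw [integral_slab_space_first hT.le (hF.integrable_mul_test (hξ.dX j) ()),
    integral_slab_space_first hT.le (hf.integrable_mul_test hξ ()),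
    ← intervalIntegral.integral_neg]
  refine intervalIntegral.integral_congr fun t ht => ?_
  rw [uIcc_of_le hT.le] at ht
  have := integral_mul_partialX_of_contDiff (hFs t ht) ((hξ.smooth_space t).of_le (by simp))
    (hξ.compact_space t) j
  simp only [hFf t ht] at this
  exact this

theorem hyperfilter_le_atTop : (hyperfilter ℕ : Filter ℕ) ≤ atTop :=
  Nat.cofinite_eq_atTop ▸ hyperfilter_le_cofinite

namespace IsRegularSol

variable {T a C : ℝ} {w : Euc n → ℝ} {g V : Euc n → ℝ → ℝ} {P : Euc n → ℝ → Euc n}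

/-- The logarithmic derivative of the mollified solution. -/
def logGrad (V : Euc n → ℝ → ℝ) (k : ℕ) (i : Fin n) (x : Euc n) (t : ℝ) : ℝ :=
  (moll (mol n k) V x t)⁻¹ * moll (partialX i (mol n k)) V x t

/-- The second logarithmic derivative of the mollified solution. -/
def logHess (V : Euc n → ℝ → ℝ) (k : ℕ) (i j : Fin n) (x : Euc n) (t : ℝ) : ℝ :=
  (moll (mol n k) V x t)⁻¹ * moll (partialX j (partialX i (mol n k))) V x t
    - logGrad V k i x t * logGrad V k j x t

theorem logHess_comm (V : Euc n → ℝ → ℝ) (k : ℕ) (i j : Fin n) (x : Euc n) (t : ℝ) :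
    logHess V k i j x t = logHess V k j i x t := by
  have : partialX j (partialX i (mol n k)) = partialX i (partialX j (mol n k)) :=
    funext fun y => partialX_comm (contDiff_mol k) j i y
  rw [logHess, logHess, this, mul_comm (logGrad V k i x t)]

theorem locBdd_inv_mol_sol (h : IsRegularSol T a C w g V P) :
    LocBdd T (fun k x t => (moll (mol n k) V x t)⁻¹) :=
  h.locBdd_comp_mol_sol measurable_inv (continuousOn_inv₀.mono fun _ hr => ne_of_gt hr)

theorem locBdd_logGrad (h : IsRegularSol T a C w g V P) (i : Fin n) :
    LocBdd T (fun k => logGrad V k i) :=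
  h.locBdd_inv_mol_sol.mul (h.locBdd_mol_grad i)

theorem locBdd_logHess (h : IsRegularSol T a C w g V P) (k : ℕ) (i j : Fin n) :
    LocBdd T (fun (_ : Unit) => logHess V k i j) :=
  ((h.locBdd_inv_mol_sol.reindex fun _ => k).mul (h.locBdd_moll_sol
    (contDiff_partialX (contDiff_partialX (contDiff_mol k) i) j).continuous
    (hasCompactSupport_partialX (hasCompactSupport_partialX (hasCompactSupport_mol k) i) j))).sub
    (((h.locBdd_logGrad i).reindex fun _ => k).mul ((h.locBdd_logGrad j).reindex fun _ => k))

theorem contDiff_logGrad (h : IsRegularSol T a C w g V P) (k : ℕ) (i : Fin n) {t : ℝ}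
    (ht : t ∈ Icc 0 T) : ContDiff ℝ ∞ fun x => logGrad V k i x t :=
  ((contDiff_moll (contDiff_mol k) (hasCompactSupport_mol k) (h.locallyIntegrable_sol ht)).inv
    fun x => (h.mol_sol_pos k x ht).ne').mul
  (contDiff_moll (contDiff_partialX (contDiff_mol k) i)
    (hasCompactSupport_partialX (hasCompactSupport_mol k) i) (h.locallyIntegrable_sol ht))

theorem partialX_logGrad (h : IsRegularSol T a C w g V P) (k : ℕ) (i j : Fin n) {t : ℝ}
    (ht : t ∈ Icc 0 T) (x : Euc n) :
    partialX j (fun x => logGrad V k i x t) x = logHess V k i j x t := by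
  have hV := h.locallyIntegrable_sol ht
  have h1 := (contDiff_moll (contDiff_mol k) (hasCompactSupport_mol k) hV).differentiable
    (by simp) x
  have hs := contDiff_partialX (contDiff_mol (n := n) k) i
  have hc := hasCompactSupport_partialX (hasCompactSupport_mol (n := n) k) i
  have h2 := (contDiff_moll hs hc hV).differentiable (by simp) x
  have hpos := (h.mol_sol_pos k x ht).ne'
  simp only [logGrad]
  rw [partialX_mul (f := fun x => (moll (mol n k) V x t)⁻¹) (h1.inv hpos) h2,
    partialX_comp_real (Φ := fun r => r⁻¹) (Φ' := fun r => -(r ^ 2)⁻¹) h1 (hasDerivAt_inv hpos),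
    partialX_moll hs hc hV, partialX_moll (contDiff_mol k) (hasCompactSupport_mol k) hV,
    logHess, logGrad, logGrad, ← inv_pow]
  ring

theorem ae_tendsto_logGrad (h : IsRegularSol T a C w g V P) (i : Fin n) :
    ∀ᵐ z ∂(volume : Measure (Euc n × ℝ)).restrict (slab n T),
      Tendsto (fun k => logGrad V k i z.1 z.2) atTop
        (𝓝 ((V z.1 z.2)⁻¹ * P z.1 z.2 i)) := by
  filter_upwards [h.ae_tendsto_mol_sol, h.ae_tendsto_mol_grad i,
    ae_slab_of_forall (p := fun z => 0 < V z.1 z.2) fun x t ht => h.sol_pos ht] with z h1 h2 h3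
  exact (h1.inv₀ h3.ne').mul h2

/-- The logarithmic Hessian is `V_k⁻¹ ∂ᵢ∂ⱼV_k` minus a product of logarithmic derivatives. On a
bounded set `V_k⁻¹` and that product are bounded uniformly in `k`, and the energy estimate controls
`∂ᵢ∂ⱼV_k` in `L²`. -/
theorem exists_logHess_bound (h : IsRegularSol T a C w g V P) (i j : Fin n) (m : ℕ) :
    ∃ B, ∀ k, MemLp (Function.uncurry (logHess V k i j)) 2 (volume.restrict (annulus n T m)) ∧
      ∫ z in annulus n T m, logHess V k i j z.1 z.2 ^ 2 ≤ B := by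
  have hfin : IsFiniteMeasure ((volume : Measure (Euc n × ℝ)).restrict (annulus n T m)) :=
    ⟨by
      rw [Measure.restrict_apply_univ]
      exact (measure_mono (annulus_subset T m)).trans_lt (volume_cylinder_lt_top T _)⟩
  have hsub : annulus n T m ⊆ slab n T := prod_mono (subset_univ _) le_rfl
  have hKc := isCompact_closedBall (0 : Euc n) (m + 1)
  set χ : ContDiffBump (0 : Euc n) := ⟨m + 1, m + 2, by positivity, by linarith⟩ with hχ
  have hχ1 : ∀ x ∈ Metric.closedBall (0 : Euc n) (m + 1), χ x = 1 := fun x hx =>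
    χ.one_of_mem_closedBall hx
  obtain ⟨E, hE⟩ := h.exists_hessian_bound (χ.contDiff (n := ⊤)) χ.hasCompactSupport i
  obtain ⟨D₁, hD₁⟩ := (h.locBdd_inv_mol_sol).bdd _ hKc
  obtain ⟨D₂, hD₂⟩ := ((h.locBdd_logGrad i).mul (h.locBdd_logGrad j)).bdd _ hKc
  have hae : ∀ {p : Euc n × ℝ → Prop}, (∀ x ∈ Metric.closedBall (0 : Euc n) (m + 1),
      ∀ t ∈ Ioc 0 T, p (x, t)) →
      ∀ᵐ z ∂(volume : Measure (Euc n × ℝ)).restrict (annulus n T m), p z := by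
    intro p hp
    have h1 : ∀ᵐ z ∂(volume : Measure (Euc n × ℝ)).restrict (slab n T),
        z.1 ∈ Metric.closedBall (0 : Euc n) (m + 1) → p z :=
      ae_slab_of_forall_Ioc fun x t ht hx => hp x hx t ht
    filter_upwards [ae_restrict_of_ae_restrict_of_subset hsub h1,
      ae_restrict_mem (measurableSet_annulus T m)] with z hz hz'
    exact hz (annulus_subset T m hz').1
  refine ⟨2 * D₁ ^ 2 * E + ∫ z in annulus n T m, 2 * D₂ ^ 2, fun k => ?_⟩
  have hmem : MemLp (Function.uncurry (logHess V k i j)) 2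
      (volume.restrict (annulus n T m)) := by
    obtain ⟨D₃, hD₃⟩ := (h.locBdd_logHess k i j).bdd _ hKc
    exact MemLp.of_bound ((h.locBdd_logHess k i j).measurable ()).aestronglyMeasurable D₃
      (hae fun x hx t ht => hD₃ () x hx t ht)
  refine ⟨hmem, ?_⟩
  have hs := contDiff_partialX (contDiff_partialX (contDiff_mol (n := n) k) i) j
  have hc := hasCompactSupport_partialX
    (hasCompactSupport_partialX (hasCompactSupport_mol (n := n) k) i) j
  have BWχ := (h.locBdd_moll_sol (ι := Unit) hs.continuous hc).mul
    (LocBdd.of_continuous (T := T) (ξ := fun x _ => χ x)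
      ((χ.contDiff (n := ⊤)).continuous.comp continuous_fst))
  have IW : Integrable (fun z : Euc n × ℝ =>
      (moll (partialX j (partialX i (mol n k))) V z.1 z.2 * χ z.1) ^ 2)
      (volume.restrict (slab n T)) := by
    have := (BWχ.mul BWχ).integrable χ.hasCompactSupport (fun _ x hx t => by
      simp [image_eq_zero_of_notMem_tsupport hx]) ()
    simpa only [← sq] using this
  have IW' : Integrable (fun z : Euc n × ℝ => 2 * D₁ ^ 2 *
      (moll (partialX j (partialX i (mol n k))) V z.1 z.2 * χ z.1) ^ 2)
      (volume.restrict (annulus n T m)) :=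
    (IW.mono_measure (Measure.restrict_mono hsub le_rfl)).const_mul _
  calc ∫ z in annulus n T m, logHess V k i j z.1 z.2 ^ 2
      ≤ ∫ z in annulus n T m, (2 * D₁ ^ 2 *
          (moll (partialX j (partialX i (mol n k))) V z.1 z.2 * χ z.1) ^ 2 + 2 * D₂ ^ 2) := by
        refine integral_mono_ae hmem.integrable_sq (IW'.add (integrable_const _)) ?_
        refine hae fun x hx t ht => ?_
        have h1 := hD₁ k x hx t ht
        have h2 := hD₂ k x hx t ht
        simp only [hχ1 x hx, mul_one, logHess]
        have h3 : (moll (mol n k) V x t)⁻¹ ^ 2 ≤ D₁ ^ 2 :=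
          sq_le_sq' (abs_le.mp h1).1 (abs_le.mp h1).2
        have h4 : (logGrad V k i x t * logGrad V k j x t) ^ 2 ≤ D₂ ^ 2 :=
          sq_le_sq' (abs_le.mp h2).1 (abs_le.mp h2).2
        have h5 := mul_le_mul_of_nonneg_right h3
          (sq_nonneg (moll (partialX j (partialX i (mol n k))) V x t))
        nlinarith [sq_nonneg ((moll (mol n k) V x t)⁻¹
          * moll (partialX j (partialX i (mol n k))) V x t
          + logGrad V k i x t * logGrad V k j x t)]
    _ = 2 * D₁ ^ 2 * (∫ z in annulus n T m,
          (moll (partialX j (partialX i (mol n k))) V z.1 z.2 * χ z.1) ^ 2)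
          + ∫ z in annulus n T m, 2 * D₂ ^ 2 := by
        rw [integral_add IW' (integrable_const _), integral_const_mul]
    _ ≤ _ := by
        refine add_le_add (mul_le_mul_of_nonneg_left ?_ (by positivity)) le_rfl
        exact (setIntegral_mono_set IW (ae_of_all _ fun z => sq_nonneg _)
          (Eventually.of_forall hsub)).trans (hE k j)

/-- The weak second logarithmic derivatives of a regular solution. -/
theorem exists_weak_logHess (h : IsRegularSol T a C w g V P) :
    ∃ D : Fin n → Fin n → Euc n → ℝ → ℝ,
      (∀ i j, ∀ M : ℕ, IntegrableOn (Function.uncurry (D i j)) ({x | ‖x‖ < M} ×ˢ Icc 0 T)) ∧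
      (∀ i j, ∀ ξ : Euc n → ℝ → ℝ, IsTest T ξ →
        ∫ z in slab n T, ((V z.1 z.2)⁻¹ * P z.1 z.2 i) * dX j ξ z.1 z.2
          = -∫ z in slab n T, D i j z.1 z.2 * ξ z.1 z.2) ∧
      (∀ i, ∀ ξ : Euc n → ℝ → ℝ, IsTest T ξ →
        ∑ j, ∫ z in slab n T, ((V z.1 z.2)⁻¹ * P z.1 z.2 j) ^ 2 * dX i ξ z.1 z.2
          = -2 * ∑ j, ∫ z in slab n T,
            D i j z.1 z.2 * ((V z.1 z.2)⁻¹ * P z.1 z.2 j * ξ z.1 z.2)) := by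
  choose D hD hDlim using fun i j => exists_weak_limit (T := T) (f := fun k => logHess V k i j)
    (h.exists_logHess_bound i j)
  refine ⟨D, hD, fun i j ξ hξ => ?_, fun i ξ hξ => ?_⟩
  · have h1 := (h.locBdd_logGrad i).tendsto_integral_mul_test (hξ.dX j)
      (F := fun x t => (V x t)⁻¹ * P x t i) (h.ae_tendsto_logGrad i)
    have h2 := hDlim i j (fun _ => ξ) ξ (spaceSupport ξ) (LocBdd.of_test hξ)
      hξ.isCompact_spaceSupport (fun _ x hx t => eq_zero_of_notMem_spaceSupport hx t)
      (fun x hx t => eq_zero_of_notMem_spaceSupport hx t) (ae_of_all _ fun z => tendsto_const_nhds)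
    refine tendsto_nhds_unique (h1.mono_left hyperfilter_le_atTop) (h2.neg.congr fun k => ?_)
    exact (integral_slab_mul_dX h.T_pos hξ j ((h.locBdd_logGrad i).reindex fun _ => k)
      (h.locBdd_logHess k i j) (fun t ht => (h.contDiff_logGrad k i ht).of_le (by simp))
      fun t ht x => h.partialX_logGrad k i j ht x).symm
  · have h1 : ∀ j, Tendsto (fun k => ∫ z in slab n T,
        logGrad V k j z.1 z.2 ^ 2 * dX i ξ z.1 z.2) (hyperfilter ℕ : Filter ℕ)
        (𝓝 (∫ z in slab n T, ((V z.1 z.2)⁻¹ * P z.1 z.2 j) ^ 2 * dX i ξ z.1 z.2)) := by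
      intro j
      refine Tendsto.mono_left ?_ hyperfilter_le_atTop
      refine LocBdd.tendsto_integral_mul_test (f := fun k x t => logGrad V k j x t ^ 2)
        (F := fun x t => ((V x t)⁻¹ * P x t j) ^ 2) ?_ (hξ.dX i) ?_
      · simpa only [sq] using (h.locBdd_logGrad j).mul (h.locBdd_logGrad j)
      · filter_upwards [h.ae_tendsto_logGrad j] with z hz using hz.pow 2
    have h2 : ∀ j, Tendsto (fun k => ∫ z in slab n T, logHess V k i j z.1 z.2 *
        (logGrad V k j z.1 z.2 * ξ z.1 z.2)) (hyperfilter ℕ : Filter ℕ)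
        (𝓝 (∫ z in slab n T, D i j z.1 z.2 * ((V z.1 z.2)⁻¹ * P z.1 z.2 j * ξ z.1 z.2))) := by
      intro j
      refine hDlim i j (fun k x t => logGrad V k j x t * ξ x t)
        (fun x t => (V x t)⁻¹ * P x t j * ξ x t) (spaceSupport ξ)
        ((h.locBdd_logGrad j).mul (LocBdd.of_test hξ))
        hξ.isCompact_spaceSupport (fun _ x hx t => ?_) (fun x hx t => ?_) ?_
      · rw [eq_zero_of_notMem_spaceSupport hx t, mul_zero]
      · rw [eq_zero_of_notMem_spaceSupport hx t, mul_zero]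
      · filter_upwards [h.ae_tendsto_logGrad j] with z hz using hz.mul_const _
    refine tendsto_nhds_unique (tendsto_finsetSum _ fun j _ => h1 j)
      (((tendsto_finsetSum _ fun j _ => h2 j).const_mul (-2)).congr fun k => ?_)
    rw [Finset.mul_sum]
    refine Finset.sum_congr rfl fun j _ => ?_
    have Bj : LocBdd T (fun (_ : Unit) => logGrad V k j) := (h.locBdd_logGrad j).reindex fun _ => k
    have BH := h.locBdd_logHess k j i
    -- The chain rule `∂ᵢ(Qⱼ²) = 2 Qⱼ ∂ᵢQⱼ` for the smooth `Qⱼ = ∂ⱼ log V_k`. Symmetry of the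
    -- Hessian turns `∂ᵢQⱼ` into `∂ⱼQᵢ`, the shape of the convection term.
    have h3 := integral_slab_mul_dX h.T_pos hξ i (F := fun x t => logGrad V k j x t ^ 2)
      (f := fun x t => 2 * (logHess V k j i x t * logGrad V k j x t))
      (by simpa only [sq] using Bj.mul Bj) ((BH.mul Bj).const_mul 2)
      (fun t ht => ((h.contDiff_logGrad k j ht).of_le (by simp)).pow 2)
      (fun t ht x => by
        rw [partialX_comp_real (Φ := fun r => r ^ 2) (Φ' := fun r => 2 * r)
          ((h.contDiff_logGrad k j ht).differentiable (by simp) x)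
          (by simpa using hasDerivAt_pow 2 (logGrad V k j x t)), h.partialX_logGrad k j i ht]
        ring)
    rw [h3, ← integral_const_mul, ← integral_neg]
    refine integral_congr_ae (ae_of_all _ fun z => ?_)
    simp only [logHess_comm V k j i]
    ring

end IsRegularSol

/-! ### The weak equation for the Cole–Hopf field. -/

theorem locallyIntegrableOn_slab {W : Type*} [NormedAddCommGroup W] {T : ℝ} {f : Euc n × ℝ → W}
    (hf : ∀ M : ℕ, IntegrableOn f ({x | ‖x‖ < M} ×ˢ Icc 0 T)) :
    LocallyIntegrableOn f (slab n T) := by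
  rintro ⟨x, t⟩ -
  obtain ⟨M, hM⟩ := exists_nat_gt ‖x‖
  refine ⟨{x | ‖x‖ < M} ×ˢ Icc 0 T, ?_, hf M⟩
  have h1 : {x : Euc n | ‖x‖ < M} ×ˢ (univ : Set ℝ) ∈ 𝓝 (x, t) :=
    prod_mem_nhds ((isOpen_lt continuous_norm continuous_const).mem_nhds hM) univ_mem
  have h2 := inter_mem_nhdsWithin (slab n T) h1
  refine mem_of_superset h2 ?_
  rintro ⟨y, s⟩ ⟨hy, hy'⟩
  exact ⟨hy'.1, hy.2⟩

theorem cylinder_subset_slab (T : ℝ) (M : ℕ) :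
    ({x : Euc n | ‖x‖ < M} ×ˢ Icc 0 T) ⊆ slab n T := prod_mono (subset_univ _) le_rfl

theorem measurableSet_cylinder (T : ℝ) (M : ℕ) :
    MeasurableSet ({x : Euc n | ‖x‖ < M} ×ˢ Icc 0 T) :=
  (isOpen_lt continuous_norm continuous_const).measurableSet.prod measurableSet_Icc

theorem isFiniteMeasure_cylinder (T : ℝ) (M : ℕ) :
    IsFiniteMeasure ((volume : Measure (Euc n × ℝ)).restrict ({x | ‖x‖ < M} ×ˢ Icc 0 T)) :=
  ⟨by
    rw [Measure.restrict_apply_univ]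
    refine (measure_mono (Set.prod_mono (fun x hx => ?_) le_rfl)).trans_lt
      (volume_cylinder_lt_top T (M : ℝ))
    exact mem_closedBall_zero_iff.mpr (le_of_lt hx)⟩

theorem LocBdd.ae_bound {ι : Type*} {T : ℝ} {q : ι → Euc n → ℝ → ℝ} (hq : LocBdd T q) (M : ℕ) :
    ∃ B, ∀ k, ∀ᵐ z ∂(volume : Measure (Euc n × ℝ)).restrict ({x | ‖x‖ < M} ×ˢ Icc 0 T),
      ‖q k z.1 z.2‖ ≤ B := by
  obtain ⟨B, hB⟩ := hq.bdd _ (isCompact_closedBall (0 : Euc n) M)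
  refine ⟨B, fun k => ?_⟩
  have h1 : ∀ᵐ z ∂(volume : Measure (Euc n × ℝ)).restrict (slab n T),
      z.1 ∈ Metric.closedBall (0 : Euc n) M → |q k z.1 z.2| ≤ B :=
    ae_slab_of_forall_Ioc fun x t ht hx => hB k x hx t ht
  filter_upwards [ae_restrict_of_ae_restrict_of_subset (cylinder_subset_slab T M) h1,
    ae_restrict_mem (measurableSet_cylinder T M)] with z hz hz'
  exact hz (mem_closedBall_zero_iff.mpr (le_of_lt hz'.1))

theorem LocBdd.integrableOn_mul {T : ℝ} {D q : Euc n → ℝ → ℝ} (hq : LocBdd T fun _ : Unit => q)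
    {M : ℕ} (hD : IntegrableOn (Function.uncurry D) ({x | ‖x‖ < M} ×ˢ Icc 0 T)) :
    IntegrableOn (fun z : Euc n × ℝ => D z.1 z.2 * q z.1 z.2) ({x | ‖x‖ < M} ×ˢ Icc 0 T) := by
  obtain ⟨B, hB⟩ := hq.ae_bound M
  exact Integrable.mul_bdd hD (hq.measurable ()).aestronglyMeasurable (hB ())

theorem LocBdd.integrableOn {T : ℝ} {q : Euc n → ℝ → ℝ} (hq : LocBdd T fun _ : Unit => q)
    (M : ℕ) : IntegrableOn (fun z : Euc n × ℝ => q z.1 z.2) ({x | ‖x‖ < M} ×ˢ Icc 0 T) := by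
  have := isFiniteMeasure_cylinder (n := n) T M
  obtain ⟨B, hB⟩ := hq.ae_bound M
  exact Integrable.of_bound (hq.measurable ()).aestronglyMeasurable B (hB ())

theorem LocBdd.integrable_mul {T : ℝ} {D q : Euc n → ℝ → ℝ} (hq : LocBdd T fun _ : Unit => q)
    (hD : ∀ M : ℕ, IntegrableOn (Function.uncurry D) ({x | ‖x‖ < M} ×ˢ Icc 0 T))
    {K : Set (Euc n)} (hK : IsCompact K) (h0 : ∀ x ∉ K, ∀ t, q x t = 0) :
    Integrable (fun z : Euc n × ℝ => D z.1 z.2 * q z.1 z.2) (volume.restrict (slab n T)) := by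
  obtain ⟨R, hR⟩ := hK.isBounded.subset_ball 0
  obtain ⟨M, hM⟩ := exists_nat_ge R
  refine IntegrableOn.of_forall_sdiff_eq_zero (hq.integrableOn_mul (hD M)) (measurableSet_slab T) ?_
  rintro ⟨x, t⟩ ⟨hx, hx'⟩
  rw [h0 x (fun hxK => hx' ⟨(mem_ball_zero_iff.mp (hR hxK)).trans_le hM, hx.2⟩), mul_zero]

theorem IsTest.coord {T : ℝ} {ψ : Euc n → ℝ → Euc n} (hψ : IsTest T ψ) (i : Fin n) :
    IsTest T (fun x t => ψ x t i) := by
  have hsub : Function.support (Function.uncurry fun x t => ψ x t i)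
      ⊆ Function.support (Function.uncurry ψ) := fun z hz hz' => hz (by
    have : ψ z.1 z.2 = 0 := hz'
    simp [Function.uncurry, this])
  exact ⟨(EuclideanSpace.proj i : Euc n →L[ℝ] ℝ).contDiff.comp hψ.smooth,
    hψ.compact.mono hsub, (closure_mono hsub).trans hψ.support⟩

theorem dX_coord {T : ℝ} {ψ : Euc n → ℝ → Euc n} (hψ : IsTest T ψ) (i j : Fin n) (x : Euc n)
    (t : ℝ) : dX j ψ x t i = dX j (fun x t => ψ x t i) x t :=
  partialX_coord ((hψ.smooth_space t).differentiable (by simp) x) j i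

theorem dT_coord {T : ℝ} {ψ : Euc n → ℝ → Euc n} (hψ : IsTest T ψ) (i : Fin n) (x : Euc n)
    (t : ℝ) : dT ψ x t i = dT (fun x t => ψ x t i) x t := by
  have h1 := (hasDerivAt_slice_time hψ.smooth x t).differentiableAt.hasDerivAt
  have h2 := (EuclideanSpace.proj i : Euc n →L[ℝ] ℝ).hasFDerivAt.comp_hasDerivAt t h1
  exact h2.deriv.symm

namespace IsRegularSol

variable {T a C : ℝ} {w : Euc n → ℝ} {g V : Euc n → ℝ → ℝ} {P : Euc n → ℝ → Euc n}

/-- The field `-2 ∇V / V` of a regular solution solves the quasilinear equation weakly. -/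
theorem isWeakSolution (h : IsRegularSol T a C w g V P) {u : Euc n → ℝ → Euc n}
    (hu : ∀ x, ∀ t ∈ Ioc 0 T, u x t = (-2 / V x t) • P x t) {u₀ : Euc n → Euc n}
    (hu₀ : LocallyIntegrable u₀)
    (hφ : ∀ η : Euc n → ℝ, ContDiff ℝ ∞ η → HasCompactSupport η → ∀ j,
      2 * ∫ x, Real.log (w x) * partialX j η x = ∫ x, u₀ x j * η x)
    {f : Euc n → ℝ → ℝ}
    (hf : ∀ᵐ z ∂(volume : Measure (Euc n × ℝ)).restrict (slab n T),
      f z.1 z.2 = -2 * ((V z.1 z.2)⁻¹ * g z.1 z.2)) :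
    IsWeakSolution T f u₀ u := by
  obtain ⟨D, hDi, hDw, hDc⟩ := h.exists_weak_logHess
  set Q : Fin n → Euc n → ℝ → ℝ := fun i x t => (V x t)⁻¹ * P x t i with hQ
  have hQu : ∀ᵐ z ∂(volume : Measure (Euc n × ℝ)).restrict (slab n T),
      ∀ i, u z.1 z.2 i = -2 * Q i z.1 z.2 := by
    refine ae_slab_of_forall_Ioc fun x t ht i => ?_
    simp only [hu x t ht, hQ, PiLp.smul_apply, smul_eq_mul]
    ring
  have hBQ : ∀ i, LocBdd T (fun _ : Unit => Q i) := fun i =>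
    h.locBdd_inv_sol.mul (h.locBdd_grad i)
  have haeM : ∀ {p : Euc n × ℝ → Prop} (M : ℕ),
      (∀ᵐ z ∂(volume : Measure (Euc n × ℝ)).restrict (slab n T), p z) →
      ∀ᵐ z ∂(volume : Measure (Euc n × ℝ)).restrict ({x | ‖x‖ < M} ×ˢ Icc 0 T), p z :=
    fun M hp => ae_restrict_of_ae_restrict_of_subset (cylinder_subset_slab T M) hp
  refine ⟨locallyIntegrableOn_slab fun M => Integrable.of_eval_piLp fun i => ?_, ?_⟩
  · refine (((hBQ i).integrableOn M).const_mul (-2)).congr ?_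
    filter_upwards [haeM M hQu] with z hz using (hz i).symm
  -- Since `uᵢ = -2 Qᵢ`, the derivative `∂ⱼuᵢ` has to be `-2` times the weak derivative `∂ⱼQᵢ`.
  set D' : Fin n → Euc n → ℝ → Euc n := fun j x t => WithLp.toLp 2 fun i => -2 * D i j x t with hD'
  have hconv : ∀ᵐ z ∂(volume : Measure (Euc n × ℝ)).restrict (slab n T),
      ∀ i, convection u D' z.1 z.2 i = ∑ j, 4 * (D i j z.1 z.2 * Q j z.1 z.2) := by
    filter_upwards [hQu] with z hz i
    simp only [convection, hD', WithLp.ofLp_sum, Finset.sum_apply, PiLp.smul_apply, smul_eq_mul, hz]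
    exact Finset.sum_congr rfl fun j _ => by ring
  refine ⟨D', ⟨fun j => locallyIntegrableOn_slab fun M => Integrable.of_eval_piLp fun i =>
    (hDi i j M).const_mul (-2), fun η hη hηc hηs j => ?_⟩,
    locallyIntegrableOn_slab fun M => Integrable.of_eval_piLp fun i => ?_, fun ψ hψ => ?_⟩
  · have hηt : IsTest T η := ⟨hη, hηc, hηs.trans (Set.prod_mono le_rfl fun _ hx => hx.2)⟩
    have J1 : ∀ i, Integrable (fun z : Euc n × ℝ =>
        (partialX j (fun y => η y z.2) z.1 • u z.1 z.2) i) (volume.restrict (slab n T)) := by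
      intro i
      refine (((hBQ i).integrable_mul_test (hηt.dX j) ()).const_mul (-2)).congr ?_
      filter_upwards [hQu] with z hz
      simp only [PiLp.smul_apply, smul_eq_mul, hz i, dX]
      ring
    have J2 : ∀ i, Integrable (fun z : Euc n × ℝ => (η z.1 z.2 • D' j z.1 z.2) i)
        (volume.restrict (slab n T)) := by
      intro i
      refine ((LocBdd.integrable_mul (LocBdd.of_test hηt) (hDi i j)
        hηt.isCompact_spaceSupport fun x hx t =>
          eq_zero_of_notMem_spaceSupport hx t).const_mul (-2)).congr (ae_of_all _ fun z => ?_)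
      simp only [hD', PiLp.smul_apply, smul_eq_mul]
      ring
    ext i
    rw [PiLp.neg_apply, eval_integral_piLp J1, eval_integral_piLp J2]
    calc _ = ∫ z in slab n T, -2 * (Q i z.1 z.2 * dX j η z.1 z.2) := by
          refine integral_congr_ae ?_
          filter_upwards [hQu] with z hz
          simp only [PiLp.smul_apply, smul_eq_mul, hz i, dX]
          ring
      _ = -(∫ z in slab n T, -2 * (D i j z.1 z.2 * η z.1 z.2)) := by
          rw [integral_const_mul, integral_const_mul, hDw i j η hηt]
          ring
      _ = _ := by
          congr 1
          refine integral_congr_ae (ae_of_all _ fun z => ?_)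
          simp only [hD', PiLp.smul_apply, smul_eq_mul]
          ring
  · refine Integrable.congr (integrable_finsetSum Finset.univ fun j _ =>
      ((hBQ j).integrableOn_mul (hDi i j M)).const_mul 4) ?_
    filter_upwards [haeM M hconv] with z hz using (hz i).symm
  have hθ : ∀ i, IsTest T (fun x t => ψ x t i) := fun i => hψ.coord i
  have A2 : ∀ i l, Integrable (fun z : Euc n × ℝ => Q l z.1 z.2 ^ 2
      * dX i (fun x t => ψ x t i) z.1 z.2) (volume.restrict (slab n T)) := fun i l => by
    simpa only [← sq] using ((hBQ l).mul (hBQ l)).integrable_mul_test ((hθ i).dX i) ()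
  have A3 : ∀ i l, Integrable (fun z : Euc n × ℝ => D i l z.1 z.2 * (Q l z.1 z.2 * ψ z.1 z.2 i))
      (volume.restrict (slab n T)) := fun i l =>
    LocBdd.integrable_mul ((hBQ l).mul (LocBdd.of_test (hθ i))) (hDi i l)
      (hθ i).isCompact_spaceSupport fun x hx t => by
        rw [eq_zero_of_notMem_spaceSupport hx t, mul_zero]
  have A0 : ∀ i, Integrable (fun z : Euc n × ℝ =>
        -(Q i z.1 z.2 * dT (fun x t => ψ x t i) z.1 z.2)
        + (∑ l, Q l z.1 z.2 ^ 2 * dX i (fun x t => ψ x t i) z.1 z.2)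
        - (∑ l, Q i z.1 z.2 * dX l (dX l (fun x t => ψ x t i)) z.1 z.2)
        + (V z.1 z.2)⁻¹ * g z.1 z.2 * dX i (fun x t => ψ x t i) z.1 z.2)
      (volume.restrict (slab n T)) := fun i =>
    ((((hBQ i).integrable_mul_test (hθ i).dT ()).neg.add
      (integrable_finsetSum _ fun l _ => A2 i l)).sub (integrable_finsetSum _ fun l _ =>
        (hBQ i).integrable_mul_test (((hθ i).dX l).dX l) ())).add
      ((h.locBdd_inv_sol.mul h.locBdd_source).integrable_mul_test ((hθ i).dX i) ())
  have S2 : ∀ i, Integrable _ _ := fun i => integrable_finsetSum Finset.univ fun l _ => A2 i l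
  have S3 : ∀ i, Integrable _ _ := fun i => integrable_finsetSum Finset.univ fun l _ => A3 i l
  -- The last two terms add up to zero by the weak chain rule `hDc`. The first of them cancels the
  -- squared gradient in the equation for `log V`, and the second is the convection term.
  have hcomp : ∀ i, ∫ z in slab n T, (-2 * (-(Q i z.1 z.2 * dT (fun x t => ψ x t i) z.1 z.2)
        + (∑ l, Q l z.1 z.2 ^ 2 * dX i (fun x t => ψ x t i) z.1 z.2)
        - (∑ l, Q i z.1 z.2 * dX l (dX l (fun x t => ψ x t i)) z.1 z.2)
        + (V z.1 z.2)⁻¹ * g z.1 z.2 * dX i (fun x t => ψ x t i) z.1 z.2)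
        + 2 * (∑ l, Q l z.1 z.2 ^ 2 * dX i (fun x t => ψ x t i) z.1 z.2)
        + 4 * ∑ l, D i l z.1 z.2 * (Q l z.1 z.2 * ψ z.1 z.2 i))
      = ∫ x, u₀ x i * ψ x 0 i := by
    intro i
    have h1 := h.integral_weak_log (hθ i) i
    have h2 := hDc i _ (hθ i)
    have h3 := hφ _ ((hθ i).smooth_space 0) ((hθ i).compact_space 0) i
    refine ((integral_add (((A0 i).const_mul (-2)).add ((S2 i).const_mul 2))
      ((S3 i).const_mul 4)).trans (congrArg (· + _) (integral_add ((A0 i).const_mul (-2))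
        ((S2 i).const_mul 2)))).trans ?_
    rw [integral_const_mul, integral_const_mul, integral_const_mul,
      integral_finsetSum _ fun l _ => A2 i l, integral_finsetSum _ fun l _ => A3 i l, h2, h1, ← h3]
    simp only [dX]
    ring
  have hlapψ : ∀ x t i, Laplacian.laplacian (fun y => ψ y t) x i
      = ∑ l, dX l (dX l (fun x t => ψ x t i)) x t := by
    intro x t i
    rw [laplacian_eq_sum_partialX (hψ.smooth_space t), WithLp.ofLp_sum, Finset.sum_apply]
    refine Finset.sum_congr rfl fun l _ => ?_
    have e1 := dX_coord (hψ.dX l) i l x t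
    have e2 : (fun x t => dX l ψ x t i) = dX l (fun x t => ψ x t i) := by
      ext y s
      exact dX_coord hψ i l y s
    rw [e2] at e1
    exact e1
  calc _ = ∫ z in slab n T, ∑ i, (-2 * (-(Q i z.1 z.2 * dT (fun x t => ψ x t i) z.1 z.2)
        + (∑ l, Q l z.1 z.2 ^ 2 * dX i (fun x t => ψ x t i) z.1 z.2)
        - (∑ l, Q i z.1 z.2 * dX l (dX l (fun x t => ψ x t i)) z.1 z.2)
        + (V z.1 z.2)⁻¹ * g z.1 z.2 * dX i (fun x t => ψ x t i) z.1 z.2)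
        + 2 * (∑ l, Q l z.1 z.2 ^ 2 * dX i (fun x t => ψ x t i) z.1 z.2)
        + 4 * ∑ l, D i l z.1 z.2 * (Q l z.1 z.2 * ψ z.1 z.2 i)) := by
        refine integral_congr_ae ?_
        filter_upwards [hQu, hconv, hf] with z hz hz2 hz3
        have i1 : inner ℝ (u z.1 z.2) (deriv (fun s => ψ z.1 s) z.2)
            = ∑ i, -2 * (Q i z.1 z.2 * dT (fun x t => ψ x t i) z.1 z.2) := by
          rw [PiLp.inner_apply]
          refine Finset.sum_congr rfl fun i _ => ?_
          rw [hz i, ← dT_coord hψ]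
          simp only [dT, RCLike.inner_apply, conj_trivial]
          ring
        have i2 : inner ℝ (convection u D' z.1 z.2) (ψ z.1 z.2)
            = ∑ i, 4 * ∑ l, D i l z.1 z.2 * (Q l z.1 z.2 * ψ z.1 z.2 i) := by
          rw [PiLp.inner_apply]
          refine Finset.sum_congr rfl fun i _ => ?_
          rw [hz2 i, Finset.mul_sum]
          simp only [RCLike.inner_apply, conj_trivial, Finset.mul_sum]
          exact Finset.sum_congr rfl fun l _ => by ring
        have i3 : inner ℝ (u z.1 z.2) (Laplacian.laplacian (fun y => ψ y z.2) z.1)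
            = ∑ i, -2 * ∑ l, Q i z.1 z.2 * dX l (dX l (fun x t => ψ x t i)) z.1 z.2 := by
          rw [PiLp.inner_apply]
          refine Finset.sum_congr rfl fun i _ => ?_
          rw [hz i, hlapψ, ← Finset.mul_sum]
          simp only [RCLike.inner_apply, conj_trivial]
          ring
        have i4 : f z.1 z.2 * divX (fun y => ψ y z.2) z.1
            = ∑ i, -2 * ((V z.1 z.2)⁻¹ * g z.1 z.2 * dX i (fun x t => ψ x t i) z.1 z.2) := by
          rw [hz3, divX, Finset.mul_sum]
          refine Finset.sum_congr rfl fun i _ => ?_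
          rw [← dX_coord hψ]
          simp only [dX]
          ring
        rw [i1, i2, i3, i4, ← Finset.sum_neg_distrib, ← Finset.sum_add_distrib,
          ← Finset.sum_sub_distrib, ← Finset.sum_add_distrib]
        refine Finset.sum_congr rfl fun i _ => ?_
        ring
    _ = ∑ i, ∫ x, u₀ x i * ψ x 0 i := by
        refine (integral_finsetSum _ fun i _ => ?_).trans
          (Finset.sum_congr rfl fun i _ => hcomp i)
        exact (((A0 i).const_mul (-2)).add ((S2 i).const_mul 2)).add ((S3 i).const_mul 4)
    _ = ∫ x, inner ℝ (u₀ x) (ψ x 0) := by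
        rw [← integral_finsetSum]
        · refine integral_congr_ae (ae_of_all _ fun x => ?_)
          simp only [PiLp.inner_apply, RCLike.inner_apply, conj_trivial]
          exact Finset.sum_congr rfl fun i _ => mul_comm _ _
        · intro i _
          have hli : LocallyIntegrable fun x => u₀ x i := fun x => by
            obtain ⟨U, hU, hI⟩ := hu₀ x
            exact ⟨U, hU, Integrable.eval_piLp hI i⟩
          refine (hli.integrable_smul_left_of_hasCompactSupport
            ((hθ i).smooth_space 0).continuous ((hθ i).compact_space 0)).congr
            (ae_of_all _ fun x => ?_)
          simp only [smul_eq_mul, mul_comm]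

end IsRegularSol

/-! ### The Lipschitz representative of the potential of a bounded field -/

theorem IsWeakGradient.fderiv_moll_apply {φ : Euc n → ℝ} {u₀ : Euc n → Euc n}
    (hφ : IsWeakGradient φ u₀) (k : ℕ) (x v : Euc n) :
    fderiv ℝ (fun x => moll (mol n k) (fun y _ => φ y) x 0) x v
      = inner ℝ (∫ y, mol n k (x - y) • u₀ y) v := by
  have hρs : ContDiff ℝ ∞ (mol n k) := contDiff_mol k
  have hρc := hasCompactSupport_mol (n := n) k
  have hηs : ContDiff ℝ ∞ (fun y => mol n k (x - y)) := hρs.comp (contDiff_const.sub contDiff_id)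
  have hηc : HasCompactSupport (fun y => mol n k (x - y)) :=
    hρc.comp_homeomorph (Homeomorph.subLeft x)
  have hui : Integrable (fun y => mol n k (x - y) • u₀ y) :=
    hφ.locallyIntegrable_grad.integrable_smul_left_of_hasCompactSupport hηs.continuous hηc
  have h1 : ∀ j, partialX j (fun x => moll (mol n k) (fun y _ => φ y) x 0) x
      = (∫ y, mol n k (x - y) • u₀ y) j := by
    intro j
    rw [partialX_moll hρs hρc (f := fun y _ => φ y) (t := 0) hφ.locallyIntegrable, moll_swap]
    have h2 := hφ.integral_eq _ hηs hηc j
    simp only [partialX_reflect (hρs.differentiable (by simp)) x j, mul_neg, integral_neg,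
      neg_inj] at h2
    rw [eval_integral_piLp fun i => Integrable.eval_piLp hui i]
    simpa only [PiLp.smul_apply, smul_eq_mul, mul_comm] using h2
  rw [PiLp.inner_apply, fderiv_apply_eq_sum]
  refine Finset.sum_congr rfl fun j _ => ?_
  rw [← h1 j]
  rfl

theorem IsWeakGradient.norm_fderiv_moll_le {φ : Euc n → ℝ} {u₀ : Euc n → Euc n} {L : ℝ}
    (hφ : IsWeakGradient φ u₀) (hL : ∀ᵐ x, ‖u₀ x‖ ≤ L) (k : ℕ) (x : Euc n) :
    ‖fderiv ℝ (fun x => moll (mol n k) (fun y _ => φ y) x 0) x‖ ≤ L := by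
  have hL0 : 0 ≤ L := by
    obtain ⟨y, hy⟩ := hL.exists
    exact (norm_nonneg _).trans hy
  refine ContinuousLinearMap.opNorm_le_bound _ hL0 fun v => ?_
  rw [hφ.fderiv_moll_apply]
  refine (norm_inner_le_norm _ _).trans (mul_le_mul_of_nonneg_right ?_ (norm_nonneg _))
  have hInt : ∫ y, mol n k (x - y) = 1 := by
    rw [integral_sub_left_eq_self (mol n k) volume x, integral_mol]
  have hi : Integrable fun y => mol n k (x - y) := (integrable_mol k).comp_sub_left x
  refine (norm_integral_le_of_norm_le (hi.mul_const L) ?_).trans_eq ?_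
  · filter_upwards [hL] with y hy
    rw [norm_smul, Real.norm_of_nonneg (mol_nonneg _ _)]
    exact mul_le_mul_of_nonneg_left hy (mol_nonneg _ _)
  · rw [integral_mul_const, hInt, one_mul]

/-- A function with bounded weak gradient agrees almost everywhere with a Lipschitz function. -/
theorem IsWeakGradient.exists_lipschitz {φ : Euc n → ℝ} {u₀ : Euc n → Euc n}
    (hφ : IsWeakGradient φ u₀) (hu₀ : MemLp u₀ ⊤ volume) :
    ∃ (L : NNReal) (φ' : Euc n → ℝ), LipschitzWith L φ' ∧ φ =ᵐ[volume] φ' := by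
  set L : NNReal := (eLpNorm u₀ ⊤ volume).toNNReal with hLdef
  have hL : ∀ᵐ x, ‖u₀ x‖ ≤ L := by
    have h1 := enorm_ae_le_eLpNormEssSup u₀ (volume : Measure (Euc n))
    filter_upwards [h1] with x hx
    rw [← eLpNorm_exponent_top] at hx
    have h2 := ENNReal.toReal_mono hu₀.2.ne hx
    rwa [toReal_enorm] at h2
  have hlip : ∀ k, LipschitzWith L (fun x => moll (mol n k) (fun y _ => φ y) x 0) := by
    intro k
    refine lipschitzWith_of_nnnorm_fderiv_le (𝕜 := ℝ) ?_ fun x => ?_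
    · exact (contDiff_moll (contDiff_mol k) (hasCompactSupport_mol k)
        (f := fun y _ => φ y) (t := 0) hφ.locallyIntegrable).differentiable (by simp)
    · exact_mod_cast hφ.norm_fderiv_moll_le hL k x
  have hae := ae_tendsto_mol hφ.locallyIntegrable
  -- On this set of full measure `φ` is a pointwise limit of functions with a common Lipschitz
  -- constant, hence Lipschitz there, and it extends to the whole space.
  set S : Set (Euc n) := {x | Tendsto (fun k => ∫ y, mol n k y • φ (x - y)) atTop (𝓝 (φ x))}
    with hS
  have hSlip : LipschitzOnWith L φ S := by
    refine LipschitzOnWith.of_dist_le_mul fun x hx y hy => ?_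
    have h1 : Tendsto (fun k => dist (∫ z, mol n k z • φ (x - z)) (∫ z, mol n k z • φ (y - z)))
      atTop (𝓝 (dist (φ x) (φ y))) := Tendsto.dist hx hy
    exact le_of_tendsto h1 (Eventually.of_forall fun k => (hlip k).dist_le_mul x y)
  obtain ⟨φ', h1, h2⟩ := hSlip.extend_real
  exact ⟨L, φ', h1, by filter_upwards [hae] with x hx using h2 hx⟩

/-- Only differences of `φ` enter, so `φ` itself may be unbounded; a bounded gradient is exactly
what makes the initial value comparable at neighbouring points. -/
theorem isWeight_exp_of_lipschitz {φ : Euc n → ℝ} {L : NNReal} (hφ : LipschitzWith L φ) :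
    IsWeight (L / 2) (fun x => Real.exp (-(1 / 2) * φ x)) := by
  refine ⟨by positivity, fun x => Real.exp_pos _, ?_, fun x y => ?_⟩
  · have := hφ.continuous
    fun_prop
  · rw [← Real.exp_add, Real.exp_le_exp]
    have h1 := hφ.dist_le_mul x y
    rw [Real.dist_eq, dist_eq_norm] at h1
    have := le_abs_self (φ x - φ y)
    linarith

/-! ### From the given data to their representatives. -/

/-- An essentially bounded function on the slab agrees almost everywhere with a bounded
measurable function. -/
theorem exists_isPotential {T : ℝ} {F : Euc n → ℝ → ℝ}
    (hF : MemLp (fun z : Euc n × ℝ => F z.1 z.2) ⊤ (volume.restrict (slab n T))) :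
    ∃ M F', IsPotential M F' ∧
      ∀ᵐ z ∂(volume : Measure (Euc n × ℝ)).restrict (slab n T), F z.1 z.2 = F' z.1 z.2 := by
  set M : ℝ := (eLpNorm (fun z : Euc n × ℝ => F z.1 z.2) ⊤ (volume.restrict (slab n T))).toReal
  have hM : ∀ᵐ z ∂(volume : Measure (Euc n × ℝ)).restrict (slab n T), |F z.1 z.2| ≤ M := by
    have h1 := enorm_ae_le_eLpNormEssSup (fun z : Euc n × ℝ => F z.1 z.2)
      (volume.restrict (slab n T))
    filter_upwards [h1] with x hx
    rw [← eLpNorm_exponent_top] at hx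
    have h2 := ENNReal.toReal_mono hF.2.ne hx
    rwa [toReal_enorm] at h2
  have hM0 : 0 ≤ M := ENNReal.toReal_nonneg
  refine ⟨M, fun x t => max (-M) (min M (hF.1.mk _ (x, t))), ⟨?_, fun x t => ?_⟩, ?_⟩
  · exact measurable_const.max (measurable_const.min hF.1.stronglyMeasurable_mk.measurable)
  · exact abs_le.mpr ⟨le_max_left _ _, max_le (by linarith) (min_le_left _ _)⟩
  · filter_upwards [hM, hF.1.ae_eq_mk] with z h1 h2
    rw [← h2, min_eq_right (abs_le.mp h1).2, max_eq_right (abs_le.mp h1).1]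

section

variable {a M T : ℝ} {w G₀ : Euc n → ℝ} {F F' : Euc n → ℝ → ℝ}

theorem ae_ae_of_ae_slab {p : Euc n × ℝ → Prop}
    (h : ∀ᵐ z ∂(volume : Measure (Euc n × ℝ)).restrict (slab n T), p z) :
    ∀ᵐ s ∂(volume : Measure ℝ).restrict (Icc 0 T), ∀ᵐ y : Euc n, p (y, s) := by
  rw [restrict_slab, ← Measure.prod_swap] at h
  exact Measure.ae_ae_of_ae_prod (ae_of_ae_map measurable_swap.aemeasurable h)

theorem heatConv_congr_ae {q q' : Euc n → ℝ} (h : q =ᵐ[volume] q') {t : ℝ} (ht : t ≠ 0)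
    (x : Euc n) : heatConv t q x = heatConv t q' x := by
  rw [heatConv, heatConv, if_neg ht, if_neg ht]
  refine integral_congr_ae ?_
  filter_upwards [h] with y hy
  rw [hy]

/-- Changing the data on null sets, the terms of the series do not change at positive times. -/
theorem seriesTerm_eq_dysonTerm
    (hFF' : ∀ᵐ z ∂(volume : Measure (Euc n × ℝ)).restrict (slab n T), F z.1 z.2 = F' z.1 z.2)
    (hG₀ : G₀ =ᵐ[volume] w) (k : ℕ) :
    ∀ x, ∀ t ∈ Ioc 0 T, seriesTerm F G₀ k x t = dysonTerm F' w k x t := by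
  induction k with
  | zero =>
    intro x t ht
    simp only [seriesTerm, dysonTerm]
    rw [heatConv_congr_ae hG₀ ht.1.ne', heatConv_eq_heatS ht.1.le]
  | succ k ih =>
    intro x t ht
    simp only [seriesTerm, dysonTerm, duh]
    rw [intervalIntegral.integral_of_le ht.1.le, integral_Ioc_eq_integral_Ioo]
    have hsub : Ioo 0 t ⊆ Icc 0 T := fun s hs => ⟨hs.1.le, hs.2.le.trans ht.2⟩
    refine integral_congr_ae ?_
    -- By Fubini `F` and `F'` agree at almost every `y` for almost every `s`; for such `s` the
    -- convolution does not see the difference, since `t - s > 0`.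
    filter_upwards [ae_restrict_of_ae_restrict_of_subset hsub (ae_ae_of_ae_slab hFF'),
      ae_restrict_mem measurableSet_Ioo] with s hs hs'
    rw [← heatConv_eq_heatS (sub_nonneg.mpr hs'.2.le)]
    refine heatConv_congr_ae ?_ (sub_pos.mpr hs'.2).ne' x
    filter_upwards [hs] with y hy
    rw [hy, ih y s ⟨hs'.1, hs'.2.le.trans ht.2⟩]

theorem seriesSum_eq_dyson
    (hFF' : ∀ᵐ z ∂(volume : Measure (Euc n × ℝ)).restrict (slab n T), F z.1 z.2 = F' z.1 z.2)
    (hG₀ : G₀ =ᵐ[volume] w) (x : Euc n) {t : ℝ} (ht : t ∈ Ioc 0 T) :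
    seriesSum F G₀ x t = dyson F' w x t :=
  tsum_congr fun k => seriesTerm_eq_dysonTerm hFF' hG₀ k x t ht

theorem seriesTerm_succ_zero (F : Euc n → ℝ → ℝ) (G₀ : Euc n → ℝ) (k : ℕ) (x : Euc n) :
    seriesTerm F G₀ (k + 1) x 0 = 0 := by
  simp [seriesTerm]

theorem seriesSum_zero (F : Euc n → ℝ → ℝ) (G₀ : Euc n → ℝ) (x : Euc n) :
    seriesSum F G₀ x 0 = G₀ x := by
  rw [seriesSum, tsum_eq_single 0]
  · simp [seriesTerm, heatConv]
  · intro k hk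
    obtain ⟨m, rfl⟩ := Nat.exists_eq_succ_of_ne_zero hk
    exact seriesTerm_succ_zero F G₀ m x

theorem measurable_heatKernel : Measurable (fun z : Euc n × ℝ => heatKernel z.1 z.2) := by
  unfold heatKernel
  fun_prop

theorem heatKernel_nonneg (x : Euc n) {t : ℝ} (ht : 0 ≤ t) : 0 ≤ heatKernel x t := by
  unfold heatKernel
  positivity

/-- Absolute convergence of the space-time integral of the heat kernel against a function
dominated by a weight. -/
theorem IsWeight.integrableOn_heatKernel_mul {B t : ℝ} {q : Euc n → ℝ → ℝ} (hw : IsWeight a w)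
    (hqm : Measurable (Function.uncurry q)) (hq : ∀ y, ∀ s ∈ Ioo 0 t, |q y s| ≤ B * w y)
    (x : Euc n) :
    IntegrableOn (fun z : Euc n × ℝ => heatKernel (x - z.1) (t - z.2) * q z.1 z.2)
      (univ ×ˢ Ioo 0 t) := by
  have hmeas : Measurable (fun z : Euc n × ℝ => heatKernel (x - z.1) (t - z.2) * q z.1 z.2) :=
    (measurable_heatKernel.comp ((measurable_const.sub measurable_fst).prodMk
      (measurable_const.sub measurable_snd))).mul hqm
  rw [IntegrableOn, Measure.volume_eq_prod, ← Measure.prod_restrict, Measure.restrict_univ,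
    integrable_prod_iff' hmeas.aestronglyMeasurable]
  have hslice : ∀ s, Measurable fun y => q y s := fun s =>
    hqm.comp (measurable_id.prodMk measurable_const)
  constructor
  · filter_upwards [ae_restrict_mem measurableSet_Ioo] with s hs
    exact hw.integrable_heatKernel_mul (hslice s) (fun y => hq y s hs) (sub_pos.mpr hs.2) x
  · have h1 := hw.integrableOn_duh (q := fun y s => |q y s|) (T := t) (B := B) hqm.abs
      (fun y s hs => by simpa using hq y s hs) t x
    refine h1.congr ?_
    filter_upwards [ae_restrict_mem measurableSet_Ioo] with s hs
    rw [← heatConv_eq_heatS (sub_nonneg.mpr hs.2.le), heatConv, if_neg (sub_pos.mpr hs.2).ne']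
    refine integral_congr_ae (ae_of_all _ fun y => ?_)
    simp only [norm_mul, Real.norm_eq_abs]
    rw [abs_of_nonneg (heatKernel_nonneg _ (sub_nonneg.mpr hs.2.le))]

theorem seriesConverges (hw : IsWeight a w) (hF : IsPotential M F')
    (hFF' : ∀ᵐ z ∂(volume : Measure (Euc n × ℝ)).restrict (slab n T), F z.1 z.2 = F' z.1 z.2)
    (hG₀ : G₀ =ᵐ[volume] w) : SeriesConverges T F G₀ := by
  refine ⟨fun x t ht => ?_, fun k x t ht => ?_, fun x t ht => ?_⟩
  · refine (hw.integrable_heatKernel_mul (B := 1) hw.continuous.measurable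
      (fun y => by rw [one_mul, abs_of_pos (hw.pos y)]) ht.1 x).congr ?_
    filter_upwards [hG₀] with y hy
    rw [hy]
  · have hb := abs_dysonTerm_le (T := T) hw hF k
    have hsub : (univ : Set (Euc n)) ×ˢ Ioo 0 t ⊆ slab n T :=
      Set.prod_mono le_rfl fun s hs => ⟨hs.1.le, hs.2.le.trans ht.2⟩
    have hA := expMoment_pos (n := n) (a * √T)
    have hM := hF.nonneg
    refine (hw.integrableOn_heatKernel_mul (t := t)
      (q := fun y s => F' y s * dysonTerm F' w k y s)
      (B := M * (expMoment n (a * √T) * ((expMoment n (a * √T) * M) ^ k / k.factorial) * T ^ k))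
      (hF.measurable_mul (measurable_dysonTerm hw hF k)) (fun y s hs => ?_) x).congr ?_
    · have h1 := hb y s ⟨hs.1.le, hs.2.le.trans ht.2⟩
      have h2 : s ^ k ≤ T ^ k := pow_le_pow_left₀ hs.1.le (hs.2.le.trans ht.2) k
      have h3 := hw.pos y
      rw [mul_assoc]
      refine hF.abs_mul_le (h1.trans ?_)
      gcongr
    · filter_upwards [ae_restrict_of_ae_restrict_of_subset hsub hFF',
        ae_restrict_mem (MeasurableSet.univ.prod measurableSet_Ioo)] with z hz hz'
      rw [hz, seriesTerm_eq_dysonTerm hFF' hG₀ k z.1 z.2 ⟨hz'.2.1, hz'.2.2.le.trans ht.2⟩]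
  -- Time `0` is separate: the series then evaluates `G₀` itself, not its representative, and only
  -- the term of index `0` is nonzero.
  · rcases ht.1.eq_or_lt with h0 | h0
    · rw [← h0]
      refine summable_of_ne_finset_zero (s := {0}) fun k hk => ?_
      obtain ⟨m, rfl⟩ := Nat.exists_eq_succ_of_ne_zero (by simpa using hk : k ≠ 0)
      rw [seriesTerm_succ_zero, abs_zero]
    · refine (summable_abs_dysonTerm hw hF x t).congr fun k => ?_
      rw [seriesTerm_eq_dysonTerm hFF' hG₀ k x t ⟨h0, ht.2⟩]

end

/-- The weak theory of the series, in terms of representatives of the data. -/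
theorem weak_theory {a M T : ℝ} {w G₀ : Euc n → ℝ} {f F F' G : Euc n → ℝ → ℝ}
    {u₀ : Euc n → Euc n} {u : Euc n → ℝ → Euc n} (hT : 0 < T) (hw : IsWeight a w)
    (hF : IsPotential M F')
    (hFF' : ∀ᵐ z ∂(volume : Measure (Euc n × ℝ)).restrict (slab n T), F z.1 z.2 = F' z.1 z.2)
    (hG₀ : G₀ =ᵐ[volume] w) (hpos : ∀ x, 0 < G₀ x) (hG : ∀ x t, G x t = seriesSum F G₀ x t)
    (hu : ∀ x t, u x t = coleHopf G x t) (hu₀ : LocallyIntegrable u₀)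
    (hφ : ∀ η : Euc n → ℝ, ContDiff ℝ ∞ η → HasCompactSupport η → ∀ j,
      2 * ∫ x, Real.log (w x) * partialX j η x = ∫ x, u₀ x j * η x)
    (hf : ∀ x t, f x t = -2 * F x t) :
    SeriesConverges T F G₀ ∧ IsWeakLinearSolution T F G₀ G ∧ (∀ x, ∀ t ∈ Icc 0 T, 0 < G x t) ∧
      (∀ x, ∀ t ∈ Ioc 0 T, DifferentiableAt ℝ (fun y => G y t) x) ∧ IsWeakSolution T f u₀ u := by
  obtain ⟨C, P, h⟩ := IsMild.exists_isRegularSol hT hw hF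
  have hGV : ∀ x, ∀ t ∈ Ioc 0 T, G x t = dyson F' w x t := fun x t ht => by
    rw [hG, seriesSum_eq_dyson hFF' hG₀ x ht]
  have hGVae : ∀ᵐ z ∂(volume : Measure (Euc n × ℝ)).restrict (slab n T),
      G z.1 z.2 = dyson F' w z.1 z.2 := ae_slab_of_forall_Ioc fun x t ht => hGV x t ht
  have hd : ∀ x, ∀ t ∈ Ioc 0 T, HasFDerivAt (fun y => G y t) (innerSL ℝ (P x t)) x := by
    intro x t ht
    refine (h.hasFDerivAt x t ht).congr_of_eventuallyEq (Eventually.of_forall fun y => ?_)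
    exact hGV y t ht
  refine ⟨seriesConverges hw hF hFF' hG₀, ⟨?_, fun η hη => ?_⟩, fun x t ht => ?_,
    fun x t ht => (hd x t ht).differentiableAt, ?_⟩
  · refine locallyIntegrableOn_slab fun M => ?_
    refine ((h.locBdd_sol (ι := Unit)).integrableOn M).congr ?_
    filter_upwards [ae_restrict_of_ae_restrict_of_subset (cylinder_subset_slab T M) hGVae]
      with z hz using hz.symm
  · have h1 := h.integral_weak_linear hη
    have h2 : ∫ x, G₀ x * η x 0 = ∫ x, w x * η x 0 := by
      refine integral_congr_ae ?_
      filter_upwards [hG₀] with x hx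
      rw [hx]
    rw [h2, ← h1]
    refine integral_congr_ae ?_
    filter_upwards [hGVae, hFF'] with z h3 h4
    rw [h3, h4]
  -- At `t = 0` the function is `G₀`, which may differ from `w` on a null set; this is where the
  -- pointwise positivity of `G₀` is used.
  · rcases ht.1.eq_or_lt with h0 | h0
    · rw [← h0, hG, seriesSum_zero]
      exact hpos x
    · rw [hGV x t ⟨h0, ht.2⟩]
      exact h.sol_pos ht
  · refine h.isWeakSolution (fun x t ht => ?_) hu₀ hφ ?_
    · rw [hu, coleHopf, hGV x t ht]
      congr 1
      exact (show HasGradientAt (fun y => G y t) (P x t) x from hd x t ht).gradient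
    · filter_upwards [hFF', ae_slab_of_forall (p := fun z => 0 < dyson F' w z.1 z.2)
        fun x t ht => h.sol_pos ht] with z h3 h4
      rw [hf, h3]
      field_simp

/-! ### Functions with regular iterated space derivatives -/

/-- The function `f` and its space derivatives up to order `k` are of class `C^m` on `U × I`. -/
def SpaceReg (m : WithTop ℕ∞) (U : Set (Euc n)) (I : Set ℝ) : ℕ → (Euc n → ℝ → ℝ) → Prop
  | 0, f => ContDiffOn ℝ m (Function.uncurry f) (U ×ˢ I)
  | k + 1, f => ContDiffOn ℝ m (Function.uncurry f) (U ×ˢ I) ∧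
      (∀ t ∈ I, ∀ x ∈ U, DifferentiableAt ℝ (fun y => f y t) x) ∧
      ∀ j, SpaceReg m U I k (dX j f)

/-- The linear form with coefficients `v`. -/
def formOf (v : Fin n → ℝ) : Euc n →L[ℝ] ℝ := ∑ j, v j • (EuclideanSpace.proj j : Euc n →L[ℝ] ℝ)

theorem formOf_single (v : Fin n → ℝ) (j : Fin n) : formOf v (EuclideanSpace.single j 1) = v j := by
  simp [formOf]

theorem hasFDerivAt_formOf {f : Euc n → ℝ} {x : Euc n} (hf : DifferentiableAt ℝ f x) :
    HasFDerivAt f (formOf fun j => partialX j f x) x := by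
  convert hf.hasFDerivAt using 1
  ext z
  rw [fderiv_apply_eq_sum (fderiv ℝ f x) z]
  simp [formOf, partialX, mul_comm]

theorem norm_formOf_le (v : Fin n → ℝ) : ‖formOf v‖ ≤ ∑ j, |v j| := by
  refine (norm_sum_le _ _).trans (Finset.sum_le_sum fun j _ => ?_)
  rw [norm_smul, Real.norm_eq_abs]
  refine mul_le_of_le_one_right (abs_nonneg _) ?_
  refine ContinuousLinearMap.opNorm_le_bound _ zero_le_one fun z => ?_
  rw [one_mul]
  exact abs_coord_le z j

namespace SpaceReg

variable {m : WithTop ℕ∞} {U : Set (Euc n)} {I : Set ℝ} {k : ℕ} {f g : Euc n → ℝ → ℝ}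

theorem contDiffOn (h : SpaceReg m U I k f) : ContDiffOn ℝ m (Function.uncurry f) (U ×ˢ I) := by
  cases k with
  | zero => exact h
  | succ k => exact h.1

theorem dX_congr (hU : IsOpen U) (hfg : ∀ x ∈ U, ∀ t ∈ I, f x t = g x t) (j : Fin n) :
    ∀ x ∈ U, ∀ t ∈ I, dX j f x t = dX j g x t := by
  intro x hx t ht
  have : (fun y => f y t) =ᶠ[𝓝 x] fun y => g y t := by
    filter_upwards [hU.mem_nhds hx] with y hy using hfg y hy t ht
  rw [dX, dX, partialX, partialX, this.fderiv_eq]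

theorem congr (hU : IsOpen U) (h : SpaceReg m U I k f)
    (hfg : ∀ x ∈ U, ∀ t ∈ I, f x t = g x t) : SpaceReg m U I k g := by
  have hc : ∀ {f g : Euc n → ℝ → ℝ}, ContDiffOn ℝ m (Function.uncurry f) (U ×ˢ I) →
      (∀ x ∈ U, ∀ t ∈ I, f x t = g x t) → ContDiffOn ℝ m (Function.uncurry g) (U ×ˢ I) :=
    fun h hfg => ContDiffOn.congr h fun z hz => (hfg z.1 hz.1 z.2 hz.2).symm
  induction k generalizing f g with
  | zero => exact hc h hfg
  | succ k ih =>
    refine ⟨hc h.1 hfg, fun t ht x hx => ?_, fun j => ih (h.2.2 j) (dX_congr hU hfg j)⟩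
    refine (h.2.1 t ht x hx).congr_of_eventuallyEq ?_
    filter_upwards [hU.mem_nhds hx] with y hy using (hfg y hy t ht).symm

theorem of_succ (h : SpaceReg m U I (k + 1) f) : SpaceReg m U I k f := by
  induction k generalizing f with
  | zero => exact h.1
  | succ k ih => exact ⟨h.1, h.2.1, fun j => ih (h.2.2 j)⟩

theorem mono {U' : Set (Euc n)} {I' : Set ℝ} (h : SpaceReg m U I k f) (hU : U' ⊆ U)
    (hI : I' ⊆ I) : SpaceReg m U' I' k f := by
  induction k generalizing f with
  | zero => exact ContDiffOn.mono h (Set.prod_mono hU hI)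
  | succ k ih => exact ⟨h.1.mono (Set.prod_mono hU hI),
      fun t ht x hx => h.2.1 t (hI ht) x (hU hx), fun j => ih (h.2.2 j)⟩

theorem add (hU : IsOpen U) (hf : SpaceReg m U I k f) (hg : SpaceReg m U I k g) :
    SpaceReg m U I k fun x t => f x t + g x t := by
  induction k generalizing f g with
  | zero => exact ContDiffOn.add hf hg
  | succ k ih =>
    refine ⟨hf.1.add hg.1, fun t ht x hx => (hf.2.1 t ht x hx).add (hg.2.1 t ht x hx), fun j => ?_⟩
    refine (ih (hf.2.2 j) (hg.2.2 j)).congr hU fun x hx t ht => ?_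
    simp only [dX, partialX]
    rw [fderiv_fun_add (hf.2.1 t ht x hx) (hg.2.1 t ht x hx)]
    rfl

theorem mul (hU : IsOpen U) (hf : SpaceReg m U I k f) (hg : SpaceReg m U I k g) :
    SpaceReg m U I k fun x t => f x t * g x t := by
  induction k generalizing f g with
  | zero => exact ContDiffOn.mul hf hg
  | succ k ih =>
    refine ⟨hf.1.mul hg.1, fun t ht x hx => (hf.2.1 t ht x hx).mul (hg.2.1 t ht x hx), fun j => ?_⟩
    refine ((ih (hf.2.2 j) hg.of_succ).add hU (ih hf.of_succ (hg.2.2 j))).congr hU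
      fun x hx t ht => ?_
    exact (partialX_mul (hf.2.1 t ht x hx) (hg.2.1 t ht x hx) j).symm

theorem const (c : ℝ) : SpaceReg m U I k fun _ _ => c := by
  induction k generalizing c with
  | zero => exact contDiffOn_const
  | succ k ih =>
    refine ⟨contDiffOn_const, fun t _ x _ => differentiableAt_const c, fun j => ?_⟩
    have : dX j (fun (_ : Euc n) (_ : ℝ) => c) = fun _ _ => 0 := by
      ext x t
      simp [dX, partialX]
    rw [this]
    exact ih 0

theorem sum (hU : IsOpen U) {ι : Type*} (s : Finset ι) {F : ι → Euc n → ℝ → ℝ}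
    (h : ∀ i ∈ s, SpaceReg m U I k (F i)) : SpaceReg m U I k fun x t => ∑ i ∈ s, F i x t := by
  classical
  induction s using Finset.induction_on with
  | empty => simpa using SpaceReg.const (m := m) (U := U) (I := I) (k := k) 0
  | insert i s hi ih =>
    simp only [Finset.sum_insert hi]
    exact (h i (Finset.mem_insert_self _ _)).add hU
      (ih fun l hl => h l (Finset.mem_insert_of_mem hl))

/-- How potentials gain regularity in the inductions: their partial derivatives are again
potentials, to which the induction hypothesis applies. -/
theorem of_hasFDerivAt (hU : IsOpen U) (hf : ContDiffOn ℝ m (Function.uncurry f) (U ×ˢ I))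
    {f' : Fin n → Euc n → ℝ → ℝ}
    (hd : ∀ t ∈ I, ∀ x ∈ U, HasFDerivAt (fun y => f y t) (formOf fun j => f' j x t) x)
    (hf' : ∀ j, SpaceReg m U I k (f' j)) : SpaceReg m U I (k + 1) f := by
  refine ⟨hf, fun t ht x hx => (hd t ht x hx).differentiableAt, fun j => (hf' j).congr hU ?_⟩
  intro x hx t ht
  rw [dX, partialX, (hd t ht x hx).fderiv, formOf_single]

theorem of_local (h : ∀ x ∈ U, ∀ t ∈ I, ∃ W ∈ 𝓝 x, ∃ J ∈ 𝓝 t, SpaceReg m W J k f) :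
    SpaceReg m U I k f := by
  have hc : ∀ {k : ℕ} {f : Euc n → ℝ → ℝ},
      (∀ x ∈ U, ∀ t ∈ I, ∃ W ∈ 𝓝 x, ∃ J ∈ 𝓝 t, SpaceReg m W J k f) →
      ContDiffOn ℝ m (Function.uncurry f) (U ×ˢ I) := by
    rintro k f h ⟨x, t⟩ ⟨hx, ht⟩
    obtain ⟨W, hW, J, hJ, hr⟩ := h x hx t ht
    exact (hr.contDiffOn.contDiffAt (prod_mem_nhds hW hJ)).contDiffWithinAt
  induction k generalizing f with
  | zero => exact hc h
  | succ k ih =>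
    refine ⟨hc h, fun t ht x hx => ?_, fun j => ih fun x hx t ht => ?_⟩
    · obtain ⟨W, hW, J, hJ, hr⟩ := h x hx t ht
      exact hr.2.1 t (mem_of_mem_nhds hJ) x (mem_of_mem_nhds hW)
    · obtain ⟨W, hW, J, hJ, hr⟩ := h x hx t ht
      exact ⟨W, hW, J, hJ, hr.2.2 j⟩

theorem of_le {m' : WithTop ℕ∞} (h : SpaceReg m U I k f) (hm : m' ≤ m) : SpaceReg m' U I k f := by
  induction k generalizing f with
  | zero => exact ContDiffOn.of_le h hm
  | succ k ih => exact ⟨h.1.of_le hm, h.2.1, fun j => ih (h.2.2 j)⟩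

theorem comp_time {I' : Set ℝ} {c : ℝ → ℝ} (h : SpaceReg 0 U I k f) (hc : ContinuousOn c I')
    (hcI : MapsTo c I' I) : SpaceReg 0 U I' k fun x t => f x (c t) := by
  have h0 : ∀ {f : Euc n → ℝ → ℝ}, ContDiffOn ℝ 0 (Function.uncurry f) (U ×ˢ I) →
      ContDiffOn ℝ 0 (Function.uncurry fun x t => f x (c t)) (U ×ˢ I') := by
    intro f hf
    rw [contDiffOn_zero] at hf ⊢
    exact hf.comp (continuousOn_fst.prodMk (hc.comp continuousOn_snd fun z hz => hz.2))
      fun z hz => ⟨hz.1, hcI hz.2⟩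
  induction k generalizing f with
  | zero => exact h0 h
  | succ k ih => exact ⟨h0 h.1, fun t ht x hx => h.2.1 (c t) (hcI ht) x hx, fun j => ih (h.2.2 j)⟩

theorem contDiffOn_slice (hU : IsOpen U) (h : ∀ k, SpaceReg m U I k f) {t : ℝ} (ht : t ∈ I) :
    ContDiffOn ℝ ∞ (fun x => f x t) U := by
  have key : ∀ (l : ℕ) {f : Euc n → ℝ → ℝ}, (∀ k, SpaceReg m U I k f) →
      ContDiffOn ℝ l (fun x => f x t) U := by
    intro l
    induction l with
    | zero =>
      intro f h
      exact contDiffOn_zero.mpr fun x hx => ((h 1).2.1 t ht x hx).continuousAt.continuousWithinAt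
    | succ l ih =>
      intro f h
      push_cast
      rw [contDiffOn_succ_iff_hasFDerivWithinAt_of_uniqueDiffOn hU.uniqueDiffOn]
      refine ⟨by simp, fun x => formOf fun j => dX j f x t, ?_, fun x hx =>
        (hasFDerivAt_formOf ((h 1).2.1 t ht x hx)).hasFDerivWithinAt⟩
      refine ContDiffOn.sum fun j _ => ContDiffOn.smul (ih fun k => (h (k + 1)).2.2 j)
        contDiffOn_const
  exact contDiffOn_infty.mpr fun l => key l h

end SpaceReg

/-! ### Smooth data -/

/-- The mollifications of `φ` converge pointwise, and their gradients, the mollifications of `u₀`,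
converge uniformly near `x` by continuity of `u₀`; so the limit may be differentiated. -/
theorem IsWeakGradient.hasFDerivAt {φ : Euc n → ℝ} {u₀ : Euc n → Euc n}
    (hφ : IsWeakGradient φ u₀) (hc : Continuous φ) (hu : Continuous u₀) (x : Euc n) :
    HasFDerivAt φ (innerSL ℝ (u₀ x)) x := by
  have hf : ∀ k, ContDiff ℝ ∞ (fun x => moll (mol n k) (fun y _ => φ y) x 0) := fun k =>
    contDiff_moll (contDiff_mol k) (hasCompactSupport_mol k) hφ.locallyIntegrable
  refine hasFDerivAt_of_tendstoUniformlyOnFilter (l := atTop)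
    (f := fun k x => moll (mol n k) (fun y _ => φ y) x 0)
    (f' := fun k x => innerSL ℝ (∫ y, mol n k (x - y) • u₀ y))
    (g' := fun x => innerSL ℝ (u₀ x)) ?_ (Eventually.of_forall fun z => ?_)
    (Eventually.of_forall fun y => tendsto_mol_of_continuous hc y)
  · rw [tendstoUniformlyOnFilter_iff_tendsto]
    have h1 : Tendsto (fun q : ℕ × Euc n => ∫ y, mol n q.1 (q.2 - y) • u₀ y)
        (atTop ×ˢ 𝓝 x) (𝓝 (u₀ x)) := by
      have h := ContDiffBump.convolution_tendsto_right (μ := volume)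
        (φ := fun q : ℕ × Euc n => bump n q.1) (g := fun _ => u₀) (k := fun q => q.2)
        (l := atTop ×ˢ 𝓝 x)
        ((tendsto_one_div_add_atTop_nhds_zero_nat (𝕜 := ℝ)).comp tendsto_fst)
        (Eventually.of_forall fun _ => hu.aestronglyMeasurable)
        ((hu.tendsto x).comp tendsto_snd) tendsto_snd
      refine h.congr fun q => ?_
      rw [convolution_lsmul_swap]
      rfl
    have h2 : Tendsto (fun q : ℕ × Euc n => u₀ q.2) (atTop ×ˢ 𝓝 x) (𝓝 (u₀ x)) :=
      (hu.tendsto x).comp tendsto_snd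
    exact ((((innerSL ℝ).continuous.tendsto _).comp h2).prodMk_nhds
      (((innerSL ℝ).continuous.tendsto _).comp h1)).mono_right (nhds_le_uniformity _)
  · convert ((hf z.1).differentiable (by simp) z.2).hasFDerivAt using 1
    ext v
    rw [hφ.fderiv_moll_apply]
    rfl

theorem IsWeakGradient.contDiff {φ : Euc n → ℝ} {u₀ : Euc n → Euc n}
    (hφ : IsWeakGradient φ u₀) (hc : Continuous φ) (hu : ContDiff ℝ ∞ u₀) : ContDiff ℝ ∞ φ := by
  rw [contDiff_infty_iff_fderiv]
  refine ⟨fun x => (hφ.hasFDerivAt hc hu.continuous x).differentiableAt, ?_⟩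
  rw [funext fun x => (hφ.hasFDerivAt hc hu.continuous x).fderiv]
  exact (innerSL ℝ).contDiff.comp hu

theorem uniqueDiffOn_slab {T : ℝ} (hT : 0 < T) : UniqueDiffOn ℝ (slab n T) :=
  uniqueDiffOn_univ.prod (uniqueDiffOn_Icc hT)

theorem hasFDerivAt_slice_of_contDiffOn {T : ℝ} {W : Type*} [NormedAddCommGroup W]
    [NormedSpace ℝ W] {H : Euc n → ℝ → W} (h : ContDiffOn ℝ ∞ (Function.uncurry H) (slab n T))
    (x : Euc n) {t : ℝ} (ht : t ∈ Icc 0 T) :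
    HasFDerivAt (fun y => H y t) ((fderivWithin ℝ (Function.uncurry H) (slab n T) (x, t)).comp
      (ContinuousLinearMap.inl ℝ (Euc n) ℝ)) x := by
  have h1 := ((h.differentiableOn (by simp)) (x, t) ⟨mem_univ _, ht⟩).hasFDerivWithinAt
  have h2 : HasFDerivWithinAt (fun y : Euc n => (y, t)) (ContinuousLinearMap.inl ℝ (Euc n) ℝ)
      univ x := (hasFDerivAt_prodMk_left x t).hasFDerivWithinAt
  have hm : MapsTo (fun y : Euc n => (y, t)) univ (slab n T) := fun y _ => ⟨mem_univ _, ht⟩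
  have h3 := HasFDerivWithinAt.comp (g := Function.uncurry H) (t := slab n T) x h1 h2 hm
  exact hasFDerivWithinAt_univ.mp h3

theorem contDiffOn_dX {T : ℝ} (hT : 0 < T) {W : Type*} [NormedAddCommGroup W]
    [NormedSpace ℝ W] {H : Euc n → ℝ → W} (h : ContDiffOn ℝ ∞ (Function.uncurry H) (slab n T))
    (j : Fin n) : ContDiffOn ℝ ∞ (Function.uncurry (dX j H)) (slab n T) := by
  refine (((h.fderivWithin (uniqueDiffOn_slab hT) (m := ∞) (by simp)).clm_apply
    (contDiffOn_const (c := ((EuclideanSpace.single j 1 : Euc n), (0 : ℝ)))))).congr fun z hz => ?_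
  change partialX j (fun y => H y z.2) z.1 = _
  rw [partialX, (hasFDerivAt_slice_of_contDiffOn h z.1 hz.2).fderiv]
  rfl

theorem spaceReg_of_contDiffOn {T : ℝ} (hT : 0 < T) {H : Euc n → ℝ → ℝ}
    (h : ContDiffOn ℝ ∞ (Function.uncurry H) (slab n T)) (k : ℕ) :
    SpaceReg ∞ univ (Icc 0 T) k H := by
  induction k generalizing H with
  | zero => exact h
  | succ k ih => exact ⟨h, fun t ht x _ =>
      (hasFDerivAt_slice_of_contDiffOn h x ht).differentiableAt, fun j => ih (contDiffOn_dX hT h j)⟩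

/-- The nearest point of `[0, T]`. -/
def clamp (T t : ℝ) : ℝ := max 0 (min t T)

theorem continuous_clamp (T : ℝ) : Continuous (clamp T) := by unfold clamp; fun_prop

theorem clamp_mem {T : ℝ} (hT : 0 < T) (t : ℝ) : clamp T t ∈ Icc 0 T :=
  ⟨le_max_left _ _, max_le hT.le (min_le_right _ _)⟩

theorem clamp_of_mem {T t : ℝ} (ht : t ∈ Icc 0 T) : clamp T t = t := by
  rw [clamp, min_eq_left ht.2, max_eq_right ht.1]

/-- Freezing the time outside `[0, T]` extends the potential to all times. A continuous function
obeys its essential bound everywhere, so the extension is bounded pointwise. -/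
theorem exists_isPotential_clamp {T : ℝ} (hT : 0 < T) {F : Euc n → ℝ → ℝ}
    (h : ContDiffOn ℝ ∞ (Function.uncurry F) (slab n T))
    (hF : MemLp (fun z : Euc n × ℝ => F z.1 z.2) ⊤ (volume.restrict (slab n T))) :
    ∃ M, IsPotential M (fun x t => F x (clamp T t)) := by
  have hc : Continuous (fun z : Euc n × ℝ => F z.1 (clamp T z.2)) :=
    h.continuousOn.comp_continuous
      (continuous_fst.prodMk ((continuous_clamp T).comp continuous_snd))
      fun z => ⟨mem_univ _, clamp_mem hT _⟩
  set M := (eLpNorm (fun z : Euc n × ℝ => F z.1 z.2) ⊤ (volume.restrict (slab n T))).toReal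
  have hae : ∀ᵐ z ∂(volume : Measure (Euc n × ℝ)).restrict (slab n T), ‖F z.1 z.2‖ ≤ M := by
    filter_upwards [ae_le_eLpNormEssSup (f := fun z : Euc n × ℝ => F z.1 z.2)
      (μ := volume.restrict (slab n T))] with z hz
    rw [← toReal_enorm, ← eLpNorm_exponent_top] at *
    exact ENNReal.toReal_mono hF.2.ne hz
  rw [ae_restrict_iff' (measurableSet_slab T)] at hae
  -- An open null set is empty, which gives the bound over `(0, T)`; `hcl` extends it to the
  -- closure.
  have hO : IsOpen (univ ×ˢ Ioo 0 T ∩ {z : Euc n × ℝ | M < ‖F z.1 (clamp T z.2)‖}) :=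
    (isOpen_univ.prod isOpen_Ioo).inter (isOpen_lt continuous_const hc.norm)
  have hempty := (hO.measure_eq_zero_iff volume).mp (measure_mono_null (fun z hz => by
    have hz2 : z.2 ∈ Icc 0 T := Ioo_subset_Icc_self hz.1.2
    have := hz.2
    simp only [mem_ofPred_eq, clamp_of_mem hz2] at this
    simp only [mem_compl_iff, mem_ofPred_eq, Classical.not_imp, not_le]
    exact ⟨⟨mem_univ _, hz2⟩, this⟩) hae)
  have hcl : univ ×ˢ Icc 0 T ⊆ {z : Euc n × ℝ | ‖F z.1 (clamp T z.2)‖ ≤ M} := by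
    rw [← closure_Ioo hT.ne, ← closure_univ, ← closure_prod_eq]
    refine closure_minimal (fun z hz => ?_) (isClosed_le hc.norm continuous_const)
    by_contra hz'
    have : z ∈ univ ×ˢ Ioo 0 T ∩ {z : Euc n × ℝ | M < ‖F z.1 (clamp T z.2)‖} :=
      ⟨hz, by simpa using hz'⟩
    rw [hempty] at this
    exact this
  refine ⟨M, hc.measurable, fun x t => ?_⟩
  have := @hcl (x, clamp T t) ⟨mem_univ _, clamp_mem hT t⟩
  simpa [clamp_of_mem (clamp_mem hT t)] using this

/-- Only continuity in time survives the clamping. It suffices for space regularity; time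
derivatives are recovered later on `[0, T]`, where the original potential is used. -/
theorem spaceReg_clamp {T : ℝ} (hT : 0 < T) {F : Euc n → ℝ → ℝ}
    (h : ContDiffOn ℝ ∞ (Function.uncurry F) (slab n T)) (k : ℕ) :
    SpaceReg 0 univ univ k (fun x t => F x (clamp T t)) :=
  ((spaceReg_of_contDiffOn hT h k).of_le (by simp)).comp_time
    (continuous_clamp T).continuousOn fun t _ => clamp_mem hT t

/-! ### Continuity of the heat potentials -/

/-- A continuous function bounded by multiples of `w`, locally uniformly in positive time. -/
structure IsTame (w : Euc n → ℝ) (q : Euc n → ℝ → ℝ) : Prop where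
  continuous : Continuous (Function.uncurry q)
  bound : ∀ T, ∃ B, ∀ y, ∀ s ∈ Icc 0 T, |q y s| ≤ B * w y

section

variable {a : ℝ} {w : Euc n → ℝ} {q : Euc n → ℝ → ℝ} {g : Euc n → ℝ}

theorem IsWeight.abs_kernel_mul_le (hw : IsWeight a w)
    (hg : ∀ z, |g z| ≤ Real.exp ‖z‖ * gauss z) {B s τ T : ℝ} (hq : ∀ y, |q y s| ≤ B * w y)
    (hτ : τ ≤ T) {x x₀ : Euc n} (hx : ‖x₀ - x‖ ≤ 1) (z : Euc n) :
    |g z * q (x - √τ • z) s|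
      ≤ B * (w x₀ * Real.exp a) * (Real.exp ((a * √T + 1) * ‖z‖) * gauss z) := by
  have hB : 0 ≤ B := nonneg_of_mul_nonneg_left ((abs_nonneg _).trans (hq x)) (hw.pos x)
  have h1 : w x ≤ w x₀ * Real.exp a := by
    refine (hw.le_mul_exp x₀ x).trans (mul_le_mul_of_nonneg_left ?_ (hw.pos _).le)
    exact Real.exp_le_exp.mpr (mul_le_of_le_one_right hw.rate_nonneg hx)
  have h2 := hw.shift_le hτ x z
  have h0 := (gauss_pos z).le
  rw [abs_mul]
  calc |g z| * |q (x - √τ • z) s|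
      ≤ (Real.exp ‖z‖ * gauss z) * (B * (w x₀ * Real.exp a * Real.exp (a * √T * ‖z‖))) := by
        refine mul_le_mul (hg z) ((hq _).trans (mul_le_mul_of_nonneg_left ?_ hB)) (abs_nonneg _)
          (by positivity)
        exact h2.trans (mul_le_mul_of_nonneg_right h1 (Real.exp_pos _).le)
    _ = _ := by
        rw [add_mul, Real.exp_add, one_mul]
        ring

/-- In parabolic variables the kernel `g` is fixed and the parameters sit in the continuous function
`q`, so dominated convergence applies, including at `τ₀ = 0`. The bound on `g` admits both `gauss z`
and `gauss z * z j`. -/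
theorem IsWeight.continuousAt_integral_kernel_mul (hw : IsWeight a w) (hgc : Continuous g)
    (hg : ∀ z, |g z| ≤ Real.exp ‖z‖ * gauss z) (hqc : Continuous (Function.uncurry q)) {B : ℝ}
    (x₀ : Euc n) (τ₀ s₀ : ℝ) (hq : ∀ᶠ s in 𝓝 s₀, ∀ y, |q y s| ≤ B * w y) :
    ContinuousAt (fun p : Euc n × ℝ × ℝ => ∫ z, g z * q (p.1 - √p.2.1 • z) p.2.2)
      (x₀, τ₀, s₀) := by
  have hcont : ∀ z, Continuous (fun p : Euc n × ℝ × ℝ => g z * q (p.1 - √p.2.1 • z) p.2.2) :=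
    fun z => continuous_const.mul (hqc.comp (f := fun p : Euc n × ℝ × ℝ =>
      (p.1 - √p.2.1 • z, p.2.2)) (by fun_prop))
  refine continuousAt_of_dominated
    (bound := fun z => B * (w x₀ * Real.exp a) *
      (Real.exp ((a * √(τ₀ + 1) + 1) * ‖z‖) * gauss z)) ?_ ?_
    ((integrable_exp_mul_gauss _).const_mul _) (ae_of_all _ fun z => (hcont z).continuousAt)
  · exact Eventually.of_forall fun p => (hgc.mul (hqc.comp (f := fun z : Euc n =>
      (p.1 - √p.2.1 • z, p.2.2)) (by fun_prop))).aestronglyMeasurable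
  · have h1 : ∀ᶠ p : Euc n × ℝ × ℝ in 𝓝 (x₀, τ₀, s₀), ∀ y, |q y p.2.2| ≤ B * w y :=
      (continuous_snd.snd.tendsto (x₀, τ₀, s₀)).eventually hq
    have h2 : ∀ᶠ p : Euc n × ℝ × ℝ in 𝓝 (x₀, τ₀, s₀), p.2.1 < τ₀ + 1 :=
      (continuous_snd.fst.tendsto (x₀, τ₀, s₀)).eventually (gt_mem_nhds (lt_add_one τ₀))
    have h3 : ∀ᶠ p : Euc n × ℝ × ℝ in 𝓝 (x₀, τ₀, s₀), p.1 ∈ Metric.ball x₀ 1 :=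
      (continuous_fst.tendsto (x₀, τ₀, s₀)).eventually (Metric.ball_mem_nhds x₀ one_pos)
    filter_upwards [h1, h2, h3] with p hp1 hp2 hp3
    refine ae_of_all _ fun z => hw.abs_kernel_mul_le hg hp1 hp2.le ?_ z
    rw [← dist_eq_norm, dist_comm]
    exact (Metric.mem_ball.mp hp3).le

theorem abs_gauss_le (z : Euc n) : |gauss z| ≤ Real.exp ‖z‖ * gauss z := by
  rw [abs_of_pos (gauss_pos z)]
  exact le_mul_of_one_le_left (gauss_pos z).le (Real.one_le_exp (norm_nonneg z))

theorem abs_gauss_mul_coord_le (j : Fin n) (z : Euc n) :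
    |gauss z * z j| ≤ Real.exp ‖z‖ * gauss z := by
  rw [abs_mul, abs_of_pos (gauss_pos z), mul_comm]
  exact mul_le_mul_of_nonneg_right ((abs_coord_le z j).trans (norm_le_exp_norm z)) (gauss_pos z).le

theorem IsWeight.isTame_heatS (hw : IsWeight a w) {q : Euc n → ℝ} (hqc : Continuous q) {B : ℝ}
    (hq : ∀ y, |q y| ≤ B * w y) : IsTame w (fun x t => heatS t q x) := by
  refine ⟨continuous_iff_continuousAt.mpr fun ⟨x, t⟩ => ?_, fun T =>
    ⟨_, fun y s hs => hw.abs_heatS_le hq hs.2 y⟩⟩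
  have h := hw.continuousAt_integral_kernel_mul continuous_gauss abs_gauss_le
    (q := fun y _ => q y) (hqc.comp continuous_fst) (B := B) x t 0 (Eventually.of_forall fun _ => hq)
  exact ContinuousAt.comp (x := (x, t)) (f := fun p : Euc n × ℝ => (p.1, p.2, (0 : ℝ))) h
    (by fun_prop)

/-- The potential of `q` for the kernel `ρ(τ) g(z)` in parabolic coordinates. -/
def timeConv (ρ : ℝ → ℝ) (g : Euc n → ℝ) (q : Euc n → ℝ → ℝ) (x : Euc n) (t : ℝ) : ℝ :=
  ∫ s in Ioo 0 t, ρ (t - s) * ∫ z, g z * q (x - √(t - s) • z) s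

/-- The substitution `τ = t - s` fixes the singularity of `ρ` at `τ = 0` and the domain of
integration; `t` remains only in `q` and in an indicator. -/
theorem timeConv_eq (ρ : ℝ → ℝ) (g : Euc n → ℝ) (q : Euc n → ℝ → ℝ) (x : Euc n) {t T : ℝ}
    (htT : t ≤ T) : timeConv ρ g q x t
      = ∫ τ in Ioo 0 T, indicator (Iio t) (fun τ => ρ τ * ∫ z, g z * q (x - √τ • z) (t - τ)) τ := by
  rw [timeConv, ← integral_indicator measurableSet_Ioo, ← integral_sub_left_eq_self _ volume t,
    ← integral_indicator measurableSet_Ioo]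
  congr 1
  ext τ
  by_cases hτ : τ ∈ Ioo 0 t
  · have h1 : t - τ ∈ Ioo 0 t := ⟨by linarith [hτ.2], by linarith [hτ.1]⟩
    have h2 : τ ∈ Ioo 0 T := ⟨hτ.1, hτ.2.trans_le htT⟩
    rw [indicator_of_mem h1, indicator_of_mem h2, indicator_of_mem (mem_Iio.mpr hτ.2),
      sub_sub_cancel]
  · have h0 : t - τ ∉ Ioo 0 t := fun h => hτ ⟨by linarith [h.2], by linarith [h.1]⟩
    rw [indicator_of_notMem h0]
    by_cases h1 : τ ∈ Ioo 0 T
    · have h2 : τ ∉ Iio t := fun h => hτ ⟨h1.1, h⟩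
      rw [indicator_of_mem h1, indicator_of_notMem h2]
    · rw [indicator_of_notMem h1]

theorem IsWeight.continuous_timeConv (hw : IsWeight a w) {ρ : ℝ → ℝ} (hρm : Measurable ρ)
    (hρ : ∀ T, IntegrableOn ρ (Ioo 0 T)) (hgc : Continuous g)
    (hg : ∀ z, |g z| ≤ Real.exp ‖z‖ * gauss z) (hq : IsTame w q) :
    Continuous (Function.uncurry (timeConv ρ g q)) := by
  refine continuous_iff_continuousAt.mpr fun ⟨x₀, t₀⟩ => ?_
  obtain ⟨B, hB⟩ := hq.bound (t₀ + 1)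
  have hx : ∀ᶠ p : Euc n × ℝ in 𝓝 (x₀, t₀), p.1 ∈ Metric.ball x₀ 1 :=
    (continuous_fst.tendsto (x₀, t₀)).eventually (Metric.ball_mem_nhds x₀ one_pos)
  have ht : ∀ᶠ p : Euc n × ℝ in 𝓝 (x₀, t₀), p.2 < t₀ + 1 :=
    (continuous_snd.tendsto (x₀, t₀)).eventually (gt_mem_nhds (lt_add_one t₀))
  have heq : Function.uncurry (timeConv ρ g q) =ᶠ[𝓝 (x₀, t₀)] fun p =>
      ∫ τ in Ioo 0 (t₀ + 1), indicator (Iio p.2)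
        (fun τ => ρ τ * ∫ z, g z * q (p.1 - √τ • z) (p.2 - τ)) τ := by
    filter_upwards [ht] with p hp using timeConv_eq ρ g q p.1 hp.le
  refine ContinuousAt.congr ?_ heq.symm
  refine continuousAt_of_dominated (bound := fun τ => ‖ρ τ‖ *
    ∫ z : Euc n, B * (w x₀ * Real.exp a) *
      (Real.exp ((a * √(t₀ + 1) + 1) * ‖z‖) * gauss z)) ?_ ?_ ?_ ?_
  · refine Eventually.of_forall fun p => ?_
    have h1 : Continuous (fun r : ℝ × Euc n => g r.2 * q (p.1 - √r.1 • r.2) (p.2 - r.1)) :=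
      (hgc.comp continuous_snd).mul (hq.continuous.comp (f := fun r : ℝ × Euc n =>
        (p.1 - √r.1 • r.2, p.2 - r.1)) (by fun_prop))
    have h2 := (h1.measurable.stronglyMeasurable.integral_prod_right' (ν := volume)).measurable
    exact ((hρm.mul h2).indicator measurableSet_Iio).aestronglyMeasurable
  · filter_upwards [hx, ht] with p hp1 hp2
    refine ae_restrict_of_forall_mem measurableSet_Ioo fun τ hτ => ?_
    by_cases h : τ ∈ Iio p.2
    · rw [indicator_of_mem h, norm_mul]
      refine mul_le_mul_of_nonneg_left ?_ (norm_nonneg _)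
      refine norm_integral_le_of_norm_le ((integrable_exp_mul_gauss _).const_mul _)
        (ae_of_all _ fun z => hw.abs_kernel_mul_le hg (s := p.2 - τ) (fun y => hB y _
          ⟨sub_nonneg.mpr (le_of_lt h), by linarith [hτ.1]⟩) hτ.2.le ?_ z)
      rw [← dist_eq_norm, dist_comm]
      exact (Metric.mem_ball.mp hp1).le
    · rw [indicator_of_notMem h, norm_zero]
      refine mul_nonneg (norm_nonneg _) (integral_nonneg fun z => ?_)
      have hB0 : 0 ≤ B := nonneg_of_mul_nonneg_left ((abs_nonneg _).trans
        (hB x₀ 0 ⟨le_rfl, (hτ.1.trans hτ.2).le⟩)) (hw.pos x₀)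
      have := (gauss_pos z).le
      have := (hw.pos x₀).le
      positivity
  · exact (hρ _).norm.mul_const _
  -- The indicator of `Iio t` is locally constant in `t` near `t₀` unless `τ = t₀`, and one point is
  -- negligible.
  · have hne : ∀ᵐ τ ∂(volume.restrict (Ioo 0 (t₀ + 1))), τ ≠ t₀ :=
      ae_restrict_of_ae (Measure.ae_ne volume t₀)
    filter_upwards [hne, ae_restrict_mem measurableSet_Ioo] with τ hτ hτT
    rcases lt_or_gt_of_ne hτ with h | h
    · have h1 : ∀ᶠ p : Euc n × ℝ in 𝓝 (x₀, t₀), τ < p.2 :=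
        (continuous_snd.tendsto (x₀, t₀)).eventually (lt_mem_nhds h)
      have h2 : ContinuousAt (fun p : Euc n × ℝ => ρ τ * ∫ z, g z * q (p.1 - √τ • z) (p.2 - τ))
          (x₀, t₀) := by
        refine continuousAt_const.mul ?_
        have h3 := hw.continuousAt_integral_kernel_mul hgc hg hq.continuous (B := B) x₀ τ (t₀ - τ)
          (by
            filter_upwards [Icc_mem_nhds (sub_pos.mpr h)
              (show t₀ - τ < t₀ + 1 by linarith [hτT.1])] with s hs y using hB y s hs)
        exact ContinuousAt.comp (x := (x₀, t₀)) (f := fun p : Euc n × ℝ => (p.1, τ, p.2 - τ)) h3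
          (by fun_prop)
      refine h2.congr ?_
      filter_upwards [h1] with p hp
      rw [indicator_of_mem (mem_Iio.mpr hp)]
    · have h1 : ∀ᶠ p : Euc n × ℝ in 𝓝 (x₀, t₀), p.2 < τ :=
        (continuous_snd.tendsto (x₀, t₀)).eventually (gt_mem_nhds h)
      refine (continuousAt_const (y := (0 : ℝ))).congr ?_
      filter_upwards [h1] with p hp
      rw [indicator_of_notMem (notMem_Iio.mpr hp.le)]

theorem IsWeight.isTame_duh (hw : IsWeight a w) (hq : IsTame w q) : IsTame w (duh q) := by
  constructor
  · have h := hw.continuous_timeConv (ρ := fun _ => 1) measurable_const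
      (fun T => integrableOn_const (by simp)) continuous_gauss abs_gauss_le hq
    convert h using 2
    ext x t
    simp only [timeConv, one_mul]
    rfl
  · intro T
    obtain ⟨B, hB⟩ := hq.bound T
    have hB0 : 0 ≤ |B| := abs_nonneg B
    refine ⟨expMoment n (a * √T) * |B| * T, fun y s hs => ?_⟩
    refine (hw.abs_duh_le 0 (B := |B|) (fun y r hr => ?_) hs y).trans ?_
    · rw [pow_zero, mul_one]
      exact (hB y r (Ioo_subset_Icc_self hr)).trans
        (mul_le_mul_of_nonneg_right (le_abs_self B) (hw.pos y).le)
    · have := (expMoment_pos (n := n) (a * √T)).le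
      have := (hw.pos y).le
      simp only [zero_add, pow_one, Nat.cast_zero, div_one]
      have := hs.2
      gcongr

theorem integrableOn_inv_sqrt (T : ℝ) : IntegrableOn (fun τ => -(1 / (2 * √τ))) (Ioo 0 T) := by
  rcases le_or_gt T 0 with hT | hT
  · simp [Ioo_eq_empty (not_lt.mpr hT)]
  have h1 : IntervalIntegrable (fun r : ℝ => r ^ (-(1 / 2) : ℝ)) volume 0 T :=
    intervalIntegral.intervalIntegrable_rpow' (by norm_num)
  have h3 := ((intervalIntegrable_iff_integrableOn_Ioo_of_le hT.le).mp h1).const_mul (-(1 / 2))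
  refine (IntegrableOn.congr_fun h3 (fun s hs => ?_) measurableSet_Ioo)
  rw [Real.rpow_neg hs.1.le, ← Real.sqrt_eq_rpow]
  field_simp

theorem IsWeight.gradDuh_coord (hw : IsWeight a w) (hq : IsTame w q) (x : Euc n) (t : ℝ)
    (j : Fin n) : gradDuh q x t j = ∫ s in Ioo 0 t, gradS (t - s) (fun y => q y s) x j := by
  obtain ⟨B, hB⟩ := hq.bound t
  have hi : IntegrableOn (fun s => gradS (t - s) (fun y => q y s) x) (Ioo 0 t) := by
    refine Integrable.mono' ((integrableOn_inv_sqrt_sub t).mul_const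
      (expMoment n (a * √t + 1) * B * w x)) (measurable_gradS (q := fun s y => q y s)
      (by fun_prop) measurable_const
      (hq.continuous.measurable.comp measurable_swap)).aestronglyMeasurable ?_
    refine ae_restrict_of_forall_mem measurableSet_Ioo fun s hs => ?_
    exact hw.norm_gradS_le (fun y => hB y s (Ioo_subset_Icc_self hs)) (by linarith [hs.1]) x
  rw [gradDuh, eval_integral_piLp fun i => Integrable.eval_piLp hi i]

theorem IsWeight.gradS_coord (hw : IsWeight a w) {q : Euc n → ℝ} (hqm : Measurable q) {B : ℝ}
    (hq : ∀ y, |q y| ≤ B * w y) (τ : ℝ) (x : Euc n) (j : Fin n) :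
    gradS τ q x j = -(1 / (2 * √τ)) * ∫ z, gauss z * z j * q (x - √τ • z) := by
  rw [gradS, PiLp.smul_apply, smul_eq_mul,
    eval_integral_piLp fun i => Integrable.eval_piLp (hw.integrable_gauss_smul hqm hq τ x) i]
  congr 2
  ext z
  rw [PiLp.smul_apply, smul_eq_mul]
  ring

theorem IsWeight.continuous_gradDuh_coord (hw : IsWeight a w) (hq : IsTame w q) (j : Fin n) :
    Continuous (Function.uncurry fun x t => gradDuh q x t j) := by
  have h := hw.continuous_timeConv (ρ := fun τ => -(1 / (2 * √τ))) (by fun_prop)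
    integrableOn_inv_sqrt (g := fun z : Euc n => gauss z * z j)
    (continuous_gauss.mul (by fun_prop)) (abs_gauss_mul_coord_le j) hq
  convert h using 2
  ext x t
  rw [hw.gradDuh_coord hq, timeConv]
  obtain ⟨B, hB⟩ := hq.bound t
  refine setIntegral_congr_fun measurableSet_Ioo fun s hs => ?_
  exact hw.gradS_coord (hq.continuous.comp (by fun_prop : Continuous fun y : Euc n =>
    (y, s))).measurable (fun y => hB y s (Ioo_subset_Icc_self hs)) _ x j

theorem IsTame.mul_potential {M : ℝ} {F : Euc n → ℝ → ℝ} (hF : IsPotential M F)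
    (hFc : Continuous (Function.uncurry F)) (hq : IsTame w q) :
    IsTame w (fun x t => F x t * q x t) := by
  refine ⟨hFc.mul hq.continuous, fun T => ?_⟩
  obtain ⟨B, hB⟩ := hq.bound T
  refine ⟨M * B, fun y s hs => ?_⟩
  rw [mul_assoc]
  exact hF.abs_mul_le (hB y s hs)

theorem isTame_dysonTerm (hw : IsWeight a w) {M : ℝ} {F : Euc n → ℝ → ℝ} (hF : IsPotential M F)
    (hFc : Continuous (Function.uncurry F)) (k : ℕ) : IsTame w (dysonTerm F w k) := by
  induction k with
  | zero =>
    exact hw.isTame_heatS hw.continuous (B := 1) fun y => by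
      rw [abs_of_pos (hw.pos y), one_mul]
  | succ k ih => exact hw.isTame_duh (ih.mul_potential hF hFc)

theorem heatS_of_nonpos (q : Euc n → ℝ) (x : Euc n) {t : ℝ} (ht : t ≤ 0) : heatS t q x = q x := by
  rw [heatS, Real.sqrt_eq_zero_of_nonpos ht]
  simp only [zero_smul, sub_zero]
  rw [integral_mul_const, integral_gauss, one_mul]

theorem dyson_of_nonpos (w : Euc n → ℝ) (F : Euc n → ℝ → ℝ) (x : Euc n) {t : ℝ} (ht : t ≤ 0) :
    dyson F w x t = w x := by
  rw [dyson, tsum_eq_single 0]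
  · exact heatS_of_nonpos w x ht
  · rintro (_ | k) hk
    · exact absurd rfl hk
    · exact duh_of_nonpos _ _ ht

theorem dyson_eq (hw : IsWeight a w) {M : ℝ} {F : Euc n → ℝ → ℝ} (hF : IsPotential M F)
    (x : Euc n) (t : ℝ) :
    dyson F w x t = heatS t w x + duh (fun y s => F y s * dyson F w y s) x t := by
  rcases le_total t 0 with ht | ht
  · rw [duh_of_nonpos _ _ ht, dyson_of_nonpos _ _ _ ht, heatS_of_nonpos _ _ ht, add_zero]
  · exact (isMild_dyson hw hF t).eq x t ⟨ht, le_rfl⟩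

theorem isTame_dyson (hw : IsWeight a w) {M : ℝ} {F : Euc n → ℝ → ℝ} (hF : IsPotential M F)
    (hFc : Continuous (Function.uncurry F)) : IsTame w (dyson F w) := by
  refine ⟨continuous_iff_continuousAt.mpr fun ⟨x₀, t₀⟩ => ?_, fun T => exists_bound_dyson hw hF T⟩
  -- The sum is constant in time for `t ≤ 0`, so it is enough to prove continuity on `t ≥ 0`, where
  -- the tail bounds give locally uniform convergence.
  have hmax : dyson F w = fun x t => dyson F w x (max t 0) := by
    ext x t
    rcases le_total t 0 with ht | ht
    · rw [max_eq_right ht, dyson_of_nonpos _ _ _ ht, dyson_zero]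
    · rw [max_eq_left ht]
  obtain ⟨ε, hε, hb⟩ := exists_tail_bound hw hF (max t₀ 0 + 1)
  suffices h : ContinuousWithinAt (Function.uncurry (dyson F w)) (univ ×ˢ Ici 0)
      (x₀, max t₀ 0) by
    rw [hmax]
    have h2 : ContinuousWithinAt (fun p : Euc n × ℝ => (p.1, max p.2 0)) univ (x₀, t₀) :=
      (by fun_prop : Continuous fun p : Euc n × ℝ => (p.1, max p.2 0)).continuousWithinAt
    have hm : MapsTo (fun p : Euc n × ℝ => (p.1, max p.2 0)) univ (univ ×ˢ Ici 0) :=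
      fun p _ => ⟨mem_univ _, mem_Ici.mpr (le_max_right _ _)⟩
    exact (continuousWithinAt_univ _ _).mp (ContinuousWithinAt.comp (t := univ ×ˢ Ici 0)
      (f := fun p : Euc n × ℝ => (p.1, max p.2 0)) (x := (x₀, t₀)) h h2 hm)
  have hU : Metric.ball x₀ 1 ×ˢ Iio (max t₀ 0 + 1) ∈ 𝓝 (x₀, max t₀ 0) :=
    prod_mem_nhds (Metric.ball_mem_nhds x₀ one_pos) (Iio_mem_nhds (lt_add_one _))
  rw [← continuousWithinAt_inter hU]
  have hlim : TendstoUniformlyOn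
      (fun N (p : Euc n × ℝ) => ∑ k ∈ Finset.range N, dysonTerm F w k p.1 p.2)
      (Function.uncurry (dyson F w)) atTop
      (univ ×ˢ Ici 0 ∩ Metric.ball x₀ 1 ×ˢ Iio (max t₀ 0 + 1)) := by
    rw [Metric.tendstoUniformlyOn_iff]
    intro δ hδ
    have h1 : Tendsto (fun N => |ε N| * (w x₀ * Real.exp a)) atTop (𝓝 0) := by
      simpa using hε.abs.mul_const (w x₀ * Real.exp a)
    filter_upwards [h1.eventually (gt_mem_nhds hδ)] with N hN p hp
    refine lt_of_le_of_lt ?_ hN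
    rw [Real.dist_eq]
    refine (hb N p.1 p.2 ⟨hp.1.2, le_of_lt hp.2.2⟩).trans ?_
    refine (mul_le_mul_of_nonneg_right (le_abs_self _) (hw.pos _).le).trans
      (mul_le_mul_of_nonneg_left ?_ (abs_nonneg _))
    refine (hw.le_mul_exp x₀ p.1).trans (mul_le_mul_of_nonneg_left ?_ (hw.pos _).le)
    refine Real.exp_le_exp.mpr (mul_le_of_le_one_right hw.rate_nonneg ?_)
    rw [← dist_eq_norm, dist_comm]
    exact (Metric.mem_ball.mp hp.2.1).le
  refine hlim.continuousOn (Eventually.of_forall fun N => ?_).frequently (x₀, max t₀ 0)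
    ⟨⟨mem_univ _, mem_Ici.mpr (le_max_right _ _)⟩, mem_of_mem_nhds hU⟩
  exact (continuous_finsetSum _ fun k _ =>
    (isTame_dysonTerm hw hF hFc k).continuous).continuousOn

end

/-! ### Space derivatives of heat potentials of compactly supported sources -/

theorem innerSL_eq_formOf (v : Euc n) : innerSL ℝ v = formOf fun j => v j := by
  ext z
  simp [formOf, PiLp.inner_apply, mul_comm]

theorem SpaceReg.contDiff_slice_one {k : ℕ} {q : Euc n → ℝ → ℝ}
    (h : SpaceReg 0 univ univ (k + 1) q) (t : ℝ) : ContDiff ℝ 1 (fun x => q x t) := by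
  rw [contDiff_one_iff_fderiv]
  have hd : ∀ x, DifferentiableAt ℝ (fun x => q x t) x := fun x => h.2.1 t (mem_univ _) x (mem_univ _)
  refine ⟨hd, ?_⟩
  rw [funext fun x => (hasFDerivAt_formOf (hd x)).fderiv]
  refine continuous_finsetSum _ fun j _ =>
    Continuous.smul (f := fun x => dX j q x t) ?_ continuous_const
  have hj := (h.2.2 j).contDiffOn.continuousOn
  rw [univ_prod_univ, continuousOn_univ] at hj
  exact hj.comp (by fun_prop : Continuous fun x : Euc n => (x, t))

theorem SpaceReg.continuous {k : ℕ} {q : Euc n → ℝ → ℝ} (h : SpaceReg 0 univ univ k q) :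
    Continuous (Function.uncurry q) := by
  have := h.contDiffOn.continuousOn
  rwa [univ_prod_univ, continuousOn_univ] at this

theorem isTame_of_isCompact {q : Euc n → ℝ → ℝ} (hq : Continuous (Function.uncurry q))
    {K : Set (Euc n)} (hK : IsCompact K) (h0 : ∀ x ∉ K, ∀ t, q x t = 0) :
    IsTame (fun _ => 1) q := by
  refine ⟨hq, fun T => ?_⟩
  obtain ⟨C, hC⟩ := (hK.prod (isCompact_Icc (a := 0) (b := T))).exists_bound_of_continuousOn
    hq.continuousOn
  refine ⟨max C 0, fun y s hs => ?_⟩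
  rw [mul_one]
  by_cases hy : y ∈ K
  · exact (hC (y, s) ⟨hy, hs⟩).trans (le_max_left _ _)
  · rw [h0 y hy, abs_zero]
    exact le_max_right _ _

theorem dX_eq_zero_of_notMem {q : Euc n → ℝ → ℝ} {K : Set (Euc n)} (hK : IsCompact K)
    (h0 : ∀ x ∉ K, ∀ t, q x t = 0) (j : Fin n) : ∀ x ∉ K, ∀ t, dX j q x t = 0 := by
  intro x hx t
  have : (fun y => q y t) =ᶠ[𝓝 x] fun _ => 0 := by
    filter_upwards [hK.isClosed.isOpen_compl.mem_nhds hx] with y hy using h0 y hy t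
  rw [dX, partialX, this.fderiv_eq]
  simp

/-- For a differentiable function the derivative can be put on the function instead of the kernel,
and the factor `1 / √τ` cancels. -/
theorem gradS_coord_eq_heatS {η : Euc n → ℝ} (h : ContDiff ℝ 1 η) {C C' : ℝ}
    (hC : ∀ x, |η x| ≤ C) (j : Fin n) (hC' : ∀ x, |partialX j η x| ≤ C') {τ : ℝ} (hτ : 0 < τ)
    (x : Euc n) : gradS τ η x j = heatS τ (partialX j η) x := by
  rw [isWeight_one.gradS_coord h.continuous.measurable (B := C) (by simpa using hC),
    integral_gauss_coord_mul_partialX h hC j hC', heatS]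
  have := Real.sqrt_pos.mpr hτ
  field_simp

theorem gradDuh_coord_eq_duh {k : ℕ} {q : Euc n → ℝ → ℝ} (h : SpaceReg 0 univ univ (k + 1) q)
    {K : Set (Euc n)} (hK : IsCompact K) (h0 : ∀ x ∉ K, ∀ t, q x t = 0) (j : Fin n) (x : Euc n)
    (t : ℝ) : gradDuh q x t j = duh (dX j q) x t := by
  have hq := isTame_of_isCompact h.continuous hK h0
  obtain ⟨C, hC⟩ := hq.bound t
  obtain ⟨C', hC'⟩ := (isTame_of_isCompact (h.2.2 j).continuous hK
    (dX_eq_zero_of_notMem hK h0 j)).bound t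
  rw [isWeight_one.gradDuh_coord hq, duh]
  refine setIntegral_congr_fun measurableSet_Ioo fun s hs => ?_
  have hs' := Ioo_subset_Icc_self hs
  exact gradS_coord_eq_heatS (h.contDiff_slice_one s) (C := C)
    (fun y => by simpa using hC y s hs') j (C' := C') (fun y => by simpa [dX] using hC' y s hs')
    (sub_pos.mpr hs.2) x

/-- The gain of one derivative: `k` derivatives are put on the source, and the last one on the
kernel, where its singularity is integrable in time. Compact support makes all derivatives of `q`
bounded on bounded time intervals. -/
theorem spaceReg_duh {k : ℕ} {q : Euc n → ℝ → ℝ} (h : SpaceReg 0 univ univ k q)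
    {K : Set (Euc n)} (hK : IsCompact K) (h0 : ∀ x ∉ K, ∀ t, q x t = 0) :
    SpaceReg 0 univ univ (k + 1) (duh q) := by
  have key : ∀ {k : ℕ} {q : Euc n → ℝ → ℝ}, SpaceReg 0 univ univ k q →
      (∀ x ∉ K, ∀ t, q x t = 0) →
      (∀ j, SpaceReg 0 univ univ k fun x t => gradDuh q x t j) →
      SpaceReg 0 univ univ (k + 1) (duh q) := by
    intro k q h h0 hj
    have hq := isTame_of_isCompact h.continuous hK h0
    refine SpaceReg.of_hasFDerivAt isOpen_univ
      (contDiffOn_zero.mpr (isWeight_one.isTame_duh hq).continuous.continuousOn)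
      (fun t _ x _ => ?_) hj
    obtain ⟨C, hC⟩ := hq.bound t
    have := isWeight_one.hasFDerivAt_duh hq.continuous.measurable (t := t) (B := C)
      (fun y s hs => hC y s (Ioo_subset_Icc_self hs)) x
    rwa [innerSL_eq_formOf] at this
  induction k generalizing q with
  | zero =>
    refine key h h0 fun j => contDiffOn_zero.mpr (Continuous.continuousOn ?_)
    exact isWeight_one.continuous_gradDuh_coord (isTame_of_isCompact h.continuous hK h0) j
  | succ k ih =>
    refine key h h0 fun j => (ih (h.2.2 j) (dX_eq_zero_of_notMem hK h0 j)).congr isOpen_univ ?_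
    exact fun x _ t _ => (gradDuh_coord_eq_duh h hK h0 j x t).symm

theorem spaceReg_heatS {η : Euc n → ℝ} (h : ContDiff ℝ ∞ η) (hc : HasCompactSupport η) (k : ℕ) :
    SpaceReg 0 univ univ k fun x t => heatS t η x := by
  have hcont : ∀ {η : Euc n → ℝ}, ContDiff ℝ ∞ η → HasCompactSupport η →
      ContDiffOn ℝ 0 (Function.uncurry fun x t => heatS t η x) (univ ×ˢ univ) := by
    intro η h hc
    obtain ⟨C, hC⟩ := HasCompactSupport.exists_norm_le hc h.continuous
    exact contDiffOn_zero.mpr (isWeight_one.isTame_heatS h.continuous (B := C)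
      (fun y => by simpa using hC y)).continuous.continuousOn
  induction k generalizing η with
  | zero => exact hcont h hc
  | succ k ih =>
    refine SpaceReg.of_hasFDerivAt isOpen_univ (hcont h hc)
      (f' := fun j x t => heatS t (partialX j η) x) (fun t _ x _ => ?_)
      fun j => ih (contDiff_partialX h j) (hasCompactSupport_partialX hc j)
    obtain ⟨C, hC⟩ := HasCompactSupport.exists_norm_le hc h.continuous
    rcases le_or_gt t 0 with ht | ht
    · simp only [heatS_of_nonpos _ _ ht]
      exact hasFDerivAt_formOf (h.differentiable (by simp) x)
    · have h1 := isWeight_one.hasFDerivAt_heatS h.continuous.measurable (B := C)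
        (fun y => by simpa using hC y) ht x
      have h2 : ∀ j, gradS t η x j = heatS t (partialX j η) x := fun j => by
        obtain ⟨C', hC'⟩ := HasCompactSupport.exists_norm_le
          (hasCompactSupport_partialX hc j) (contDiff_partialX h j).continuous
        exact gradS_coord_eq_heatS (h.of_le (by simp)) hC j hC' ht x
      rw [innerSL_eq_formOf] at h1
      simpa only [h2] using h1

/-! ### The heat kernel away from the origin -/

/-- The heat kernel, extended by zero to nonpositive times. -/
def kern (z : Euc n) (τ : ℝ) : ℝ := if 0 < τ then heatKernel z τ else 0

/-- The class of functions generated from the heat kernel by taking space derivatives. -/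
inductive IsFarKernel : (Euc n → ℝ → ℝ) → Prop
  | kern : IsFarKernel kern
  | coord (i : Fin n) {κ : Euc n → ℝ → ℝ} :
      IsFarKernel κ → IsFarKernel fun z τ => z i * κ z τ
  | inv {κ : Euc n → ℝ → ℝ} : IsFarKernel κ → IsFarKernel fun z τ => τ⁻¹ * κ z τ
  | add {κ κ' : Euc n → ℝ → ℝ} :
      IsFarKernel κ → IsFarKernel κ' → IsFarKernel fun z τ => κ z τ + κ' z τ
  | const_mul (c : ℝ) {κ : Euc n → ℝ → ℝ} : IsFarKernel κ → IsFarKernel fun z τ => c * κ z τ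

theorem formOf_apply (v : Fin n → ℝ) (z : Euc n) : formOf v z = ∑ j, v j * z j := by
  simp [formOf]

theorem one_div_rpow_half_le {τ : ℝ} (hτ : 0 < τ) :
    1 / (4 * Real.pi * τ) ^ ((n : ℝ) / 2) ≤ 1 + τ⁻¹ ^ n := by
  have hpi : 1 ≤ 4 * Real.pi := by linarith [Real.pi_gt_three]
  have hy : 0 < 4 * Real.pi * τ := by positivity
  have hle : τ ≤ 4 * Real.pi * τ := le_mul_of_one_le_left hτ.le hpi
  have hx : 0 ≤ τ⁻¹ ^ n := by positivity
  rcases le_total 1 (4 * Real.pi * τ) with h | h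
  · have h1 : 1 ≤ (4 * Real.pi * τ) ^ ((n : ℝ) / 2) := Real.one_le_rpow h (by positivity)
    have h2 : 1 / (4 * Real.pi * τ) ^ ((n : ℝ) / 2) ≤ 1 := (div_le_one (by linarith)).mpr h1
    linarith
  · have h1 : τ ^ n ≤ (4 * Real.pi * τ) ^ ((n : ℝ) / 2) := by
      refine (pow_le_pow_left₀ hτ.le hle n).trans ?_
      rw [← Real.rpow_natCast]
      refine Real.rpow_le_rpow_of_exponent_ge hy h ?_
      have : (0 : ℝ) ≤ n := by positivity
      linarith
    have h2 : 1 / (4 * Real.pi * τ) ^ ((n : ℝ) / 2) ≤ 1 / τ ^ n :=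
      one_div_le_one_div_of_le (by positivity) h1
    rw [inv_pow, ← one_div]
    linarith

theorem pow_le_exp_div (m : ℕ) {x : ℝ} (hx : 0 ≤ x) :
    x ^ m ≤ 8 ^ m * m.factorial * Real.exp (x / 8) := by
  have h := Real.pow_div_factorial_le_exp (x / 8) (by positivity) m
  rw [div_le_iff₀ (by positivity), div_pow, div_le_iff₀ (by positivity)] at h
  linarith

/-- Away from `z = 0` the Gaussian factor beats every power of `τ⁻¹` and every exponential in `z` at
the same time. -/
theorem exists_kern_bound (l : ℕ) (b T : ℝ) : ∃ C, 0 ≤ C ∧ ∀ z : Euc n, 1 ≤ ‖z‖ →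
    ∀ τ ∈ Ioc 0 T, τ⁻¹ ^ l * |kern z τ| ≤ C * Real.exp (-b * ‖z‖) := by
  refine ⟨(8 ^ l * l.factorial + 8 ^ (l + n) * (l + n).factorial) * Real.exp (2 * T * b ^ 2),
    by positivity, fun z hz τ hτ => ?_⟩
  have hτ0 := hτ.1
  have hT : 0 < T := hτ.1.trans_le hτ.2
  have hx : 0 ≤ τ⁻¹ := by positivity
  have hk : |kern z τ| ≤ (1 + τ⁻¹ ^ n) * Real.exp (-(‖z‖ ^ 2) / (4 * τ)) := by
    rw [kern, if_pos hτ0, heatKernel, abs_of_nonneg (by positivity)]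
    exact mul_le_mul_of_nonneg_right (one_div_rpow_half_le hτ0) (Real.exp_pos _).le
  -- The exponent is halved: since `‖z‖ ≥ 1`, one half is at least `τ⁻¹ / 8` and absorbs the powers
  -- of `τ⁻¹`; the other, with `τ ≤ T` and the square `(‖z‖ - 4 T b)²`, gives decay at rate `b`.
  have he : Real.exp (-(‖z‖ ^ 2) / (4 * τ))
      ≤ Real.exp (-(τ⁻¹ / 8)) * (Real.exp (2 * T * b ^ 2) * Real.exp (-b * ‖z‖)) := by
    rw [← Real.exp_add, ← Real.exp_add]
    refine Real.exp_le_exp.mpr ?_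
    have h1 : 1 ≤ ‖z‖ ^ 2 := one_le_pow₀ hz
    have h2 : -(‖z‖ ^ 2) / (4 * τ) = -(τ⁻¹ * ‖z‖ ^ 2 / 8) - τ⁻¹ * ‖z‖ ^ 2 / 8 := by
      field_simp
      norm_num
    have h3 : τ⁻¹ * 1 ≤ τ⁻¹ * ‖z‖ ^ 2 := mul_le_mul_of_nonneg_left h1 hx
    have h4 : T⁻¹ * ‖z‖ ^ 2 ≤ τ⁻¹ * ‖z‖ ^ 2 :=
      mul_le_mul_of_nonneg_right (inv_anti₀ hτ0 hτ.2) (by positivity)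
    have h5 : 0 ≤ T⁻¹ * (‖z‖ - 4 * T * b) ^ 2 := by positivity
    have h6 : T⁻¹ * (‖z‖ - 4 * T * b) ^ 2
        = T⁻¹ * ‖z‖ ^ 2 - 8 * b * ‖z‖ + 16 * T * b ^ 2 := by
      field_simp
      ring
    rw [h2]
    linarith
  have hE : ∀ m : ℕ, τ⁻¹ ^ m * Real.exp (-(τ⁻¹ / 8)) ≤ 8 ^ m * m.factorial := by
    intro m
    rw [Real.exp_neg, ← div_eq_mul_inv, div_le_iff₀ (Real.exp_pos _)]
    exact pow_le_exp_div m hx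
  calc τ⁻¹ ^ l * |kern z τ|
      ≤ τ⁻¹ ^ l * ((1 + τ⁻¹ ^ n) * (Real.exp (-(τ⁻¹ / 8)) *
          (Real.exp (2 * T * b ^ 2) * Real.exp (-b * ‖z‖)))) := by
        refine mul_le_mul_of_nonneg_left (hk.trans (mul_le_mul_of_nonneg_left he ?_)) ?_ <;>
          positivity
    _ = (τ⁻¹ ^ l * Real.exp (-(τ⁻¹ / 8)) + τ⁻¹ ^ (l + n) * Real.exp (-(τ⁻¹ / 8))) *
          (Real.exp (2 * T * b ^ 2) * Real.exp (-b * ‖z‖)) := by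
        rw [pow_add]
        ring
    _ ≤ (8 ^ l * l.factorial + 8 ^ (l + n) * (l + n).factorial) *
          (Real.exp (2 * T * b ^ 2) * Real.exp (-b * ‖z‖)) :=
        mul_le_mul_of_nonneg_right (add_le_add (hE l) (hE (l + n))) (by positivity)
    _ = _ := by ring

namespace IsFarKernel

variable {κ : Euc n → ℝ → ℝ}

theorem eq_zero (h : IsFarKernel κ) (z : Euc n) {τ : ℝ} (hτ : τ ≤ 0) : κ z τ = 0 := by
  induction h with
  | kern => exact if_neg (not_lt.mpr hτ)
  | coord i _ ih => simp [ih]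
  | inv _ ih => simp [ih]
  | add _ _ ih ih' => simp [ih, ih']
  | const_mul c _ ih => simp [ih]

theorem continuousOn (h : IsFarKernel κ) :
    ContinuousOn (Function.uncurry κ) (univ ×ˢ Ioi 0) := by
  have hne : ∀ p ∈ (univ : Set (Euc n)) ×ˢ Ioi (0 : ℝ), p.2 ≠ 0 := fun p hp => (mem_Ioi.mp hp.2).ne'
  induction h with
  | kern =>
    have h1 : ContinuousOn (fun p : Euc n × ℝ => heatKernel p.1 p.2) (univ ×ˢ Ioi 0) := by
      refine ContinuousOn.mul (ContinuousOn.div continuousOn_const ?_ fun p hp => ?_) ?_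
      · refine ContinuousOn.rpow_const (by fun_prop) fun p hp => Or.inr (by positivity)
      · have : 0 < p.2 := hp.2
        positivity
      · refine Real.continuous_exp.comp_continuousOn (ContinuousOn.div (by fun_prop) (by fun_prop)
          fun p hp => ?_)
        exact mul_ne_zero four_ne_zero (hne p hp)
    exact h1.congr fun p hp => if_pos hp.2
  | coord i _ ih =>
    exact (((EuclideanSpace.proj i : Euc n →L[ℝ] ℝ).continuous.comp
      continuous_fst).continuousOn).mul ih
  | inv _ ih => exact (continuousOn_snd.inv₀ hne).mul ih
  | add _ _ ih ih' => exact ih.add ih'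
  | const_mul c _ ih => exact continuousOn_const.mul ih

theorem measurable (h : IsFarKernel κ) : Measurable (Function.uncurry κ) := by
  have h1 : Function.uncurry κ = indicator (univ ×ˢ Ioi 0) (Function.uncurry κ) := by
    ext p
    by_cases hp : p ∈ univ ×ˢ Ioi (0 : ℝ)
    · rw [indicator_of_mem hp]
    · rw [indicator_of_notMem hp]
      exact h.eq_zero p.1 (not_lt.mp fun h' => hp ⟨mem_univ _, h'⟩)
  have hs : MeasurableSet ((univ : Set (Euc n)) ×ˢ Ioi (0 : ℝ)) :=
    MeasurableSet.univ.prod measurableSet_Ioi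
  classical
  rw [h1, ← piecewise_eq_indicator]
  exact h.continuousOn.measurable_piecewise continuousOn_const hs

/-- Stated for all `l` and `b` so that the induction closes: a factor `τ⁻¹` raises `l` by one, and a
coordinate `zᵢ ≤ exp ‖z‖` raises `b` by one. -/
theorem exists_bound (h : IsFarKernel κ) (l : ℕ) (b T : ℝ) : ∃ C, 0 ≤ C ∧ ∀ z : Euc n, 1 ≤ ‖z‖ →
    ∀ τ ∈ Ioc 0 T, τ⁻¹ ^ l * |κ z τ| ≤ C * Real.exp (-b * ‖z‖) := by
  induction h generalizing l b with
  | kern => exact exists_kern_bound l b T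
  | @coord i κ _ ih =>
    obtain ⟨C, hC0, hC⟩ := ih l (b + 1)
    refine ⟨C, hC0, fun z hz τ hτ => ?_⟩
    have h1 : |z i| ≤ Real.exp ‖z‖ := (abs_coord_le z i).trans (norm_le_exp_norm z)
    calc τ⁻¹ ^ l * |z i * κ z τ| = |z i| * (τ⁻¹ ^ l * |κ z τ|) := by
          rw [abs_mul]
          ring
      _ ≤ Real.exp ‖z‖ * (C * Real.exp (-(b + 1) * ‖z‖)) := by
          have := hτ.1
          exact mul_le_mul h1 (hC z hz τ hτ) (by positivity) (Real.exp_pos _).le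
      _ = C * Real.exp (-b * ‖z‖) := by
          rw [mul_left_comm, ← Real.exp_add]
          ring_nf
  | @inv κ _ ih =>
    obtain ⟨C, hC0, hC⟩ := ih (l + 1) b
    refine ⟨C, hC0, fun z hz τ hτ => (le_of_eq ?_).trans (hC z hz τ hτ)⟩
    have := hτ.1
    rw [abs_mul, abs_of_pos (by positivity : 0 < τ⁻¹), pow_succ]
    ring
  | @add κ κ' _ _ ih ih' =>
    obtain ⟨C, hC0, hC⟩ := ih l b
    obtain ⟨C', hC0', hC'⟩ := ih' l b
    refine ⟨C + C', by positivity, fun z hz τ hτ => ?_⟩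
    have := hτ.1
    have h1 : τ⁻¹ ^ l * |κ z τ + κ' z τ| ≤ τ⁻¹ ^ l * (|κ z τ| + |κ' z τ|) :=
      mul_le_mul_of_nonneg_left (abs_add_le _ _) (by positivity)
    linarith [hC z hz τ hτ, hC' z hz τ hτ]
  | @const_mul c κ _ ih =>
    obtain ⟨C, hC0, hC⟩ := ih l b
    refine ⟨|c| * C, by positivity, fun z hz τ hτ => ?_⟩
    have := mul_le_mul_of_nonneg_left (hC z hz τ hτ) (abs_nonneg c)
    rw [abs_mul]
    linarith

theorem continuousAt (h : IsFarKernel κ) {z : Euc n} (hz : 1 < ‖z‖) (τ : ℝ) :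
    ContinuousAt (Function.uncurry κ) (z, τ) := by
  rcases lt_trichotomy τ 0 with hτ | rfl | hτ
  · refine (continuousAt_const (y := (0 : ℝ))).congr ?_
    filter_upwards [(continuous_snd.tendsto (z, τ)).eventually (gt_mem_nhds hτ)] with p hp
    exact (h.eq_zero p.1 (le_of_lt hp)).symm
  -- With `l = 1` the bound reads `|κ z τ| ≤ C τ`, so the extension by zero is continuous across `τ
  -- = 0`.
  · obtain ⟨C, hC0, hC⟩ := h.exists_bound 1 0 1
    have h0 : Function.uncurry κ (z, 0) = 0 := h.eq_zero z le_rfl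
    rw [ContinuousAt, h0]
    have hlim : Tendsto (fun p : Euc n × ℝ => C * |p.2|) (𝓝 (z, 0)) (𝓝 0) := by
      have : Continuous fun p : Euc n × ℝ => C * |p.2| := by fun_prop
      simpa using this.tendsto (z, 0)
    refine squeeze_zero_norm' ?_ hlim
    have h1 : ∀ᶠ p : Euc n × ℝ in 𝓝 (z, 0), 1 < ‖p.1‖ :=
      (continuous_fst.norm.tendsto (z, (0 : ℝ))).eventually (lt_mem_nhds hz)
    have h2 : ∀ᶠ p : Euc n × ℝ in 𝓝 (z, 0), p.2 < 1 :=
      (continuous_snd.tendsto (z, (0 : ℝ))).eventually (gt_mem_nhds one_pos)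
    filter_upwards [h1, h2] with p hp1 hp2
    rcases le_or_gt p.2 0 with hp | hp
    · have h3 : Function.uncurry κ p = 0 := h.eq_zero p.1 hp
      rw [h3, norm_zero]
      positivity
    · have h3 := hC p.1 hp1.le p.2 ⟨hp, hp2.le⟩
      rw [pow_one, neg_zero, zero_mul, Real.exp_zero, mul_one, inv_mul_le_iff₀ hp] at h3
      rw [abs_of_pos hp, mul_comm]
      exact h3
  · exact h.continuousOn.continuousAt ((isOpen_univ.prod isOpen_Ioi).mem_nhds ⟨mem_univ _, hτ⟩)

/-- The class is closed under space derivatives because `∂ⱼK = -(1/2) τ⁻¹ zⱼ K`; the generators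
other than the kernel follow by the product rule. -/
theorem exists_hasFDerivAt (h : IsFarKernel κ) : ∃ κ' : Fin n → Euc n → ℝ → ℝ,
    (∀ j, IsFarKernel (κ' j)) ∧
      ∀ z τ, HasFDerivAt (fun y => κ y τ) (formOf fun j => κ' j z τ) z := by
  induction h with
  | kern =>
    refine ⟨fun j z τ => -(1 / 2) * (τ⁻¹ * (z j * ColeHopf.kern z τ)), fun j =>
      const_mul _ (inv (coord j kern)), fun z τ => ?_⟩
    rcases le_or_gt τ 0 with hτ | hτ
    · have h1 : ∀ y : Euc n, ColeHopf.kern y τ = 0 := fun y => if_neg (not_lt.mpr hτ)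
      simp only [h1, mul_zero]
      refine (hasFDerivAt_const (0 : ℝ) z).congr_fderiv ?_
      ext y
      simp [formOf_apply]
    · have h1 : ∀ y : Euc n, ColeHopf.kern y τ = heatKernel y τ := fun y => if_pos hτ
      simp only [h1]
      refine (hasFDerivAt_heatKernel hτ z).congr_fderiv ?_
      rw [innerSL_eq_formOf]
      ext y
      rw [smul_apply, formOf_apply, formOf_apply, smul_eq_mul, Finset.mul_sum]
      refine Finset.sum_congr rfl fun j _ => ?_
      field_simp
  | @coord i κ h ih =>
    obtain ⟨κ', hκ', hd⟩ := ih
    refine ⟨fun j z τ => (if j = i then 1 else 0) * κ z τ + z i * κ' j z τ, fun j =>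
      (const_mul _ h).add (coord i (hκ' j)), fun z τ => ?_⟩
    refine (((EuclideanSpace.proj i : Euc n →L[ℝ] ℝ).hasFDerivAt (x := z)).mul
      (hd z τ)).congr_fderiv ?_
    ext y
    simp only [formOf_apply, add_apply, smul_apply,
      smul_eq_mul, Finset.mul_sum, add_mul, Finset.sum_add_distrib, PiLp.proj_apply]
    simp [add_comm, mul_assoc]
  | @inv κ h ih =>
    obtain ⟨κ', hκ', hd⟩ := ih
    refine ⟨fun j z τ => τ⁻¹ * κ' j z τ, fun j => inv (hκ' j), fun z τ => ?_⟩
    refine ((hd z τ).const_mul τ⁻¹).congr_fderiv ?_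
    ext y
    simp [formOf_apply, Finset.mul_sum, mul_assoc]
  | @add κ₁ κ₂ _ _ ih ih' =>
    obtain ⟨κ', hκ', hd⟩ := ih
    obtain ⟨κ'', hκ'', hd'⟩ := ih'
    refine ⟨fun j z τ => κ' j z τ + κ'' j z τ, fun j => (hκ' j).add (hκ'' j), fun z τ => ?_⟩
    refine ((hd z τ).add (hd' z τ)).congr_fderiv ?_
    ext y
    simp [formOf_apply, add_mul, Finset.sum_add_distrib]
  | @const_mul c κ h ih =>
    obtain ⟨κ', hκ', hd⟩ := ih
    refine ⟨fun j z τ => c * κ' j z τ, fun j => const_mul c (hκ' j), fun z τ => ?_⟩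
    refine ((hd z τ).const_mul c).congr_fderiv ?_
    ext y
    simp [formOf_apply, Finset.mul_sum, mul_assoc]

end IsFarKernel

/-! ### Potentials of distant sources -/

/-- A source `q` spread over the points `(Y, S)` of space-time with `S ≥ 0`, which is supported at
distance at least `2` from `x₀` and grows at most exponentially. -/
structure IsFarSource {Ω : Type*} [MeasurableSpace Ω] (μ : Measure Ω) (x₀ : Euc n)
    (Y : Ω → Euc n) (S q : Ω → ℝ) : Prop where
  measurable_space : Measurable Y
  measurable_time : Measurable S
  measurable_source : Measurable q
  time_nonneg : ∀ y, q y ≠ 0 → 0 ≤ S y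
  far : ∀ y, q y ≠ 0 → 2 ≤ ‖x₀ - Y y‖
  integrable : ∃ b, 0 ≤ b ∧ Integrable (fun y => Real.exp (-b * ‖Y y‖) * |q y|) μ

/-- The potential of a source for the kernel `κ`. -/
def farPot {Ω : Type*} [MeasurableSpace Ω] (μ : Measure Ω) (Y : Ω → Euc n) (S q : Ω → ℝ)
    (κ : Euc n → ℝ → ℝ) (x : Euc n) (t : ℝ) : ℝ := ∫ y, κ (x - Y y) (t - S y) * q y ∂μ

namespace IsFarSource

variable {Ω : Type*} [MeasurableSpace Ω] {μ : Measure Ω} {x₀ : Euc n} {Y : Ω → Euc n}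
  {S q : Ω → ℝ} {κ : Euc n → ℝ → ℝ}

theorem one_lt_norm (h : IsFarSource μ x₀ Y S q) {x : Euc n} (hx : x ∈ Metric.ball x₀ 1) {y : Ω}
    (hy : q y ≠ 0) : 1 < ‖x - Y y‖ := by
  have h1 := h.far y hy
  have h2 : ‖x₀ - x‖ < 1 := by
    rw [← dist_eq_norm, dist_comm]
    exact Metric.mem_ball.mp hx
  have h3 := norm_add_le (x₀ - x) (x - Y y)
  rw [sub_add_sub_cancel] at h3
  linarith

/-- For `x` in the unit ball the source stays at distance more than `1`, where the kernel decays at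
the rate `b` for which the source is integrable; moving `x` costs only a constant factor. -/
theorem exists_bound (h : IsFarSource μ x₀ Y S q) (hκ : IsFarKernel κ) (T : ℝ) :
    ∃ g : Ω → ℝ, Integrable g μ ∧ ∀ x ∈ Metric.ball x₀ 1, ∀ t ∈ Iio T, ∀ y,
      ‖κ (x - Y y) (t - S y) * q y‖ ≤ g y := by
  obtain ⟨b, hb, hi⟩ := h.integrable
  obtain ⟨C, hC0, hC⟩ := hκ.exists_bound 0 b T
  refine ⟨fun y => C * Real.exp (b * (‖x₀‖ + 1)) * (Real.exp (-b * ‖Y y‖) * |q y|),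
    hi.const_mul _, fun x hx t ht y => ?_⟩
  have h0 : 0 ≤ C * Real.exp (b * (‖x₀‖ + 1)) * (Real.exp (-b * ‖Y y‖) * |q y|) := by positivity
  by_cases hy : q y = 0
  · rw [hy, mul_zero, norm_zero]
    positivity
  rcases le_or_gt (t - S y) 0 with hτ | hτ
  · rw [hκ.eq_zero _ hτ, zero_mul, norm_zero]
    exact h0
  have h1 := hC (x - Y y) (h.one_lt_norm hx hy).le (t - S y)
    ⟨hτ, by linarith [h.time_nonneg y hy, mem_Iio.mp ht]⟩
  rw [pow_zero, one_mul] at h1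
  have h2 : Real.exp (-b * ‖x - Y y‖)
      ≤ Real.exp (b * (‖x₀‖ + 1)) * Real.exp (-b * ‖Y y‖) := by
    rw [← Real.exp_add]
    refine Real.exp_le_exp.mpr ?_
    have h3 : ‖Y y‖ ≤ ‖x - Y y‖ + (‖x₀‖ + 1) := by
      have h4 := norm_sub_le x (x - Y y)
      rw [sub_sub_cancel] at h4
      have h5 := norm_le_norm_add_norm_sub x₀ x
      have h6 : ‖x₀ - x‖ < 1 := by
        rw [← dist_eq_norm, dist_comm]
        exact Metric.mem_ball.mp hx
      linarith
    have := mul_le_mul_of_nonneg_left h3 hb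
    linarith
  rw [norm_mul, Real.norm_eq_abs, Real.norm_eq_abs]
  calc |κ (x - Y y) (t - S y)| * |q y|
      ≤ C * (Real.exp (b * (‖x₀‖ + 1)) * Real.exp (-b * ‖Y y‖)) * |q y| :=
        mul_le_mul_of_nonneg_right (h1.trans (mul_le_mul_of_nonneg_left h2 hC0)) (abs_nonneg _)
    _ = _ := by ring

theorem measurable_integrand (h : IsFarSource μ x₀ Y S q) (hκ : IsFarKernel κ) (x : Euc n)
    (t : ℝ) : Measurable (fun y => κ (x - Y y) (t - S y) * q y) :=
  (hκ.measurable.comp ((measurable_const.sub h.measurable_space).prodMk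
    (measurable_const.sub h.measurable_time))).mul h.measurable_source

theorem integrable_integrand (h : IsFarSource μ x₀ Y S q) (hκ : IsFarKernel κ) {x : Euc n}
    (hx : x ∈ Metric.ball x₀ 1) (t : ℝ) :
    Integrable (fun y => κ (x - Y y) (t - S y) * q y) μ := by
  obtain ⟨g, hg, hb⟩ := h.exists_bound hκ (t + 1)
  exact hg.mono' (h.measurable_integrand hκ x t).aestronglyMeasurable
    (ae_of_all _ (hb x hx t (mem_Iio.mpr (lt_add_one t))))

theorem hasFDerivAt_farPot (h : IsFarSource μ x₀ Y S q) {κ' : Fin n → Euc n → ℝ → ℝ}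
    (hκ : IsFarKernel κ) (hκ' : ∀ j, IsFarKernel (κ' j))
    (hd : ∀ z τ, HasFDerivAt (fun y => κ y τ) (formOf fun j => κ' j z τ) z) {x : Euc n}
    (hx : x ∈ Metric.ball x₀ 1) (t : ℝ) :
    HasFDerivAt (fun y => farPot μ Y S q κ y t) (formOf fun j => farPot μ Y S q (κ' j) x t) x := by
  choose g hg hb using fun j => h.exists_bound (hκ' j) (t + 1)
  have ht : t ∈ Iio (t + 1) := mem_Iio.mpr (lt_add_one t)
  have hm : ∀ x : Euc n, Measurable fun y => formOf fun j => κ' j (x - Y y) (t - S y) * q y :=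
    fun x => Finset.measurable_fun_sum _ fun j _ =>
      (h.measurable_integrand (hκ' j) x t).smul measurable_const
  have key := hasFDerivAt_integral_of_dominated_of_fderiv_le (μ := μ) (x₀ := x)
    (F := fun x y => κ (x - Y y) (t - S y) * q y)
    (F' := fun x y => formOf fun j => κ' j (x - Y y) (t - S y) * q y)
    (bound := fun y => ∑ j, g j y) (Metric.isOpen_ball.mem_nhds hx)
    (Eventually.of_forall fun x => (h.measurable_integrand hκ x t).aestronglyMeasurable)
    (h.integrable_integrand hκ hx t) (hm x).aestronglyMeasurable
    (ae_of_all _ fun y x' hx' => (norm_formOf_le _).trans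
      (Finset.sum_le_sum fun j _ => hb j x' hx' t ht y))
    (integrable_finsetSum _ fun j _ => hg j)
    (ae_of_all _ fun y x' _ => ?_)
  · refine key.congr_fderiv ?_
    simp only [formOf]
    rw [integral_finsetSum _ fun j _ => (h.integrable_integrand (hκ' j) hx t).smul_const _]
    exact Finset.sum_congr rfl fun j _ => integral_smul_const _ _
  · have h1 := (HasFDerivAt.comp x' (hd (x' - Y y) (t - S y))
      ((hasFDerivAt_id x').sub_const (Y y))).mul_const (q y)
    refine h1.congr_fderiv ?_
    ext v
    simp [formOf_apply, Finset.mul_sum, mul_comm, mul_left_comm]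

/-- All derivatives fall on the kernel, so no regularity of the source is needed. -/
theorem spaceReg_farPot (h : IsFarSource μ x₀ Y S q) (hκ : IsFarKernel κ) (T : ℝ) (k : ℕ) :
    SpaceReg 0 (Metric.ball x₀ 1) (Iio T) k (farPot μ Y S q κ) := by
  have hc : ∀ {κ : Euc n → ℝ → ℝ}, IsFarKernel κ →
      ContDiffOn ℝ 0 (Function.uncurry (farPot μ Y S q κ)) (Metric.ball x₀ 1 ×ˢ Iio T) := by
    intro κ hκ
    obtain ⟨g, hg, hb⟩ := h.exists_bound hκ T
    refine contDiffOn_zero.mpr (continuousOn_of_dominated (bound := g)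
      (F := fun (p : Euc n × ℝ) y => κ (p.1 - Y y) (p.2 - S y) * q y)
      (fun p _ => (h.measurable_integrand hκ p.1 p.2).aestronglyMeasurable)
      (fun p hp => ae_of_all _ (hb p.1 hp.1 p.2 hp.2)) hg (ae_of_all _ fun y p hp => ?_))
    by_cases hy : q y = 0
    · simp only [hy, mul_zero]
      exact continuousWithinAt_const
    · have h1 := hκ.continuousAt (h.one_lt_norm hp.1 hy) (p.2 - S y)
      have h2 : ContinuousAt (fun p : Euc n × ℝ => κ (p.1 - Y y) (p.2 - S y)) p :=
        ContinuousAt.comp (x := p) (f := fun p : Euc n × ℝ => (p.1 - Y y, p.2 - S y)) h1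
          (by fun_prop)
      exact (h2.mul continuousAt_const).continuousWithinAt
  induction k generalizing κ with
  | zero => exact hc hκ
  | succ k ih =>
    obtain ⟨κ', hκ', hd⟩ := hκ.exists_hasFDerivAt
    exact SpaceReg.of_hasFDerivAt Metric.isOpen_ball (hc hκ)
      (fun t _ x hx => h.hasFDerivAt_farPot hκ hκ' hd hx t) fun j => ih (hκ' j)

end IsFarSource

/-! ### Local regularity of the Dyson series -/

section

variable {a : ℝ} {w : Euc n → ℝ}

theorem IsWeight.integrable_exp_neg_mul (hw : IsWeight a w) {q : Euc n → ℝ} (hqm : Measurable q)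
    {B : ℝ} (hq : ∀ y, |q y| ≤ B * w y) :
    Integrable fun y : Euc n => Real.exp (-(a + 1) * ‖y‖) * |q y| := by
  have hB : 0 ≤ B := nonneg_of_mul_nonneg_left ((abs_nonneg _).trans (hq 0)) (hw.pos 0)
  refine Integrable.mono' (integrable_exp_neg_norm.const_mul (B * w 0))
    ((by fun_prop : Measurable fun y : Euc n => Real.exp (-(a + 1) * ‖y‖)).mul
      hqm.norm).aestronglyMeasurable (ae_of_all _ fun y => ?_)
  rw [Real.norm_of_nonneg (by positivity)]
  have h1 := (hq y).trans (mul_le_mul_of_nonneg_left (hw.le_zero_mul_exp y) hB)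
  calc Real.exp (-(a + 1) * ‖y‖) * |q y|
      ≤ Real.exp (-(a + 1) * ‖y‖) * (B * (w 0 * Real.exp (a * ‖y‖))) :=
        mul_le_mul_of_nonneg_left h1 (Real.exp_pos _).le
    _ = B * w 0 * (Real.exp (-(a + 1) * ‖y‖) * Real.exp (a * ‖y‖)) := by ring
    _ = B * w 0 * Real.exp (-‖y‖) := by
        rw [← Real.exp_add]
        ring_nf

theorem heatS_eq_integral_kern {t : ℝ} (ht : 0 < t) (q : Euc n → ℝ) (x : Euc n) :
    heatS t q x = ∫ y, kern (x - y) t * q y := by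
  rw [← heatConv_eq_heatS ht.le, heatConv, if_neg ht.ne']
  simp [kern, ht]

theorem IsWeight.spaceReg_heatS_of_far (hw : IsWeight a w) {q : Euc n → ℝ} (hqm : Measurable q)
    {B : ℝ} (hq : ∀ y, |q y| ≤ B * w y) {x₀ : Euc n} (h0 : ∀ y, q y ≠ 0 → 2 ≤ ‖x₀ - y‖) (T : ℝ)
    (k : ℕ) : SpaceReg 0 (Metric.ball x₀ 1) (Iio T) k fun x t => heatS t q x := by
  have hs : IsFarSource volume x₀ (fun y : Euc n => y) (fun _ => 0) q :=
    ⟨measurable_id, measurable_const, hqm, fun _ _ => le_rfl, h0,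
      a + 1, by linarith [hw.rate_nonneg], hw.integrable_exp_neg_mul hqm hq⟩
  refine (hs.spaceReg_farPot .kern T k).congr Metric.isOpen_ball fun x hx t _ => ?_
  simp only [farPot, sub_zero]
  rcases le_or_gt t 0 with ht | ht
  · rw [heatS_of_nonpos _ _ ht]
    -- At nonpositive times `heatS` returns `q` itself and the kernel integral is zero; they agree
    -- because `q` vanishes near `x₀`.
    have h1 : q x = 0 := by
      by_contra h
      have := hs.one_lt_norm hx h
      simp at this
      linarith
    rw [h1]
    simp [kern, not_lt.mpr ht]
  · exact (heatS_eq_integral_kern ht q x).symm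

theorem IsWeight.spaceReg_duh_of_far (hw : IsWeight a w) {q : Euc n → ℝ → ℝ} (hq : IsTame w q)
    {x₀ : Euc n} (h0 : ∀ y s, q y s ≠ 0 → 2 ≤ ‖x₀ - y‖) (T : ℝ) (k : ℕ) :
    SpaceReg 0 (Metric.ball x₀ 1) (Iio T) k (duh q) := by
  obtain ⟨B, hB⟩ := hq.bound T
  -- Integrating up to the fixed time `T` instead of `t` changes nothing, because the extended
  -- kernel vanishes for `s ≥ t`.
  set r : Euc n × ℝ → ℝ := indicator (univ ×ˢ Ioo 0 T) (fun p => q p.1 p.2) with hr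
  have hrm : Measurable r :=
    hq.continuous.measurable.indicator (MeasurableSet.univ.prod measurableSet_Ioo)
  have hr0 : ∀ p, r p ≠ 0 → p.2 ∈ Ioo 0 T ∧ q p.1 p.2 ≠ 0 := by
    intro p hp
    have h1 : p ∈ univ ×ˢ Ioo 0 T := mem_of_indicator_ne_zero hp
    rw [hr, indicator_of_mem h1] at hp
    exact ⟨h1.2, hp⟩
  have hs : IsFarSource ((volume : Measure (Euc n)).prod (volume.restrict (Ioo 0 T))) x₀ Prod.fst
      Prod.snd r := by
    refine ⟨measurable_fst, measurable_snd, hrm, fun p hp => (hr0 p hp).1.1.le,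
      fun p hp => h0 _ _ (hr0 p hp).2, a + 1, by linarith [hw.rate_nonneg], ?_⟩
    have h1 := (hw.integrable_exp_neg_mul hw.continuous.measurable (B := 1)
      (fun y => by rw [abs_of_pos (hw.pos y), one_mul])).mul_prod
      (integrableOn_const (s := Ioo 0 T) (μ := volume) (C := |B|) (by simp))
    refine h1.mono' (((by fun_prop : Measurable fun p : Euc n × ℝ =>
      Real.exp (-(a + 1) * ‖p.1‖))).mul hrm.norm).aestronglyMeasurable (ae_of_all _ fun p => ?_)
    rw [Real.norm_of_nonneg (by positivity), mul_assoc]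
    refine mul_le_mul_of_nonneg_left ?_ (Real.exp_pos _).le
    by_cases hp : r p = 0
    · rw [hp, abs_zero]
      positivity
    · have h2 := (hr0 p hp).1
      have h3 : r p = q p.1 p.2 := indicator_of_mem (mk_mem_prod (mem_univ p.1) h2) _
      rw [h3, abs_of_pos (hw.pos _), mul_comm]
      exact (hB _ _ (Ioo_subset_Icc_self h2)).trans
        (mul_le_mul_of_nonneg_right (le_abs_self B) (hw.pos _).le)
  refine (hs.spaceReg_farPot .kern T k).congr Metric.isOpen_ball fun x hx t ht => ?_
  rw [farPot, integral_prod_symm _ (hs.integrable_integrand .kern hx t), duh,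
    ← integral_indicator measurableSet_Ioo, ← integral_indicator measurableSet_Ioo]
  congr 1
  ext s
  by_cases hsT : s ∈ Ioo 0 T
  · have h1 : ∀ y : Euc n, r (y, s) = q y s := fun y =>
      indicator_of_mem (mk_mem_prod (mem_univ y) hsT) _
    rw [indicator_of_mem hsT]
    simp only [h1]
    by_cases hst : s < t
    · rw [indicator_of_mem (mem_Ioo.mpr ⟨hsT.1, hst⟩),
        heatS_eq_integral_kern (sub_pos.mpr hst)]
    · have h2 : s ∉ Ioo 0 t := fun h => hst h.2
      rw [indicator_of_notMem h2]
      have h3 : ¬ 0 < t - s := by linarith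
      simp [kern, h3]
  · have h2 : s ∉ Ioo 0 t := fun h => hsT ⟨h.1, h.2.trans ht⟩
    rw [indicator_of_notMem hsT, indicator_of_notMem h2]

end

theorem spaceReg_of_contDiff {m : WithTop ℕ∞} (hm : m ≤ ∞) {U : Set (Euc n)} {I : Set ℝ} {k : ℕ}
    {η : Euc n → ℝ} (h : ContDiff ℝ ∞ η) : SpaceReg m U I k fun x _ => η x := by
  have hc : ∀ {η : Euc n → ℝ}, ContDiff ℝ ∞ η →
      ContDiffOn ℝ m (Function.uncurry fun (x : Euc n) (_ : ℝ) => η x) (U ×ˢ I) :=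
    fun h => ((h.of_le hm).comp contDiff_fst).contDiffOn
  induction k generalizing η with
  | zero => exact hc h
  | succ k ih => exact ⟨hc h, fun t _ x _ => h.differentiable (by simp) x,
      fun j => ih (contDiff_partialX h j)⟩

section

variable {a M : ℝ} {w : Euc n → ℝ} {F : Euc n → ℝ → ℝ}

/-- The sum of the Dyson series has continuous space derivatives of all orders when the data
have. -/
theorem spaceReg_dyson (hw : IsWeight a w) (hws : ContDiff ℝ ∞ w) (hF : IsPotential M F)
    (hFs : ∀ k, SpaceReg 0 univ univ k F) (k : ℕ) : SpaceReg 0 univ univ k (dyson F w) := by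
  have hV := isTame_dyson hw hF (hFs 0).continuous
  induction k with
  | zero => exact contDiffOn_zero.mpr hV.continuous.continuousOn
  | succ k ih =>
    refine SpaceReg.of_local fun x₀ _ t₀ _ => ⟨Metric.ball x₀ 1, Metric.ball_mem_nhds x₀ one_pos,
      Iio (t₀ + 1), Iio_mem_nhds (lt_add_one t₀), ?_⟩
    set q : Euc n → ℝ → ℝ := fun x t => F x t * dyson F w x t with hq
    have hqr : SpaceReg 0 univ univ k q := (hFs k).mul isOpen_univ ih
    have hqt : IsTame w q := hV.mul_potential hF (hFs 0).continuous
    -- The inner radius `2` makes `(1 - χ) q` a far source. For `χ q`, which has compact support,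
    -- the induction hypothesis gives `k` derivatives and the Duhamel integral adds one.
    let χ : ContDiffBump x₀ := ⟨2, 3, by norm_num, by norm_num⟩
    have hχs : ContDiff ℝ ∞ χ := χ.contDiff (n := ⊤)
    have hχ0 : ∀ x, 0 ≤ χ x := fun x => χ.nonneg
    have hχ1 : ∀ x, χ x ≤ 1 := fun x => χ.le_one
    have hfar : ∀ y, 1 - χ y ≠ 0 → 2 ≤ ‖x₀ - y‖ := by
      intro y hy
      by_contra! hlt
      refine hy (sub_eq_zero.mpr (χ.one_of_mem_closedBall ?_).symm)
      rw [Metric.mem_closedBall, dist_comm, dist_eq_norm]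
      exact hlt.le
    have hcut : ∀ x (r c : ℝ), |r| ≤ c → |χ x * r| ≤ c ∧ |(1 - χ x) * r| ≤ c := by
      intro x r c hr
      rw [abs_mul, abs_mul, abs_of_nonneg (hχ0 x), abs_of_nonneg (sub_nonneg.mpr (hχ1 x))]
      exact ⟨(mul_le_of_le_one_left (abs_nonneg r) (hχ1 x)).trans hr,
        (mul_le_of_le_one_left (abs_nonneg r) (by linarith [hχ0 x])).trans hr⟩
    have hw1 : ∀ y, |w y| ≤ 1 * w y := fun y => by rw [abs_of_pos (hw.pos y), one_mul]
    have hq1 : IsTame w fun x t => (1 - χ x) * q x t := by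
      refine ⟨(continuous_const.sub (hχs.continuous.comp continuous_fst)).mul hqt.continuous,
        fun T => ?_⟩
      obtain ⟨B, hB⟩ := hqt.bound T
      exact ⟨B, fun y s hs => (hcut y _ _ (hB y s hs)).2⟩
    have hq2 : IsTame w fun x t => χ x * q x t := by
      refine ⟨(hχs.continuous.comp continuous_fst).mul hqt.continuous, fun T => ?_⟩
      obtain ⟨B, hB⟩ := hqt.bound T
      exact ⟨B, fun y s hs => (hcut y _ _ (hB y s hs)).1⟩
    have h1 : SpaceReg 0 univ univ (k + 1) fun x t => heatS t (fun y => χ y * w y) x :=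
      spaceReg_heatS (hχs.mul hws) χ.hasCompactSupport.mul_right (k + 1)
    have h2 := hw.spaceReg_heatS_of_far (q := fun y => (1 - χ y) * w y)
      ((continuous_const.sub hχs.continuous).mul hws.continuous).measurable
      (fun y => (hcut y _ _ (hw1 y)).2) (fun y hy => hfar y (left_ne_zero_of_mul hy)) (t₀ + 1)
      (k + 1)
    have h3 : SpaceReg 0 univ univ (k + 1) (duh fun x t => χ x * q x t) := by
      refine spaceReg_duh ((spaceReg_of_contDiff (by simp) hχs).mul isOpen_univ hqr)
        χ.hasCompactSupport (fun x hx t => ?_)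
      rw [image_eq_zero_of_notMem_tsupport hx, zero_mul]
    have h4 := hw.spaceReg_duh_of_far hq1 (fun y s hy => hfar y (left_ne_zero_of_mul hy)) (t₀ + 1)
      (k + 1)
    have hball : IsOpen (Metric.ball x₀ 1) := Metric.isOpen_ball
    refine (((h1.mono (subset_univ _) (subset_univ _)).add hball h2).add hball
      ((h3.mono (subset_univ _) (subset_univ _)).add hball h4)).congr hball fun x _ t _ => ?_
    rw [dyson_eq hw hF x t]
    congr 1
    · rw [← heatS_add (fun y => χ y * w y) (fun y => (1 - χ y) * w y) _ _
        (hw.integrable_gauss_mul (hχs.continuous.mul hws.continuous).measurable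
          (fun y => (hcut y _ _ (hw1 y)).1) t x) (hw.integrable_gauss_mul
          ((continuous_const.sub hχs.continuous).mul hws.continuous).measurable
          (fun y => (hcut y _ _ (hw1 y)).2) t x)]
      congr 1
      ext y
      ring
    · obtain ⟨B, hB⟩ := hqt.bound t
      rw [← duh_add hw hq2.continuous.measurable hq1.continuous.measurable
        (fun y s hs => (hcut y _ _ (hB y s (Ioo_subset_Icc_self hs))).1)
        (fun y s hs => (hcut y _ _ (hB y s (Ioo_subset_Icc_self hs))).2)]
      congr 1
      ext y s
      ring

theorem SpaceReg.contDiff_slice {V : Euc n → ℝ → ℝ} (h : ∀ k, SpaceReg 0 univ univ k V) (t : ℝ) :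
    ContDiff ℝ ∞ fun x => V x t :=
  contDiffOn_univ.mp (SpaceReg.contDiffOn_slice isOpen_univ h (mem_univ t))

/-- The right-hand side `ΔV + F V` of the heat equation with a potential. -/
def heatRHS (F V : Euc n → ℝ → ℝ) (x : Euc n) (t : ℝ) : ℝ :=
  (∑ j, dX j (dX j V) x t) + F x t * V x t

theorem spaceReg_heatRHS {m : WithTop ℕ∞} {I : Set ℝ} {V : Euc n → ℝ → ℝ}
    (hV : ∀ k, SpaceReg m univ I k V) (hF : ∀ k, SpaceReg m univ I k F) (k : ℕ) :
    SpaceReg m univ I k (heatRHS F V) :=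
  (SpaceReg.sum isOpen_univ _ fun j _ => ((hV (k + 2)).2.2 j).2.2 j).add isOpen_univ
    ((hF k).mul isOpen_univ (hV k))

theorem integral_mul_lap {η f : Euc n → ℝ} (hη : ContDiff ℝ ∞ η) (hc : HasCompactSupport η)
    (hf : ContDiff ℝ ∞ f) : ∫ x, lap η x * f x = ∫ x, η x * ∑ j, partialX j (partialX j f) x := by
  simp only [lap, Finset.sum_mul, Finset.mul_sum]
  rw [integral_finsetSum, integral_finsetSum]
  · refine Finset.sum_congr rfl fun j _ => ?_
    have h1 := integral_mul_partialX_of_contDiff (hf.of_le (by simp))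
      ((contDiff_partialX hη j).of_le (by simp)) (hasCompactSupport_partialX hc j) j
    have h2 := integral_mul_partialX_of_contDiff ((contDiff_partialX hf j).of_le (by simp))
      (hη.of_le (by simp)) hc j
    simp only [mul_comm (f _)] at h1
    rw [h1, h2, neg_neg]
    simp only [mul_comm]
  · exact fun j _ => (hη.continuous.mul (contDiff_partialX (contDiff_partialX hf j)
      j).continuous).integrable_of_hasCompactSupport hc.mul_right
  · exact fun j _ => ((contDiff_partialX (contDiff_partialX hη j) j).continuous.mul
      hf.continuous).integrable_of_hasCompactSupport
      (hasCompactSupport_partialX (hasCompactSupport_partialX hc j) j).mul_right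

/-- Once the space derivatives are known to be continuous, the equation tested in space can be
localized to a point with mollifiers. -/
theorem dyson_eq_add_integral (hw : IsWeight a w) (hws : ContDiff ℝ ∞ w) (hF : IsPotential M F)
    (hFs : ∀ k, SpaceReg 0 univ univ k F) (x : Euc n) {t : ℝ} (ht : 0 ≤ t) :
    dyson F w x t = dyson F w x 0 + ∫ s in (0 : ℝ)..t, heatRHS F (dyson F w) x s := by
  have hV := spaceReg_dyson hw hws hF hFs
  set V := dyson F w
  have hB : Continuous (Function.uncurry (heatRHS F V)) := (spaceReg_heatRHS hV hFs 0).continuous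
  have hBs : ∀ s, Continuous fun y => heatRHS F V y s := fun s =>
    hB.comp (by fun_prop : Continuous fun y : Euc n => (y, s))
  have hVs := SpaceReg.contDiff_slice hV
  -- The mild equation tested with the mollifier centred at `x`, with the Laplacian moved from the
  -- mollifier to `V`.
  have key : ∀ k, ∫ y, mol n k y • V (x - y) t = (∫ y, mol n k y • w (x - y))
      + ∫ s in (0 : ℝ)..t, ∫ y, mol n k y • heatRHS F V (x - y) s := by
    intro k
    have hηs : ContDiff ℝ ∞ (fun y => mol n k (x - y)) :=
      (contDiff_mol k).comp (contDiff_const.sub contDiff_id)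
    have hηc : HasCompactSupport (fun y => mol n k (x - y)) :=
      (hasCompactSupport_mol k).comp_homeomorph (Homeomorph.subLeft x)
    have hsw : ∀ g : Euc n → ℝ, ∫ y, mol n k y • g (x - y) = ∫ y, mol n k (x - y) * g y :=
      fun g => by
        rw [← integral_sub_left_eq_self _ volume x]
        simp
    have h1 := (isMild_dyson hw hF t).integral_mul_eq hw hF hηs hηc ⟨ht, le_rfl⟩
    simp only [hsw]
    rw [hsw fun y => V y t, h1]
    congr 1
    refine intervalIntegral.integral_congr fun s _ => ?_
    beta_reduce
    rw [hsw fun y => heatRHS F V y s, integral_mul_lap hηs hηc (hVs s), ← integral_add]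
    · refine integral_congr_ae (ae_of_all _ fun y => ?_)
      simp only [heatRHS, dX, mul_add]
      rfl
    · exact (hηs.continuous.mul (continuous_finsetSum _ fun j _ => (contDiff_partialX
        (contDiff_partialX (hVs s) j) j).continuous)).integrable_of_hasCompactSupport hηc.mul_right
    · have hFc : Continuous fun y => F y s :=
        (hFs 0).continuous.comp (by fun_prop : Continuous fun y : Euc n => (y, s))
      exact (hηs.continuous.mul (hFc.mul (hVs s).continuous)).integrable_of_hasCompactSupport
        hηc.mul_right
  obtain ⟨C, hC⟩ := ((isCompact_closedBall x 1).prod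
    (isCompact_Icc (a := 0) (b := t))).exists_bound_of_continuousOn hB.continuousOn
  have hlim : Tendsto (fun k => ∫ s in (0 : ℝ)..t, ∫ y, mol n k y • heatRHS F V (x - y) s) atTop
      (𝓝 (∫ s in (0 : ℝ)..t, heatRHS F V x s)) := by
    refine intervalIntegral.tendsto_integral_filter_of_dominated_convergence (fun _ => C)
      (Eventually.of_forall fun k => ?_) (Eventually.of_forall fun k => ae_of_all _ fun s hs => ?_)
      intervalIntegrable_const
      (ae_of_all _ fun s _ => tendsto_mol_of_continuous (hBs s) x)
    · exact ((measurable_moll (contDiff_mol k).continuous.measurable hB.measurable).comp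
        (measurable_const.prodMk measurable_id)).aestronglyMeasurable
    · rw [uIoc_of_le ht] at hs
      refine (norm_integral_le_of_norm_le ((integrable_mol k).mul_const C)
        (ae_of_all _ fun y => ?_)).trans_eq ?_
      · rw [norm_smul, Real.norm_of_nonneg (mol_nonneg k y)]
        by_cases hy : mol n k y = 0
        · rw [hy, zero_mul, zero_mul]
        · refine mul_le_mul_of_nonneg_left (hC (x - y, s) ⟨?_, Ioc_subset_Icc_self hs⟩)
            (mol_nonneg k y)
          simpa using norm_le_one_of_mol_ne_zero hy
      · rw [integral_mul_const, integral_mol, one_mul]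
  have h2 := (tendsto_mol_of_continuous hw.continuous x).add hlim
  have h3 := tendsto_mol_of_continuous (hVs t).continuous x
  rw [show V x 0 = w x from dyson_zero w F x]
  exact tendsto_nhds_unique (h3.congr key) h2

end

/-! ### Joint smoothness in space and time -/

/-- Continuous partial derivatives give total differentiability, including on the boundary slices:
the increment is split into a space step at the later point's time and a time step at the base
point, and each is estimated by the mean value inequality. -/
theorem hasFDerivWithinAt_slab {T : ℝ} {A B : Euc n → ℝ → ℝ} {A' : Fin n → Euc n → ℝ → ℝ}
    (hA : ∀ x, ∀ t ∈ Icc 0 T, HasFDerivAt (fun y => A y t) (formOf fun j => A' j x t) x)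
    (hB : ∀ x, ∀ t ∈ Icc 0 T, HasDerivWithinAt (fun s => A x s) (B x t) (Icc 0 T) t)
    (hA'c : ∀ j, ContinuousOn (Function.uncurry (A' j)) (slab n T))
    (hBc : ContinuousOn (Function.uncurry B) (slab n T)) {z : Euc n × ℝ} (hz : z ∈ slab n T) :
    HasFDerivWithinAt (Function.uncurry A)
      ((formOf fun j => A' j z.1 z.2).comp (ContinuousLinearMap.fst ℝ (Euc n) ℝ)
        + B z.1 z.2 • ContinuousLinearMap.snd ℝ (Euc n) ℝ) (slab n T) z := by
  have hf : ContinuousOn (fun z : Euc n × ℝ => formOf fun j => A' j z.1 z.2) (slab n T) :=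
    continuousOn_finsetSum _ fun j _ => (hA'c j).smul continuousOn_const
  rw [hasFDerivWithinAt_iff_isLittleO, Asymptotics.isLittleO_iff]
  intro ε hε
  obtain ⟨δ, hδ, h1⟩ := Metric.continuousWithinAt_iff.mp (hf z hz) (ε / 2) (by positivity)
  obtain ⟨δ', hδ', h2⟩ := Metric.continuousWithinAt_iff.mp (hBc z hz) (ε / 2) (by positivity)
  filter_upwards [inter_mem_nhdsWithin (slab n T) (Metric.ball_mem_nhds z (lt_min hδ hδ'))]
    with p hp
  have hpz := Metric.mem_ball.mp hp.2
  have hd1 : dist p.1 z.1 < min δ δ' := (le_max_left _ _).trans_lt hpz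
  have hd2 : dist p.2 z.2 < min δ δ' := (le_max_right _ _).trans_lt hpz
  have hs : ‖A p.1 p.2 - A z.1 p.2 - (formOf fun j => A' j z.1 z.2) (p.1 - z.1)‖
      ≤ ε / 2 * ‖p.1 - z.1‖ := by
    refine (convex_ball z.1 (min δ δ')).norm_image_sub_le_of_norm_hasFDerivWithin_le'
      (fun y _ => (hA y p.2 hp.1.2).hasFDerivWithinAt) (fun y hy => ?_)
      (Metric.mem_ball_self (lt_min hδ hδ')) (Metric.mem_ball.mpr hd1)
    have h3 := h1 (x := (y, p.2)) ⟨mem_univ _, hp.1.2⟩ (max_lt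
      (lt_of_lt_of_le (Metric.mem_ball.mp hy) (min_le_left _ _))
      (hd2.trans_le (min_le_left _ _)))
    rw [dist_eq_norm] at h3
    exact h3.le
  have ht : ‖A z.1 p.2 - A z.1 z.2 - (B z.1 z.2 • (1 : ℝ →L[ℝ] ℝ)) (p.2 - z.2)‖
      ≤ ε / 2 * ‖p.2 - z.2‖ := by
    refine ((convex_Icc 0 T).inter
      (convex_ball z.2 (min δ δ'))).norm_image_sub_le_of_norm_hasFDerivWithin_le'
      (f := fun s => A z.1 s) (f' := fun s => B z.1 s • (1 : ℝ →L[ℝ] ℝ))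
      (fun s hs => ?_) (fun s hs => ?_)
      ⟨hz.2, Metric.mem_ball_self (lt_min hδ hδ')⟩ ⟨hp.1.2, Metric.mem_ball.mpr hd2⟩
    · refine ((hB z.1 s hs.1).mono inter_subset_left).hasFDerivWithinAt.congr_fderiv ?_
      ext
      simp
    · have h3 := h2 (x := (z.1, s)) ⟨mem_univ _, hs.1⟩ (max_lt (by simpa using hδ')
        (lt_of_lt_of_le (Metric.mem_ball.mp hs.2) (min_le_right _ _)))
      rw [← sub_smul, norm_smul, norm_one, mul_one, ← dist_eq_norm]
      exact h3.le
  have heq : Function.uncurry A p - Function.uncurry A z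
      - ((formOf fun j => A' j z.1 z.2).comp (ContinuousLinearMap.fst ℝ (Euc n) ℝ)
        + B z.1 z.2 • ContinuousLinearMap.snd ℝ (Euc n) ℝ) (p - z)
      = (A p.1 p.2 - A z.1 p.2 - (formOf fun j => A' j z.1 z.2) (p.1 - z.1))
        + (A z.1 p.2 - A z.1 z.2 - (B z.1 z.2 • (1 : ℝ →L[ℝ] ℝ)) (p.2 - z.2)) := by
    simp only [Function.uncurry_def, add_apply, ContinuousLinearMap.comp_apply, smul_apply,
      ContinuousLinearMap.coe_fst', ContinuousLinearMap.coe_snd', Prod.fst_sub, Prod.snd_sub,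
      one_apply_eq_self]
    ring
  rw [heq]
  have hn1 : ‖p.1 - z.1‖ ≤ ‖p - z‖ := norm_fst_le (p - z)
  have hn2 : ‖p.2 - z.2‖ ≤ ‖p - z‖ := norm_snd_le (p - z)
  calc _ ≤ ε / 2 * ‖p.1 - z.1‖ + ε / 2 * ‖p.2 - z.2‖ := norm_add_le_of_le hs ht
    _ ≤ ε / 2 * ‖p - z‖ + ε / 2 * ‖p - z‖ := by gcongr
    _ = ε * ‖p - z‖ := by ring

/-- On `[0, T]` the function `A` is a primitive of `B` in time, and both have continuous space
derivatives of all orders. -/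
structure IsTimePrimitive (T : ℝ) (A B : Euc n → ℝ → ℝ) : Prop where
  reg : ∀ k, SpaceReg 0 univ univ k A
  reg_deriv : ∀ k, SpaceReg 0 univ univ k B
  eq : ∀ x, ∀ t ∈ Icc 0 T, A x t = A x 0 + ∫ s in (0 : ℝ)..t, B x s

namespace IsTimePrimitive

variable {T : ℝ} {A B : Euc n → ℝ → ℝ}

theorem hasDerivWithinAt (h : IsTimePrimitive T A B) (x : Euc n) {t : ℝ} (ht : t ∈ Icc 0 T) :
    HasDerivWithinAt (fun s => A x s) (B x t) (Icc 0 T) t := by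
  have hc : Continuous fun s => B x s :=
    (h.reg_deriv 0).continuous.comp (by fun_prop : Continuous fun s : ℝ => (x, s))
  have h1 := (hc.integral_hasStrictDerivAt 0 t).hasDerivAt.const_add (A x 0)
  exact h1.hasDerivWithinAt.congr (fun s hs => h.eq x s hs) (h.eq x t ht)

/-- Differentiation under the time integral. It makes the relation inherit to all space derivatives,
which drives the induction in `spaceReg_succ`. -/
theorem dX (h : IsTimePrimitive T A B) (j : Fin n) : IsTimePrimitive T (dX j A) (dX j B) := by
  refine ⟨fun k => (h.reg (k + 1)).2.2 j, fun k => (h.reg_deriv (k + 1)).2.2 j, fun x t ht => ?_⟩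
  have hBj : ∀ i, Continuous (Function.uncurry (ColeHopf.dX i B)) := fun i =>
    ((h.reg_deriv 1).2.2 i).continuous
  have hBjs : ∀ i x, Continuous fun s => ColeHopf.dX i B x s := fun i x =>
    (hBj i).comp (by fun_prop : Continuous fun s : ℝ => (x, s))
  have hBc : ∀ x, Continuous fun s => B x s := fun x =>
    (h.reg_deriv 0).continuous.comp (by fun_prop : Continuous fun s : ℝ => (x, s))
  choose C hC using fun i => ((isCompact_closedBall x 1).prod
    (isCompact_Icc (a := 0) (b := t))).exists_bound_of_continuousOn (hBj i).continuousOn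
  have hform : ∀ x, Continuous fun s => formOf fun i => ColeHopf.dX i B x s := fun x =>
    continuous_finsetSum _ fun i _ => (hBjs i x).smul continuous_const
  have hd := intervalIntegral.hasFDerivAt_integral_of_dominated_of_fderiv_le (𝕜 := ℝ)
    (μ := volume) (a := 0) (b := t) (F := fun x s => B x s)
    (F' := fun x s => formOf fun i => ColeHopf.dX i B x s) (bound := fun _ => ∑ i, C i)
    (x₀ := x) (Metric.ball_mem_nhds x one_pos)
    (Eventually.of_forall fun x => (hBc x).aestronglyMeasurable)
    ((hBc x).intervalIntegrable _ _) (hform x).aestronglyMeasurable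
    (ae_of_all _ fun s hs y hy => (norm_formOf_le _).trans (Finset.sum_le_sum fun i _ => by
      rw [uIoc_of_le ht.1] at hs
      exact hC i (y, s) ⟨Metric.ball_subset_closedBall hy, Ioc_subset_Icc_self hs⟩))
    intervalIntegrable_const
    (ae_of_all _ fun s _ y _ => hasFDerivAt_formOf
      ((h.reg_deriv 1).2.1 s (mem_univ _) y (mem_univ _)))
  have h0 := ((h.reg 1).2.1 0 (mem_univ _) x (mem_univ _)).hasFDerivAt
  have h1 : ColeHopf.dX j A x t
      = (fderiv ℝ (fun y => A y 0) x + ∫ s in (0 : ℝ)..t, formOf fun i => ColeHopf.dX i B x s)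
        (EuclideanSpace.single j 1) := by
    have h2 : (fun y => A y t) = fun y => A y 0 + ∫ s in (0 : ℝ)..t, B y s :=
      funext fun y => h.eq y t ht
    rw [ColeHopf.dX, partialX, h2, (h0.fun_add hd).fderiv]
  rw [h1, add_apply, ContinuousLinearMap.intervalIntegral_apply
    ((hform x).intervalIntegrable 0 t)]
  simp only [formOf_single]
  rfl

/-- The total derivative of `A` has the components `∇A` and `B`, both of class `C^m`, so `A` is of
class `C^(m + 1)`. -/
theorem spaceReg_succ (hT : 0 < T) {m : ℕ} (h : IsTimePrimitive T A B)
    (hA : ∀ k, SpaceReg m univ (Icc 0 T) k A) (hB : ∀ k, SpaceReg m univ (Icc 0 T) k B) (k : ℕ) :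
    SpaceReg (m + 1) univ (Icc 0 T) k A := by
  have hc : ∀ {A B : Euc n → ℝ → ℝ}, IsTimePrimitive T A B →
      (∀ k, SpaceReg m univ (Icc 0 T) k A) → (∀ k, SpaceReg m univ (Icc 0 T) k B) →
      ContDiffOn ℝ (m + 1) (Function.uncurry A) (univ ×ˢ Icc 0 T) := by
    intro A B h hA hB
    have hAj : ∀ j, ContDiffOn ℝ m (Function.uncurry (ColeHopf.dX j A)) (slab n T) := fun j =>
      ((hA 1).2.2 j).contDiffOn
    have hB0 : ContDiffOn ℝ m (Function.uncurry B) (slab n T) := hB 0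
    refine (contDiffOn_succ_iff_hasFDerivWithinAt_of_uniqueDiffOn
      (uniqueDiffOn_slab (n := n) hT)).mpr ⟨by simp, _, ?_, fun z hz =>
        hasFDerivWithinAt_slab (A' := fun j => ColeHopf.dX j A) (B := B) (fun x t ht =>
          hasFDerivAt_formOf ((hA 1).2.1 t ht x (mem_univ _)))
        (fun x t ht => h.hasDerivWithinAt x ht) (fun j => (hAj j).continuousOn)
        hB0.continuousOn hz⟩
    exact ((ContDiffOn.sum fun j _ => (hAj j).smul contDiffOn_const).clm_comp
      contDiffOn_const).add (hB0.smul contDiffOn_const)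
  induction k generalizing A B with
  | zero => exact hc h hA hB
  | succ k ih => exact ⟨hc h hA hB, (hA 1).2.1, fun j =>
      ih (h.dX j) (fun k => (hA (k + 1)).2.2 j) fun k => (hB (k + 1)).2.2 j⟩

end IsTimePrimitive

theorem contDiffOn_of_isTimePrimitive {T : ℝ} (hT : 0 < T) {F V : Euc n → ℝ → ℝ}
    (h : IsTimePrimitive T V (heatRHS F V)) (hF : ∀ k, SpaceReg ∞ univ (Icc 0 T) k F) :
    ContDiffOn ℝ ∞ (Function.uncurry V) (slab n T) := by
  -- The induction on `m` must carry all `k`: the time derivative `ΔV + F V` costs two space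
  -- derivatives, which are free as long as every order is available.
  have key : ∀ m k : ℕ, SpaceReg m univ (Icc 0 T) k V := by
    intro m
    induction m with
    | zero => exact fun k => (h.reg k).mono Subset.rfl (subset_univ _)
    | succ m ih =>
      intro k
      have hFm : ∀ k, SpaceReg m univ (Icc 0 T) k F := fun k =>
        (hF k).of_le (by exact_mod_cast le_top)
      exact_mod_cast h.spaceReg_succ hT ih (spaceReg_heatRHS ih hFm) k
  exact contDiffOn_infty.mpr fun m => key m 0

/-! ### The classical equation -/

theorem gradient_coord (g : Euc n → ℝ) (x : Euc n) (i : Fin n) :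
    gradient g x i = partialX i g x := by
  have h := InnerProductSpace.toDual_symm_apply (𝕜 := ℝ) (x := EuclideanSpace.single i (1 : ℝ))
    (y := fderiv ℝ g x)
  rw [EuclideanSpace.inner_single_right] at h
  simpa [gradient, partialX] using h

theorem partialX_const_mul {f : Euc n → ℝ} {x : Euc n} (hf : DifferentiableAt ℝ f x) (c : ℝ)
    (j : Fin n) : partialX j (fun y => c * f y) x = c * partialX j f x := by
  rw [partialX, fderiv_const_mul hf]
  rfl

section

variable {T : ℝ} {F Fc V h : Euc n → ℝ → ℝ} {u : Euc n → ℝ → Euc n}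

theorem contDiff_slice_of_contDiffOn {W : Type*} [NormedAddCommGroup W] [NormedSpace ℝ W]
    {H : Euc n → ℝ → W} (hH : ContDiffOn ℝ ∞ (Function.uncurry H) (slab n T)) {t : ℝ}
    (ht : t ∈ Icc 0 T) : ContDiff ℝ ∞ fun y => H y t :=
  hH.comp_contDiff (contDiff_id.prodMk contDiff_const) fun _ => ⟨mem_univ _, ht⟩

/-- The logarithmic derivative `L` of `V` in the direction `i` satisfies a viscous Burgers
equation. -/
theorem logDeriv_equation (hFc : ∀ x, ∀ t ∈ Icc 0 T, Fc x t = F x t)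
    (hV : IsTimePrimitive T V (heatRHS Fc V))
    (hVs : ContDiffOn ℝ ∞ (Function.uncurry V) (slab n T))
    (hFs : ContDiffOn ℝ ∞ (Function.uncurry F) (slab n T))
    (hpos : ∀ x, ∀ t ∈ Icc 0 T, 0 < V x t) {L : Fin n → Euc n → ℝ → ℝ}
    (hL : ∀ i x t, L i x t = dX i V x t / V x t)
    (hLs : ∀ i, ContDiffOn ℝ ∞ (Function.uncurry (L i)) (slab n T)) (x : Euc n) {t : ℝ}
    (ht : t ∈ Icc 0 T) (i : Fin n) :
    HasDerivWithinAt (fun s => L i x s)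
      ((∑ j, dX j (dX j (L i)) x t) + 2 * (∑ j, L j x t * dX j (L i) x t) + dX i F x t)
      (Icc 0 T) t := by
  have hVt := contDiff_slice_of_contDiffOn hVs ht
  have hLt := contDiff_slice_of_contDiffOn (hLs i) ht
  have hFt := contDiff_slice_of_contDiffOn hFs ht
  have hd : ∀ {f : Euc n → ℝ}, ContDiff ℝ ∞ f → ∀ y, DifferentiableAt ℝ f y :=
    fun hf y => hf.differentiable (by simp) y
  -- The space derivatives are computed from the product `∂ᵢV = V Lᵢ` rather than from the quotient,
  -- so that no powers of `V` in denominators arise before the last step.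
  have e0 : ∀ i y, dX i V y t = V y t * L i y t := fun i y => by
    rw [hL, mul_div_cancel₀ _ (hpos y t ht).ne']
  have e1 : ∀ j y, dX j (dX i V) y t = dX j V y t * L i y t + V y t * dX j (L i) y t := by
    intro j y
    rw [dX, funext (e0 i)]
    exact partialX_mul (hd hVt y) (hd hLt y) j
  have e2 : ∀ j, dX j (dX j (dX i V)) x t = dX j (dX j V) x t * L i x t
      + 2 * (V x t * (L j x t * dX j (L i) x t)) + V x t * dX j (dX j (L i)) x t := by
    intro j
    have hVj : ContDiff ℝ ∞ fun y => dX j V y t := contDiff_partialX hVt j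
    have hLj : ContDiff ℝ ∞ fun y => dX j (L i) y t := contDiff_partialX hLt j
    have h1 : dX j (dX j (dX i V)) x t = partialX j (fun y => dX j V y t * L i y t
        + V y t * dX j (L i) y t) x := by
      rw [dX, funext (e1 j)]
    have h2 := partialX_mul (hd hVj x) (hd hLt x) j
    have h3 := partialX_mul (hd hVt x) (hd hLj x) j
    have h4 : partialX j (fun y => dX j V y t * L i y t + V y t * dX j (L i) y t) x
        = partialX j (fun y => dX j V y t * L i y t) x
          + partialX j (fun y => V y t * dX j (L i) y t) x := by
      simp only [partialX]
      rw [fderiv_fun_add (hd (hVj.mul hLt) x) (hd (hVt.mul hLj) x)]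
      rfl
    have h5 : partialX j (fun y => V y t) x = V x t * L j x t := e0 j x
    rw [h1, h4]
    refine (congrArg₂ (· + ·) h2 h3).trans ?_
    simp only [dX, h5]
    ring
  have hswap : ∀ j, partialX i (fun y => dX j (dX j V) y t) x = dX j (dX j (dX i V)) x t := by
    intro j
    have h1 : (fun y => dX i (dX j V) y t) = fun y => dX j (dX i V) y t :=
      funext fun y => partialX_comm hVt i j y
    calc partialX i (fun y => dX j (dX j V) y t) x
        = partialX j (fun y => dX i (dX j V) y t) x :=
          partialX_comm (contDiff_partialX hVt j) i j x
      _ = _ := by rw [h1]; rfl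
  have hR : dX i (heatRHS Fc V) x t = (∑ j, dX j (dX j (dX i V)) x t)
      + (dX i F x t * V x t + F x t * dX i V x t) := by
    have h1 : (fun y => heatRHS Fc V y t)
        = fun y => (∑ j, dX j (dX j V) y t) + F y t * V y t := by
      ext y
      rw [heatRHS, hFc y t ht]
    have hjj : ∀ j, ContDiff ℝ ∞ fun y => dX j (dX j V) y t := fun j =>
      contDiff_partialX (contDiff_partialX hVt j) j
    have h2 : dX i (heatRHS Fc V) x t = (∑ j, partialX i (fun y => dX j (dX j V) y t) x)
        + partialX i (fun y => F y t * V y t) x := by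
      rw [dX, h1, partialX, fderiv_fun_add (hd (ContDiff.sum fun j _ => hjj j) x)
        (hd (hFt.mul hVt) x), fderiv_fun_sum fun j _ => hd (hjj j) x, add_apply, sum_apply]
      rfl
    rw [h2, partialX_mul (hd hFt x) (hd hVt x) i]
    simp only [hswap]
    rfl
  have h0 := (hpos x t ht).ne'
  have hdt := ((hV.dX i).hasDerivWithinAt x ht).div (hV.hasDerivWithinAt x ht) h0
  have hfun : (fun s => L i x s) = (fun s => dX i V x s) / fun s => V x s :=
    funext fun s => hL i x s
  rw [hfun]
  refine hdt.congr_deriv ?_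
  rw [hR, heatRHS, hFc x t ht, e0 i x, div_eq_iff (pow_ne_zero 2 h0)]
  simp only [e2, Finset.sum_add_distrib, ← Finset.sum_mul, ← Finset.mul_sum]
  ring

theorem classical_equation (hT : 0 < T) (hFc : ∀ x, ∀ t ∈ Icc 0 T, Fc x t = F x t)
    (hV : IsTimePrimitive T V (heatRHS Fc V))
    (hVs : ContDiffOn ℝ ∞ (Function.uncurry V) (slab n T))
    (hFs : ContDiffOn ℝ ∞ (Function.uncurry F) (slab n T))
    (hpos : ∀ x, ∀ t ∈ Icc 0 T, 0 < V x t)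
    (hu : ∀ x, ∀ t ∈ Icc 0 T, ∀ i, u x t i = -2 * (dX i V x t / V x t))
    (hh : ∀ x t, h x t = -2 * F x t) :
    ContDiffOn ℝ ∞ (Function.uncurry u) (slab n T) ∧ ∀ x, ∀ t ∈ Icc 0 T,
      derivWithin (fun s => u x s) (Icc 0 T) t
          + convection u (fun j y s => partialX j (fun y' => u y' s) y) x t
        = Laplacian.laplacian (fun y => u y t) x + gradient (fun y => h y t) x := by
  set L : Fin n → Euc n → ℝ → ℝ := fun i x t => dX i V x t / V x t with hL
  have hLs : ∀ i, ContDiffOn ℝ ∞ (Function.uncurry (L i)) (slab n T) := fun i =>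
    (contDiffOn_dX hT hVs i).div hVs fun z hz => (hpos z.1 z.2 hz.2).ne'
  have hus : ContDiffOn ℝ ∞ (Function.uncurry u) (slab n T) :=
    (contDiffOn_piLp 2).mpr fun i => ((contDiffOn_const (c := (-2 : ℝ))).mul (hLs i)).congr
      fun z hz => hu z.1 z.2 hz.2 i
  refine ⟨hus, fun x t ht => ?_⟩
  have hut := contDiff_slice_of_contDiffOn hus ht
  have hFt := contDiff_slice_of_contDiffOn hFs ht
  have hLt := fun i => contDiff_slice_of_contDiffOn (hLs i) ht
  have hdu : ∀ j i y, partialX j (fun y' => u y' t) y i = -2 * dX j (L i) y t := by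
    intro j i y
    rw [partialX_coord (hut.differentiable (by simp) y), funext fun y' => hu y' t ht i]
    exact partialX_const_mul ((hLt i).differentiable (by simp) y) _ j
  have hddu : ∀ j i, partialX j (partialX j fun y' => u y' t) x i
      = -2 * dX j (dX j (L i)) x t := by
    intro j i
    rw [partialX_coord ((contDiff_partialX hut j).differentiable (by simp) x),
      funext fun y => hdu j i y]
    exact partialX_const_mul ((contDiff_partialX (hLt i) j).differentiable (by simp) x) _ j
  have hUD : UniqueDiffWithinAt ℝ (Icc 0 T) t := uniqueDiffOn_Icc hT t ht
  have hdiff : DifferentiableWithinAt ℝ (fun s => u x s) (Icc 0 T) t := by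
    have hm : MapsTo (fun s : ℝ => (x, s)) (Icc 0 T) (slab n T) := fun s hs => ⟨mem_univ _, hs⟩
    exact ((hus.comp (contDiffOn_const.prodMk contDiffOn_id) hm).differentiableOn (by simp)) t ht
  ext i
  have ht1 : derivWithin (fun s => u x s) (Icc 0 T) t i
      = -2 * ((∑ j, dX j (dX j (L i)) x t) + 2 * (∑ j, L j x t * dX j (L i) x t)
        + dX i F x t) := by
    have h1 : HasDerivWithinAt (fun s => u x s i) (derivWithin (fun s => u x s) (Icc 0 T) t i)
        (Icc 0 T) t :=
      (EuclideanSpace.proj i : Euc n →L[ℝ] ℝ).hasFDerivAt.comp_hasDerivWithinAt t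
        hdiff.hasDerivWithinAt
    have h2 := ((logDeriv_equation hFc hV hVs hFs hpos (L := L) (fun _ _ _ => rfl) hLs x ht
      i).const_mul (-2)).congr (fun s hs => hu x s hs i) (hu x t ht i)
    exact hUD.eq_deriv _ h1 h2
  have hgrad : gradient (fun y => h y t) x i = -2 * dX i F x t := by
    rw [gradient_coord, funext fun y => hh y t]
    exact partialX_const_mul (hFt.differentiable (by simp) x) _ i
  have hlap : Laplacian.laplacian (fun y => u y t) x i = ∑ j, -2 * dX j (dX j (L i)) x t := by
    rw [laplacian_eq_sum_partialX hut]
    simp only [← hddu]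
    exact map_sum (EuclideanSpace.proj i : Euc n →L[ℝ] ℝ) _ _
  have hconv : convection u (fun j y s => partialX j (fun y' => u y' s) y) x t i
      = ∑ j, 4 * (L j x t * dX j (L i) x t) := by
    refine (map_sum (EuclideanSpace.proj i : Euc n →L[ℝ] ℝ) _ _).trans
      (Finset.sum_congr rfl fun j _ => ?_)
    change u x t j * partialX j (fun y' => u y' t) x i = _
    rw [hdu, hu x t ht j]
    ring
  rw [PiLp.add_apply, PiLp.add_apply, ht1, hgrad, hlap, hconv, ← Finset.mul_sum, ← Finset.mul_sum]
  ring

end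

/-! ### Assembly of the smooth case. -/

/-- For smooth data the Cole–Hopf field is smooth, bounded and solves the equation at every
point. -/
theorem classical_theory {T : ℝ} (hT : 0 < T) {φ : Euc n → ℝ} {u₀ : Euc n → Euc n}
    {f F G : Euc n → ℝ → ℝ} {u : Euc n → ℝ → Euc n} {K : NNReal} (hLip : LipschitzWith K φ)
    (hφ : IsWeakGradient φ u₀) (hu₀ : ContDiff ℝ ∞ u₀)
    (hFm : MemLp (fun z : Euc n × ℝ => F z.1 z.2) ⊤ (volume.restrict (slab n T)))
    (hFs : ContDiffOn ℝ ∞ (Function.uncurry F) (slab n T))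
    (hG : ∀ x t, G x t = seriesSum F (fun x => Real.exp (-(1 / 2) * φ x)) x t)
    (hu : ∀ x t, u x t = coleHopf G x t) (hf : ∀ x t, f x t = -2 * F x t) :
    ContDiffOn ℝ ∞ (Function.uncurry u) (slab n T) ∧
      (∃ C : ℝ, ∀ x, ∀ t ∈ Icc 0 T, ‖u x t‖ ≤ C) ∧ IsClassicalSolution T f u₀ u := by
  set w : Euc n → ℝ := fun x => Real.exp (-(1 / 2) * φ x)
  have hw : IsWeight (K / 2) w := isWeight_exp_of_lipschitz hLip
  have hws : ContDiff ℝ ∞ w :=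
    Real.contDiff_exp.comp (contDiff_const.mul (hφ.contDiff hLip.continuous hu₀))
  obtain ⟨M, hM⟩ := exists_isPotential_clamp hT hFs hFm
  set Fc : Euc n → ℝ → ℝ := fun x t => F x (clamp T t)
  have hFc : ∀ x, ∀ t ∈ Icc 0 T, Fc x t = F x t := fun x t ht => by
    simp only [Fc, clamp_of_mem ht]
  have hFcs := spaceReg_clamp hT hFs
  have hae : ∀ᵐ z ∂(volume : Measure (Euc n × ℝ)).restrict (slab n T),
      F z.1 z.2 = Fc z.1 z.2 := ae_slab_of_forall fun x t ht => (hFc x t ht).symm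
  have hGV : ∀ x, ∀ t ∈ Icc 0 T, G x t = dyson Fc w x t := by
    intro x t ht
    rcases ht.1.eq_or_lt with rfl | h0
    · rw [hG, seriesSum_zero, dyson_zero]
    · rw [hG, seriesSum_eq_dyson hae Filter.EventuallyEq.rfl x ⟨h0, ht.2⟩]
  set V := dyson Fc w
  have hV : IsTimePrimitive T V (heatRHS Fc V) :=
    ⟨spaceReg_dyson hw hws hM hFcs, spaceReg_heatRHS (spaceReg_dyson hw hws hM hFcs) hFcs,
      fun x t ht => dyson_eq_add_integral hw hws hM hFcs x ht.1⟩
  have hVs := contDiffOn_of_isTimePrimitive hT hV fun k =>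
    (spaceReg_of_contDiffOn hT hFs k).congr isOpen_univ fun x _ t ht => (hFc x t ht).symm
  obtain ⟨C, P, hreg⟩ := IsMild.exists_isRegularSol hT hw hM
  have hpos : ∀ x, ∀ t ∈ Icc 0 T, 0 < V x t := fun x t ht => by
    have h1 := (hw.pos x).trans_le (hreg.le_sol x t ht)
    exact pos_of_mul_pos_right h1 hreg.const_nonneg
  have hslice : ∀ t ∈ Icc 0 T, (fun y => G y t) = fun y => V y t := fun t ht =>
    funext fun y => hGV y t ht
  have huV : ∀ x, ∀ t ∈ Icc 0 T, ∀ i, u x t i = -2 * (dX i V x t / V x t) := by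
    intro x t ht i
    rw [hu, coleHopf, PiLp.smul_apply, gradient_coord, hslice t ht, hGV x t ht, smul_eq_mul, dX]
    ring
  obtain ⟨hus, heq⟩ := classical_equation hT hFc hV hVs hFs hpos huV hf
  have hbd : ∀ x, ∀ t ∈ Ioc 0 T, ‖u x t‖ ≤ 2 * C ^ 2 := by
    intro x t ht
    have htc := Ioc_subset_Icc_self ht
    have hp := hpos x t htc
    have hg : gradient (fun y => G y t) x = P x t := by
      rw [hslice t htc]
      exact (show HasGradientAt (fun y => V y t) (P x t) x from hreg.hasFDerivAt x t ht).gradient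
    rw [hu, coleHopf, hg, hGV x t htc, norm_smul, norm_div, norm_neg, Real.norm_two,
      Real.norm_of_nonneg hp.le, div_mul_eq_mul_div, div_le_iff₀ hp]
    -- The weight cancels: `‖∇V‖ ≤ C w ≤ C² V`. Hence `u` is bounded globally although `V` need not
    -- be bounded above or away from zero.
    have h1 := mul_le_mul_of_nonneg_left (hreg.le_sol x t htc) hreg.const_nonneg
    linarith [hreg.grad_le x t ht]
  have hinit : ∀ x, u x 0 = u₀ x := by
    intro x
    have h0 : (0 : ℝ) ∈ Icc 0 T := ⟨le_rfl, hT.le⟩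
    have hV0 : (fun y => V y 0) = w := funext fun y => dyson_zero w Fc y
    have hd := ((hφ.hasFDerivAt hLip.continuous hu₀.continuous x).const_mul (-(1 / 2))).exp
    ext i
    have h1 : dX i V x 0 = w x * (-(1 / 2) * u₀ x i) := by
      rw [dX, hV0, partialX, hd.fderiv, innerSL_eq_formOf]
      simp only [smul_apply, formOf_single, smul_eq_mul]
      rfl
    rw [huV x 0 h0, h1, show V x 0 = w x from congrFun hV0 x]
    have := (hw.pos x).ne'
    field_simp
  refine ⟨hus, ⟨2 * C ^ 2, fun x t ht => ?_⟩, heq, hinit⟩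
  rcases ht.1.eq_or_lt with rfl | h0
  -- The gradient bound of a regular solution holds only for `t > 0`; the bound at `t = 0` follows
  -- from the continuity of `u`.
  · have hm : MapsTo (fun s : ℝ => (x, s)) (Ioc 0 T) (slab n T) := fun s hs =>
      ⟨mem_univ _, Ioc_subset_Icc_self hs⟩
    have hc : ContinuousWithinAt (fun s => u x s) (Ioc 0 T) 0 :=
      ContinuousWithinAt.comp (x := (0 : ℝ)) (f := fun s : ℝ => (x, s))
        (hus.continuousOn (x, 0) ⟨mem_univ _, ht⟩) (by fun_prop) hm
    have : (𝓝[Ioc 0 T] (0 : ℝ)).NeBot := by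
      rw [← mem_closure_iff_nhdsWithin_neBot, closure_Ioc hT.ne]
      exact ht
    exact le_of_tendsto hc.norm (by filter_upwards [self_mem_nhdsWithin] with s hs using hbd x s hs)
  · exact hbd x t ⟨h0, ht.2⟩

end ColeHopf

end

/-! ### The theorem. -/

theorem mainTheorem1 (n : ℕ) (T : ℝ) (hT : 0 < T)
    (f p : Euc n → ℝ → ℝ) (φ : Euc n → ℝ) (u₀ : Euc n → Euc n)
    (hfp : MemLp (fun z : Euc n × ℝ => f z.1 z.2 - p z.1 z.2) ⊤ (volume.restrict (slab n T)))
    (hu₀ : MemLp u₀ ⊤ volume)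
    (hφ : IsWeakGradient φ u₀)
    (F : Euc n → ℝ → ℝ) (hF : ∀ x t, F x t = 1 / 2 * (p x t - f x t))
    (G₀ : Euc n → ℝ) (hG₀ : ∀ x, G₀ x = Real.exp (-(1 / 2) * φ x))
    (G : Euc n → ℝ → ℝ) (hG : ∀ x t, G x t = seriesSum F G₀ x t)
    (u : Euc n → ℝ → Euc n) (hu : ∀ x t, u x t = coleHopf G x t) :
    (SeriesConverges T F G₀ ∧
      IsWeakLinearSolution T F G₀ G ∧
      (∀ x, ∀ t ∈ Icc 0 T, 0 < G x t) ∧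
      (∀ x, ∀ t ∈ Ioc 0 T, DifferentiableAt ℝ (fun y => G y t) x) ∧
      IsWeakSolution T (fun x t => f x t - p x t) u₀ u) ∧
    (Continuous φ → ContDiff ℝ ∞ u₀ → ContDiffOn ℝ ∞ (Function.uncurry F) (slab n T) →
      ContDiffOn ℝ ∞ (Function.uncurry u) (slab n T) ∧
      (∃ C : ℝ, ∀ x, ∀ t ∈ Icc 0 T, ‖u x t‖ ≤ C) ∧
      IsClassicalSolution T (fun x t => f x t - p x t) u₀ u) := by
  obtain rfl : G₀ = fun x => Real.exp (-(1 / 2) * φ x) := funext hG₀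
  have hf : ∀ x t, f x t - p x t = -2 * F x t := fun x t => by
    rw [hF]
    ring
  have hFm : MemLp (fun z : Euc n × ℝ => F z.1 z.2) ⊤ (volume.restrict (slab n T)) := by
    have h1 : (fun z : Euc n × ℝ => F z.1 z.2)
        = fun z => -(1 / 2) * (f z.1 z.2 - p z.1 z.2) := funext fun z => by
      rw [hF]
      ring
    rw [h1]
    exact hfp.const_mul (-(1 / 2))
  obtain ⟨K, φ', hLip, hφφ'⟩ := hφ.exists_lipschitz hu₀
  constructor
  · obtain ⟨M, F', hF', hFF'⟩ := exists_isPotential hFm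
    refine weak_theory hT (isWeight_exp_of_lipschitz hLip) hF' hFF' ?_ (fun x => Real.exp_pos _) hG
      hu hφ.locallyIntegrable_grad (fun η hη hc j => ?_) hf
    · filter_upwards [hφφ'] with x hx
      rw [hx]
    · have h1 : ∫ x, Real.log (Real.exp (-(1 / 2) * φ' x)) * partialX j η x
          = ∫ x, -(1 / 2) * (φ x * partialX j η x) := by
        refine integral_congr_ae ?_
        filter_upwards [hφφ'] with x hx
        rw [Real.log_exp, hx, mul_assoc]
      rw [h1, integral_const_mul, hφ.integral_eq η hη hc j]
      ring
  · intro hc hu₀s hFs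
    -- A continuous `φ` equals its Lipschitz representative everywhere, so no modification of the
    -- initial value is needed in the smooth case.
    obtain rfl : φ = φ' := (hc.ae_eq_iff_eq volume hLip.continuous).mp hφφ'
    exact classical_theory hT hLip hφ hu₀s hFm hFs hG hu hf
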